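/- **Setting.** Let $(J_x)_{x\in\mathbb Z}$, $(\lambda_x)_{x\in\mathbb Z}$ be bounded real sequences, $N\ge 0$ an integer and $\beta_l,\beta_r\in\mathbb R$. Let $h$ be the Jacobi matrix $(hu)(n)=J_nu(n+1)+J_{n-1}u(n-1)+\lambda_nu(n)$ on $\ell^2(\mathbb Z)$, let $h_l,h_r$ be its restrictions to $\ell^2((-\infty,-N-1])$ and $\ell^2([N+1,\infty))$ (extended by $0$), and $k=-\beta_lh_l-\beta_rh_r$. For $M\ge 0$ let $h_M,h_{l,M},h_{r,M},k_M$ be the compressions of $h,h_l,h_r,k$ to $\ell^2([-M,M])$. *Finite volume.* On the Fermionic Fock space over $\ell^2([-M,M])$ with trace $\mathrm{tr}$ put $H_M=d\Gamma(h_M)$, $\omega_M=e^{-\beta_ld\Gamma(h_{l,M})-\beta_rd\Gamma(h_{r,M})}/\mathrm{tr}(e^{-\beta_ld\Gamma(h_{l,M})-\beta_rd\Gamma(h_{r,M})})$, $\omega_{t,M}=e^{-itH_M}\omega_Me^{itH_M}$ and $S_M=-\log\omega_M$. For $t,\alpha\in\mathbb R$ let $$e_{p,t,M}(\alpha)=\log\mathrm{tr}\Big(\big[\omega_M^{\frac{1-\alpha}p}\,\omega_{t,M}^{\frac{2\alpha}p}\,\omega_M^{\frac{1-\alpha}p}\big]^{p/2}\Big)\quad(0<p<\infty),\qquad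 e_{\infty,t,M}(\alpha)=\log\mathrm{tr}\big(e^{(1-\alpha)\log\omega_M+\alpha\log\omega_{t,M}}\big).$$ For $t\neq0$ the full counting statistics $\mathbb P_{t,M}$ is the law of $\phi=(s'-s)/t$, where the pair $(s,s')$ of eigenvalues of $S_M$ has probability $\mathrm{tr}(e^{-itH_M}\omega_M\mathbb 1_s(S_M)e^{itH_M}\mathbb 1_{s'}(S_M))$, $\mathbb 1_s(S_M)$ being the spectral projections. *Extended chain.* Let $\mathcal O_{\rm loc}$ be the $*$-algebra generated by the annihilation operators $a_x$, $x\in\mathbb Z$, on the Fermionic Fock space over $\ell^2(\mathbb Z)$, and $\mathcal O$ its norm closure. The finite-volume observables are identified with the subalgebra generated by the $a_x$, $|x|\le M$. The dynamics $\tau$ of the extended chain is the strongly continuous group of $*$-automorphisms of $\mathcal O$ with $\tau^t(A)=\lim_Me^{itH_M}Ae^{-itH_M}$ in norm for $A\in\mathcal O_{\rm loc}$, and its initial state $\omega$ is the state on $\mathcal O$ with $\omega(A)=\lim_M\mathrm{tr}(\omega_MA)$ for $A\in\mathcal O_{\rm loc}$. Let $\Phi_{l/r}=-i[H_M,d\Gamma(h_{l/r,M})]$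 (independent of $M\ge N+2$), $\sigma=-\beta_l\Phi_l-\beta_r\Phi_r\in\mathcal O_{\rm loc}$, $\sigma_s=\tau^s(\sigma)$, $\Sigma^t=\frac1t\int_0^t\sigma_s\,ds$ and $\mathrm{ES}_t(\alpha)=\log\omega(e^{-\alpha t\Sigma^t})$ (at $t=0$, $t\Sigma^t=0$). *Trace formulas.* For bounded operators $h,k$ put $k_s=e^{ish}ke^{-ish}$ and $$\mathcal K_{p,t}(\gamma,u)=\tfrac12e^{-(1-\gamma)k_{tu}/p}\Big[\mathbb 1+\big(e^{(1-\gamma)k_{tu}/p}e^{2\gamma k_{-t(1-u)}/p}e^{(1-\gamma)k_{tu}/p}\big)^{-p/2}\Big]^{-1}e^{(1-\gamma)k_{tu}/p}+\text{h.c.}\quad(0<p<\infty),$$ $$\mathcal K_{\infty,t}(\gamma,u)=\big(\mathbb 1+e^{-(1-\gamma)k_{tu}-\gamma k_{-t(1-u)}}\big)^{-1},\qquad \mathcal F_{p,t}(\alpha;h,k)=t\int_0^\alpha d\gamma\int_0^1du\;\mathrm{tr}\big(\mathcal K_{p,t}(\gamma,u)\,i[k,h]\big).$$ **Proposition.** The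 dynamics $\tau$ and the initial state $\omega$ of the extended chain exist, and: 1. For all $\alpha,t\in\mathbb R$ and $p\in\,]0,\infty]$, $e_{p,t,M}(\alpha)=\mathcal F_{p,t}(\alpha;h_M,k_M)$ for all $M$, and the limit $e_{p,t}(\alpha)=\lim_{M\to\infty}e_{p,t,M}(\alpha)$ exists, is finite, and equals $\mathcal F_{p,t}(\alpha;h,k)$. 2. $e_{p,t}(0)=e_{p,t}(1)=0$. 3. $\alpha\mapsto e_{p,t}(\alpha)$ is real-analytic and convex on $\mathbb R$; $(p,t,\alpha)\mapsto e_{p,t}(\alpha)$ is jointly continuous on $]0,\infty]\times\mathbb R\times\mathbb R$; $\alpha\mapsto\mathrm{ES}_t(\alpha)$ is real-analytic on $\mathbb R$. 4. $e_{p,t}(\alpha)=e_{p,-t}(\alpha)$. 5. $e_{p,t}(\alpha)=e_{p,t}(1-\alpha)$. 6. $]0,\infty]\ni p\mapsto e_{p,t}(\alpha)$ is continuous and decreasing (not necessarily strictly). 7. $e_{p,t}'(0)=\mathrm{ES}_t'(0)=-e_{p,t}'(1)=-t\,\omega(\Sigma^t)$. 8. $e_{2,t}''(0)=\mathrm{ES}_t''(0)=\int_0^t\int_0^t\omega\big((\sigma_s-\omega(\sigma_s))(\sigma_u-\omega(\sigma_u))\big)\,ds\,du$.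 9. For $t\ne0$, the probability measures $\mathbb P_{t,M}$ converge weakly, as $M\to\infty$, to a Borel probability measure $\mathbb P_t$ on $\mathbb R$, all moments of $\mathbb P_{t,M}$ converge to the corresponding (finite) moments of $\mathbb P_t$, and $e_{2,t}(\alpha)=\log\int_{\mathbb R}e^{-t\alpha\phi}\,d\mathbb P_t(\phi)$ for all $\alpha\in\mathbb R$, with a finite integral. -/

import Mathlib

open Filter Topology MeasureTheory
open scoped ENNReal InnerProductSpace

noncomputable section

namespace XY

/-! ## Hilbert spaces of square-summable families -/

/-- The Hilbert space `ℓ²(ι)` of square-summable complex families. -/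
def Ell2 (ι : Type) : Type := lp (fun _ : ι => ℂ) 2

instance (ι : Type) : NormedAddCommGroup (Ell2 ι) :=
  inferInstanceAs (NormedAddCommGroup (lp (fun _ : ι => ℂ) 2))

instance (ι : Type) : InnerProductSpace ℂ (Ell2 ι) :=
  inferInstanceAs (InnerProductSpace ℂ (lp (fun _ : ι => ℂ) 2))

instance (ι : Type) : CompleteSpace (Ell2 ι) :=
  inferInstanceAs (CompleteSpace (lp (fun _ : ι => ℂ) 2))

instance (ι : Type) : CoeFun (Ell2 ι) (fun _ => ι → ℂ) where
  coe u := ((show lp (fun _ : ι => ℂ) 2 from u) : ι → ℂ)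

/-- Bounded operators on `ℓ²(ι)`. -/
abbrev Op (ι : Type) : Type := Ell2 ι →L[ℂ] Ell2 ι

/-- The basis vector `δ_x` of `ℓ²(ι)`. -/
def delta {ι : Type} [DecidableEq ι] (x : ι) : Ell2 ι :=
  lp.single (E := fun _ : ι => ℂ) 2 x (1 : ℂ)

/-- The matrix element `⟨δ_x, A δ_y⟩`. -/
def entry {ι : Type} [DecidableEq ι] (A : Op ι) (x y : ι) : ℂ :=
  ⟪delta x, A (delta y)⟫_ℂ

theorem summable_pullback {α β : Type} (f : β → α) (hf : f.Injective)
    (u : lp (fun _ : α => ℂ) 2) : Summable (fun b => ‖u (f b)‖ ^ (2 : ℝ)) := by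
  have h2 : 0 < (2 : ℝ≥0∞).toReal := by norm_num
  have h := (lp.memℓp u).summable h2
  have h3 : (2 : ℝ≥0∞).toReal = 2 := by norm_num
  rw [h3] at h
  exact h.comp_injective hf

theorem pullback_bound {α β : Type} (w : β → ℂ) (C : ℝ) (hC : ∀ b, ‖w b‖ ≤ C)
    (f : β → α) (u : lp (fun _ : α => ℂ) 2) (b : β) :
    ‖w b * u (f b)‖ ^ (2 : ℝ) ≤ |C| ^ (2 : ℝ) * ‖u (f b)‖ ^ (2 : ℝ) := by
  rw [norm_mul, Real.mul_rpow (norm_nonneg _) (norm_nonneg _)]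
  gcongr
  exact (hC b).trans (le_abs_self C)

theorem memℓp_pullback {α β : Type} (f : β → α) (hf : f.Injective) (w : β → ℂ)
    (hw : ∃ C : ℝ, ∀ b, ‖w b‖ ≤ C) (u : lp (fun _ : α => ℂ) 2) :
    Memℓp (fun b => w b * u (f b)) (2 : ℝ≥0∞) := by
  obtain ⟨C, hC⟩ := hw
  apply memℓp_gen
  have h3 : (2 : ℝ≥0∞).toReal = 2 := by norm_num
  rw [h3]
  exact Summable.of_nonneg_of_le (fun b => by positivity)
    (fun b => pullback_bound w C hC f u b) ((summable_pullback f hf u).mul_left _)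

/-- `pullback` below, for the underlying space of sequences. -/
def pullbackLp {α β : Type} (f : β → α) (hf : f.Injective) (w : β → ℂ)
    (hw : ∃ C : ℝ, ∀ b, ‖w b‖ ≤ C) :
    lp (fun _ : α => ℂ) 2 →L[ℂ] lp (fun _ : β => ℂ) 2 :=
  LinearMap.mkContinuousOfExistsBound
    { toFun := fun u => ⟨fun b => w b * u (f b), memℓp_pullback f hf w hw u⟩
      map_add' := fun u v => by
        ext b
        exact mul_add _ _ _
      map_smul' := fun c u => by
        ext b
        exact mul_left_comm _ _ _ }
    (by
      obtain ⟨C, hC⟩ := hw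
      refine ⟨|C|, fun u => ?_⟩
      have h2 : 0 < (2 : ℝ≥0∞).toReal := by norm_num
      have h3 : (2 : ℝ≥0∞).toReal = 2 := by norm_num
      have hs := summable_pullback f hf u
      have hu := (lp.memℓp u).summable h2
      rw [h3] at hu
      refine (Real.rpow_le_rpow_iff (norm_nonneg _) (by positivity) (by norm_num : (0:ℝ) < 2)).1 ?_
      rw [Real.mul_rpow (abs_nonneg _) (norm_nonneg _)]
      have e1 := lp.norm_rpow_eq_tsum h2 u
      have e2 := lp.norm_rpow_eq_tsum h2
        (⟨fun b => w b * u (f b), memℓp_pullback f hf w ⟨C, hC⟩ u⟩ : lp (fun _ : β => ℂ) 2)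
      rw [h3] at e1 e2
      refine (le_of_eq e2).trans ?_
      rw [e1, ← tsum_mul_left]
      calc _ ≤ ∑' b, |C| ^ (2 : ℝ) * ‖u (f b)‖ ^ (2 : ℝ) :=
            Summable.tsum_le_tsum (fun b => pullback_bound w C hC f u b)
              (Summable.of_nonneg_of_le (fun b => by positivity)
                (fun b => pullback_bound w C hC f u b) (hs.mul_left _)) (hs.mul_left _)
        _ ≤ _ := tsum_comp_le_tsum_of_inj (hu.mul_left _) (fun a => by positivity) hf)

/-- The bounded operator `(W u)(b) = w(b) u(f(b))` from `ℓ²(α)` to `ℓ²(β)`, for an injective map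
`f : β → α` and a bounded weight `w`. -/
def pullback {α β : Type} (f : β → α) (hf : f.Injective) (w : β → ℂ)
    (hw : ∃ C : ℝ, ∀ b, ‖w b‖ ≤ C) : Ell2 α →L[ℂ] Ell2 β :=
  pullbackLp f hf w hw

theorem pullback_apply {α β : Type} (f : β → α) (hf : f.Injective) (w : β → ℂ)
    (hw : ∃ C : ℝ, ∀ b, ‖w b‖ ≤ C) (u : Ell2 α) (b : β) :
    pullback f hf w hw u b = w b * u (f b) := rfl

/-- The trace of an operator on `ℓ²(ι)`, computed in the basis `δ_x`. It is applied to operators on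
finite-dimensional spaces and to finite-rank operators that kill all but finitely many `δ_x`. -/
def tr {ι : Type} [DecidableEq ι] (A : Op ι) : ℂ := ∑' x, entry A x x

/-! ## Fermionic Fock space -/

/-- Change the occupation of the site `x` in the configuration `S`. -/
def toggle {ι : Type} [DecidableEq ι] (x : ι) (S : Finset ι) : Finset ι :=
  if x ∈ S then S.erase x else insert x S

theorem toggle_injective {ι : Type} [DecidableEq ι] (x : ι) : (toggle x).Injective := by
  apply Function.Involutive.injective
  intro S
  by_cases h : x ∈ S <;> simp [toggle, h]

/-- The Fermionic Fock space over `ℓ²(ι)` in the occupation number representation: it has the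
orthonormal basis `δ_S = δ_{x₁} ∧ … ∧ δ_{xₙ}`, for the finite sets `S = {x₁ < … < xₙ}` of sites. -/
abbrev Fock (ι : Type) : Type := Ell2 (Finset ι)

/-- The annihilation operator `a_x = a(δ_x)` on the Fock space: `a_x δ_T = 0` if `x ∉ T`, and
`a_x δ_T = (-1)^{#{y ∈ T : y < x}} δ_{T \ {x}}` if `x ∈ T`. -/
def ann {ι : Type} [LinearOrder ι] (x : ι) : Op (Finset ι) :=
  pullback (toggle x) (toggle_injective x)
    (fun S => if x ∈ S then 0 else (-1) ^ (S.filter (· < x)).card)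
    ⟨1, fun S => by by_cases h : x ∈ S <;> simp [h]⟩

/-- The second quantization `dΓ(A) = ∑_{x,y} ⟨δ_x, A δ_y⟩ a_x* a_y` of an operator on `ℓ²(ι)`,
for finite `ι`. -/
def dGamma {ι : Type} [LinearOrder ι] [Fintype ι] (A : Op ι) : Op (Finset ι) :=
  ∑ x, ∑ y, entry A x y • (star (ann x) * ann y)

/-! ## The model -/

/-- The data of the open XY chain: bounded couplings `J`, a bounded magnetic field `lam`, the
half-width `N` of the central part, and the inverse temperatures of the left and right parts. -/
structure Chain where
  J : ℤ → ℝ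
  lam : ℤ → ℝ
  N : ℕ
  betaL : ℝ
  betaR : ℝ
  J_bdd : ∃ C : ℝ, ∀ x, |J x| ≤ C
  lam_bdd : ∃ C : ℝ, ∀ x, |lam x| ≤ C

/-- The sites of the finite interval `[-M, M]`. -/
abbrev Vol (M : ℕ) : Type := ↥(Finset.Icc (-(M : ℤ)) (M : ℤ))

/-- The orthogonal projection of `ℓ²(ℤ)` onto `ℓ²(𝒜)`. -/
def proj (A : Set ℤ) : Op ℤ :=
  open Classical in
  pullback id Function.injective_id (fun x => if x ∈ A then 1 else 0)
    ⟨1, fun x => by by_cases h : x ∈ A <;> simp [h]⟩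

/-- The restriction `ℓ²(ℤ) → ℓ²([-M, M])`. -/
def restrict (M : ℕ) : Ell2 ℤ →L[ℂ] Ell2 (Vol M) :=
  pullback Subtype.val Subtype.val_injective (fun _ => 1) ⟨1, fun _ => by simp⟩

/-- The orthogonal projection of the Fock space over `ℓ²(ℤ)` onto the Fock space over
`ℓ²([-M, M])`. -/
def restrictFock (M : ℕ) : Fock ℤ →L[ℂ] Fock (Vol M) :=
  pullback (Finset.map (Function.Embedding.subtype _)) (Finset.map_injective _) (fun _ => 1)
    ⟨1, fun _ => by simp⟩

/-- The compression `R A R*`. -/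
def compress {α β : Type} (R : Ell2 α →L[ℂ] Ell2 β) (A : Op α) : Op β :=
  R ∘L A ∘L ContinuousLinearMap.adjoint R

namespace Chain

variable (X : Chain)

/-- The Jacobi matrix `(h u)(n) = J_n u(n+1) + J_{n-1} u(n-1) + λ_n u(n)` on `ℓ²(ℤ)`. -/
def h : Op ℤ :=
  pullback (fun n => n + 1) (add_left_injective 1) (fun n => (X.J n : ℂ))
      (by simpa using X.J_bdd) +
    pullback (fun n => n - 1) (sub_left_injective) (fun n => (X.J (n - 1) : ℂ))
      (by obtain ⟨C, hC⟩ := X.J_bdd; exact ⟨C, fun n => by simpa using hC (n - 1)⟩) +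
    pullback id Function.injective_id (fun n => (X.lam n : ℂ)) (by simpa using X.lam_bdd)

/-- The restriction of the Jacobi matrix to the left part `(-∞, -N-1]`. -/
def hL : Op ℤ := proj (Set.Iic (-(X.N : ℤ) - 1)) * X.h * proj (Set.Iic (-(X.N : ℤ) - 1))

/-- The restriction of the Jacobi matrix to the right part `[N+1, ∞)`. -/
def hR : Op ℤ := proj (Set.Ici ((X.N : ℤ) + 1)) * X.h * proj (Set.Ici ((X.N : ℤ) + 1))

/-- `k = -β_l h_l - β_r h_r`. -/
def k : Op ℤ := -((X.betaL : ℂ) • X.hL) - (X.betaR : ℂ) • X.hR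

/-- The Jacobi matrix `h_M` of the chain confined to `[-M, M]`. -/
def hVol (M : ℕ) : Op (Vol M) := compress (restrict M) X.h

/-- `h_{l,M}`, supported on `[-M, -N-1]`. -/
def hLVol (M : ℕ) : Op (Vol M) := compress (restrict M) X.hL

/-- `h_{r,M}`, supported on `[N+1, M]`. -/
def hRVol (M : ℕ) : Op (Vol M) := compress (restrict M) X.hR

/-- `k_M = -β_l h_{l,M} - β_r h_{r,M}`. -/
def kVol (M : ℕ) : Op (Vol M) := -((X.betaL : ℂ) • X.hLVol M) - (X.betaR : ℂ) • X.hRVol M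

/-! ### The chain confined to `[-M, M]` -/

/-- The Hamiltonian `H_M = dΓ(h_M)`. -/
def H (M : ℕ) : Op (Finset (Vol M)) := dGamma (X.hVol M)

/-- The propagator `exp(i t H_M)`. -/
def U (M : ℕ) (t : ℝ) : Op (Finset (Vol M)) :=
  NormedSpace.exp ((Complex.I * (t : ℂ)) • X.H M)

/-- `exp(-β_l H_{l,M} - β_r H_{r,M})`. -/
def gibbs (M : ℕ) : Op (Finset (Vol M)) :=
  NormedSpace.exp
    (-((X.betaL : ℂ) • dGamma (X.hLVol M)) - (X.betaR : ℂ) • dGamma (X.hRVol M))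

/-- The initial density matrix `ω_M`. -/
def omega (M : ℕ) : Op (Finset (Vol M)) := (tr (X.gibbs M))⁻¹ • X.gibbs M

/-- The evolved density matrix `ω_{t,M} = exp(-i t H_M) ω_M exp(i t H_M)`. -/
def omegaT (M : ℕ) (t : ℝ) : Op (Finset (Vol M)) := X.U M (-t) * X.omega M * X.U M t

/-- The finite-volume entropic pressure functionals `e_{p,t,M}(α)`, for `0 < p ≤ ∞`. -/
def eVol (M : ℕ) (p : ℝ≥0∞) (t α : ℝ) : ℝ :=
  if p = ⊤ then
    Real.log (tr (NormedSpace.exp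
      (((1 - α : ℝ) : ℂ) • CFC.log (X.omega M) + (α : ℂ) • CFC.log (X.omegaT M t)))).re
  else
    Real.log (tr ((X.omega M ^ ((1 - α) / p.toReal) * X.omegaT M t ^ (2 * α / p.toReal) *
      X.omega M ^ ((1 - α) / p.toReal)) ^ (p.toReal / 2))).re

/-- The entropy observable `S_M = -log ω_M`. -/
def S (M : ℕ) : Op (Finset (Vol M)) := -CFC.log (X.omega M)

/-- The spectral projection `1_s(S_M)` onto the eigenspace of `S_M` for the eigenvalue `s`. -/
def specProj (M : ℕ) (s : ℝ) : Op (Finset (Vol M)) :=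
  cfc (fun x : ℝ => if x = s then (1 : ℝ) else 0) (X.S M)

/-- The full counting statistics `ℙ_{t,M}`, the law of `(s' - s) / t` where the pair `(s, s')` of
eigenvalues of `S_M` has the probability `tr(e^{-itH} ω 1_s(S) e^{itH} 1_{s'}(S))`. -/
def fcs (M : ℕ) (t : ℝ) : Measure ℝ :=
  Measure.sum fun q : spectrum ℝ (X.S M) × spectrum ℝ (X.S M) =>
    ENNReal.ofReal (tr (X.U M (-t) * X.omega M * X.specProj M q.1 * X.U M t *
      X.specProj M q.2)).re • Measure.dirac (((q.2 : ℝ) - (q.1 : ℝ)) / t)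

end Chain

/-! ### Trace formulas -/

/-- `k_s = e^{ish} k e^{-ish}`, as an operator on the one-particle space. -/
def evolve {ι : Type} (h k : Op ι) (s : ℝ) : Op ι :=
  NormedSpace.exp ((Complex.I * (s : ℂ)) • h) * k * NormedSpace.exp (-((Complex.I * (s : ℂ)) • h))

/-- The operator `𝒦_{p,t}(γ, u)` built from `h` and `k`. -/
def kernelK {ι : Type} (h k : Op ι) (p : ℝ≥0∞) (t γ u : ℝ) : Op ι :=
  if p = ⊤ then
    Ring.inverse (1 + NormedSpace.exp
      (-(((1 - γ : ℝ) : ℂ) • evolve h k (t * u)) - (γ : ℂ) • evolve h k (-(t * (1 - u)))))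
  else
    let E : ℝ → Op ι := fun s => NormedSpace.exp
      (((s * (1 - γ) / p.toReal : ℝ) : ℂ) • evolve h k (t * u))
    let F : Op ι := E 1 * NormedSpace.exp
      (((2 * γ / p.toReal : ℝ) : ℂ) • evolve h k (-(t * (1 - u)))) * E 1
    let T : Op ι := (1 / 2 : ℂ) • (E (-1) * Ring.inverse (1 + F ^ (-(p.toReal / 2))) * E 1)
    T + star T

/-- The trace formula `t ∫₀^α dγ ∫₀¹ du tr(𝒦_{p,t}(γ, u) i[k, h])`. -/
def traceFormula {ι : Type} [DecidableEq ι] (h k : Op ι) (p : ℝ≥0∞) (t α : ℝ) : ℂ :=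
  (t : ℂ) * ∫ γ in (0 : ℝ)..α, ∫ u in (0 : ℝ)..1,
    tr (kernelK h k p t γ u * (Complex.I • (k * h - h * k)))

/-! ## The extended chain -/

/-- The algebra of observables `𝒪` of the extended chain: the norm closure of the `*`-algebra
generated by the `a_x`, `x ∈ ℤ`, on the Fock space over `ℓ²(ℤ)`. -/
def obs : StarSubalgebra ℂ (Op (Finset ℤ)) :=
  (StarAlgebra.adjoin ℂ (Set.range (ann : ℤ → Op (Finset ℤ)))).topologicalClosure

/-- The annihilation operator `a_x` as an element of `𝒪`. -/
def annO (x : ℤ) : obs :=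
  ⟨ann x, StarSubalgebra.le_topologicalClosure _
    (StarAlgebra.subset_adjoin ℂ _ (Set.mem_range_self x))⟩

/-- The local observables: the `*`-algebra generated by the `a_x`, which is the union over `M` of the
algebras generated by the `a_x` with `|x| ≤ M`. -/
def obsLoc : StarSubalgebra ℂ obs := StarAlgebra.adjoin ℂ (Set.range annO)

/-- The second quantization in `𝒪` of the part of an operator on `ℓ²(ℤ)` that lives on `[-M, M]`. -/
def dGammaO (M : ℕ) (A : Op ℤ) : obs :=
  ∑ x ∈ Finset.Icc (-(M : ℤ)) M, ∑ y ∈ Finset.Icc (-(M : ℤ)) M,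
    entry A x y • (star (annO x) * annO y)

namespace Chain

variable (X : Chain)

/-- `H_M` as an element of `𝒪`. -/
def HO (M : ℕ) : obs := dGammaO M X.h

/-- The heat flux `-i[H, H_l]` out of the left part. It is the same local observable in every volume
`[-M, M]` with `M ≥ N + 2`. -/
def fluxL : obs :=
  -(Complex.I • (X.HO (X.N + 2) * dGammaO (X.N + 2) X.hL -
    dGammaO (X.N + 2) X.hL * X.HO (X.N + 2)))

/-- The heat flux `-i[H, H_r]` out of the right part. It is the same local observable in every volume
`[-M, M]` with `M ≥ N + 2`. -/
def fluxR : obs :=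
  -(Complex.I • (X.HO (X.N + 2) * dGammaO (X.N + 2) X.hR -
    dGammaO (X.N + 2) X.hR * X.HO (X.N + 2)))

/-- The entropy production observable `σ = -β_l Φ_l - β_r Φ_r`. -/
def sigma : obs := -((X.betaL : ℂ) • X.fluxL) - (X.betaR : ℂ) • X.fluxR

/-- `τ` is the dynamics of the extended chain: the strongly continuous group of `*`-automorphisms of
`𝒪` with `τ^t(A) = lim_M e^{itH_M} A e^{-itH_M}` for all local `A`. -/
structure IsDynamics (τ : ℝ → obs ≃⋆ₐ[ℂ] obs) : Prop where
  add : ∀ (s t : ℝ) (A : obs), τ (s + t) A = τ s (τ t A)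
  continuous : ∀ A : obs, Continuous fun t => τ t A
  tendsto : ∀ t : ℝ, ∀ A ∈ obsLoc, Tendsto
    (fun M => NormedSpace.exp ((Complex.I * (t : ℂ)) • X.HO M) * A *
      NormedSpace.exp (-((Complex.I * (t : ℂ)) • X.HO M))) atTop (𝓝 (τ t A))

/-- `ω` is the initial state of the extended chain: the state on `𝒪` with
`ω(A) = lim_M tr(ω_M A)` for all local `A`. For `M` large `A` lies in the algebra generated by the
`a_x` with `|x| ≤ M`, and it acts on the Fock space over `ℓ²([-M, M])` as its compression. -/
structure IsInitialState (ω : obs →L[ℂ] ℂ) : Prop where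
  one : ω 1 = 1
  nonneg : ∀ A, ∃ r : ℝ, 0 ≤ r ∧ ω (star A * A) = (r : ℂ)
  tendsto : ∀ A ∈ obsLoc, Tendsto
    (fun M => tr (X.omega M * compress (restrictFock M) (A : Op (Finset ℤ)))) atTop (𝓝 (ω A))

/-- The mean entropy production rate `Σ^t = (1/t) ∫₀^t σ_s ds`, where `σ_s = τ^s(σ)`. -/
def meanRate (τ : ℝ → obs ≃⋆ₐ[ℂ] obs) (t : ℝ) : obs :=
  ((1 / t : ℝ) : ℂ) • ∫ s in (0 : ℝ)..t, τ s X.sigma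

/-- The Evans-Searles functional `ES_t(α) = log ω(e^{-α t Σ^t})`. -/
def ES (τ : ℝ → obs ≃⋆ₐ[ℂ] obs) (ω : obs →L[ℂ] ℂ) (t α : ℝ) : ℝ :=
  Real.log (ω (NormedSpace.exp (-((α * t : ℝ) : ℂ) • X.meanRate τ t))).re

/-- The correlation `ω((σ_s - ω(σ_s)) (σ_u - ω(σ_u)))`. -/
def corr (τ : ℝ → obs ≃⋆ₐ[ℂ] obs) (ω : obs →L[ℂ] ℂ) (s u : ℝ) : ℂ :=
  ω ((τ s X.sigma - ω (τ s X.sigma) • 1) * (τ u X.sigma - ω (τ u X.sigma) • 1))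

end Chain

end XY

end

/-!
# Entropic functionals of a free Fermi chain out of equilibrium

*Reduction to one particle.* The annihilation operators of the Fock space satisfy the canonical
anticommutation relations, so that `e^{dΓ(C)} a*(f) = a*(e^C f) e^{dΓ(C)}` (`IsCAR.exp_crea`). An
operator that fixes the vacuum is determined by such a relation (`IsGamma.unique`), so that products
of operators `e^{dΓ(C)}` are again of this form. Hence, up to normalization, `e_{p,t,M}` is the
`pressure` `log tr e^{dΓ(C)}` for an operator `C` built from `k_M` and `k_M` evolved to the time `-t`. The
two-point function of a Gibbs state, `tr_exp_dGamma_mul`, and the chain rule under the trace,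
`hasDerivAt_tr_cfc`, give the derivative of the pressure in `α` (`hasDerivAt_pressure`): it is the
trace of the kernel `𝒦_{p,t}(γ, 0)` against `k_{-t} - k`. As this difference is the integral of the
flux `i[k, h]` along the evolution, integration over `[0, α]` yields the trace formula
(`pressure_sub_eq_traceFormula`).

*Infinite volume.* Outside the centre of the chain `k` is locally a multiple of `h`, so that
`i[k, h]` has finitely many matrix elements and they do not depend on `M` (`entry_flow_vol`,
`entry_flow_eq_zero`). The finite-volume kernels converge strongly (`SConv`) and dominated
convergence gives the limit (`Chain.tendsto_eVol`). With `r = 1/p` the kernel becomes a function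
that extends continuously to `r = 0` (`kernelAB_eq_kernelR`), which yields the joint continuity up
to `p = ∞`. Since real powers of the positive operators in the kernel extend holomorphically in `γ`
(`exists_analyticAt_rpow`), the limit is real-analytic in `α`.

*Convexity, monotonicity, symmetries.* These properties concern traces, but complex interpolation
is simplest for norms. By the formula `log tr e^{dΓ(C)} = tr log (1 + e^C)` and the
representation of `log (1 + e^x)` as a mixture of the functions `max(x - s, 0)`, the pressure is a
mixture over `s` of the numbers `p log ‖Y_s‖`, where `Y_s` is a product of exponentials on the Fock
space, shifted by `s` times the number operator (`exists_sums_pressure`, `sum_softplus_le`).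
Convexity in `α` and monotonicity in `p` then follow from the three lines theorem
(`log_norm_expFamily_le`), and the symmetry `α ↔ 1 - α` from `‖Y* Y‖ = ‖Y Y*‖` (`pressure_swap`).
The case `p = ∞` is a limit. Time-reversal invariance holds because `h` and `k` have real matrix
elements (`traceFormula_neg`).

*Full counting statistics.* The moment generating function of `ℙ_{t,M}` is the exponential of the
functional with `p = 2`. It converges everywhere, which gives tightness, the convergence of all
moments, and uniqueness of the cluster points (`exists_limit_of_tendsto_mgf`).

*The extended chain.* On generators the convergence of the dynamics follows from that of the
one-particle dynamics, because `‖a*(f)‖ ≤ ‖f‖`; it extends to the closed algebra as the evolutions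
are contractions (`exists_tendsto_evolO`). For the initial state, a field operator
is split into two parts which the density matrix exchanges (`exists_pull_through`). By the
cyclicity of the trace this expresses the expectation of a word of field operators through
anticommutators and shorter words, and its convergence follows by induction
(`exists_tendsto_word`).

*Derivatives at `α = 0`.* For `p = 2` they are the first moments of the full counting statistics,
that is, those of the increment of `-log ω_M` in time, which converges in norm to the integrated
entropy production (`tendsto_entropyProdVol`, `derivs_e_two`). The first derivative does not depend
on `p`, as the kernel at `γ = 0` does not (`kernelAB_zero`). Those of `ES_t` are the first cumulants
of the same observable in the state `ω` (`derivs_log_genFun`).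
-/

open Filter Topology MeasureTheory
open scoped ENNReal InnerProductSpace

noncomputable section

namespace XY

/-! ### Coordinates, matrix elements and the trace on `ℓ²(ι)` -/

section Basics

variable {ι κ : Type}

theorem ell2_ext {u v : Ell2 ι} (h : ∀ x, u x = v x) : u = v := by
  apply Subtype.ext
  funext x
  exact h x

@[simp] theorem ell2_add (u v : Ell2 ι) (x : ι) : (u + v) x = u x + v x := rfl
@[simp] theorem ell2_sub (u v : Ell2 ι) (x : ι) : (u - v) x = u x - v x := rfl
@[simp] theorem ell2_zero (x : ι) : (0 : Ell2 ι) x = 0 := rfl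
@[simp] theorem ell2_smul (c : ℂ) (u : Ell2 ι) (x : ι) : (c • u) x = c * u x := rfl

theorem ell2_sum {α : Type*} (s : Finset α) (f : α → Ell2 ι) (x : ι) :
    (∑ a ∈ s, f a) x = ∑ a ∈ s, f a x := by
  classical
  induction s using Finset.induction_on with
  | empty => simp
  | insert a s ha ih => rw [Finset.sum_insert ha, Finset.sum_insert ha, ell2_add, ih]

variable [DecidableEq ι] [DecidableEq κ]

theorem delta_apply (x y : ι) : delta x y = if y = x then (1 : ℂ) else 0 := by
  change (lp.single (E := fun _ : ι => ℂ) 2 x (1 : ℂ)) y = _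
  rw [lp.single_apply, Pi.single_apply]

theorem inner_delta (x : ι) (u : Ell2 ι) : ⟪delta x, u⟫_ℂ = u x := by
  have := lp.inner_single_left (𝕜 := ℂ) (G := fun _ : ι => ℂ) x 1 u
  refine Eq.trans this ?_
  simp

theorem entry_eq (A : Op ι) (x y : ι) : entry A x y = A (delta y) x := inner_delta _ _

theorem norm_delta (x : ι) : ‖delta x‖ = 1 := by
  have : ‖delta x‖ ^ 2 = 1 := by
    have h := inner_self_eq_norm_sq_to_K (𝕜 := ℂ) (delta x)
    rw [inner_delta, delta_apply] at h
    simp only [if_true] at h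
    have h' : ((‖delta x‖ ^ 2 : ℝ) : ℂ) = ((1 : ℝ) : ℂ) := by
      push_cast
      exact h.symm
    exact Complex.ofReal_injective h'
  nlinarith [norm_nonneg (delta x)]

theorem hasSum_delta (u : Ell2 ι) : HasSum (fun x => u x • delta x) u := by
  have := lp.hasSum_single (p := 2) (E := fun _ : ι => ℂ) (by norm_num) u
  have h2 : (fun x => u x • delta x) = fun x => (show Ell2 ι from
      lp.single (E := fun _ : ι => ℂ) 2 x (u x)) := by
    funext x
    apply ell2_ext
    intro y
    rw [ell2_smul, delta_apply]
    change _ = (lp.single (E := fun _ : ι => ℂ) 2 x _) y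
    rw [lp.single_apply, Pi.single_apply]
    by_cases h : y = x
    · subst h
      simp
    · simp [h]
  rw [h2]
  exact this

theorem clm_ext_delta {E : Type*} [NormedAddCommGroup E] [NormedSpace ℂ E] {A B : Ell2 ι →L[ℂ] E}
    (h : ∀ x, A (delta x) = B (delta x)) : A = B := by
  ext u
  have hA := A.hasSum (hasSum_delta u)
  have hB := B.hasSum (hasSum_delta u)
  simp only [map_smul, h] at hA hB
  exact hA.unique hB

theorem op_ext_entry {A B : Op ι} (h : ∀ x y, entry A x y = entry B x y) : A = B := by
  apply clm_ext_delta
  intro y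
  apply ell2_ext
  intro x
  rw [← entry_eq, ← entry_eq, h]

theorem entry_add (A B : Op ι) (x y : ι) : entry (A + B) x y = entry A x y + entry B x y := by
  simp [entry_eq]

theorem entry_smul (c : ℂ) (A : Op ι) (x y : ι) : entry (c • A) x y = c * entry A x y := by
  simp [entry_eq]

theorem entry_star (A : Op ι) (x y : ι) : entry (star A) x y = star (entry A y x) := by
  rw [entry, ContinuousLinearMap.star_eq_adjoint, ContinuousLinearMap.adjoint_inner_right,
    ← inner_conj_symm]
  rfl

theorem entry_one (x y : ι) : entry (1 : Op ι) x y = if x = y then 1 else 0 := by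
  rw [entry_eq]
  exact delta_apply y x

theorem pullback_delta {α β : Type} [DecidableEq α] [DecidableEq β] (f : β → α) (hf : f.Injective)
    (w : β → ℂ) (hw : ∃ C : ℝ, ∀ b, ‖w b‖ ≤ C) (b : β) :
    pullback f hf w hw (delta (f b)) = w b • delta b := by
  apply ell2_ext
  intro c
  rw [pullback_apply, ell2_smul, delta_apply, delta_apply]
  by_cases h : c = b
  · simp [h]
  · simp [h, hf.ne h]

theorem adjoint_pullback_delta {α β : Type} [DecidableEq α] [DecidableEq β] (f : β → α)
    (hf : f.Injective) (w : β → ℂ) (hw : ∃ C : ℝ, ∀ b, ‖w b‖ ≤ C) (b : β) :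
    ContinuousLinearMap.adjoint (pullback f hf w hw) (delta b) = star (w b) • delta (f b) := by
  refine ext_inner_right ℂ fun u => ?_
  rw [ContinuousLinearMap.adjoint_inner_left, inner_smul_left, inner_delta, inner_delta,
    pullback_apply]
  simp

theorem continuous_entry (x y : ι) : Continuous fun A : Op ι => entry A x y := by
  unfold entry
  fun_prop

section Finite

variable [Fintype ι]

theorem eq_sum_delta (u : Ell2 ι) : u = ∑ x, u x • delta x :=
  (hasSum_delta u).unique (hasSum_fintype _)

theorem apply_eq_sum_entry (A : Op ι) (u : Ell2 ι) (x : ι) :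
    A u x = ∑ y, entry A x y * u y := by
  conv_lhs => rw [eq_sum_delta u]
  rw [map_sum, ell2_sum]
  simp [entry_eq, mul_comm]

theorem entry_mul (A B : Op ι) (x y : ι) : entry (A * B) x y = ∑ z, entry A x z * entry B z y := by
  rw [entry_eq, mul_apply_eq_comp, apply_eq_sum_entry]
  simp [entry_eq]

/-- The matrix of an operator on a finite-dimensional `ℓ²(ι)`, as a homomorphism of
`*`-algebras. -/
def toMat : Op ι →⋆ₐ[ℂ] Matrix ι ι ℂ where
  toFun A := Matrix.of fun x y => entry A x y
  map_one' := by
    ext x y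
    simp [entry_one, Matrix.one_apply]
  map_mul' A B := by
    ext x y
    simp [entry_mul, Matrix.mul_apply]
  map_zero' := by
    ext x y
    simp [entry_eq]
  map_add' A B := by
    ext x y
    simp [entry_add]
  commutes' c := by
    ext x y
    rw [Algebra.algebraMap_eq_smul_one, Algebra.algebraMap_eq_smul_one]
    simp [entry_smul, entry_one, Matrix.one_apply]
  map_star' A := by
    ext x y
    simp [entry_star]

theorem toMat_apply (A : Op ι) (x y : ι) : toMat A x y = entry A x y := rfl

theorem tr_eq_sum (A : Op ι) : tr A = ∑ x, entry A x x := tsum_fintype _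

theorem tr_eq_trace (A : Op ι) : tr A = (toMat A).trace := tr_eq_sum A

/-- The trace as a continuous linear functional. -/
def trL : Op ι →L[ℂ] ℂ where
  toFun := tr
  map_add' A B := by simp [tr_eq_trace]
  map_smul' c A := by simp [tr_eq_trace]
  cont := by
    simp only [funext fun A : Op ι => tr_eq_sum A]
    exact continuous_finsetSum _ fun x _ => continuous_entry x x

theorem trL_apply (A : Op ι) : trL A = tr A := rfl

theorem tr_mul_comm (A B : Op ι) : tr (A * B) = tr (B * A) := by
  rw [tr_eq_trace, tr_eq_trace, map_mul, map_mul, Matrix.trace_mul_comm]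

theorem tr_add (A B : Op ι) : tr (A + B) = tr A + tr B := trL.map_add A B
theorem tr_sub (A B : Op ι) : tr (A - B) = tr A - tr B := trL.map_sub A B
theorem tr_smul (c : ℂ) (A : Op ι) : tr (c • A) = c * tr A := trL.map_smul c A

theorem tr_star (A : Op ι) : tr (star A) = star (tr A) := by
  rw [tr_eq_trace, tr_eq_trace, map_star, Matrix.star_eq_conjTranspose, Matrix.trace_conjTranspose]

theorem tr_one : tr (1 : Op ι) = Fintype.card ι := by
  rw [tr_eq_trace, map_one, Matrix.trace_one]

theorem tr_im_eq_zero {A : Op ι} (hA : IsSelfAdjoint A) : (tr A).im = 0 := by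
  have h := tr_star A
  rw [hA.star_eq] at h
  exact Complex.conj_eq_iff_im.1 h.symm

theorem tr_star_mul_self (A : Op ι) : tr (star A * A) = ((∑ x, ‖A (delta x)‖ ^ 2 : ℝ) : ℂ) := by
  rw [tr_eq_sum]
  push_cast
  refine Finset.sum_congr rfl fun x _ => ?_
  rw [entry, mul_apply_eq_comp, ContinuousLinearMap.star_eq_adjoint,
    ContinuousLinearMap.adjoint_inner_right, inner_self_eq_norm_sq_to_K]
  rfl

theorem tr_nonneg {A : Op ι} (hA : 0 ≤ A) : 0 ≤ (tr A).re := by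
  obtain ⟨B, rfl⟩ := CStarAlgebra.nonneg_iff_eq_star_mul_self.1 hA
  rw [tr_star_mul_self, Complex.ofReal_re]
  positivity

theorem tr_mul_nonneg {A B : Op ι} (hA : 0 ≤ A) (hB : 0 ≤ B) : 0 ≤ (tr (A * B)).re := by
  obtain ⟨C, rfl⟩ := CStarAlgebra.nonneg_iff_eq_star_mul_self.1 hA
  rw [mul_assoc, tr_mul_comm]
  exact tr_nonneg (by simpa using star_left_conjugate_nonneg hB (star C))

/-- A density matrix defines a functional of norm at most one. -/
theorem norm_tr_mul_le {ρ : Op ι} (hρ : 0 ≤ ρ) (B : Op ι) : ‖tr (ρ * B)‖ ≤ (tr ρ).re * ‖B‖ := by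
  obtain ⟨C, hC, rfl⟩ := CStarAlgebra.nonneg_iff_exists_isSelfAdjoint_and_eq_mul_self.1 hρ
  have hC' : tr (C * C) = ((∑ x, ‖C (delta x)‖ ^ 2 : ℝ) : ℂ) := by
    rw [← tr_star_mul_self, hC.star_eq]
  rw [hC', mul_assoc, tr_mul_comm, mul_assoc, tr_eq_sum, Complex.ofReal_re, Finset.sum_mul]
  refine (norm_sum_le _ _).trans (Finset.sum_le_sum fun x _ => ?_)
  have : entry (C * (B * C)) x x = ⟪C (delta x), B (C (delta x))⟫_ℂ := by
    rw [entry, mul_apply_eq_comp, mul_apply_eq_comp]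
    conv_lhs => rw [← hC.star_eq]
    rw [ContinuousLinearMap.star_eq_adjoint, ContinuousLinearMap.adjoint_inner_right,
      ← ContinuousLinearMap.star_eq_adjoint, hC.star_eq]
  rw [this]
  refine (norm_inner_le_norm _ _).trans ?_
  calc ‖C (delta x)‖ * ‖B (C (delta x))‖ ≤ ‖C (delta x)‖ * (‖B‖ * ‖C (delta x)‖) := by
        gcongr
        exact B.le_opNorm _
    _ = _ := by ring

end Finite

end Basics

/-! ### Canonical anticommutation relations -/

section CAR

/-- The canonical anticommutation relations for a family of annihilation operators in a
`*`-algebra. -/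
structure IsCAR {ι 𝔄 : Type*} [DecidableEq ι] [Ring 𝔄] [StarRing 𝔄] (c : ι → 𝔄) : Prop where
  anti : ∀ x y, c x * c y + c y * c x = 0
  mixed : ∀ x y, c x * star (c y) + star (c y) * c x = if x = y then 1 else 0

theorem exp_add_of_comm {𝔄 : Type*} [NormedRing 𝔄] [NormedAlgebra ℂ 𝔄] [CompleteSpace 𝔄] {a b : 𝔄}
    (h : Commute a b) : NormedSpace.exp (a + b) = NormedSpace.exp a * NormedSpace.exp b := by
  let _ : NormedAlgebra ℚ 𝔄 := NormedAlgebra.restrictScalars ℚ ℂ 𝔄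
  exact NormedSpace.exp_add_of_commute h

theorem exp_mul_exp_neg {𝔄 : Type*} [NormedRing 𝔄] [NormedAlgebra ℂ 𝔄] [CompleteSpace 𝔄] (a : 𝔄) :
    NormedSpace.exp a * NormedSpace.exp (-a) = 1 := by
  rw [← exp_add_of_comm (Commute.refl a).neg_right, add_neg_cancel, NormedSpace.exp_zero]

theorem exp_neg_mul_exp {𝔄 : Type*} [NormedRing 𝔄] [NormedAlgebra ℂ 𝔄] [CompleteSpace 𝔄] (a : 𝔄) :
    NormedSpace.exp (-a) * NormedSpace.exp a = 1 := by
  simpa using exp_mul_exp_neg (-a)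

/-- If `[H, ψ(v)] = ψ(v')` along a curve `v`, then `exp(s H)` implements the flow of `v`. -/
theorem exp_conj_of_commutator {V 𝔄 : Type*} [NormedAddCommGroup V] [NormedSpace ℂ V]
    [NormedRing 𝔄] [NormedAlgebra ℂ 𝔄] [CompleteSpace 𝔄]
    (ψ : V →L[ℂ] 𝔄) (H : 𝔄) (v v' : ℂ → V) (hv : ∀ s, HasDerivAt v (v' s) s)
    (hc : ∀ s, H * ψ (v s) - ψ (v s) * H = ψ (v' s)) (s : ℂ) :
    NormedSpace.exp (s • H) * ψ (v 0) * NormedSpace.exp (-(s • H)) = ψ (v s) := by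
  have key : ∀ s, NormedSpace.exp (-(s • H)) * ψ (v s) * NormedSpace.exp (s • H) = ψ (v 0) := by
    intro s
    have hd : ∀ s : ℂ, HasDerivAt
        (fun s : ℂ => NormedSpace.exp (s • (-H)) * ψ (v s) * NormedSpace.exp (s • H)) 0 s := by
      intro s
      have h1 := hasDerivAt_exp_smul_const (𝕂 := ℂ) (-H) s
      have h2 := hasDerivAt_exp_smul_const' (𝕂 := ℂ) H s
      have h3 := (ψ.hasFDerivAt (x := v s)).comp_hasDerivAt s (hv s)
      refine ((h1.mul h3).mul h2).congr_deriv ?_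
      simp only [← hc, Pi.mul_apply, Function.comp_apply]
      noncomm_ring
    have := is_const_of_deriv_eq_zero (fun s => (hd s).differentiableAt) (fun s => (hd s).deriv) s 0
    simpa using this
  have h1 := exp_mul_exp_neg (s • H)
  calc _ = NormedSpace.exp (s • H) * (NormedSpace.exp (-(s • H)) * ψ (v s) *
        NormedSpace.exp (s • H)) * NormedSpace.exp (-(s • H)) := by rw [key]
    _ = (NormedSpace.exp (s • H) * NormedSpace.exp (-(s • H))) * ψ (v s) *
        (NormedSpace.exp (s • H) * NormedSpace.exp (-(s • H))) := by noncomm_ring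
    _ = _ := by rw [h1, one_mul, mul_one]

variable {ι : Type} [DecidableEq ι] [Fintype ι] {𝔄 : Type*} [NormedRing 𝔄] [StarRing 𝔄]
  [NormedAlgebra ℂ 𝔄]

/-- The creation operator `a*(f) = ∑ f(x) c_x*`. -/
def crea (c : ι → 𝔄) : Ell2 ι →L[ℂ] 𝔄 :=
  ∑ x, (innerSL ℂ (delta x)).smulRight (star (c x))

/-- The second quantization `∑ A_{xy} c_x* c_y` with respect to a family `c`. -/
def dG (c : ι → 𝔄) : Op ι →L[ℂ] 𝔄 :=
  ∑ x, ∑ y, ((innerSL ℂ (delta x)).comp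
    (ContinuousLinearMap.apply ℂ (Ell2 ι) (delta y))).smulRight (star (c x) * c y)

theorem crea_apply (c : ι → 𝔄) (f : Ell2 ι) : crea c f = ∑ x, f x • star (c x) := by
  simp [crea, inner_delta]

theorem crea_delta (c : ι → 𝔄) (x : ι) : crea c (delta x) = star (c x) := by
  simp [crea_apply, delta_apply]

theorem dG_apply (c : ι → 𝔄) (A : Op ι) :
    dG c A = ∑ x, ∑ y, entry A x y • (star (c x) * c y) := by
  simp [dG, entry]

theorem dG_eq_sum_crea (c : ι → 𝔄) (A : Op ι) : dG c A = ∑ y, crea c (A (delta y)) * c y := by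
  rw [dG_apply, Finset.sum_comm]
  simp [crea_apply, Finset.sum_mul, entry_eq]

theorem star_dG [StarModule ℂ 𝔄] (c : ι → 𝔄) (A : Op ι) : star (dG c A) = dG c (star A) := by
  rw [dG_apply, dG_apply, Finset.sum_comm]
  simp [star_sum, entry_star]

variable {c : ι → 𝔄} (hc : IsCAR c)
include hc

theorem IsCAR.crea_comm (f : Ell2 ι) (x : ι) :
    c x * crea c f + crea c f * c x = f x • (1 : 𝔄) := by
  rw [crea_apply, Finset.mul_sum, Finset.sum_mul, ← Finset.sum_add_distrib]
  simp only [mul_smul_comm, smul_mul_assoc, ← smul_add, hc.mixed]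
  simp

theorem IsCAR.crea_anti [StarModule ℂ 𝔄] (f g : Ell2 ι) :
    crea c f * crea c g + crea c g * crea c f = 0 := by
  have h : ∀ x y, star (c x) * star (c y) + star (c y) * star (c x) = 0 := by
    intro x y
    rw [← star_mul, ← star_mul, ← star_add, hc.anti, star_zero]
  rw [crea_apply, crea_apply, Finset.sum_mul_sum, Finset.sum_mul_sum, Finset.sum_comm (γ := ι),
    ← Finset.sum_add_distrib]
  refine Finset.sum_eq_zero fun x _ => ?_
  rw [← Finset.sum_add_distrib]
  refine Finset.sum_eq_zero fun y _ => ?_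
  rw [smul_mul_smul_comm, smul_mul_smul_comm, mul_comm (g x), ← smul_add, h, smul_zero]

theorem IsCAR.anni_crea [StarModule ℂ 𝔄] (f g : Ell2 ι) :
    star (crea c g) * crea c f + crea c f * star (crea c g) = ⟪g, f⟫_ℂ • (1 : 𝔄) := by
  have h : star (crea c g) = ∑ x, star (g x) • c x := by
    simp [crea_apply, star_sum]
  rw [h, Finset.sum_mul, Finset.mul_sum, ← Finset.sum_add_distrib]
  simp only [mul_smul_comm, smul_mul_assoc, ← smul_add, hc.crea_comm]
  rw [eq_sum_delta g, sum_inner, Finset.sum_smul]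
  refine Finset.sum_congr rfl fun x _ => ?_
  rw [inner_smul_left, inner_delta, ← eq_sum_delta, smul_smul]
  rfl

/-- The bound `‖a*(f)‖ ≤ ‖f‖`: with `b = a*(f)`, the relations `b² = 0` and `b*b + bb* = ‖f‖²` give
`(b*b)² = ‖f‖² b*b`. -/
theorem IsCAR.norm_crea_le [StarModule ℂ 𝔄] [CStarRing 𝔄] (f : Ell2 ι) : ‖crea c f‖ ≤ ‖f‖ := by
  set b := crea c f
  have h0 : b * b = 0 := by
    have h := hc.crea_anti f f
    rw [← two_smul ℂ, smul_eq_zero] at h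
    exact h.resolve_left two_ne_zero
  have h1 : b * star b = ((‖f‖ ^ 2 : ℝ) : ℂ) • (1 : 𝔄) - star b * b := by
    have h := hc.anni_crea f f
    rw [inner_self_eq_norm_sq_to_K] at h
    rw [eq_sub_iff_add_eq, add_comm]
    push_cast
    exact h
  have h2 : (star b * b) * (star b * b) = ((‖f‖ ^ 2 : ℝ) : ℂ) • (star b * b) := by
    calc (star b * b) * (star b * b) = star b * (b * star b) * b := by noncomm_ring
      _ = ((‖f‖ ^ 2 : ℝ) : ℂ) • (star b * b) - star b * star b * (b * b) := by
          rw [h1, mul_sub, sub_mul, mul_smul_comm, mul_one, smul_mul_assoc]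
          noncomm_ring
      _ = _ := by rw [h0, mul_zero, sub_zero]
  have h3 : (‖b‖ * ‖b‖) * (‖b‖ * ‖b‖) = ‖f‖ ^ 2 * (‖b‖ * ‖b‖) := by
    have h4 : star (star b * b) = star b * b := by simp
    have h5 := CStarRing.norm_star_mul_self (x := star b * b)
    rw [h4, h2, norm_smul, CStarRing.norm_star_mul_self, Complex.norm_real, Real.norm_eq_abs,
      abs_of_nonneg (by positivity)] at h5
    exact h5.symm
  by_cases hb : ‖b‖ = 0
  · rw [hb]
    positivity
  · have h6 : ‖b‖ * ‖b‖ = ‖f‖ ^ 2 := mul_right_cancel₀ (mul_ne_zero hb hb) h3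
    nlinarith [norm_nonneg b, norm_nonneg f]

theorem IsCAR.dG_comm_crea [StarModule ℂ 𝔄] (A : Op ι) (f : Ell2 ι) :
    dG c A * crea c f - crea c f * dG c A = crea c (A f) := by
  have h1 : ∀ y, crea c (A (delta y)) * c y * crea c f - crea c f * (crea c (A (delta y)) * c y) =
      crea c (f y • A (delta y)) := by
    intro y
    have h2 := hc.crea_comm f y
    have h3 := hc.crea_anti f (A (delta y))
    calc _ = crea c (A (delta y)) * (c y * crea c f + crea c f * c y) -
          (crea c f * crea c (A (delta y)) + crea c (A (delta y)) * crea c f) * c y := by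
          noncomm_ring
      _ = _ := by rw [h2, h3]; simp
  rw [dG_eq_sum_crea, Finset.sum_mul, Finset.mul_sum, ← Finset.sum_sub_distrib]
  simp only [h1]
  rw [← map_sum]
  congr 1
  conv_rhs => rw [eq_sum_delta f]
  simp

theorem IsCAR.dG_comm_c [StarModule ℂ 𝔄] (A : Op ι) (z : ι) :
    dG c A * c z - c z * dG c A = -∑ y, entry A z y • c y := by
  have h := congrArg star (hc.dG_comm_crea (star A) (delta z))
  rw [star_sub, star_mul, star_mul, star_dG, star_star, crea_delta, star_star, crea_apply,
    star_sum] at h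
  rw [← neg_sub, h]
  congr 1
  refine Finset.sum_congr rfl fun y _ => ?_
  rw [star_smul, star_star, ← entry_eq, entry_star, star_star]

theorem IsCAR.dG_comm [StarModule ℂ 𝔄] (A B : Op ι) :
    dG c A * dG c B - dG c B * dG c A = dG c (A * B - B * A) := by
  have h1 : ∀ y, dG c A * (crea c (B (delta y)) * c y) - crea c (B (delta y)) * c y * dG c A =
      crea c (A (B (delta y))) * c y - ∑ z, entry A y z • (crea c (B (delta y)) * c z) := by
    intro y
    have h2 := hc.dG_comm_crea A (B (delta y))
    have h3 := hc.dG_comm_c A y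
    calc _ = (dG c A * crea c (B (delta y)) - crea c (B (delta y)) * dG c A) * c y +
          crea c (B (delta y)) * (dG c A * c y - c y * dG c A) := by noncomm_ring
      _ = _ := by rw [h2, h3, mul_neg, Finset.mul_sum, sub_eq_add_neg]; simp
  conv_lhs => rw [dG_eq_sum_crea c B, Finset.sum_mul, Finset.mul_sum, ← Finset.sum_sub_distrib]
  simp only [h1]
  rw [Finset.sum_sub_distrib, Finset.sum_comm, map_sub, dG_eq_sum_crea, dG_eq_sum_crea]
  congr 1
  refine Finset.sum_congr rfl fun z _ => ?_
  simp only [← smul_mul_assoc, ← Finset.sum_mul, ← map_smul, ← map_sum]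
  congr 2
  rw [mul_apply_eq_comp]
  conv_rhs => rw [eq_sum_delta (A (delta z))]
  simp [entry_eq]

theorem IsCAR.exp_crea [StarModule ℂ 𝔄] [CompleteSpace 𝔄] (A : Op ι) (f : Ell2 ι) :
    NormedSpace.exp (dG c A) * crea c f * NormedSpace.exp (-dG c A) =
      crea c (NormedSpace.exp A f) := by
  have := exp_conj_of_commutator (crea c) (dG c A) (fun s => NormedSpace.exp (s • A) f)
    (fun s => A (NormedSpace.exp (s • A) f)) (fun s => ?_) (fun s => hc.dG_comm_crea _ _) 1
  · simpa using this
  · have h := hasDerivAt_exp_smul_const' (𝕂 := ℂ) A s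
    exact ((ContinuousLinearMap.apply ℂ (Ell2 ι) f).hasFDerivAt.comp_hasDerivAt s h)

theorem IsCAR.exp_dG [StarModule ℂ 𝔄] [CompleteSpace 𝔄] (A B : Op ι) :
    NormedSpace.exp (dG c A) * dG c B * NormedSpace.exp (-dG c A) =
      dG c (NormedSpace.exp A * B * NormedSpace.exp (-A)) := by
  have := exp_conj_of_commutator (dG c) (dG c A)
    (fun s => NormedSpace.exp (s • A) * B * NormedSpace.exp (s • (-A)))
    (fun s => A * (NormedSpace.exp (s • A) * B * NormedSpace.exp (s • (-A))) -
      (NormedSpace.exp (s • A) * B * NormedSpace.exp (s • (-A))) * A)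
    (fun s => ?_) (fun s => hc.dG_comm _ _) 1
  · simpa using this
  · have h1 := hasDerivAt_exp_smul_const' (𝕂 := ℂ) A s
    have h2 := hasDerivAt_exp_smul_const (𝕂 := ℂ) (-A) s
    convert! (h1.mul_const B).mul h2 using 1
    noncomm_ring

end CAR

/-! ### The annihilation operators of the Fock space -/

section Fock

variable {ι : Type}

theorem mem_toggle [DecidableEq ι] (x z : ι) (S : Finset ι) :
    z ∈ toggle x S ↔ (z ≠ x ∧ z ∈ S) ∨ (z = x ∧ z ∉ S) := by
  unfold toggle
  split_ifs with h
  · simp only [Finset.mem_erase]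
    constructor
    · intro h; exact Or.inl h
    · rintro (h1 | ⟨rfl, h1⟩)
      · exact h1
      · exact absurd h h1
  · simp only [Finset.mem_insert]
    constructor
    · rintro (rfl | h1)
      · exact Or.inr ⟨rfl, h⟩
      · by_cases hz : z = x
        · subst hz; exact absurd h1 h
        · exact Or.inl ⟨hz, h1⟩
    · rintro (h1 | h1)
      · exact Or.inr h1.2
      · exact Or.inl h1.1

theorem toggle_toggle [DecidableEq ι] (x : ι) (S : Finset ι) : toggle x (toggle x S) = S := by
  ext z
  simp only [mem_toggle]
  tauto

theorem toggle_comm [DecidableEq ι] (x y : ι) (S : Finset ι) :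
    toggle x (toggle y S) = toggle y (toggle x S) := by
  ext z
  simp only [mem_toggle]
  tauto

variable [LinearOrder ι]

/-- The Jordan–Wigner sign `(-1)^{#{y ∈ S : y < x}}`. -/
def jwSign (x : ι) (S : Finset ι) : ℂ := (-1) ^ (S.filter (· < x)).card

theorem jwSign_mul_self (x : ι) (S : Finset ι) : jwSign x S * jwSign x S = 1 := by
  rw [jwSign, ← pow_add, ← two_mul, pow_mul]
  simp

theorem jwSign_toggle (x y : ι) (S : Finset ι) :
    jwSign x (toggle y S) = if y < x then -jwSign x S else jwSign x S := by
  unfold jwSign toggle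
  split_ifs with h1 h2 h2
  · rw [Finset.filter_erase]
    have hm : y ∈ S.filter (· < x) := by simp [h1, h2]
    have h3 := Finset.card_erase_add_one hm
    rw [← h3, pow_succ]
    ring
  · rw [Finset.filter_erase, Finset.erase_eq_of_notMem (by simp [h2])]
  · rw [Finset.filter_insert, if_pos h2, Finset.card_insert_of_notMem (by simp [h1]), pow_succ]
    ring
  · rw [Finset.filter_insert, if_neg h2]

theorem ann_delta (x : ι) (S : Finset ι) :
    ann x (delta S) = if x ∈ S then jwSign x S • delta (toggle x S) else 0 := by
  have h := pullback_delta (toggle x) (toggle_injective x)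
    (fun S : Finset ι => if x ∈ S then (0 : ℂ) else (-1) ^ (S.filter (· < x)).card)
    ⟨1, fun S => by by_cases h : x ∈ S <;> simp [h]⟩ (toggle x S)
  rw [toggle_toggle] at h
  refine h.trans ?_
  have h2 := jwSign_toggle x x S
  rw [if_neg (lt_irrefl x)] at h2
  by_cases hx : x ∈ S
  · have hn : x ∉ toggle x S := by rw [mem_toggle]; tauto
    rw [if_pos hx, if_neg hn, ← h2]
    rfl
  · have hn : x ∈ toggle x S := by rw [mem_toggle]; tauto
    rw [if_neg hx, if_pos hn, zero_smul]

theorem star_ann_delta (x : ι) (S : Finset ι) :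
    star (ann x) (delta S) = if x ∈ S then 0 else jwSign x S • delta (toggle x S) := by
  have h := adjoint_pullback_delta (toggle x) (toggle_injective x)
    (fun S : Finset ι => if x ∈ S then (0 : ℂ) else (-1) ^ (S.filter (· < x)).card)
    ⟨1, fun S => by by_cases h : x ∈ S <;> simp [h]⟩ S
  refine h.trans ?_
  by_cases hx : x ∈ S
  · simp [hx]
  · simp [hx, jwSign]

theorem ann_isCAR : IsCAR (ann : ι → Op (Finset ι)) where
  anti x y := by
    apply clm_ext_delta
    intro S
    simp only [add_apply, mul_apply_eq_comp, ann_delta,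
      zero_apply]
    rcases eq_or_ne x y with rfl | hxy
    · by_cases hx : x ∈ S
      · have hn : x ∉ toggle x S := by rw [mem_toggle]; tauto
        simp [hx, ann_delta, hn]
      · simp [hx]
    · have e1 : x ∈ toggle y S ↔ x ∈ S := by rw [mem_toggle]; tauto
      have e2 : y ∈ toggle x S ↔ y ∈ S := by
        rw [mem_toggle]; have := hxy.symm; tauto
      by_cases hx : x ∈ S <;> by_cases hy : y ∈ S <;>
        simp only [hx, hy, e1, e2, if_true, if_false, map_smul, map_zero, ann_delta, smul_zero,
          add_zero]
      rw [toggle_comm y x, smul_smul, smul_smul, ← add_smul, jwSign_toggle, jwSign_toggle]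
      rcases lt_or_gt_of_ne hxy with h | h
      · simp [h, h.not_gt, mul_comm]
      · simp [h, h.not_gt, mul_comm]
  mixed x y := by
    apply clm_ext_delta
    intro S
    simp only [add_apply, mul_apply_eq_comp, ann_delta, star_ann_delta]
    rcases eq_or_ne x y with rfl | hxy
    · have e1 : x ∈ toggle x S ↔ x ∉ S := by rw [mem_toggle]; tauto
      have e2 := jwSign_toggle x x S
      rw [if_neg (lt_irrefl x)] at e2
      by_cases hx : x ∈ S
      · simp [hx, e1, star_ann_delta, e2, toggle_toggle, smul_smul, jwSign_mul_self]
      · simp [hx, e1, ann_delta, e2, toggle_toggle, smul_smul, jwSign_mul_self]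
    · have e1 : x ∈ toggle y S ↔ x ∈ S := by rw [mem_toggle]; tauto
      have e2 : y ∈ toggle x S ↔ y ∈ S := by
        rw [mem_toggle]; have := hxy.symm; tauto
      by_cases hx : x ∈ S <;> by_cases hy : y ∈ S <;>
        simp only [hx, hy, e1, e2, if_true, if_false, map_smul, map_zero, ann_delta,
          star_ann_delta, smul_zero, add_zero, hxy, zero_apply]
      rw [toggle_comm y x, smul_smul, smul_smul, ← add_smul, jwSign_toggle, jwSign_toggle]
      rcases lt_or_gt_of_ne hxy with h | h
      · simp [h, h.not_gt, mul_comm]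
      · simp [h, h.not_gt, mul_comm]

end Fock

/-! ### Second quantization of one-particle operators and quasi-free traces -/

section SecondQuantization

/-- The exponential series respects intertwining relations. -/
theorem exp_intertwine {E F : Type*} [NormedAddCommGroup E] [NormedSpace ℂ E] [CompleteSpace E]
    [NormedAddCommGroup F] [NormedSpace ℂ F] [CompleteSpace F] {R : E →L[ℂ] F} {A : F →L[ℂ] F}
    {A' : E →L[ℂ] E} (h : A ∘L R = R ∘L A') :
    NormedSpace.exp A ∘L R = R ∘L NormedSpace.exp A' := by
  have hp : ∀ n : ℕ, (A ^ n) ∘L R = R ∘L (A' ^ n) := by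
    intro n
    induction n with
    | zero => rfl
    | succ n ih =>
      calc (A ^ (n + 1)) ∘L R = (A ^ n) ∘L (A ∘L R) := by rw [pow_succ]; rfl
        _ = ((A ^ n) ∘L R) ∘L A' := by rw [h]; rfl
        _ = _ := by rw [ih, pow_succ]; rfl
  have h1 := (ContinuousLinearMap.precomp F R).hasSum (NormedSpace.exp_series_hasSum_exp' (𝕂 := ℂ) A)
  have h2 := (ContinuousLinearMap.postcomp E R).hasSum
    (NormedSpace.exp_series_hasSum_exp' (𝕂 := ℂ) A')
  refine h1.unique ?_
  convert! h2 using 1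
  funext n
  rw [map_smul, map_smul]
  congr 1
  exact hp n

theorem ann_vacuum {ι : Type} [LinearOrder ι] (x : ι) : ann x (delta (∅ : Finset ι)) = 0 := by
  simp [ann_delta]

variable {ι : Type} [LinearOrder ι] [Fintype ι]

theorem dGamma_eq (A : Op ι) : dGamma A = dG ann A := (dG_apply _ _).symm

theorem dGamma_vacuum (A : Op ι) : dGamma A (delta ∅) = 0 := by
  simp [dGamma, ann_vacuum]

theorem star_dGamma (A : Op ι) : star (dGamma A) = dGamma (star A) := by
  rw [dGamma_eq, dGamma_eq, star_dG]

theorem isSelfAdjoint_dGamma {A : Op ι} (hA : IsSelfAdjoint A) : IsSelfAdjoint (dGamma A) := by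
  rw [IsSelfAdjoint, star_dGamma, hA.star_eq]

theorem dGamma_add (A B : Op ι) : dGamma (A + B) = dGamma A + dGamma B := by
  simp [dGamma_eq]

theorem dGamma_sub (A B : Op ι) : dGamma (A - B) = dGamma A - dGamma B := by
  simp [dGamma_eq]

theorem dGamma_smul (z : ℂ) (A : Op ι) : dGamma (z • A) = z • dGamma A := by
  simp [dGamma_eq]

theorem dGamma_neg (A : Op ι) : dGamma (-A) = -dGamma A := by
  simp [dGamma_eq]

/-- `V` is the second quantization `Γ(T)`: it fixes the vacuum and intertwines the creation
operators `a*(f)` and `a*(Tf)`. -/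
structure IsGamma (V : Op (Finset ι)) (T : Op ι) : Prop where
  vac : V (delta ∅) = delta ∅
  intertwines : ∀ f, V * crea ann f = crea ann (T f) * V

theorem IsGamma.mul {V W : Op (Finset ι)} {S T : Op ι} (hV : IsGamma V S) (hW : IsGamma W T) :
    IsGamma (V * W) (S * T) where
  vac := by rw [mul_apply_eq_comp, hW.vac, hV.vac]
  intertwines f := by
    rw [mul_assoc, hW.intertwines, ← mul_assoc, hV.intertwines, mul_assoc, mul_apply_eq_comp]

theorem isGamma_exp (A : Op ι) : IsGamma (NormedSpace.exp (dGamma A)) (NormedSpace.exp A) where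
  vac := by
    have h : dGamma A ∘L ContinuousLinearMap.toSpanSingleton ℂ (delta ∅) =
        ContinuousLinearMap.toSpanSingleton ℂ (delta ∅) ∘L (0 : ℂ →L[ℂ] ℂ) := by
      ext
      simp [dGamma_vacuum]
    have h2 := congrArg (fun B : ℂ →L[ℂ] Ell2 (Finset ι) => B 1) (exp_intertwine h)
    simpa [NormedSpace.exp_zero] using h2
  intertwines f := by
    rw [dGamma_eq, ← ann_isCAR.exp_crea, mul_assoc, exp_neg_mul_exp, mul_one]

/-- An operator on the Fock space is determined by its action on the vacuum and its commutation
with the creation operators. -/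
theorem IsGamma.unique {V W : Op (Finset ι)} {T : Op ι} (hV : IsGamma V T) (hW : IsGamma W T) :
    V = W := by
  apply clm_ext_delta
  intro S
  induction S using Finset.induction_on with
  | empty => rw [hV.vac, hW.vac]
  | insert x S hx ih =>
    have h1 : delta (insert x S) = jwSign x S • crea ann (delta x) (delta S) := by
      rw [crea_delta, star_ann_delta, if_neg hx, smul_smul, jwSign_mul_self, one_smul, toggle,
        if_neg hx]
    have h2 := congrArg (fun B : Op (Finset ι) => B (delta S)) (hV.intertwines (delta x))
    have h3 := congrArg (fun B : Op (Finset ι) => B (delta S)) (hW.intertwines (delta x))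
    simp only [mul_apply_eq_comp] at h2 h3
    rw [h1, map_smul, map_smul, h2, h3, ih]

theorem exp_dGamma_conj (A B : Op ι) :
    NormedSpace.exp (dGamma A) * dGamma B * NormedSpace.exp (-dGamma A) =
      dGamma (NormedSpace.exp A * B * NormedSpace.exp (-A)) := by
  rw [dGamma_eq, dGamma_eq, dGamma_eq, ann_isCAR.exp_dG]

/-- The two-point function of the Gibbs state of `dΓ(C)` is `(1 + e^{-C})⁻¹`. It follows from
`e^{dΓ(C)} a*(f) = a*(e^C f) e^{dΓ(C)}`, the cyclicity of the trace and the anticommutation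
relations. -/
theorem tr_exp_dGamma_mul {C R : Op ι} (hR : (1 + NormedSpace.exp (-C)) * R = 1) (D : Op ι) :
    tr (NormedSpace.exp (dGamma C) * dGamma D) = tr (NormedSpace.exp (dGamma C)) * tr (R * D) := by
  set G := NormedSpace.exp (dGamma C) with hG
  have key : ∀ f z, tr (G * (crea ann (f + NormedSpace.exp C f) * ann z)) =
      (NormedSpace.exp C f) z * tr G := by
    intro f z
    have h1 : tr (G * (crea ann f * ann z)) = tr (G * (ann z * crea ann (NormedSpace.exp C f))) := by
      rw [← mul_assoc, (isGamma_exp C).intertwines, mul_assoc, tr_mul_comm, mul_assoc]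
    rw [map_add, add_mul, mul_add, tr_add, h1, ← tr_add, ← mul_add, ann_isCAR.crea_comm,
      mul_smul_comm, mul_one, tr_smul]
  have hE := exp_mul_exp_neg C
  have h2 : ∀ v : Ell2 ι, NormedSpace.exp C ((NormedSpace.exp (-C)) (R v)) = R v := by
    intro v
    rw [← mul_apply_eq_comp, hE]
    rfl
  have h3 : ∀ v : Ell2 ι, NormedSpace.exp (-C) (R v) + R v = v := by
    intro v
    have := congrArg (fun B : Op ι => B v) hR
    simpa [mul_apply_eq_comp, add_comm, add_mul] using this
  -- `f = e^{-C} R D δ_z` satisfies `f + e^C f = D δ_z`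
  have h4 : ∀ z, tr (G * (crea ann (D (delta z)) * ann z)) = entry (R * D) z z * tr G := by
    intro z
    have := key (NormedSpace.exp (-C) (R (D (delta z)))) z
    rw [h2, h3] at this
    rw [this, entry_eq, mul_apply_eq_comp]
  rw [dGamma_eq, dG_eq_sum_crea, Finset.mul_sum, ← trL_apply, map_sum]
  simp only [trL_apply, h4]
  rw [← Finset.sum_mul, ← tr_eq_sum, mul_comm]

end SecondQuantization

/-! ### Differentiation of traces of functions of an operator -/

section TraceCalculus

variable {ι : Type} [DecidableEq ι] [Fintype ι]

theorem hasDerivAt_tr {Y : ℝ → Op ι} {Y' : Op ι} {γ : ℝ} (h : HasDerivAt Y Y' γ) :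
    HasDerivAt (fun s => tr (Y s)) (tr Y') γ :=
  ((trL (ι := ι)).restrictScalars ℝ).hasFDerivAt.comp_hasDerivAt γ h

theorem exists_hasDerivAt_pow {X : ℝ → Op ι} {X' : Op ι} {γ : ℝ} (hX : HasDerivAt X X' γ) (n : ℕ) :
    ∃ D, HasDerivAt (fun s => X s ^ n) D γ ∧ ∀ Z, Commute Z (X γ) →
      tr (Z * D) = n * tr (Z * X γ ^ (n - 1) * X') := by
  induction n with
  | zero =>
    refine ⟨0, by simpa using hasDerivAt_const γ (1 : Op ι), fun Z _ => ?_⟩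
    simp [← trL_apply]
  | succ n ih =>
    obtain ⟨D, hD, hZ⟩ := ih
    refine ⟨D * X γ + X γ ^ n * X', ?_, fun Z hc => ?_⟩
    · simp only [pow_succ]
      exact hD.mul hX
    · rw [mul_add, tr_add, ← mul_assoc, tr_mul_comm, ← mul_assoc, hZ _ ((Commute.refl _).mul_left hc),
        ← hc.eq, Nat.add_sub_cancel]
      rcases n with _ | n
      · simp
      · rw [Nat.add_sub_cancel, mul_assoc Z (X γ), ← pow_succ', ← mul_assoc]
        push_cast
        ring

theorem hasDerivAt_tr_aeval {X : ℝ → Op ι} {X' : Op ι} {γ : ℝ} (hX : HasDerivAt X X' γ)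
    (q : Polynomial ℝ) : HasDerivAt (fun s => tr (Polynomial.aeval (X s) q))
      (tr (Polynomial.aeval (X γ) (Polynomial.derivative q) * X')) γ := by
  induction q using Polynomial.induction_on' with
  | add p q hp hq =>
    simp only [map_add, tr_add, add_mul]
    exact hp.add hq
  | monomial n a =>
    obtain ⟨D, hD, hZ⟩ := exists_hasDerivAt_pow hX n
    have h1 := hasDerivAt_tr (hD.const_smul ((a : ℝ) : ℂ))
    have hfun : (fun s => tr (Polynomial.aeval (X s) (Polynomial.monomial n a))) =
        fun s => tr (((a : ℝ) : ℂ) • X s ^ n) := by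
      funext s
      rw [Polynomial.aeval_monomial, ← Algebra.smul_def]
      simp
    rw [hfun]
    refine HasDerivAt.congr_deriv h1 ?_
    have h2 := hZ 1 (Commute.one_left _)
    rw [one_mul, one_mul] at h2
    rw [tr_smul, h2, Polynomial.derivative_monomial, Polynomial.aeval_monomial,
      ← Algebra.smul_def, smul_mul_assoc, ← Complex.coe_smul, tr_smul]
    push_cast
    simp [mul_assoc]

theorem exists_polynomial_derivative_eq (p : Polynomial ℝ) :
    ∃ q : Polynomial ℝ, Polynomial.derivative q = p := by
  induction p using Polynomial.induction_on' with
  | add p q hp hq =>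
    obtain ⟨a, rfl⟩ := hp
    obtain ⟨b, rfl⟩ := hq
    exact ⟨a + b, by simp⟩
  | monomial n a =>
    refine ⟨Polynomial.monomial (n + 1) (a / (n + 1)), ?_⟩
    rw [Polynomial.derivative_monomial]
    have : (n : ℝ) + 1 ≠ 0 := by positivity
    simp [div_mul_cancel₀ _ this]

/-- A `C¹` function on a compact interval is approximated by polynomials together with its
derivative. -/
theorem exists_polynomial_near_C1 {a b : ℝ} {f f' : ℝ → ℝ}
    (hf : ∀ x ∈ Set.Icc a b, HasDerivAt f (f' x) x) (hf' : ContinuousOn f' (Set.Icc a b))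
    {ε : ℝ} (hε : 0 < ε) : ∃ q : Polynomial ℝ, ∀ x ∈ Set.Icc a b,
      |(Polynomial.derivative q).eval x - f' x| ≤ ε ∧ |q.eval x - f x| ≤ ε * (b - a) := by
  obtain ⟨p, hp⟩ := exists_polynomial_near_of_continuousOn a b f' hf' ε hε
  obtain ⟨q, rfl⟩ := exists_polynomial_derivative_eq p
  refine ⟨q + Polynomial.C (f a - q.eval a), fun x hx => ⟨?_, ?_⟩⟩
  · simpa using (hp x hx).le
  · have h1 : ∀ y ∈ Set.Icc a b, HasDerivWithinAt (fun y => q.eval y - f y)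
        ((Polynomial.derivative q).eval y - f' y) (Set.Icc a b) y := fun y hy =>
      ((q.hasDerivAt y).sub (hf y hy)).hasDerivWithinAt
    have h2 := Convex.norm_image_sub_le_of_norm_hasDerivWithin_le h1
      (fun y hy => (hp y hy).le) (convex_Icc a b) (Set.left_mem_Icc.2 (hx.1.trans hx.2)) hx
    have h3 : (q + Polynomial.C (f a - q.eval a)).eval x - f x =
        (q.eval x - f x) - (q.eval a - f a) := by
      simp
      ring
    rw [h3]
    refine h2.trans ?_
    rw [Real.norm_eq_abs, abs_of_nonneg (by linarith [hx.1])]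
    exact mul_le_mul_of_nonneg_left (by linarith [hx.2]) hε.le

/-- The chain rule `d/dγ tr f(X) = tr (f'(X) X')` under the trace, although `X` and `X'` need not
commute. -/
theorem hasDerivAt_tr_cfc {X X' : ℝ → Op ι} {γ₀ a b δ C : ℝ} (hδ : 0 < δ)
    (hX : ∀ γ ∈ Metric.ball γ₀ δ, HasDerivAt X (X' γ) γ)
    (hsa : ∀ γ ∈ Metric.ball γ₀ δ, IsSelfAdjoint (X γ))
    (hsp : ∀ γ ∈ Metric.ball γ₀ δ, spectrum ℝ (X γ) ⊆ Set.Icc a b)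
    (hC : ∀ γ ∈ Metric.ball γ₀ δ, ‖X' γ‖ ≤ C) {f f' : ℝ → ℝ}
    (hf : ∀ x ∈ Set.Icc a b, HasDerivAt f (f' x) x) (hf' : ContinuousOn f' (Set.Icc a b)) :
    HasDerivAt (fun γ => tr (cfc f (X γ))) (tr (cfc f' (X γ₀) * X' γ₀)) γ₀ := by
  -- the formula is algebraic for the polynomials `q n`, which approximate `f` in the `C¹` norm on
  -- `[a, b]`; the derivatives converge uniformly near `γ₀`
  choose q hq using fun n : ℕ => exists_polynomial_near_C1 hf hf' (Nat.one_div_pos_of_nat (n := n))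
  have hfc : ContinuousOn f (Set.Icc a b) := fun x hx => (hf x hx).continuousAt.continuousWithinAt
  have hsub : ∀ (g : ℝ → ℝ) (p : Polynomial ℝ) (r : ℝ), 0 ≤ r → ContinuousOn g (Set.Icc a b) →
      (∀ x ∈ Set.Icc a b, |p.eval x - g x| ≤ r) → ∀ γ ∈ Metric.ball γ₀ δ,
      ‖Polynomial.aeval (X γ) p - cfc g (X γ)‖ ≤ r := by
    intro g p r hr hg hpg γ hγ
    have h1 := cfc_polynomial p (X γ) (hsa γ hγ)
    rw [← h1, ← cfc_sub _ _ (X γ) (by fun_prop) (hg.mono (hsp γ hγ))]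
    exact norm_cfc_le hr fun x hx => hpg x (hsp γ hγ hx)
  have hlim : Tendsto (fun n : ℕ => 1 / ((n : ℝ) + 1)) atTop (𝓝 0) :=
    tendsto_one_div_add_atTop_nhds_zero_nat
  refine hasDerivAt_of_tendstoUniformlyOn (l := atTop) (s := Metric.ball γ₀ δ)
    (f := fun n γ => tr (Polynomial.aeval (X γ) (q n)))
    (f' := fun n γ => tr (Polynomial.aeval (X γ) (Polynomial.derivative (q n)) * X' γ))
    (g' := fun γ => tr (cfc f' (X γ) * X' γ)) Metric.isOpen_ball ?_
    (Eventually.of_forall fun n γ hγ => hasDerivAt_tr_aeval (hX γ hγ) (q n)) (fun γ hγ => ?_)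
    (Metric.mem_ball_self hδ)
  · have hC0 : 0 ≤ C := (norm_nonneg _).trans (hC γ₀ (Metric.mem_ball_self hδ))
    have h0 : Tendsto (fun n : ℕ => ‖trL (ι := ι)‖ * (1 / ((n : ℝ) + 1) * C)) atTop (𝓝 0) := by
      simpa using (hlim.mul_const C).const_mul ‖trL (ι := ι)‖
    rw [Metric.tendstoUniformlyOn_iff]
    intro ε hε
    filter_upwards [h0.eventually (gt_mem_nhds hε)] with n hn γ hγ
    refine lt_of_le_of_lt ?_ hn
    rw [dist_comm, dist_eq_norm, ← tr_sub, ← sub_mul, ← trL_apply]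
    refine (trL.le_opNorm _).trans ?_
    gcongr
    refine (norm_mul_le _ _).trans ?_
    gcongr
    · exact hsub f' _ _ (by positivity) hf' (fun x hx => (hq n x hx).1) γ hγ
    · exact hC γ hγ
  · have hc := (trL (ι := ι)).continuous.tendsto (cfc f (X γ))
    refine hc.comp ?_
    rw [tendsto_iff_norm_sub_tendsto_zero]
    rcases le_or_gt a b with hab | hab
    · refine squeeze_zero (fun n => norm_nonneg _) (fun n => hsub f _ (1 / ((n : ℝ) + 1) * (b - a))
        (mul_nonneg (by positivity) (by linarith)) hfc (fun x hx => (hq n x hx).2) γ hγ) ?_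
      simpa using hlim.mul_const (b - a)
    · refine squeeze_zero (fun n => norm_nonneg _) (fun n => hsub f _ 0 le_rfl hfc
        (fun x hx => absurd (hx.1.trans hx.2) hab.not_ge) γ hγ) tendsto_const_nhds

end TraceCalculus

/-! ### Exponentials and powers of self-adjoint operators -/

section Exponentials

variable {ι : Type}

theorem sa_smul {A : Op ι} (hA : IsSelfAdjoint A) (s : ℝ) : IsSelfAdjoint ((s : ℂ) • A) := by
  rw [Complex.coe_smul]
  exact IsSelfAdjoint.smul (IsSelfAdjoint.all s) hA

theorem sa_exp {A : Op ι} (hA : IsSelfAdjoint A) : IsSelfAdjoint (NormedSpace.exp A) :=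
  hA.exp_nonneg.isSelfAdjoint

theorem norm_one_op_le : ‖(1 : Op ι)‖ ≤ 1 := ContinuousLinearMap.norm_id_le

theorem spectrum_subset_Icc {A : Op ι} : spectrum ℝ A ⊆ Set.Icc (-‖A‖) ‖A‖ := by
  intro x hx
  have h := spectrum.norm_le_norm_mul_of_mem hx
  rw [Real.norm_eq_abs] at h
  have h2 : ‖A‖ * ‖(1 : Op ι)‖ ≤ ‖A‖ := mul_le_of_le_one_right (norm_nonneg _) norm_one_op_le
  exact abs_le.1 (h.trans h2)

theorem norm_exp_le {A : Op ι} (hA : IsSelfAdjoint A) :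
    ‖NormedSpace.exp A‖ ≤ Real.exp ‖A‖ := by
  rw [← CFC.real_exp_eq_normedSpace_exp]
  refine norm_cfc_le (Real.exp_pos _).le fun x hx => ?_
  rw [Real.norm_eq_abs, abs_of_pos (Real.exp_pos _)]
  exact Real.exp_le_exp.2 (spectrum_subset_Icc hx).2

theorem exp_rpow {A : Op ι} (hA : IsSelfAdjoint A) (s : ℝ) :
    NormedSpace.exp A ^ s = NormedSpace.exp ((s : ℂ) • A) := by
  rw [Complex.coe_smul, ← CFC.real_exp_eq_normedSpace_exp (ha := hA),
    CFC.cfc_rpow (fun x _ => Real.exp_pos x),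
    ← CFC.real_exp_eq_normedSpace_exp (ha := IsSelfAdjoint.smul (IsSelfAdjoint.all s) hA),
    ← cfc_comp_smul s Real.exp A]
  refine cfc_congr fun x _ => ?_
  simp only [smul_eq_mul]
  rw [mul_comm, Real.exp_mul]

theorem isUnit_one_add {X : Op ι} (hX : 0 ≤ X) : IsUnit (1 + X) :=
  (IsStrictlyPositive.add_nonneg (by cfc_tac) hX).isUnit

theorem inverse_nonneg {X : Op ι} (hX : 0 ≤ X) : 0 ≤ Ring.inverse (1 + X) := by
  have : IsStrictlyPositive (1 + X) := IsStrictlyPositive.add_nonneg (by cfc_tac) hX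
  exact this.ringInverse.nonneg

theorem norm_inverse_le {X : Op ι} (hX : 0 ≤ X) : ‖Ring.inverse (1 + X)‖ ≤ 1 := by
  have h := CStarAlgebra.ringInverse_le_ringInverse (a := (1 : Op ι)) (b := 1 + X)
    (le_add_of_nonneg_right hX) (by cfc_tac)
  rw [Ring.inverse_one] at h
  exact (CStarAlgebra.norm_le_norm_of_nonneg_of_le (inverse_nonneg hX) h).trans norm_one_op_le

/-- The positive operator `e^a e^b e^a`. -/
def sandw (a b : Op ι) : Op ι := NormedSpace.exp a * NormedSpace.exp b * NormedSpace.exp a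

theorem sandw_nonneg {a b : Op ι} (ha : IsSelfAdjoint a) (hb : IsSelfAdjoint b) :
    0 ≤ sandw a b := by
  have := star_left_conjugate_nonneg hb.exp_nonneg (NormedSpace.exp a)
  rwa [(sa_exp ha).star_eq] at this

theorem sandw_mul_sandw_neg (a b : Op ι) : sandw a b * sandw (-a) (-b) = 1 := by
  calc sandw a b * sandw (-a) (-b) = NormedSpace.exp a * (NormedSpace.exp b *
        (NormedSpace.exp a * NormedSpace.exp (-a)) * NormedSpace.exp (-b)) *
        NormedSpace.exp (-a) := by simp only [sandw, mul_assoc]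
    _ = 1 := by simp [exp_mul_exp_neg]

theorem sandw_isUnit (a b : Op ι) : IsUnit (sandw a b) :=
  ⟨⟨_, _, sandw_mul_sandw_neg a b, by simpa using sandw_mul_sandw_neg (-a) (-b)⟩, rfl⟩

theorem sandw_strictlyPositive {a b : Op ι} (ha : IsSelfAdjoint a) (hb : IsSelfAdjoint b) :
    IsStrictlyPositive (sandw a b) :=
  (sandw_isUnit a b).isStrictlyPositive (sandw_nonneg ha hb)

theorem norm_sandw_le {a b : Op ι} (ha : IsSelfAdjoint a) (hb : IsSelfAdjoint b) :
    ‖sandw a b‖ ≤ Real.exp (2 * ‖a‖ + ‖b‖) := by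
  have h1 := norm_exp_le ha
  have h2 := norm_exp_le hb
  calc ‖sandw a b‖ ≤ ‖NormedSpace.exp a‖ * ‖NormedSpace.exp b‖ * ‖NormedSpace.exp a‖ :=
        norm_mul₃_le
    _ ≤ Real.exp ‖a‖ * Real.exp ‖b‖ * Real.exp ‖a‖ := by gcongr
    _ = _ := by rw [← Real.exp_add, ← Real.exp_add]; ring_nf

theorem spectrum_sandw {a b : Op ι} (ha : IsSelfAdjoint a) (hb : IsSelfAdjoint b) :
    spectrum ℝ (sandw a b) ⊆
      Set.Icc (Real.exp (-(2 * ‖a‖ + ‖b‖))) (Real.exp (2 * ‖a‖ + ‖b‖)) := by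
  intro x hx
  refine ⟨?_, (spectrum_subset_Icc hx).2.trans (norm_sandw_le ha hb)⟩
  have hu : (sandw_isUnit a b).unit⁻¹ = sandw (-a) (-b) := by
    rw [Units.inv_eq_of_mul_eq_one_right]
    exact sandw_mul_sandw_neg a b
  have h0 : 0 ≤ x := spectrum_nonneg_of_nonneg (sandw_nonneg ha hb) hx
  have hx0 : x ≠ 0 := fun h => spectrum.zero_notMem ℝ (sandw_isUnit a b) (h ▸ hx)
  have h1 : x⁻¹ ∈ spectrum ℝ (sandw (-a) (-b)) := by
    rw [← hu]
    have := (spectrum.inv_mem_iff (r := Units.mk0 x hx0) (a := (sandw_isUnit a b).unit)).1 hx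
    simpa using this
  have h2 := (spectrum_subset_Icc h1).2.trans (norm_sandw_le ha.neg hb.neg)
  rw [norm_neg, norm_neg] at h2
  rw [Real.exp_neg]
  exact inv_le_of_inv_le₀ (lt_of_le_of_ne h0 hx0.symm) h2

theorem exists_log_sandw {a b : Op ι} (ha : IsSelfAdjoint a) (hb : IsSelfAdjoint b) :
    ∃ L, IsSelfAdjoint L ∧ NormedSpace.exp L = sandw a b :=
  ⟨CFC.log (sandw a b), IsSelfAdjoint.log, CFC.exp_log _ (sandw_strictlyPositive ha hb)⟩

/-- The operator `𝒦_{p,t}(γ, u)` as a function of `A = k_{tu}` and `B = k_{-t(1-u)}`. -/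
def kernelAB (p : ℝ≥0∞) (γ : ℝ) (A B : Op ι) : Op ι :=
  if p = ⊤ then
    Ring.inverse (1 + NormedSpace.exp (-(((1 - γ : ℝ) : ℂ) • A) - (γ : ℂ) • B))
  else
    (1 / 2 : ℂ) • (NormedSpace.exp (((-1 * (1 - γ) / p.toReal : ℝ) : ℂ) • A) *
      Ring.inverse (1 + sandw (((1 * (1 - γ) / p.toReal : ℝ) : ℂ) • A)
        (((2 * γ / p.toReal : ℝ) : ℂ) • B) ^ (-(p.toReal / 2))) *
      NormedSpace.exp (((1 * (1 - γ) / p.toReal : ℝ) : ℂ) • A)) +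
    star ((1 / 2 : ℂ) • (NormedSpace.exp (((-1 * (1 - γ) / p.toReal : ℝ) : ℂ) • A) *
      Ring.inverse (1 + sandw (((1 * (1 - γ) / p.toReal : ℝ) : ℂ) • A)
        (((2 * γ / p.toReal : ℝ) : ℂ) • B) ^ (-(p.toReal / 2))) *
      NormedSpace.exp (((1 * (1 - γ) / p.toReal : ℝ) : ℂ) • A)))

theorem kernelK_eq (h k : Op ι) (p : ℝ≥0∞) (t γ u : ℝ) : kernelK h k p t γ u =
    kernelAB p γ (evolve h k (t * u)) (evolve h k (-(t * (1 - u)))) := rfl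

end Exponentials

/-! ### The pressure of a pair of one-particle operators -/

section Pressure

variable {ι : Type} [LinearOrder ι] [Fintype ι]

/-- The positive operator on the Fock space whose trace defines the pressure functional of two
one-particle operators `A` and `B`. -/
def pressureOp (p : ℝ≥0∞) (A B : Op ι) (α : ℝ) : Op (Finset ι) :=
  if p = ⊤ then
    NormedSpace.exp (((1 - α : ℝ) : ℂ) • dGamma A + (α : ℂ) • dGamma B)
  else
    sandw ((((1 - α) / p.toReal : ℝ) : ℂ) • dGamma A) (((2 * α / p.toReal : ℝ) : ℂ) • dGamma B) ^
      (p.toReal / 2)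

/-- The pressure functional: it equals `e_{p,t,M}` up to a constant when `A = k_M` and `B` is
`k_M` evolved to the time `-t`. -/
def pressure (p : ℝ≥0∞) (A B : Op ι) (α : ℝ) : ℝ := Real.log (tr (pressureOp p A B α)).re

theorem sandw_dGamma {a b L : Op ι} (h : NormedSpace.exp L = sandw a b) :
    sandw (dGamma a) (dGamma b) = NormedSpace.exp (dGamma L) :=
  (((isGamma_exp a).mul (isGamma_exp b)).mul (isGamma_exp a)).unique (by
    rw [← sandw, ← h]
    exact isGamma_exp L)

theorem tr_exp_pos {κ : Type} [DecidableEq κ] [Fintype κ] [Nonempty κ] {A : Op κ}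
    (hA : IsSelfAdjoint A) : 0 < (tr (NormedSpace.exp A)).re := by
  have h1 : NormedSpace.exp A = star (NormedSpace.exp ((1 / 2 : ℂ) • A)) *
      NormedSpace.exp ((1 / 2 : ℂ) • A) := by
    have hs : IsSelfAdjoint ((1 / 2 : ℂ) • A) := by
      simpa using sa_smul hA (1 / 2)
    rw [(sa_exp hs).star_eq, ← exp_add_of_comm (Commute.refl _), ← add_smul]
    norm_num
  rw [h1, tr_star_mul_self, Complex.ofReal_re]
  refine Finset.sum_pos (fun x _ => ?_) Finset.univ_nonempty
  have h2 : NormedSpace.exp ((1 / 2 : ℂ) • A) (delta x) ≠ 0 := by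
    intro h
    have h3 := congrArg (fun B : Op κ => B (delta x)) (exp_neg_mul_exp ((1 / 2 : ℂ) • A))
    simp only [mul_apply_eq_comp, h, map_zero] at h3
    have h4 := norm_delta x
    rw [show delta x = 0 from h3.symm] at h4
    simp at h4
  positivity

theorem exists_pressureOp_eq_exp {p : ℝ≥0∞} {A B : Op ι} (hA : IsSelfAdjoint A)
    (hB : IsSelfAdjoint B) (α : ℝ) :
    ∃ C : Op ι, IsSelfAdjoint C ∧ pressureOp p A B α = NormedSpace.exp (dGamma C) := by
  by_cases hp' : p = ⊤
  · refine ⟨((1 - α : ℝ) : ℂ) • A + (α : ℂ) • B, (sa_smul hA _).add (sa_smul hB _), ?_⟩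
    simp only [pressureOp, hp', if_true, dGamma_add, dGamma_smul]
  · obtain ⟨L, hL, hL'⟩ := exists_log_sandw (sa_smul hA ((1 - α) / p.toReal))
      (sa_smul hB (2 * α / p.toReal))
    refine ⟨((p.toReal / 2 : ℝ) : ℂ) • L, sa_smul hL _, ?_⟩
    rw [pressureOp, if_neg hp', ← dGamma_smul, ← dGamma_smul, sandw_dGamma hL',
      exp_rpow (isSelfAdjoint_dGamma hL), dGamma_smul]

theorem re_tr_pressureOp_pos {p : ℝ≥0∞} {A B : Op ι} (hA : IsSelfAdjoint A)
    (hB : IsSelfAdjoint B) (α : ℝ) : 0 < (tr (pressureOp p A B α)).re := by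
  obtain ⟨C, hC, h⟩ := exists_pressureOp_eq_exp (p := p) hA hB α
  rw [h]
  exact tr_exp_pos (isSelfAdjoint_dGamma hC)

end Pressure

/-! ### The derivative of the pressure -/

section PressureDeriv

variable {ι : Type}

theorem isSelfAdjoint_inverse {X : Op ι} (hX : 0 ≤ X) : IsSelfAdjoint (Ring.inverse (1 + X)) :=
  (inverse_nonneg hX).isSelfAdjoint

theorem isSelfAdjoint_kernelAB (p : ℝ≥0∞) (γ : ℝ) {A B : Op ι} (hA : IsSelfAdjoint A)
    (hB : IsSelfAdjoint B) : IsSelfAdjoint (kernelAB p γ A B) := by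
  unfold kernelAB
  split_ifs
  · refine isSelfAdjoint_inverse (IsSelfAdjoint.exp_nonneg ?_)
    exact (sa_smul hA _).neg.sub (sa_smul hB _)
  · exact IsSelfAdjoint.add_star_self _

variable [LinearOrder ι] [Fintype ι]

theorem tr_mul_im_eq_zero {A B : Op ι} (hA : IsSelfAdjoint A) (hB : IsSelfAdjoint B) :
    (tr (A * B)).im = 0 := by
  have h := tr_star (A * B)
  rw [star_mul, hA.star_eq, hB.star_eq, tr_mul_comm] at h
  exact Complex.conj_eq_iff_im.1 h.symm

theorem hasDerivAt_log_re {f : ℝ → ℂ} {z w : ℂ} {s : ℝ} (hf : HasDerivAt f (z * w) s)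
    (hz : f s = z) (him : z.im = 0) (hre : 0 < z.re) :
    HasDerivAt (fun x => Real.log (f x).re) w.re s := by
  have h1 := (Complex.reCLM.hasFDerivAt (x := f s)).comp_hasDerivAt s hf
  have h2 := HasDerivAt.log h1 (by simpa [hz] using hre.ne')
  refine h2.congr_deriv ?_
  simp only [Function.comp_apply, Complex.reCLM_apply, Complex.mul_re, him, zero_mul, sub_zero, hz]
  field_simp

theorem hasDerivAt_pressure_top {A B : Op ι} (hA : IsSelfAdjoint A) (hB : IsSelfAdjoint B)
    (γ : ℝ) : HasDerivAt (pressure ⊤ A B) (tr (kernelAB ⊤ γ A B * (B - A))).re γ := by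
  set X : ℝ → Op (Finset ι) := fun s => ((1 - s : ℝ) : ℂ) • dGamma A + (s : ℂ) • dGamma B with hX
  have hsa : ∀ s, IsSelfAdjoint (X s) := fun s =>
    (sa_smul (isSelfAdjoint_dGamma hA) _).add (sa_smul (isSelfAdjoint_dGamma hB) _)
  have hder : ∀ s, HasDerivAt X (dGamma (B - A)) s := by
    intro s
    have h1 : HasDerivAt (fun s : ℝ => ((1 - s : ℝ) : ℂ)) ((-1 : ℝ) : ℂ) s :=
      ((hasDerivAt_id s).const_sub 1).ofReal_comp
    have h2 : HasDerivAt (fun s : ℝ => (s : ℂ)) ((1 : ℝ) : ℂ) s := (hasDerivAt_id s).ofReal_comp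
    refine ((h1.smul_const (dGamma A)).add (h2.smul_const (dGamma B))).congr_deriv ?_
    rw [dGamma_sub]
    push_cast
    rw [neg_one_smul, one_smul, sub_eq_neg_add]
  have hb : ∀ s ∈ Metric.ball γ 1, spectrum ℝ (X s) ⊆
      Set.Icc (-((|γ| + 2) * ‖dGamma A‖ + (|γ| + 1) * ‖dGamma B‖))
        ((|γ| + 2) * ‖dGamma A‖ + (|γ| + 1) * ‖dGamma B‖) := by
    intro s hs
    have h1 : |s - γ| < 1 := hs
    have h2 : |s| ≤ |γ| + 1 := by
      have := abs_sub_abs_le_abs_sub s γ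
      linarith
    have h3 : |1 - s| ≤ |γ| + 2 := by
      have := abs_sub (1 : ℝ) s
      rw [abs_one] at this
      linarith
    have h4 : ‖X s‖ ≤ (|γ| + 2) * ‖dGamma A‖ + (|γ| + 1) * ‖dGamma B‖ := by
      refine (norm_add_le _ _).trans ?_
      rw [norm_smul, norm_smul, Complex.norm_real, Complex.norm_real, Real.norm_eq_abs,
        Real.norm_eq_abs]
      gcongr
    exact spectrum_subset_Icc.trans (Set.Icc_subset_Icc (neg_le_neg h4) h4)
  have h1 := hasDerivAt_tr_cfc (γ₀ := γ) one_pos (fun s _ => hder s) (fun s _ => hsa s) hb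
    (fun _ _ => le_rfl) (f := Real.exp) (f' := Real.exp) (fun x _ => Real.hasDerivAt_exp x)
    (by fun_prop)
  simp only [fun s => CFC.real_exp_eq_normedSpace_exp (ha := hsa s)] at h1
  have hC : X γ = dGamma (((1 - γ : ℝ) : ℂ) • A + (γ : ℂ) • B) := by
    rw [dGamma_add, dGamma_smul, dGamma_smul]
  have hCsa : IsSelfAdjoint (((1 - γ : ℝ) : ℂ) • A + (γ : ℂ) • B) :=
    (sa_smul hA _).add (sa_smul hB _)
  have h2 : NormedSpace.exp (-(((1 - γ : ℝ) : ℂ) • A + (γ : ℂ) • B)) =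
      NormedSpace.exp (-(((1 - γ : ℝ) : ℂ) • A) - (γ : ℂ) • B) := by
    congr 1
    abel
  have h3 := tr_exp_dGamma_mul (C := ((1 - γ : ℝ) : ℂ) • A + (γ : ℂ) • B)
    (R := kernelAB ⊤ γ A B) (by
      rw [kernelAB, if_pos rfl, h2]
      refine Ring.mul_inverse_cancel _ (isUnit_one_add ?_)
      rw [← h2]
      exact hCsa.neg.exp_nonneg) (B - A)
  rw [hC, h3] at h1
  have h4 := hasDerivAt_log_re h1 (by rw [hC])
    (tr_im_eq_zero (sa_exp (isSelfAdjoint_dGamma hCsa))) (tr_exp_pos (isSelfAdjoint_dGamma hCsa))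
  have h5 : pressure ⊤ A B = fun s => Real.log (tr (NormedSpace.exp (X s))).re := by
    funext s
    rw [pressure, pressureOp, if_pos rfl]
  rw [h5]
  exact h4

theorem continuous_exp_op {κ : Type} : Continuous fun A : Op κ => NormedSpace.exp A := by
  let _ : NormedAlgebra ℚ (Op κ) := NormedAlgebra.restrictScalars ℚ ℂ (Op κ)
  exact NormedSpace.exp_continuous

theorem hasDerivAt_exp_affine {κ : Type} (A : Op κ) (a b s : ℝ) :
    HasDerivAt (fun s : ℝ => NormedSpace.exp (((a + b * s : ℝ) : ℂ) • A))
      ((b : ℂ) • (A * NormedSpace.exp (((a + b * s : ℝ) : ℂ) • A))) s := by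
  simp only [Complex.coe_smul]
  have h1 : HasFDerivAt (fun u : ℝ => NormedSpace.exp (u • A))
      (ContinuousLinearMap.toSpanSingleton ℝ (A * NormedSpace.exp ((a + b * s) • A)))
      (a + b * s) := (hasDerivAt_exp_smul_const' (𝕂 := ℝ) A (a + b * s)).hasFDerivAt
  have h2 : HasDerivAt (fun s : ℝ => a + b * s) b s :=
    (((hasDerivAt_id' s).const_mul b).const_add a).congr_deriv (mul_one b)
  exact h1.comp_hasDerivAt s h2

/-- The derivative of a curve `s ↦ e^{(a + bs)K} e^{csK'} e^{(a + bs)K}`. -/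
def sandwDeriv {κ : Type} (K K' : Op κ) (a b c s : ℝ) : Op κ :=
  (b : ℂ) • (K * sandw (((a + b * s : ℝ) : ℂ) • K) (((0 + c * s : ℝ) : ℂ) • K') +
    sandw (((a + b * s : ℝ) : ℂ) • K) (((0 + c * s : ℝ) : ℂ) • K') * K) +
  (c : ℂ) • (NormedSpace.exp (((a + b * s : ℝ) : ℂ) • K) * K' *
    NormedSpace.exp (-(((a + b * s : ℝ) : ℂ) • K)) *
    sandw (((a + b * s : ℝ) : ℂ) • K) (((0 + c * s : ℝ) : ℂ) • K'))

theorem hasDerivAt_sandw {κ : Type} (K K' : Op κ) (a b c s : ℝ) :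
    HasDerivAt (fun s : ℝ => sandw (((a + b * s : ℝ) : ℂ) • K) (((0 + c * s : ℝ) : ℂ) • K'))
      (sandwDeriv K K' a b c s) s := by
  have h1 := hasDerivAt_exp_affine K a b s
  have h2 := hasDerivAt_exp_affine K' 0 c s
  refine ((h1.mul h2).mul h1).congr_deriv ?_
  simp only [Pi.mul_apply, sandwDeriv, sandw]
  set E := NormedSpace.exp (((a + b * s : ℝ) : ℂ) • K) with hE
  set G := NormedSpace.exp (((0 + c * s : ℝ) : ℂ) • K')
  have h3 : NormedSpace.exp (-(((a + b * s : ℝ) : ℂ) • K)) * E = 1 := exp_neg_mul_exp _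
  have h4 : K * E = E * K := ((Commute.refl K).smul_right _).exp_right.eq
  have h5 : E * K' * NormedSpace.exp (-(((a + b * s : ℝ) : ℂ) • K)) * (E * G * E) =
      E * K' * G * E := by
    calc _ = E * K' * (NormedSpace.exp (-(((a + b * s : ℝ) : ℂ) • K)) * E) * G * E := by
          simp only [mul_assoc]
      _ = _ := by rw [h3, mul_one]
  rw [h5]
  have h4' : ∀ Z, K * (E * Z) = E * (K * Z) := fun Z => by rw [← mul_assoc, h4, mul_assoc]
  simp only [smul_mul_assoc, mul_smul_comm, smul_add, add_mul, mul_assoc, h4, h4']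
  abel

theorem continuous_sandwDeriv {κ : Type} (K K' : Op κ) (a b c : ℝ) :
    Continuous (sandwDeriv K K' a b c) := by
  have h1 : Continuous fun s : ℝ => NormedSpace.exp (((a + b * s : ℝ) : ℂ) • K) :=
    continuous_exp_op.comp (by fun_prop)
  have h2 : Continuous fun s : ℝ => NormedSpace.exp (-(((a + b * s : ℝ) : ℂ) • K)) :=
    continuous_exp_op.comp (by fun_prop)
  have h3 : Continuous fun s : ℝ => NormedSpace.exp (((0 + c * s : ℝ) : ℂ) • K') :=
    continuous_exp_op.comp (by fun_prop)
  unfold sandwDeriv sandw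
  fun_prop

theorem hasDerivAt_tr_sandw_rpow {κ : Type} [DecidableEq κ] [Fintype κ] {K K' L : Op κ}
    (hK : IsSelfAdjoint K) (hK' : IsSelfAdjoint K') (hL : IsSelfAdjoint L) (a b c γ r : ℝ)
    (hLe : NormedSpace.exp L = sandw (((a + b * γ : ℝ) : ℂ) • K) (((0 + c * γ : ℝ) : ℂ) • K')) :
    HasDerivAt (fun s : ℝ => tr (sandw (((a + b * s : ℝ) : ℂ) • K)
        (((0 + c * s : ℝ) : ℂ) • K') ^ r))
      (tr (NormedSpace.exp ((r : ℂ) • L) * ((2 * r * b : ℂ) • K + (r * c : ℂ) •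
        (NormedSpace.exp (((a + b * γ : ℝ) : ℂ) • K) * K' *
          NormedSpace.exp (-(((a + b * γ : ℝ) : ℂ) • K)))))) γ := by
  set X : ℝ → Op κ := fun s =>
    sandw (((a + b * s : ℝ) : ℂ) • K) (((0 + c * s : ℝ) : ℂ) • K') with hX
  have hX0 : ∀ s, 0 ≤ X s := fun s => sandw_nonneg (sa_smul hK _) (sa_smul hK' _)
  obtain ⟨m, hm⟩ := (isCompact_closedBall γ 1).exists_bound_of_continuousOn
    (f := sandwDeriv K K' a b c) (continuous_sandwDeriv K K' a b c).continuousOn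
  obtain ⟨R, hR⟩ := (isCompact_closedBall γ 1).exists_bound_of_continuousOn
    (f := fun s : ℝ => 2 * ‖((a + b * s : ℝ) : ℂ) • K‖ + ‖((0 + c * s : ℝ) : ℂ) • K'‖)
    (by fun_prop)
  have hsp : ∀ s ∈ Metric.ball γ 1, spectrum ℝ (X s) ⊆ Set.Icc (Real.exp (-R)) (Real.exp R) := by
    intro s hs
    have h1 := (le_abs_self _).trans (hR s (Metric.ball_subset_closedBall hs))
    exact (spectrum_sandw (sa_smul hK _) (sa_smul hK' _)).trans
      (Set.Icc_subset_Icc (Real.exp_le_exp.2 (neg_le_neg h1)) (Real.exp_le_exp.2 h1))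
  have hpos : ∀ x ∈ Set.Icc (Real.exp (-R)) (Real.exp R), 0 < x := fun x hx =>
    (Real.exp_pos _).trans_le hx.1
  have h1 := hasDerivAt_tr_cfc (γ₀ := γ) one_pos (fun s _ => hasDerivAt_sandw K K' a b c s)
    (fun s _ => (hX0 s).isSelfAdjoint) hsp
    (fun s hs => hm s (Metric.ball_subset_closedBall hs)) (f := fun x => x ^ r)
    (f' := fun x => r * x ^ (r - 1))
    (fun x hx => Real.hasDerivAt_rpow_const (Or.inl (hpos x hx).ne'))
    (continuousOn_const.mul (continuousOn_id.rpow_const fun x hx => Or.inl (hpos x hx).ne'))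
  have hf : ∀ s, cfc (fun x : ℝ => x ^ r) (X s) = X s ^ r := fun s =>
    (CFC.rpow_eq_cfc_real (hX0 s)).symm
  have hf' : cfc (fun x : ℝ => r * x ^ (r - 1)) (X γ) =
      (r : ℂ) • (NormedSpace.exp ((r : ℂ) • L) * NormedSpace.exp (-L)) := by
    have hc : ContinuousOn (fun x : ℝ => x ^ (r - 1)) (spectrum ℝ (X γ)) :=
      continuousOn_id.rpow_const fun x hx =>
        Or.inl (hpos x (hsp γ (Metric.mem_ball_self one_pos) hx)).ne'
    rw [cfc_const_mul r (fun x => x ^ (r - 1)) (X γ) hc, Complex.coe_smul]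
    congr 1
    rw [← CFC.rpow_eq_cfc_real (hX0 γ), show X γ = NormedSpace.exp L from hLe.symm, exp_rpow hL,
      ← exp_add_of_comm]
    · congr 1
      push_cast
      rw [sub_smul, one_smul, sub_eq_add_neg]
    · exact ((Commute.refl _).smul_left _).neg_right
  have h1' := HasDerivAt.congr_of_eventuallyEq (f₁ := fun s => tr (X s ^ r)) h1
    (Filter.Eventually.of_forall fun s => congrArg tr (hf s).symm)
  refine h1'.congr_deriv ?_
  rw [hf', sandwDeriv, ← hLe]
  set F := NormedSpace.exp ((r : ℂ) • L)
  set Q := NormedSpace.exp (((a + b * γ : ℝ) : ℂ) • K) * K' *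
    NormedSpace.exp (-(((a + b * γ : ℝ) : ℂ) • K))
  have hFL : F * NormedSpace.exp L = NormedSpace.exp L * F := by
    rw [← exp_add_of_comm ((Commute.refl _).smul_left _),
      ← exp_add_of_comm ((Commute.refl _).smul_right _), add_comm]
  have t1 : tr (F * NormedSpace.exp (-L) * (NormedSpace.exp L * K)) = tr (F * K) := by
    rw [mul_assoc, ← mul_assoc (NormedSpace.exp (-L)), exp_neg_mul_exp, one_mul]
  have t2 : ∀ Z, tr (F * NormedSpace.exp (-L) * (Z * NormedSpace.exp L)) = tr (F * Z) := by
    intro Z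
    rw [← mul_assoc, tr_mul_comm, ← mul_assoc, ← mul_assoc, ← hFL, mul_assoc F, exp_mul_exp_neg,
      mul_one]
  simp only [smul_mul_assoc, mul_smul_comm, mul_add, tr_smul, tr_add, t1, t2, smul_add]
  ring

theorem hasDerivAt_pressure_of_ne_top {p : ℝ≥0∞} (hp : 0 < p) (hp' : p ≠ ⊤) {A B : Op ι}
    (hA : IsSelfAdjoint A) (hB : IsSelfAdjoint B) (γ : ℝ) :
    HasDerivAt (pressure p A B) (tr (kernelAB p γ A B * (B - A))).re γ := by
  set q := p.toReal with hq
  have hq0 : 0 < q := ENNReal.toReal_pos hp.ne' hp'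
  have e1 : ∀ s : ℝ, (1 - s) / q = 1 / q + -1 / q * s := fun s => by ring
  have e2 : ∀ s : ℝ, 2 * s / q = 0 + 2 / q * s := fun s => by ring
  have e3 : 1 * (1 - γ) / q = 1 / q + -1 / q * γ := by ring
  have e4 : -1 * (1 - γ) / q = -(1 / q + -1 / q * γ) := by ring
  set m : ℝ := 1 / q + -1 / q * γ with hm
  obtain ⟨L, hL, hLe⟩ := exists_log_sandw (sa_smul hA m) (sa_smul hB (0 + 2 / q * γ))
  have hLΓ : NormedSpace.exp (dGamma L) =
      sandw ((m : ℂ) • dGamma A) (((0 + 2 / q * γ : ℝ) : ℂ) • dGamma B) := by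
    rw [← dGamma_smul, ← dGamma_smul, sandw_dGamma hLe]
  set C : Op ι := ((q / 2 : ℝ) : ℂ) • L with hC
  have hCsa : IsSelfAdjoint C := sa_smul hL _
  have h1 := hasDerivAt_tr_sandw_rpow (isSelfAdjoint_dGamma hA) (isSelfAdjoint_dGamma hB)
    (isSelfAdjoint_dGamma hL) (1 / q) (-1 / q) (2 / q) γ (q / 2) hLΓ
  set E := NormedSpace.exp ((m : ℂ) • A) with hE
  set E' := NormedSpace.exp (-((m : ℂ) • A)) with hE'
  have hEE' : E * E' = 1 := exp_mul_exp_neg _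
  have hEA : E * A = A * E := ((Commute.refl A).smul_left _).exp_left.eq
  have hconj : ((2 * (q / 2 : ℝ) * (-1 / q : ℝ) : ℂ) • dGamma A + ((q / 2 : ℝ) * (2 / q : ℝ) : ℂ) •
      (NormedSpace.exp ((m : ℂ) • dGamma A) * dGamma B * NormedSpace.exp (-((m : ℂ) • dGamma A))))
      = dGamma (E * (B - A) * E') := by
    rw [show (m : ℂ) • dGamma A = dGamma ((m : ℂ) • A) from (dGamma_smul _ _).symm,
      exp_dGamma_conj, ← dGamma_smul, ← dGamma_smul, ← dGamma_add]
    congr 1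
    have c1 : (2 * (q / 2 : ℝ) * (-1 / q : ℝ) : ℂ) = -1 := by
      have : (q : ℂ) ≠ 0 := by exact_mod_cast hq0.ne'
      push_cast
      field_simp
    have c2 : ((q / 2 : ℝ) * (2 / q : ℝ) : ℂ) = 1 := by
      have : (q : ℂ) ≠ 0 := by exact_mod_cast hq0.ne'
      push_cast
      field_simp
    rw [c1, c2, one_smul, neg_one_smul, mul_sub, sub_mul, hEA, mul_assoc A, hEE', mul_one]
    abel
  rw [← hm, hconj, ← dGamma_smul, ← hC] at h1
  set R := Ring.inverse (1 + NormedSpace.exp (-C)) with hR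
  have hR0 : (1 + NormedSpace.exp (-C)) * R = 1 :=
    Ring.mul_inverse_cancel _ (isUnit_one_add hCsa.neg.exp_nonneg)
  rw [tr_exp_dGamma_mul hR0] at h1
  have hfun : pressure p A B = fun s : ℝ => Real.log (tr (sandw
      (((1 / q + -1 / q * s : ℝ) : ℂ) • dGamma A) (((0 + 2 / q * s : ℝ) : ℂ) • dGamma B) ^
        (q / 2))).re := by
    funext s
    rw [pressure, pressureOp, if_neg hp', ← hq, e1, e2]
  rw [hfun]
  have hval : tr (sandw ((m : ℂ) • dGamma A) (((0 + 2 / q * γ : ℝ) : ℂ) • dGamma B) ^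
        (q / 2)) = tr (NormedSpace.exp (dGamma C)) := by
    rw [← hLΓ, exp_rpow (isSelfAdjoint_dGamma hL), hC, dGamma_smul]
  have h2 := hasDerivAt_log_re h1 (by rw [← hm]; exact hval)
    (tr_im_eq_zero (sa_exp (isSelfAdjoint_dGamma hCsa)))
    (tr_exp_pos (isSelfAdjoint_dGamma hCsa))
  refine h2.congr_deriv ?_
  -- the trace against the symmetrized kernel is the real part
  have hker : kernelAB p γ A B = (1 / 2 : ℂ) • (E' * R * E) + star ((1 / 2 : ℂ) • (E' * R * E)) := by
    have hneg : ((-m : ℝ) : ℂ) • A = -((m : ℂ) • A) := by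
      push_cast
      rw [neg_smul]
    rw [kernelAB, if_neg hp', ← hq, e3, e4, e2, hneg, ← hE, ← hE', ← hLe, exp_rpow hL]
    have : ((-(q / 2) : ℝ) : ℂ) • L = -C := by
      rw [hC]
      push_cast
      rw [neg_smul]
    rw [this]
  have hD : IsSelfAdjoint (B - A) := hB.sub hA
  have ht : tr (R * (E * (B - A) * E')) = tr (E' * R * E * (B - A)) := by
    rw [← mul_assoc, tr_mul_comm, ← mul_assoc, ← mul_assoc]
  have hst : tr (star (E' * R * E) * (B - A)) = star (tr (E' * R * E * (B - A))) := by
    rw [← tr_star, star_mul (E' * R * E), hD.star_eq, tr_mul_comm]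
  rw [hker, star_smul, add_mul, tr_add, smul_mul_assoc, smul_mul_assoc, tr_smul, tr_smul, hst, ht]
  simp
  ring

theorem hasDerivAt_pressure {p : ℝ≥0∞} (hp : 0 < p) {A B : Op ι} (hA : IsSelfAdjoint A)
    (hB : IsSelfAdjoint B) (γ : ℝ) :
    HasDerivAt (pressure p A B) (tr (kernelAB p γ A B * (B - A))).re γ := by
  by_cases hp' : p = ⊤
  · subst hp'
    exact hasDerivAt_pressure_top hA hB γ
  · exact hasDerivAt_pressure_of_ne_top hp hp' hA hB γ

end PressureDeriv

/-! ### Joint continuity of the kernel, up to `p = ∞` -/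

section KernelContinuity

variable {κ : Type}

/-- The entire function `(e^y - 1) / y` of an operator, as an integral. -/
def expQuot (Y : Op κ) : Op κ := ∫ s in (0 : ℝ)..1, NormedSpace.exp (((0 + 1 * s : ℝ) : ℂ) • Y)

theorem exp_eq_one_add_mul_expQuot (Y : Op κ) : NormedSpace.exp Y = 1 + Y * expQuot Y := by
  have hc : Continuous fun s : ℝ => NormedSpace.exp (((0 + 1 * s : ℝ) : ℂ) • Y) :=
    continuous_exp_op.comp (by fun_prop)
  have h1 : ∀ s ∈ Set.uIcc (0 : ℝ) 1, HasDerivAt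
      (fun s : ℝ => NormedSpace.exp (((0 + 1 * s : ℝ) : ℂ) • Y))
      (ContinuousLinearMap.mul ℝ (Op κ) Y (NormedSpace.exp (((0 + 1 * s : ℝ) : ℂ) • Y))) s := by
    intro s _
    simpa using hasDerivAt_exp_affine Y 0 1 s
  have h2 := intervalIntegral.integral_eq_sub_of_hasDerivAt h1
    (((ContinuousLinearMap.mul ℝ (Op κ) Y).continuous.comp hc).intervalIntegrable 0 1)
  rw [ContinuousLinearMap.intervalIntegral_comp_comm _ (hc.intervalIntegrable 0 1)] at h2
  rw [expQuot]
  simp only [ContinuousLinearMap.mul_apply'] at h2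
  rw [h2]
  simp [NormedSpace.exp_zero]

theorem continuous_expQuot : Continuous fun Y : Op κ => expQuot Y := by
  unfold expQuot
  refine intervalIntegral.continuous_parametric_intervalIntegral_of_continuous' ?_ 0 1
  exact continuous_exp_op.comp (by fun_prop)

theorem expQuot_zero : expQuot (0 : Op κ) = 1 := by
  simp [expQuot, NormedSpace.exp_zero]

/-- The difference quotient `(e^{ra} e^{rb} e^{ra} - 1) / r`, extended continuously to `r = 0`. -/
def sandwQuot (r : ℝ) (a b : Op κ) : Op κ :=
  a * expQuot ((r : ℂ) • a) * NormedSpace.exp ((r : ℂ) • b) * NormedSpace.exp ((r : ℂ) • a) +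
    b * expQuot ((r : ℂ) • b) * NormedSpace.exp ((r : ℂ) • a) + a * expQuot ((r : ℂ) • a)

theorem sandw_eq_one_add (r : ℝ) (a b : Op κ) :
    sandw ((r : ℂ) • a) ((r : ℂ) • b) = 1 + (r : ℂ) • sandwQuot r a b := by
  have ha := exp_eq_one_add_mul_expQuot ((r : ℂ) • a)
  have hb := exp_eq_one_add_mul_expQuot ((r : ℂ) • b)
  set Ga := expQuot ((r : ℂ) • a)
  set Gb := expQuot ((r : ℂ) • b)
  simp only [sandw, sandwQuot, ha, hb, smul_mul_assoc, add_mul, mul_add, smul_add, one_mul, mul_one,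
    mul_smul_comm]
  abel

theorem sandwQuot_zero (a b : Op κ) : sandwQuot 0 a b = (2 : ℂ) • a + b := by
  simp only [sandwQuot, Complex.ofReal_zero, zero_smul, expQuot_zero, NormedSpace.exp_zero, mul_one,
    two_smul]
  abel

/-- The operator `r⁻¹ log (e^{ra} e^{rb} e^{ra})`, extended continuously to `r = 0`. -/
def logQuot (r : ℝ) (a b : Op κ) : Op κ :=
  sandwQuot r a b * cfc (dslope Real.log 1) (sandw ((r : ℂ) • a) ((r : ℂ) • b))

theorem logQuot_zero (a b : Op κ) : logQuot 0 a b = (2 : ℂ) • a + b := by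
  rw [logQuot, sandwQuot_zero]
  have : sandw (((0 : ℝ) : ℂ) • a) (((0 : ℝ) : ℂ) • b) = 1 := by
    simp [sandw, NormedSpace.exp_zero]
  rw [this, cfc_apply_one]
  simp

theorem continuousOn_dslope_log : ContinuousOn (dslope Real.log 1) (Set.Ioi 0) :=
  (continuousOn_dslope (Ioi_mem_nhds one_pos)).2
    ⟨Real.continuousOn_log.mono fun _ hx => ne_of_gt hx, Real.differentiableAt_log one_ne_zero⟩

theorem spectrum_sandw_pos {a b : Op κ} (ha : IsSelfAdjoint a) (hb : IsSelfAdjoint b) :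
    spectrum ℝ (sandw a b) ⊆ Set.Ioi 0 :=
  (spectrum_sandw ha hb).trans fun _ hx => (Real.exp_pos _).trans_le hx.1

theorem smul_logQuot {a b : Op κ} (ha : IsSelfAdjoint a) (hb : IsSelfAdjoint b) (r : ℝ) :
    (r : ℂ) • logQuot r a b = CFC.log (sandw ((r : ℂ) • a) ((r : ℂ) • b)) := by
  set F := sandw ((r : ℂ) • a) ((r : ℂ) • b) with hF
  have hsp : spectrum ℝ F ⊆ Set.Ioi 0 := spectrum_sandw_pos (sa_smul ha r) (sa_smul hb r)
  have hsa : IsSelfAdjoint F := (sandw_nonneg (sa_smul ha r) (sa_smul hb r)).isSelfAdjoint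
  have h1 : (r : ℂ) • sandwQuot r a b = cfc (fun x : ℝ => x - 1) F := by
    rw [cfc_sub (fun x : ℝ => x) (fun _ => 1) F, cfc_id' ℝ F, cfc_const_one ℝ F, hF,
      sandw_eq_one_add]
    simp
  rw [logQuot, ← hF, ← smul_mul_assoc, h1, ← cfc_mul (fun x : ℝ => x - 1) (dslope Real.log 1) F
    (by fun_prop) (continuousOn_dslope_log.mono hsp), CFC.log]
  refine cfc_congr fun x _ => ?_
  have := sub_smul_dslope Real.log 1 x
  simpa using this

theorem isSelfAdjoint_logQuot {a b : Op κ} (ha : IsSelfAdjoint a) (hb : IsSelfAdjoint b) (r : ℝ) :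
    IsSelfAdjoint (logQuot r a b) := by
  by_cases hr : r = 0
  · rw [hr, logQuot_zero]
    refine IsSelfAdjoint.add ?_ hb
    simpa using sa_smul ha 2
  · have h := sa_smul (IsSelfAdjoint.log (a := sandw ((r : ℂ) • a) ((r : ℂ) • b))) r⁻¹
    rw [← smul_logQuot ha hb, smul_smul, Complex.ofReal_inv, inv_mul_cancel₀
      (by exact_mod_cast hr), one_smul] at h
    exact h

theorem sandw_rpow {a b : Op κ} (ha : IsSelfAdjoint a) (hb : IsSelfAdjoint b) (r s : ℝ) :
    sandw ((r : ℂ) • a) ((r : ℂ) • b) ^ s =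
      NormedSpace.exp (((s * r : ℝ) : ℂ) • logQuot r a b) := by
  have h := CFC.exp_log _ (sandw_strictlyPositive (sa_smul ha r) (sa_smul hb r))
  rw [← smul_logQuot ha hb] at h
  rw [← h, exp_rpow (sa_smul (isSelfAdjoint_logQuot ha hb r) r), smul_smul]
  push_cast
  rfl

/-- The kernel `𝒦_{p,t}` as a function of `r = 1 / p ∈ [0, ∞)`. -/
def kernelR (r γ : ℝ) (A B : Op κ) : Op κ :=
  (1 / 2 : ℂ) • (NormedSpace.exp ((r : ℂ) • -(((1 - γ : ℝ) : ℂ) • A)) *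
    Ring.inverse (1 + NormedSpace.exp ((-(1 / 2) : ℂ) •
      logQuot r (((1 - γ : ℝ) : ℂ) • A) (((2 * γ : ℝ) : ℂ) • B))) *
    NormedSpace.exp ((r : ℂ) • (((1 - γ : ℝ) : ℂ) • A))) +
  star ((1 / 2 : ℂ) • (NormedSpace.exp ((r : ℂ) • -(((1 - γ : ℝ) : ℂ) • A)) *
    Ring.inverse (1 + NormedSpace.exp ((-(1 / 2) : ℂ) •
      logQuot r (((1 - γ : ℝ) : ℂ) • A) (((2 * γ : ℝ) : ℂ) • B))) *
    NormedSpace.exp ((r : ℂ) • (((1 - γ : ℝ) : ℂ) • A))))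

theorem kernelAB_eq_kernelR {p : ℝ≥0∞} (hp : 0 < p) (γ : ℝ) {A B : Op κ} (hA : IsSelfAdjoint A)
    (hB : IsSelfAdjoint B) : kernelAB p γ A B = kernelR (p⁻¹).toReal γ A B := by
  by_cases hp' : p = ⊤
  · subst hp'
    have h1 : IsSelfAdjoint (Ring.inverse (1 + NormedSpace.exp
        (-(((1 - γ : ℝ) : ℂ) • A) - (γ : ℂ) • B))) :=
      isSelfAdjoint_inverse (IsSelfAdjoint.exp_nonneg ((sa_smul hA _).neg.sub (sa_smul hB _)))
    have h2 : (-(1 / 2) : ℂ) • ((2 : ℂ) • ((1 - γ : ℝ) : ℂ) • A + ((2 * γ : ℝ) : ℂ) • B) =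
        -(((1 - γ : ℝ) : ℂ) • A) - (γ : ℂ) • B := by
      push_cast
      module
    rw [kernelAB, if_pos rfl, kernelR]
    simp only [ENNReal.inv_top, ENNReal.toReal_zero, Complex.ofReal_zero, zero_smul,
      NormedSpace.exp_zero, one_mul, mul_one, logQuot_zero, h2, star_smul, h1.star_eq]
    rw [← add_smul]
    norm_num
  · have hq0 : 0 < p.toReal := ENNReal.toReal_pos hp.ne' hp'
    set q := p.toReal with hq
    have hr : (p⁻¹).toReal = q⁻¹ := ENNReal.toReal_inv p
    have hqc : (q : ℂ) ≠ 0 := by exact_mod_cast hq0.ne'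
    have e1 : ((1 * (1 - γ) / q : ℝ) : ℂ) • A = ((q⁻¹ : ℝ) : ℂ) • (((1 - γ : ℝ) : ℂ) • A) := by
      rw [smul_smul]
      congr 1
      push_cast
      ring
    have e2 : ((-1 * (1 - γ) / q : ℝ) : ℂ) • A = ((q⁻¹ : ℝ) : ℂ) • -(((1 - γ : ℝ) : ℂ) • A) := by
      rw [smul_neg, smul_smul, ← neg_smul]
      congr 1
      push_cast
      ring
    have e3 : ((2 * γ / q : ℝ) : ℂ) • B = ((q⁻¹ : ℝ) : ℂ) • (((2 * γ : ℝ) : ℂ) • B) := by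
      rw [smul_smul]
      congr 1
      push_cast
      ring
    have e4 : ((-(q / 2) * q⁻¹ : ℝ) : ℂ) = -(1 / 2) := by
      push_cast
      field_simp
    rw [kernelAB, if_neg hp', kernelR, hr, ← hq, e1, e2, e3,
      sandw_rpow (sa_smul hA _) (sa_smul hB _), e4]

variable {T : Type*} [TopologicalSpace T] {r γ : T → ℝ} {A B : T → Op κ}

theorem continuous_sandw (hA : Continuous A) (hB : Continuous B) :
    Continuous fun x => sandw (A x) (B x) := by
  have h1 := continuous_exp_op.comp hA
  have h2 := continuous_exp_op.comp hB
  exact (h1.mul h2).mul h1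

theorem continuous_logQuot (hr : Continuous r) (hA : Continuous A) (hB : Continuous B)
    (hAs : ∀ x, IsSelfAdjoint (A x)) (hBs : ∀ x, IsSelfAdjoint (B x)) :
    Continuous fun x => logQuot (r x) (A x) (B x) := by
  have hrA : Continuous fun x => (r x : ℂ) • A x := (Complex.continuous_ofReal.comp hr).smul hA
  have hrB : Continuous fun x => (r x : ℂ) • B x := (Complex.continuous_ofReal.comp hr).smul hB
  refine Continuous.mul ?_ (Continuous.cfc_of_mem_nhdsSet (s := Set.Ioi 0) _ ?_
    (continuous_sandw hrA hrB) (fun x => (sandw_nonneg (sa_smul (hAs x) _)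
      (sa_smul (hBs x) _)).isSelfAdjoint) continuousOn_dslope_log)
  · have h1 := continuous_exp_op.comp hrA
    have h2 := continuous_exp_op.comp hrB
    have h3 := continuous_expQuot.comp hrA
    have h4 := continuous_expQuot.comp hrB
    exact ((((hA.mul h3).mul h2).mul h1).add ((hB.mul h4).mul h1)).add (hA.mul h3)
  · exact isOpen_Ioi.mem_nhdsSet.2 (Set.iUnion_subset fun x =>
      spectrum_sandw_pos (sa_smul (hAs x) _) (sa_smul (hBs x) _))

theorem continuous_inverse_one_add {Y : T → Op κ} (hY : Continuous Y) (h0 : ∀ x, 0 ≤ Y x) :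
    Continuous fun x => Ring.inverse (1 + Y x) := by
  refine continuous_iff_continuousAt.2 fun x => ?_
  have h1 := NormedRing.inverse_continuousAt (isUnit_one_add (h0 x)).unit
  exact ContinuousAt.comp (f := fun x => 1 + Y x) (g := Ring.inverse) h1
    (continuous_const.add hY).continuousAt

theorem continuous_kernelR (hr : Continuous r) (hγ : Continuous γ) (hA : Continuous A)
    (hB : Continuous B) (hAs : ∀ x, IsSelfAdjoint (A x)) (hBs : ∀ x, IsSelfAdjoint (B x)) :
    Continuous fun x => kernelR (r x) (γ x) (A x) (B x) := by
  have hrc : Continuous fun x => (r x : ℂ) := Complex.continuous_ofReal.comp hr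
  have ha : Continuous fun x => ((1 - γ x : ℝ) : ℂ) • A x :=
    (Complex.continuous_ofReal.comp (continuous_const.sub hγ)).smul hA
  have hb : Continuous fun x => ((2 * γ x : ℝ) : ℂ) • B x :=
    (Complex.continuous_ofReal.comp (continuous_const.mul hγ)).smul hB
  have h1 := continuous_exp_op.comp (hrc.smul ha)
  have h2 := continuous_exp_op.comp (hrc.smul ha.neg)
  have h3 := continuous_logQuot hr ha hb (fun x => sa_smul (hAs x) _) (fun x => sa_smul (hBs x) _)
  have h4 := continuous_inverse_one_add
    (continuous_exp_op.comp (h3.const_smul (-(1 / 2) : ℂ))) (fun x => by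
      refine IsSelfAdjoint.exp_nonneg ?_
      simpa using sa_smul (isSelfAdjoint_logQuot (sa_smul (hAs x) (1 - γ x))
        (sa_smul (hBs x) (2 * γ x)) (r x)) (-(1 / 2)))
  have h5 := ((h2.mul h4).mul h1).const_smul (1 / 2 : ℂ)
  exact h5.add h5.star

theorem continuous_kernelAB {p : T → ℝ≥0∞} (hp : Continuous p) (hp0 : ∀ x, 0 < p x)
    (hγ : Continuous γ) (hA : Continuous A)
    (hB : Continuous B) (hAs : ∀ x, IsSelfAdjoint (A x)) (hBs : ∀ x, IsSelfAdjoint (B x)) :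
    Continuous fun x => kernelAB (p x) (γ x) (A x) (B x) := by
  simp only [fun x => kernelAB_eq_kernelR (hp0 x) (γ x) (hAs x) (hBs x)]
  refine continuous_kernelR ?_ hγ hA hB hAs hBs
  refine continuous_iff_continuousAt.2 fun x => ?_
  exact (ENNReal.tendsto_toReal (by simpa using (hp0 x).ne')).comp
    ((continuous_inv.tendsto _).comp hp.continuousAt)

end KernelContinuity

/-! ### The one-particle dynamics -/

section Evolve

variable {κ : Type} {h : Op κ}

theorem smul_I_neg (h : Op κ) (s : ℝ) :
    (Complex.I * ((-s : ℝ) : ℂ)) • h = -((Complex.I * (s : ℂ)) • h) := by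
  push_cast
  rw [mul_neg, neg_smul]

theorem star_exp_I (hh : IsSelfAdjoint h) (s : ℝ) :
    star (NormedSpace.exp ((Complex.I * (s : ℂ)) • h)) =
      NormedSpace.exp (-((Complex.I * (s : ℂ)) • h)) := by
  rw [NormedSpace.star_exp, star_smul, hh.star_eq, ← neg_smul]
  congr 2
  simp

theorem star_exp_neg_I (hh : IsSelfAdjoint h) (s : ℝ) :
    star (NormedSpace.exp (-((Complex.I * (s : ℂ)) • h))) =
      NormedSpace.exp ((Complex.I * (s : ℂ)) • h) := by
  rw [← star_exp_I hh, star_star]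

theorem evolve_zero (h k : Op κ) : evolve h k 0 = k := by
  simp [evolve, NormedSpace.exp_zero]

theorem exp_I_add (h : Op κ) (s t : ℝ) : NormedSpace.exp ((Complex.I * ((s + t : ℝ) : ℂ)) • h) =
    NormedSpace.exp ((Complex.I * (s : ℂ)) • h) * NormedSpace.exp ((Complex.I * (t : ℂ)) • h) := by
  rw [← exp_add_of_comm (((Commute.refl h).smul_left _).smul_right _), ← add_smul]
  push_cast
  rw [mul_add]

theorem evolve_evolve (h k : Op κ) (s t : ℝ) : evolve h (evolve h k s) t = evolve h k (s + t) := by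
  have h1 := exp_I_add h t s
  have h2 := exp_I_add h (-s) (-t)
  rw [show -s + -t = -(s + t) by ring, smul_I_neg, smul_I_neg, smul_I_neg] at h2
  rw [add_comm t s] at h1
  simp only [evolve, h1, h2, mul_assoc]

/-- The one-particle dynamics as a group of `*`-automorphisms. -/
def evolveHom (hh : IsSelfAdjoint h) (s : ℝ) : Op κ →⋆ₐ[ℂ] Op κ where
  toFun A := evolve h A s
  map_one' := by simp [evolve, exp_mul_exp_neg]
  map_mul' A B := by
    calc _ = NormedSpace.exp ((Complex.I * (s : ℂ)) • h) * A *
          (NormedSpace.exp (-((Complex.I * (s : ℂ)) • h)) *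
            NormedSpace.exp ((Complex.I * (s : ℂ)) • h)) * B *
          NormedSpace.exp (-((Complex.I * (s : ℂ)) • h)) := by
          rw [exp_neg_mul_exp, mul_one]
          simp only [evolve, mul_assoc]
      _ = _ := by simp only [evolve, mul_assoc]
  map_zero' := by simp [evolve]
  map_add' A B := by simp [evolve, mul_add, add_mul]
  commutes' c := by
    simp [evolve, Algebra.algebraMap_eq_smul_one, exp_mul_exp_neg]
  map_star' A := by
    simp only [evolve, star_mul, star_exp_I hh, star_exp_neg_I hh, mul_assoc]

theorem evolveHom_apply (hh : IsSelfAdjoint h) (s : ℝ) (A : Op κ) :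
    evolveHom hh s A = evolve h A s := rfl

theorem continuous_evolveHom (hh : IsSelfAdjoint h) (s : ℝ) : Continuous (evolveHom hh s) :=
  (continuous_const.mul continuous_id).mul continuous_const

theorem norm_evolve_le (hh : IsSelfAdjoint h) (A : Op κ) (s : ℝ) : ‖evolve h A s‖ ≤ ‖A‖ :=
  NonUnitalStarAlgHom.norm_apply_le (evolveHom hh s) A

theorem isSelfAdjoint_evolve (hh : IsSelfAdjoint h) {k : Op κ} (hk : IsSelfAdjoint k) (s : ℝ) :
    IsSelfAdjoint (evolve h k s) := hk.map (evolveHom hh s)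

theorem evolve_smul (z : ℂ) (A : Op κ) (s : ℝ) : evolve h (z • A) s = z • evolve h A s := by
  simp [evolve]

theorem map_exp_op {F : Type*} [FunLike F (Op κ) (Op κ)] [RingHomClass F (Op κ) (Op κ)] (f : F)
    (hf : Continuous f) (A : Op κ) : f (NormedSpace.exp A) = NormedSpace.exp (f A) := by
  let _ : NormedAlgebra ℚ (Op κ) := NormedAlgebra.restrictScalars ℚ ℂ (Op κ)
  exact NormedSpace.map_exp f hf A

theorem map_inverse {f : Op κ →⋆ₐ[ℝ] Op κ} {Y : Op κ} (hY : 0 ≤ Y) :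
    f (Ring.inverse (1 + Y)) = Ring.inverse (1 + f Y) := by
  obtain ⟨u, hu⟩ := isUnit_one_add hY
  have h1 : (1 + f Y) = (Units.map (f : Op κ →* Op κ) u : (Op κ)ˣ) := by
    simp [hu]
  rw [h1, ← hu, Ring.inverse_unit, Ring.inverse_unit]
  rfl

theorem map_ofReal_smul (f : Op κ →⋆ₐ[ℝ] Op κ) (s : ℝ) (A : Op κ) :
    f ((s : ℂ) • A) = (s : ℂ) • f A := by
  rw [Complex.coe_smul, Complex.coe_smul, map_smul]

theorem map_kernelAB {f : Op κ →⋆ₐ[ℝ] Op κ} (hf : Continuous f) (p : ℝ≥0∞) (γ : ℝ) {A B : Op κ}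
    (hA : IsSelfAdjoint A) (hB : IsSelfAdjoint B) :
    f (kernelAB p γ A B) = kernelAB p γ (f A) (f B) := by
  by_cases hp : p = ⊤
  · simp only [kernelAB, if_pos hp]
    rw [map_inverse (((sa_smul hA _).neg.sub (sa_smul hB _)).exp_nonneg), map_exp_op f hf]
    simp only [map_sub, map_neg, map_ofReal_smul]
  · simp only [kernelAB, if_neg hp]
    have h0 := sandw_nonneg (sa_smul hA (1 * (1 - γ) / p.toReal)) (sa_smul hB (2 * γ / p.toReal))
    have h1 : f (sandw (((1 * (1 - γ) / p.toReal : ℝ) : ℂ) • A)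
        (((2 * γ / p.toReal : ℝ) : ℂ) • B)) = sandw (((1 * (1 - γ) / p.toReal : ℝ) : ℂ) • f A)
        (((2 * γ / p.toReal : ℝ) : ℂ) • f B) := by
      simp only [sandw, map_mul, map_exp_op f hf, map_ofReal_smul]
    have h2 : f (sandw (((1 * (1 - γ) / p.toReal : ℝ) : ℂ) • A)
        (((2 * γ / p.toReal : ℝ) : ℂ) • B) ^ (-(p.toReal / 2))) =
        sandw (((1 * (1 - γ) / p.toReal : ℝ) : ℂ) • f A)
        (((2 * γ / p.toReal : ℝ) : ℂ) • f B) ^ (-(p.toReal / 2)) := by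
      rw [CFC.rpow_eq_cfc_real h0, StarAlgHom.map_cfc f (fun x : ℝ => x ^ (-(p.toReal / 2))) _
        (continuousOn_id.rpow_const fun x hx => Or.inl (spectrum_sandw_pos
          (sa_smul hA _) (sa_smul hB _) hx).ne') hf h0.isSelfAdjoint (h0.isSelfAdjoint.map f), h1,
        ← CFC.rpow_eq_cfc_real (sandw_nonneg (sa_smul (hA.map f) _) (sa_smul (hB.map f) _))]
    have h3 : (0 : Op κ) ≤ sandw (((1 * (1 - γ) / p.toReal : ℝ) : ℂ) • A)
        (((2 * γ / p.toReal : ℝ) : ℂ) • B) ^ (-(p.toReal / 2)) := CFC.rpow_nonneg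
    rw [show (1 / 2 : ℂ) = ((1 / 2 : ℝ) : ℂ) by push_cast; rfl]
    simp only [map_add, map_star, map_ofReal_smul, map_mul, map_inverse h3, h2, map_exp_op f hf]

/-- The kernel at `(γ, u)` is the kernel at `(γ, 0)` evolved to the time `tu`. -/
theorem kernelK_eq_evolve (hh : IsSelfAdjoint h) {k : Op κ} (hk : IsSelfAdjoint k) (p : ℝ≥0∞)
    (t γ u : ℝ) : kernelK h k p t γ u = evolve h (kernelAB p γ k (evolve h k (-t))) (t * u) := by
  have h1 := map_kernelAB (f := (evolveHom hh (t * u)).restrictScalars ℝ)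
    (continuous_evolveHom hh _) p γ hk (isSelfAdjoint_evolve hh hk (-t))
  simp only [StarAlgHom.restrictScalars_apply, evolveHom_apply, evolve_evolve] at h1
  rw [kernelK_eq, h1]
  congr 2
  ring

/-- The commutator `i[k, h]`. -/
def flow (h k : Op κ) : Op κ := Complex.I • (k * h - h * k)

theorem isSelfAdjoint_flow (hh : IsSelfAdjoint h) {k : Op κ} (hk : IsSelfAdjoint k) :
    IsSelfAdjoint (flow h k) := by
  rw [IsSelfAdjoint, flow, star_smul, star_sub, star_mul, star_mul, hh.star_eq, hk.star_eq,
    Complex.star_def, Complex.conj_I, neg_smul, ← smul_neg, neg_sub]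

theorem continuous_evolve (h : Op κ) :
    Continuous fun q : Op κ × ℝ => evolve h q.1 q.2 := by
  have h1 : Continuous fun q : Op κ × ℝ => NormedSpace.exp ((Complex.I * (q.2 : ℂ)) • h) :=
    continuous_exp_op.comp (by fun_prop)
  have h2 : Continuous fun q : Op κ × ℝ => NormedSpace.exp (-((Complex.I * (q.2 : ℂ)) • h)) :=
    continuous_exp_op.comp (by fun_prop)
  exact (h1.mul continuous_fst).mul h2

theorem hasDerivAt_evolve (h k : Op κ) (s : ℝ) :
    HasDerivAt (fun s => evolve h k s) (evolve h (-flow h k) s) s := by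
  have h1 := hasDerivAt_exp_affine (Complex.I • h) 0 1 s
  have h2 := hasDerivAt_exp_affine (Complex.I • h) 0 (-1) s
  have h3 := (h1.mul_const k).mul h2
  have e1 : ∀ s : ℝ, ((0 + 1 * s : ℝ) : ℂ) • Complex.I • h = (Complex.I * (s : ℂ)) • h := by
    intro s
    rw [smul_smul]
    congr 1
    push_cast
    ring
  have e2 : ∀ s : ℝ, ((0 + -1 * s : ℝ) : ℂ) • Complex.I • h = -((Complex.I * (s : ℂ)) • h) := by
    intro s
    rw [smul_smul, ← neg_smul]
    congr 1
    push_cast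
    ring
  simp only [e1, e2] at h3
  refine h3.congr_deriv ?_
  simp only [flow, evolve]
  set E := NormedSpace.exp ((Complex.I * (s : ℂ)) • h)
  set E' := NormedSpace.exp (-((Complex.I * (s : ℂ)) • h))
  have c1 : h * E = E * h := ((Commute.refl h).smul_right _).exp_right.eq
  simp only [Complex.ofReal_one, one_smul, Complex.ofReal_neg, neg_smul, smul_mul_assoc,
    mul_smul_comm, mul_neg, neg_mul, mul_sub, sub_mul, smul_sub, c1]
  simp only [mul_assoc]
  abel

end Evolve

/-! ### The trace formula in finite volume -/

section FiniteTraceFormula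

variable {ι : Type} [LinearOrder ι] [Fintype ι] {h k : Op ι}

theorem tr_evolve_mul (A B : Op ι) (s : ℝ) :
    tr (A * evolve h B (-s)) = tr (evolve h A s * B) := by
  simp only [evolve, smul_I_neg, neg_neg]
  rw [← mul_assoc, tr_mul_comm]
  simp only [mul_assoc]

/-- The fundamental theorem of calculus for `u ↦ tr(K k_{-tu})`, whose derivative is
`t tr(K_{tu} i[k, h])` by the cyclicity of the trace. -/
theorem integral_tr_evolve (h k K : Op ι) (t : ℝ) :
    (t : ℂ) * ∫ u in (0 : ℝ)..1, tr (evolve h K (t * u) * flow h k) =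
      tr (K * (evolve h k (-t) - k)) := by
  have h1 : ∀ u ∈ Set.uIcc (0 : ℝ) 1, HasDerivAt (fun u => tr (K * evolve h k (-(t * u))))
      ((t : ℂ) * tr (evolve h K (t * u) * flow h k)) u := by
    intro u _
    have h2 : HasDerivAt (fun u : ℝ => -(t * u)) (-t) u :=
      (((hasDerivAt_id' u).const_mul t).neg).congr_deriv (by ring)
    have h3 := ((hasDerivAt_evolve h k (-(t * u))).scomp u h2).const_mul K
    refine (hasDerivAt_tr h3).congr_deriv ?_
    have : evolve h (-flow h k) (-(t * u)) = -evolve h (flow h k) (-(t * u)) := by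
      simp [evolve]
    rw [this, smul_neg, neg_smul, neg_neg, mul_smul_comm, ← Complex.coe_smul, tr_smul,
      tr_evolve_mul]
  have hc : Continuous fun u : ℝ => (t : ℂ) * tr (evolve h K (t * u) * flow h k) := by
    have h2 : Continuous fun u : ℝ => evolve h K (t * u) * flow h k :=
      ((continuous_evolve h).comp (continuous_const.prodMk (by fun_prop))).mul continuous_const
    exact continuous_const.mul (trL.continuous.comp h2)
  rw [← intervalIntegral.integral_const_mul,
    intervalIntegral.integral_eq_sub_of_hasDerivAt h1 (hc.intervalIntegrable 0 1), ← tr_sub,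
    ← mul_sub]
  simp [evolve_zero]

/-- The trace formula is the integral of the derivative of the pressure of `k` and `k_{-t}` over
`[0, α]`. -/
theorem pressure_sub_eq_traceFormula {p : ℝ≥0∞} (hp : 0 < p) (hh : IsSelfAdjoint h)
    (hk : IsSelfAdjoint k) (t α : ℝ) :
    ((pressure p k (evolve h k (-t)) α - pressure p k (evolve h k (-t)) 0 : ℝ) : ℂ) =
      traceFormula h k p t α := by
  have hB := isSelfAdjoint_evolve hh hk (-t)
  have hc : Continuous fun γ =>
      (tr (kernelAB p γ k (evolve h k (-t)) * (evolve h k (-t) - k))).re :=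
    Complex.continuous_re.comp (trL.continuous.comp ((continuous_kernelAB continuous_const
      (fun _ => hp) continuous_id continuous_const continuous_const (fun _ => hk)
      (fun _ => hB)).mul continuous_const))
  rw [← intervalIntegral.integral_eq_sub_of_hasDerivAt
    (fun γ _ => hasDerivAt_pressure hp hk hB γ) (hc.intervalIntegrable 0 α),
    ← intervalIntegral.integral_ofReal, traceFormula, ← intervalIntegral.integral_const_mul]
  refine intervalIntegral.integral_congr fun γ _ => ?_
  simp only [kernelK_eq_evolve hh hk]
  have h1 := integral_tr_evolve h k (kernelAB p γ k (evolve h k (-t))) t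
  simp only [flow] at h1
  rw [h1]
  refine Complex.ext rfl ?_
  rw [Complex.ofReal_im, tr_mul_im_eq_zero (isSelfAdjoint_kernelAB p γ hk hB) (hB.sub hk)]

end FiniteTraceFormula

/-! ### Finite-volume functionals in terms of the pressure -/

section FiniteVolume

theorem entry_pullback {ι : Type} [DecidableEq ι] (f : ι → ι) (hf : f.Injective) (w : ι → ℂ)
    (hw : ∃ C : ℝ, ∀ b, ‖w b‖ ≤ C) (x y : ι) :
    entry (pullback f hf w hw) x y = if f x = y then w x else 0 := by
  rw [entry_eq, pullback_apply, delta_apply]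
  split_ifs <;> simp

theorem isSelfAdjoint_proj (s : Set ℤ) : IsSelfAdjoint (proj s) := by
  refine op_ext_entry fun x y => ?_
  simp only [entry_star, proj, entry_pullback, id]
  by_cases hxy : x = y
  · subst hxy
    split_ifs <;> simp
  · simp [hxy, Ne.symm hxy]

theorem isSelfAdjoint_compress {α β : Type} (R : Ell2 α →L[ℂ] Ell2 β) {A : Op α}
    (hA : IsSelfAdjoint A) : IsSelfAdjoint (compress R A) := by
  have h1 : ContinuousLinearMap.adjoint A = A := hA
  rw [IsSelfAdjoint, ContinuousLinearMap.star_eq_adjoint, compress,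
    ContinuousLinearMap.adjoint_comp, ContinuousLinearMap.adjoint_comp,
    ContinuousLinearMap.adjoint_adjoint, h1]
  rfl

theorem compress_add {α β : Type} (R : Ell2 α →L[ℂ] Ell2 β) (A B : Op α) :
    compress R (A + B) = compress R A + compress R B := by
  ext u
  simp [compress]

theorem compress_smul {α β : Type} (R : Ell2 α →L[ℂ] Ell2 β) (z : ℂ) (A : Op α) :
    compress R (z • A) = z • compress R A := by
  ext u
  simp [compress]

namespace Chain

variable (X : Chain)

theorem entry_h (x y : ℤ) : entry X.h x y = (if x + 1 = y then (X.J x : ℂ) else 0) +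
    (if x - 1 = y then (X.J (x - 1) : ℂ) else 0) + if x = y then (X.lam x : ℂ) else 0 := by
  simp only [h, entry_add, entry_pullback, id]

theorem isSelfAdjoint_h : IsSelfAdjoint X.h := by
  refine op_ext_entry fun x y => ?_
  simp only [entry_star, entry_h, star_add, apply_ite (star : ℂ → ℂ), star_zero]
  have h1 : (if y + 1 = x then star (X.J y : ℂ) else 0) =
      if x - 1 = y then (X.J (x - 1) : ℂ) else 0 := by
    by_cases hc : x - 1 = y
    · subst hc
      simp
    · rw [if_neg hc, if_neg (by omega)]
  have h2 : (if y - 1 = x then star (X.J (y - 1) : ℂ) else 0) =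
      if x + 1 = y then (X.J x : ℂ) else 0 := by
    by_cases hc : x + 1 = y
    · subst hc
      simp
    · rw [if_neg hc, if_neg (by omega)]
  have h3 : (if y = x then star (X.lam y : ℂ) else 0) = if x = y then (X.lam x : ℂ) else 0 := by
    by_cases hc : x = y
    · subst hc
      simp
    · rw [if_neg hc, if_neg (Ne.symm hc)]
  rw [h1, h2, h3]
  ring

theorem isSelfAdjoint_hL : IsSelfAdjoint X.hL := by
  have h1 := isSelfAdjoint_proj (Set.Iic (-(X.N : ℤ) - 1))
  rw [IsSelfAdjoint, hL, star_mul, star_mul, h1.star_eq, X.isSelfAdjoint_h.star_eq, mul_assoc]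

theorem isSelfAdjoint_hR : IsSelfAdjoint X.hR := by
  have h1 := isSelfAdjoint_proj (Set.Ici ((X.N : ℤ) + 1))
  rw [IsSelfAdjoint, hR, star_mul, star_mul, h1.star_eq, X.isSelfAdjoint_h.star_eq, mul_assoc]

theorem isSelfAdjoint_k : IsSelfAdjoint X.k :=
  (sa_smul X.isSelfAdjoint_hL _).neg.sub (sa_smul X.isSelfAdjoint_hR _)

theorem isSelfAdjoint_hVol (M : ℕ) : IsSelfAdjoint (X.hVol M) :=
  isSelfAdjoint_compress _ X.isSelfAdjoint_h

theorem kVol_eq (M : ℕ) : X.kVol M = compress (restrict M) X.k := by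
  rw [k, kVol, sub_eq_add_neg, sub_eq_add_neg, compress_add, ← neg_smul, ← neg_smul, ← neg_smul,
    ← neg_smul, compress_smul, compress_smul]
  rfl

theorem isSelfAdjoint_kVol (M : ℕ) : IsSelfAdjoint (X.kVol M) := by
  rw [kVol_eq]
  exact isSelfAdjoint_compress _ X.isSelfAdjoint_k

theorem gibbs_eq (M : ℕ) : X.gibbs M = NormedSpace.exp (dGamma (X.kVol M)) := by
  simp only [gibbs, kVol, dGamma_sub, dGamma_neg, dGamma_smul]

/-- The logarithm of the finite-volume partition function. -/
def logZ (M : ℕ) : ℝ := Real.log (tr (X.gibbs M)).re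

theorem tr_gibbs (M : ℕ) : tr (X.gibbs M) = (Real.exp (X.logZ M) : ℂ) := by
  have hsa := isSelfAdjoint_dGamma (X.isSelfAdjoint_kVol M)
  have h1 := tr_exp_pos hsa
  have h2 := tr_im_eq_zero (sa_exp hsa)
  rw [logZ, gibbs_eq, Real.exp_log h1]
  exact Complex.ext rfl h2

theorem exp_sub_smul_one {κ : Type} (A : Op κ) (l : ℝ) :
    NormedSpace.exp (A - (l : ℂ) • (1 : Op κ)) = ((Real.exp (-l) : ℝ) : ℂ) • NormedSpace.exp A := by
  have h1 : NormedSpace.exp (-((l : ℂ) • (1 : Op κ))) = ((Real.exp (-l) : ℝ) : ℂ) • (1 : Op κ) := by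
    have h2 := (NormedSpace.algebraMap_exp_comm (𝕂 := ℂ) (𝔸 := Op κ) (-(l : ℂ))).symm
    rw [Algebra.algebraMap_eq_smul_one, Algebra.algebraMap_eq_smul_one, neg_smul,
      ← Complex.exp_eq_exp_ℂ] at h2
    rw [h2]
    push_cast
    rfl
  rw [sub_eq_add_neg, exp_add_of_comm ((Commute.one_right A).smul_right _).neg_right, h1,
    mul_smul_comm, mul_one]

theorem omega_eq_exp (M : ℕ) : X.omega M =
    NormedSpace.exp (dGamma (X.kVol M) - (X.logZ M : ℂ) • 1) := by
  rw [exp_sub_smul_one, omega, tr_gibbs, gibbs_eq, Real.exp_neg, Complex.ofReal_inv]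

theorem U_eq_exp (M : ℕ) (t : ℝ) :
    X.U M t = NormedSpace.exp ((Complex.I * (t : ℂ)) • dGamma (X.hVol M)) := rfl

theorem U_neg_eq_exp (M : ℕ) (t : ℝ) :
    X.U M (-t) = NormedSpace.exp (-((Complex.I * (t : ℂ)) • dGamma (X.hVol M))) := by
  rw [U_eq_exp, smul_I_neg]

theorem U_mul_U_neg (M : ℕ) (t : ℝ) : X.U M t * X.U M (-t) = 1 := by
  rw [U_neg_eq_exp, U_eq_exp, exp_mul_exp_neg]

theorem evolve_dGamma {ι : Type} [LinearOrder ι] [Fintype ι] (h k : Op ι) (t : ℝ) :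
    evolve (dGamma h) (dGamma k) t = dGamma (evolve h k t) := by
  rw [evolve, ← dGamma_smul, exp_dGamma_conj, evolve]

theorem omegaT_eq_evolve (M : ℕ) (t : ℝ) :
    X.omegaT M t = evolve (dGamma (X.hVol M)) (X.omega M) (-t) := by
  simp only [omegaT, evolve, smul_I_neg, neg_neg, U_eq_exp]

theorem omegaT_eq_exp (M : ℕ) (t : ℝ) : X.omegaT M t =
    NormedSpace.exp (dGamma (evolve (X.hVol M) (X.kVol M) (-t)) - (X.logZ M : ℂ) • 1) := by
  have hsa := isSelfAdjoint_dGamma (X.isSelfAdjoint_hVol M)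
  rw [omegaT_eq_evolve, omega_eq_exp, ← evolveHom_apply hsa,
    map_exp_op _ (continuous_evolveHom hsa _), map_sub, map_smul, map_one, evolveHom_apply,
    evolve_dGamma]

theorem pressure_zero_right {ι : Type} [LinearOrder ι] [Fintype ι] {p : ℝ≥0∞} (hp : 0 < p)
    {A : Op ι} (hA : IsSelfAdjoint A) (B : Op ι) :
    pressure p A B 0 = Real.log (tr (NormedSpace.exp (dGamma A))).re := by
  rw [pressure, pressureOp]
  by_cases hp' : p = ⊤
  · simp [hp']
  · have hq : 0 < p.toReal := ENNReal.toReal_pos hp.ne' hp'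
    rw [if_neg hp']
    have h1 : sandw ((((1 - 0) / p.toReal : ℝ) : ℂ) • dGamma A)
        (((2 * 0 / p.toReal : ℝ) : ℂ) • dGamma B) =
        NormedSpace.exp (((2 / p.toReal : ℝ) : ℂ) • dGamma A) := by
      simp only [sandw, mul_zero, zero_div, Complex.ofReal_zero, zero_smul, NormedSpace.exp_zero,
        mul_one, sub_zero]
      rw [← exp_add_of_comm (Commute.refl _), ← add_smul]
      congr 2
      push_cast
      ring
    rw [h1, exp_rpow (sa_smul (isSelfAdjoint_dGamma hA) _), smul_smul, ← Complex.ofReal_mul]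
    congr 4
    rw [div_mul_div_comm, mul_comm 2, div_self (by positivity), Complex.ofReal_one, one_smul]

theorem eVol_eq_pressure {p : ℝ≥0∞} (hp : 0 < p) (M : ℕ) (t α : ℝ) : X.eVol M p t α =
    pressure p (X.kVol M) (evolve (X.hVol M) (X.kVol M) (-t)) α -
      pressure p (X.kVol M) (evolve (X.hVol M) (X.kVol M) (-t)) 0 := by
  have hk := X.isSelfAdjoint_kVol M
  have hB := isSelfAdjoint_evolve (X.isSelfAdjoint_hVol M) hk (-t)
  set B := evolve (X.hVol M) (X.kVol M) (-t) with hBdef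
  have hone : ∀ {κ : Type} (l : ℝ), IsSelfAdjoint ((l : ℂ) • (1 : Op κ)) := fun l =>
    sa_smul (IsSelfAdjoint.one _) l
  have hK := (isSelfAdjoint_dGamma hk).sub (hone (X.logZ M))
  have hKB := (isSelfAdjoint_dGamma hB).sub (hone (X.logZ M))
  have hz : pressure p (X.kVol M) B 0 = X.logZ M := by
    rw [pressure_zero_right hp hk, logZ, gibbs_eq]
    congr!
  rw [hz]
  have key : ∀ Y, Y = ((Real.exp (-X.logZ M) : ℝ) : ℂ) • pressureOp p (X.kVol M) B α →
      Real.log (tr Y).re = pressure p (X.kVol M) B α - X.logZ M := by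
    rintro Y rfl
    have h0 : 0 < (tr (pressureOp p (X.kVol M) B α)).re := by
      convert re_tr_pressureOp_pos (p := p) hk hB α
    have h1 : pressure p (X.kVol M) B α = Real.log (tr (pressureOp p (X.kVol M) B α)).re := by
      rw [pressure]
      congr!
    rw [tr_smul, Complex.re_ofReal_mul, Real.log_mul (Real.exp_pos _).ne' h0.ne', Real.log_exp, h1]
    ring
  by_cases hp' : p = ⊤
  · rw [eVol, if_pos hp']
    refine key _ ?_
    rw [omega_eq_exp, omegaT_eq_exp, CFC.log_exp _ hK, CFC.log_exp _ hKB, pressureOp, if_pos hp',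
      ← exp_sub_smul_one]
    congr 1
    push_cast
    module
  · rw [eVol, if_neg hp']
    refine key _ ?_
    have hq : 0 < p.toReal := ENNReal.toReal_pos hp.ne' hp'
    set q := p.toReal
    obtain ⟨L, hL, hLe⟩ := exists_log_sandw (sa_smul (isSelfAdjoint_dGamma hk) ((1 - α) / q))
      (sa_smul (isSelfAdjoint_dGamma hB) (2 * α / q))
    have h1 : ∀ (K : Op (Finset (Vol M))) (s : ℝ), (s : ℂ) • (K - (X.logZ M : ℂ) • (1 : Op _)) =
        (s : ℂ) • K - ((s * X.logZ M : ℝ) : ℂ) • (1 : Op _) := by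
      intro K s
      push_cast
      module
    rw [omega_eq_exp, omegaT_eq_exp, exp_rpow hK, exp_rpow hKB, h1, h1, exp_sub_smul_one,
      exp_sub_smul_one, pressureOp, if_neg hp', ← hLe, exp_rpow hL]
    have h2 : ((Real.exp (-((1 - α) / q * X.logZ M)) : ℝ) : ℂ) •
          NormedSpace.exp ((((1 - α) / q : ℝ) : ℂ) • dGamma (X.kVol M)) *
        ((Real.exp (-(2 * α / q * X.logZ M)) : ℝ) : ℂ) •
          NormedSpace.exp (((2 * α / q : ℝ) : ℂ) • dGamma B) *
        ((Real.exp (-((1 - α) / q * X.logZ M)) : ℝ) : ℂ) •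
          NormedSpace.exp ((((1 - α) / q : ℝ) : ℂ) • dGamma (X.kVol M)) =
        NormedSpace.exp (L - ((2 / q * X.logZ M : ℝ) : ℂ) • 1) := by
      rw [exp_sub_smul_one, hLe, sandw]
      simp only [smul_mul_assoc, mul_smul_comm, smul_smul]
      rw [← Complex.ofReal_mul, ← Complex.ofReal_mul, ← Real.exp_add, ← Real.exp_add]
      congr 4
      ring
    rw [h2, exp_rpow (hL.sub (hone _)), smul_sub, smul_smul, ← Complex.ofReal_mul,
      exp_sub_smul_one]
    congr 4
    field_simp

theorem eVol_eq_traceFormula {p : ℝ≥0∞} (hp : 0 < p) (M : ℕ) (t α : ℝ) :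
    (X.eVol M p t α : ℂ) = traceFormula (X.hVol M) (X.kVol M) p t α := by
  rw [eVol_eq_pressure X hp,
    pressure_sub_eq_traceFormula hp (X.isSelfAdjoint_hVol M) (X.isSelfAdjoint_kVol M)]
  congr!

end Chain

end FiniteVolume

/-! ### Strong convergence of finite-volume operators -/

section StrongConvergence

theorem restrict_apply (M : ℕ) (u : Ell2 ℤ) (x : Vol M) : restrict M u x = u x.1 := by
  rw [restrict, pullback_apply, one_mul]

theorem adjoint_restrict_delta (M : ℕ) (x : Vol M) :
    ContinuousLinearMap.adjoint (restrict M) (delta x) = delta x.1 := by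
  rw [restrict, adjoint_pullback_delta]
  simp

theorem restrict_delta (M : ℕ) (x : Vol M) : restrict M (delta x.1) = delta x := by
  refine (pullback_delta Subtype.val Subtype.val_injective (fun _ => 1) _ x).trans ?_
  rw [one_smul]

theorem restrict_comp_adjoint (M : ℕ) :
    restrict M ∘L ContinuousLinearMap.adjoint (restrict M) = 1 := by
  refine clm_ext_delta fun x => ?_
  rw [ContinuousLinearMap.comp_apply, adjoint_restrict_delta, restrict_delta]
  rfl

theorem norm_restrict_le (M : ℕ) : ‖restrict M‖ ≤ 1 := by
  have h := ContinuousLinearMap.norm_adjoint_comp_self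
    (ContinuousLinearMap.adjoint (restrict M))
  rw [ContinuousLinearMap.adjoint_adjoint, restrict_comp_adjoint,
    LinearIsometryEquiv.norm_map] at h
  have h1 : ‖(1 : Op (Vol M))‖ ≤ 1 := norm_one_op_le
  nlinarith [norm_nonneg (restrict M)]

theorem norm_restrict_apply_le (M : ℕ) (u : Ell2 ℤ) : ‖restrict M u‖ ≤ ‖u‖ :=
  (restrict M).le_of_opNorm_le_of_le (norm_restrict_le M) le_rfl |>.trans (by rw [one_mul])

theorem tendsto_Icc_atTop :
    Tendsto (fun M : ℕ => Finset.Icc (-(M : ℤ)) M) atTop atTop := by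
  refine tendsto_atTop_finset_of_monotone (fun a b hab => ?_) fun x => ⟨x.natAbs, ?_⟩
  · refine Finset.Icc_subset_Icc ?_ ?_ <;> omega
  · rw [Finset.mem_Icc]
    omega

theorem adjoint_restrict_restrict (M : ℕ) (u : Ell2 ℤ) :
    ContinuousLinearMap.adjoint (restrict M) (restrict M u) =
      ∑ x ∈ Finset.Icc (-(M : ℤ)) M, u x • delta x := by
  rw [eq_sum_delta (restrict M u), map_sum,
    ← Finset.sum_coe_sort (Finset.Icc (-(M : ℤ)) M) fun x => u x • (delta x : Ell2 ℤ)]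
  refine Finset.sum_congr rfl fun x _ => ?_
  rw [map_smul, adjoint_restrict_delta, restrict_apply]

theorem tendsto_adjoint_restrict (u : Ell2 ℤ) :
    Tendsto (fun M => ContinuousLinearMap.adjoint (restrict M) (restrict M u)) atTop (𝓝 u) := by
  simp only [adjoint_restrict_restrict]
  exact (hasSum_delta u).comp tendsto_Icc_atTop

/-- Strong convergence of a bounded sequence of operators on `ℓ²([-M, M])` to an operator on
`ℓ²(ℤ)`. -/
structure SConv (A : ∀ M, Op (Vol M)) (A' : Op ℤ) : Prop where
  bdd : ∃ C, ∀ M, ‖A M‖ ≤ C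
  tendsto : ∀ u, Tendsto (fun M => ‖A M (restrict M u) - restrict M (A' u)‖) atTop (𝓝 0)

variable {A B : ∀ M, Op (Vol M)} {A' B' : Op ℤ}

theorem norm_compress_restrict_le (M : ℕ) (A : Op ℤ) : ‖compress (restrict M) A‖ ≤ ‖A‖ := by
  have h1 := norm_restrict_le M
  calc ‖compress (restrict M) A‖
      ≤ ‖restrict M‖ * (‖A‖ * ‖ContinuousLinearMap.adjoint (restrict M)‖) :=
        (ContinuousLinearMap.opNorm_comp_le _ _).trans
          (mul_le_mul_of_nonneg_left (ContinuousLinearMap.opNorm_comp_le _ _) (norm_nonneg _))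
    _ = ‖restrict M‖ * (‖A‖ * ‖restrict M‖) := by rw [LinearIsometryEquiv.norm_map]
    _ ≤ 1 * (‖A‖ * 1) := by gcongr
    _ = ‖A‖ := by ring

theorem sConv_compress (A : Op ℤ) : SConv (fun M => compress (restrict M) A) A where
  bdd := ⟨‖A‖, fun M => norm_compress_restrict_le M A⟩
  tendsto u := by
    have h1 : Tendsto (fun M => ‖A‖ * ‖ContinuousLinearMap.adjoint (restrict M) (restrict M u) - u‖)
        atTop (𝓝 (‖A‖ * 0)) :=
      (tendsto_iff_norm_sub_tendsto_zero.1 (tendsto_adjoint_restrict u)).const_mul _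
    rw [mul_zero] at h1
    refine squeeze_zero (fun _ => norm_nonneg _) (fun M => ?_) h1
    have : compress (restrict M) A (restrict M u) - restrict M (A u) =
        restrict M (A (ContinuousLinearMap.adjoint (restrict M) (restrict M u) - u)) := by
      simp [compress]
    rw [this]
    exact (norm_restrict_apply_le _ _).trans (A.le_opNorm _)

theorem SConv.one : SConv (fun _ => 1) 1 where
  bdd := ⟨1, fun _ => norm_one_op_le⟩
  tendsto u := by simp

theorem SConv.add (hA : SConv A A') (hB : SConv B B') : SConv (fun M => A M + B M) (A' + B') where
  bdd := by
    obtain ⟨C, hC⟩ := hA.bdd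
    obtain ⟨D, hD⟩ := hB.bdd
    exact ⟨C + D, fun M => (norm_add_le _ _).trans (add_le_add (hC M) (hD M))⟩
  tendsto u := by
    have h := (hA.tendsto u).add (hB.tendsto u)
    rw [add_zero] at h
    refine squeeze_zero (fun _ => norm_nonneg _) (fun M => ?_) h
    refine le_trans (le_of_eq ?_) (norm_add_le _ _)
    rw [add_apply, add_apply, map_add]
    congr 1
    abel

theorem SConv.smul (hA : SConv A A') (z : ℂ) : SConv (fun M => z • A M) (z • A') where
  bdd := by
    obtain ⟨C, hC⟩ := hA.bdd
    exact ⟨‖z‖ * C, fun M => by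
      rw [norm_smul]
      exact mul_le_mul_of_nonneg_left (hC M) (norm_nonneg _)⟩
  tendsto u := by
    have h := (hA.tendsto u).const_mul ‖z‖
    rw [mul_zero] at h
    refine h.congr fun M => ?_
    rw [← norm_smul]
    simp [smul_sub]

theorem SConv.neg (hA : SConv A A') : SConv (fun M => -A M) (-A') := by
  simpa using hA.smul (-1)

theorem SConv.sub (hA : SConv A A') (hB : SConv B B') : SConv (fun M => A M - B M) (A' - B') := by
  simpa [sub_eq_add_neg] using hA.add hB.neg

theorem SConv.mul (hA : SConv A A') (hB : SConv B B') : SConv (fun M => A M * B M) (A' * B') where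
  bdd := by
    obtain ⟨C, hC⟩ := hA.bdd
    obtain ⟨D, hD⟩ := hB.bdd
    exact ⟨C * D, fun M => (norm_mul_le _ _).trans (mul_le_mul (hC M) (hD M) (norm_nonneg _)
      ((norm_nonneg _).trans (hC M)))⟩
  tendsto u := by
    obtain ⟨C, hC⟩ := hA.bdd
    have h := ((hB.tendsto u).const_mul C).add (hA.tendsto (B' u))
    rw [mul_zero, add_zero] at h
    refine squeeze_zero (fun _ => norm_nonneg _) (fun M => ?_) h
    have e : (A M * B M) (restrict M u) - restrict M ((A' * B') u) =
        A M (B M (restrict M u) - restrict M (B' u)) +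
          (A M (restrict M (B' u)) - restrict M (A' (B' u))) := by
      rw [map_sub, mul_apply_eq_comp, mul_apply_eq_comp]
      abel
    rw [e]
    exact (norm_add_le _ _).trans (add_le_add_left ((A M).le_of_opNorm_le (hC M) _) _)

theorem SConv.pow (hA : SConv A A') (n : ℕ) : SConv (fun M => A M ^ n) (A' ^ n) := by
  induction n with
  | zero => simpa using SConv.one
  | succ n ih => simpa only [pow_succ] using ih.mul hA

theorem SConv.inverse (hA : SConv A A') (hA0 : ∀ M, 0 ≤ A M) (hA0' : 0 ≤ A') :
    SConv (fun M => Ring.inverse (1 + A M)) (Ring.inverse (1 + A')) where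
  bdd := ⟨1, fun M => norm_inverse_le (hA0 M)⟩
  tendsto u := by
    have h := (SConv.one.add hA).tendsto (Ring.inverse (1 + A') u)
    refine squeeze_zero (fun _ => norm_nonneg _) (fun M => ?_) h
    have e1 : ∀ v, (1 + A') (Ring.inverse (1 + A') v) = v := fun v => by
      rw [← mul_apply_eq_comp, Ring.mul_inverse_cancel _ (isUnit_one_add hA0')]
      rfl
    have e2 : ∀ v, Ring.inverse (1 + A M) ((1 + A M) v) = v := fun v => by
      rw [← mul_apply_eq_comp, Ring.inverse_mul_cancel _ (isUnit_one_add (hA0 M))]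
      rfl
    have e : Ring.inverse (1 + A M) (restrict M u) - restrict M (Ring.inverse (1 + A') u) =
        -Ring.inverse (1 + A M) ((1 + A M) (restrict M (Ring.inverse (1 + A') u)) -
          restrict M ((1 + A') (Ring.inverse (1 + A') u))) := by
      rw [map_sub, e1, e2]
      abel
    rw [e, norm_neg]
    refine ((Ring.inverse (1 + A M)).le_of_opNorm_le (norm_inverse_le (hA0 M)) _).trans ?_
    rw [one_mul]

theorem hasSum_exp_apply {κ : Type} (A : Op κ) (u : Ell2 κ) :
    HasSum (fun n : ℕ => ((n.factorial : ℂ)⁻¹) • (A ^ n) u) (NormedSpace.exp A u) := by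
  have h := NormedSpace.exp_series_hasSum_exp' (𝕂 := ℂ) A
  exact h.mapL (ContinuousLinearMap.apply ℂ (Ell2 κ) u)

theorem norm_exp_le' {κ : Type} (A : Op κ) : ‖NormedSpace.exp A‖ ≤ Real.exp ‖A‖ := by
  have h := NormedSpace.exp_series_hasSum_exp' (𝕂 := ℂ) A
  have h2 := NormedSpace.exp_series_hasSum_exp' (𝕂 := ℝ) ‖A‖
  rw [← Real.exp_eq_exp_ℝ] at h2
  refine h.norm_le_of_bounded h2 fun n => ?_
  rw [norm_smul, norm_inv, Complex.norm_natCast, smul_eq_mul]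
  gcongr
  induction n with
  | zero => simpa using norm_one_op_le
  | succ n ih =>
    rw [pow_succ, pow_succ]
    exact (norm_mul_le _ _).trans (mul_le_mul_of_nonneg_right ih (norm_nonneg _))

theorem norm_pow_apply_le {κ : Type} {A : Op κ} {C : ℝ} (hC : ‖A‖ ≤ C) (n : ℕ) (u : Ell2 κ) :
    ‖(A ^ n) u‖ ≤ C ^ n * ‖u‖ := by
  induction n generalizing u with
  | zero => simp
  | succ n ih =>
    rw [pow_succ, pow_succ, mul_apply_eq_comp, mul_assoc]
    refine (ih (A u)).trans ?_
    have := (norm_nonneg A).trans hC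
    gcongr
    exact A.le_of_opNorm_le hC u

/-- The exponential series converges strongly term by term and is dominated by that of a common
bound of the norms. -/
theorem SConv.exp (hA : SConv A A') :
    SConv (fun M => NormedSpace.exp (A M)) (NormedSpace.exp A') where
  bdd := by
    obtain ⟨C, hC⟩ := hA.bdd
    exact ⟨Real.exp C, fun M => (norm_exp_le' _).trans (Real.exp_le_exp.2 (hC M))⟩
  tendsto u := by
    obtain ⟨C, hC⟩ := hA.bdd
    set D := max C ‖A'‖ with hD
    have hD0 : 0 ≤ D := (norm_nonneg A').trans (le_max_right _ _)
    have hsum : ∀ M, HasSum (fun n : ℕ => ((n.factorial : ℂ)⁻¹) • ((A M ^ n) (restrict M u) -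
        restrict M ((A' ^ n) u))) (NormedSpace.exp (A M) (restrict M u) -
          restrict M (NormedSpace.exp A' u)) := by
      intro M
      have h := (hasSum_exp_apply (A M) (restrict M u)).sub
        ((hasSum_exp_apply A' u).mapL (restrict M))
      refine h.congr_fun fun n => ?_
      rw [map_smul, smul_sub]
    have hs : Summable fun n : ℕ => D ^ n / (n.factorial : ℝ) * (2 * ‖u‖) :=
      (Real.summable_pow_div_factorial D).mul_right _
    have hbd : ∀ M n : ℕ, ‖((n.factorial : ℂ)⁻¹) • ((A M ^ n) (restrict M u) -
        restrict M ((A' ^ n) u))‖ ≤ D ^ n / (n.factorial : ℝ) * (2 * ‖u‖) := by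
      intro M n
      rw [norm_smul, norm_inv, Complex.norm_natCast, inv_mul_eq_div, div_mul_eq_mul_div]
      gcongr
      refine (norm_sub_le _ _).trans ?_
      have h2 := norm_pow_apply_le ((hC M).trans (le_max_left C ‖A'‖)) n (restrict M u)
      have h3 := norm_pow_apply_le (le_max_right C ‖A'‖) n u
      have h4 := norm_restrict_apply_le M u
      have h5 := norm_restrict_apply_le M ((A' ^ n) u)
      have h6 : D ^ n * ‖restrict M u‖ ≤ D ^ n * ‖u‖ := by gcongr
      rw [← hD] at h2 h3
      linarith
    have h1 := tendsto_tsum_of_dominated_convergence (𝓕 := atTop)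
      (f := fun (M : ℕ) (n : ℕ) => ‖((n.factorial : ℂ)⁻¹) • ((A M ^ n) (restrict M u) -
        restrict M ((A' ^ n) u))‖) (g := fun _ => 0) hs (fun n => by
          simp only [norm_smul]
          simpa using ((hA.pow n).tendsto u).const_mul ‖((n.factorial : ℂ)⁻¹)‖)
      (Eventually.of_forall fun M n => by
        rw [norm_norm]
        exact hbd M n)
    rw [tsum_zero] at h1
    refine squeeze_zero (fun _ => norm_nonneg _) (fun M => ?_) h1
    rw [← (hsum M).tsum_eq]
    exact norm_tsum_le_tsum_norm (Summable.of_nonneg_of_le (fun _ => norm_nonneg _) (hbd M) hs)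

theorem SConv.aeval (hA : SConv A A') (q : Polynomial ℝ) :
    SConv (fun M => Polynomial.aeval (A M) q) (Polynomial.aeval A' q) := by
  induction q using Polynomial.induction_on' with
  | add p q hp hq => simpa only [map_add] using hp.add hq
  | monomial n a =>
    have h := (hA.pow n).smul (a : ℂ)
    simpa only [Polynomial.aeval_monomial, Algebra.algebraMap_eq_smul_one, smul_mul_assoc, one_mul,
      Complex.coe_smul] using h

theorem norm_cfc_sub_aeval_le {κ : Type} {A : Op κ} (hA : IsSelfAdjoint A) {a b ε : ℝ}
    (hsp : spectrum ℝ A ⊆ Set.Icc a b) {f : ℝ → ℝ} (hf : ContinuousOn f (Set.Icc a b))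
    {q : Polynomial ℝ} (hε : 0 ≤ ε) (hq : ∀ x ∈ Set.Icc a b, |q.eval x - f x| ≤ ε) :
    ‖cfc f A - Polynomial.aeval A q‖ ≤ ε := by
  rw [← cfc_polynomial q A hA, ← cfc_sub f q.eval A (hf.mono hsp) q.continuous.continuousOn]
  refine norm_cfc_le hε fun x hx => ?_
  rw [Real.norm_eq_abs, abs_sub_comm]
  exact hq x (hsp hx)

theorem SConv.cfc (hA : SConv A A') (hsa : ∀ M, IsSelfAdjoint (A M)) (hsa' : IsSelfAdjoint A')
    {a b : ℝ} (hsp : ∀ M, spectrum ℝ (A M) ⊆ Set.Icc a b) (hsp' : spectrum ℝ A' ⊆ Set.Icc a b)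
    {f : ℝ → ℝ} (hf : ContinuousOn f (Set.Icc a b)) :
    SConv (fun M => cfc f (A M)) (cfc f A') where
  bdd := by
    obtain ⟨C, hC⟩ := isCompact_Icc.exists_bound_of_continuousOn hf
    exact ⟨max C 0, fun M => norm_cfc_le (le_max_right _ _) fun x hx =>
      (hC x (hsp M hx)).trans (le_max_left _ _)⟩
  tendsto u := by
    rw [Metric.tendsto_atTop]
    intro ε hε
    obtain ⟨δ, hδ, hδε⟩ : ∃ δ > 0, δ * ‖u‖ + δ * ‖u‖ < ε / 2 := by
      refine ⟨ε / (8 * (‖u‖ + 1)), by positivity, ?_⟩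
      have : ε / (8 * (‖u‖ + 1)) * ‖u‖ ≤ ε / 8 := by
        rw [div_mul_eq_mul_div, div_le_div_iff₀ (by positivity) (by positivity)]
        nlinarith [norm_nonneg u]
      linarith
    obtain ⟨q, hq⟩ := exists_polynomial_near_of_continuousOn a b f hf δ hδ
    have hq' : ∀ x ∈ Set.Icc a b, |q.eval x - f x| ≤ δ := fun x hx => (hq x hx).le
    obtain ⟨M₀, hM₀⟩ := Metric.tendsto_atTop.1 ((hA.aeval q).tendsto u) (ε / 2) (by positivity)
    refine ⟨M₀, fun M hM => ?_⟩
    have h0 := hM₀ M hM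
    rw [dist_zero_right, norm_norm] at h0 ⊢
    have h1 := norm_cfc_sub_aeval_le (hsa M) (hsp M) hf hδ.le hq'
    have h2 := norm_cfc_sub_aeval_le hsa' hsp' hf hδ.le hq'
    have e : _root_.cfc f (A M) (restrict M u) - restrict M (_root_.cfc f A' u) =
        (_root_.cfc f (A M) - Polynomial.aeval (A M) q) (restrict M u) +
          (Polynomial.aeval (A M) q (restrict M u) - restrict M (Polynomial.aeval A' q u)) -
          restrict M ((_root_.cfc f A' - Polynomial.aeval A' q) u) := by
      simp only [sub_apply, map_sub]
      abel
    have h3 := (_root_.cfc f (A M) - Polynomial.aeval (A M) q).le_of_opNorm_le h1 (restrict M u)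
    have h4 := (_root_.cfc f A' - Polynomial.aeval A' q).le_of_opNorm_le h2 u
    have h5 := norm_restrict_apply_le M u
    have h6 := norm_restrict_apply_le M ((_root_.cfc f A' - Polynomial.aeval A' q) u)
    have h7 : δ * ‖restrict M u‖ ≤ δ * ‖u‖ := by gcongr
    rw [e]
    refine (norm_sub_le _ _).trans_lt ?_
    have h8 := norm_add_le ((_root_.cfc f (A M) - Polynomial.aeval (A M) q) (restrict M u))
      (Polynomial.aeval (A M) q (restrict M u) - restrict M (Polynomial.aeval A' q u))
    linarith

theorem SConv.sandw (hA : SConv A A') (hB : SConv B B') :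
    SConv (fun M => sandw (A M) (B M)) (sandw A' B') := (hA.exp.mul hB.exp).mul hA.exp

theorem SConv.sandw_rpow (hA : SConv A A') (hB : SConv B B') (hAs : ∀ M, IsSelfAdjoint (A M))
    (hBs : ∀ M, IsSelfAdjoint (B M)) (hAs' : IsSelfAdjoint A') (hBs' : IsSelfAdjoint B') (s : ℝ) :
    SConv (fun M => XY.sandw (A M) (B M) ^ s) (XY.sandw A' B' ^ s) := by
  obtain ⟨C, hC⟩ := hA.bdd
  obtain ⟨D, hD⟩ := hB.bdd
  set m := 2 * max C ‖A'‖ + max D ‖B'‖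
  have hm : ∀ {κ : Type} {a b : Op κ}, IsSelfAdjoint a → IsSelfAdjoint b → ‖a‖ ≤ max C ‖A'‖ →
      ‖b‖ ≤ max D ‖B'‖ → spectrum ℝ (XY.sandw a b) ⊆ Set.Icc (Real.exp (-m)) (Real.exp m) := by
    intro κ a b ha hb h1 h2
    have h3 : 2 * ‖a‖ + ‖b‖ ≤ m := by linarith
    exact (spectrum_sandw ha hb).trans (Set.Icc_subset_Icc (Real.exp_le_exp.2 (neg_le_neg h3))
      (Real.exp_le_exp.2 h3))
  have h := (hA.sandw hB).cfc (fun M => (sandw_nonneg (hAs M) (hBs M)).isSelfAdjoint)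
    (sandw_nonneg hAs' hBs').isSelfAdjoint
    (fun M => hm (hAs M) (hBs M) ((hC M).trans (le_max_left _ _)) ((hD M).trans (le_max_left _ _)))
    (hm hAs' hBs' (le_max_right _ _) (le_max_right _ _)) (f := fun x => x ^ s)
    (continuousOn_id.rpow_const fun x hx => Or.inl ((Real.exp_pos _).trans_le hx.1).ne')
  rw [← CFC.rpow_eq_cfc_real (sandw_nonneg hAs' hBs')] at h
  convert h using 2 with M
  exact CFC.rpow_eq_cfc_real (sandw_nonneg (hAs M) (hBs M))

theorem SConv.evolve (hA : SConv A A') (hB : SConv B B') (s : ℝ) :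
    SConv (fun M => evolve (A M) (B M) s) (evolve A' B' s) :=
  ((hA.smul _).exp.mul hB).mul (hA.smul _).neg.exp

/-- The matrix element `⟨δ_x, A δ_y⟩` of an operator on `ℓ²([-M, M])`, for arbitrary `x, y ∈ ℤ`; it
vanishes if `x` or `y` lies outside `[-M, M]`. -/
def entryIn {M : ℕ} (A : Op (Vol M)) (x y : ℤ) : ℂ :=
  ⟪restrict M (delta x), A (restrict M (delta y))⟫_ℂ

theorem entryIn_star {M : ℕ} (A : Op (Vol M)) (x y : ℤ) :
    entryIn (star A) x y = star (entryIn A y x) := by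
  rw [entryIn, entryIn, ContinuousLinearMap.star_eq_adjoint,
    ContinuousLinearMap.adjoint_inner_right,
    Complex.star_def, inner_conj_symm]

theorem norm_entryIn_le {M : ℕ} (A : Op (Vol M)) (x y : ℤ) : ‖entryIn A x y‖ ≤ ‖A‖ := by
  have h1 := norm_restrict_apply_le M (delta x)
  have h2 := norm_restrict_apply_le M (delta y)
  rw [norm_delta] at h1 h2
  calc ‖entryIn A x y‖ ≤ ‖restrict M (delta x)‖ * (‖A‖ * ‖restrict M (delta y)‖) :=
        (norm_inner_le_norm _ _).trans (mul_le_mul_of_nonneg_left (A.le_opNorm _) (norm_nonneg _))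
    _ ≤ 1 * (‖A‖ * 1) := by gcongr
    _ = ‖A‖ := by ring

theorem SConv.entryIn (hA : SConv A A') (x y : ℤ) :
    Tendsto (fun M => entryIn (A M) x y) atTop (𝓝 (entry A' x y)) := by
  have h1 : Tendsto (fun M => ⟪delta x, ContinuousLinearMap.adjoint (restrict M) (restrict M
      (A' (delta y)))⟫_ℂ) atTop (𝓝 (entry A' x y)) :=
    tendsto_const_nhds.inner (tendsto_adjoint_restrict _)
  have h2 : Tendsto (fun M => ⟪restrict M (delta x), A M (restrict M (delta y)) -
      restrict M (A' (delta y))⟫_ℂ) atTop (𝓝 0) := by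
    refine squeeze_zero_norm (fun M => ?_) (hA.tendsto (delta y))
    have h3 := norm_restrict_apply_le M (delta x)
    rw [norm_delta] at h3
    refine (norm_inner_le_norm _ _).trans ?_
    exact mul_le_of_le_one_left (norm_nonneg _) h3
  have h4 := h1.add h2
  rw [add_zero] at h4
  refine h4.congr fun M => ?_
  rw [ContinuousLinearMap.adjoint_inner_right, ← inner_add_right, XY.entryIn]
  congr 1
  abel

theorem tendsto_entryIn_kernelAB {p : ℝ≥0∞} (γ : ℝ) (hA : SConv A A') (hB : SConv B B')
    (hAs : ∀ M, IsSelfAdjoint (A M))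
    (hBs : ∀ M, IsSelfAdjoint (B M)) (hAs' : IsSelfAdjoint A') (hBs' : IsSelfAdjoint B') (x y : ℤ) :
    Tendsto (fun M => entryIn (kernelAB p γ (A M) (B M)) x y) atTop
      (𝓝 (entry (kernelAB p γ A' B') x y)) := by
  by_cases hp : p = ⊤
  · simp only [kernelAB, if_pos hp]
    refine SConv.entryIn (SConv.inverse ((hA.smul _).neg.sub (hB.smul _)).exp (fun M => ?_) ?_) x y
    · exact ((sa_smul (hAs M) _).neg.sub (sa_smul (hBs M) _)).exp_nonneg
    · exact ((sa_smul hAs' _).neg.sub (sa_smul hBs' _)).exp_nonneg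
  · simp only [kernelAB, if_neg hp]
    have h1 := (((hA.smul ((-1 * (1 - γ) / p.toReal : ℝ) : ℂ)).exp.mul
      (SConv.inverse (SConv.sandw_rpow (hA.smul ((1 * (1 - γ) / p.toReal : ℝ) : ℂ))
        (hB.smul ((2 * γ / p.toReal : ℝ) : ℂ)) (fun M => sa_smul (hAs M) _)
        (fun M => sa_smul (hBs M) _) (sa_smul hAs' _) (sa_smul hBs' _) (-(p.toReal / 2)))
        (fun M => CFC.rpow_nonneg) CFC.rpow_nonneg)).mul
        (hA.smul ((1 * (1 - γ) / p.toReal : ℝ) : ℂ)).exp).smul (1 / 2)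
    have h2 := (h1.entryIn x y).add (h1.entryIn y x).star
    rw [← entry_star, ← entry_add] at h2
    refine h2.congr fun M => ?_
    rw [← entryIn_star, XY.entryIn, XY.entryIn, XY.entryIn, ← inner_add_right, ← add_apply]

theorem norm_kernelAB_le {κ : Type} (p : ℝ≥0∞) (γ : ℝ) {A B : Op κ} (hA : IsSelfAdjoint A)
    (hB : IsSelfAdjoint B) :
    ‖kernelAB p γ A B‖ ≤ Real.exp (2 * (|1 - γ| / p.toReal * ‖A‖)) := by
  by_cases hp : p = ⊤
  · simp only [kernelAB, if_pos hp]
    refine (norm_inverse_le (((sa_smul hA _).neg.sub (sa_smul hB _)).exp_nonneg)).trans ?_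
    simp [hp]
  · simp only [kernelAB, if_neg hp]
    have h1 : ∀ s : ℝ, |s| = 1 → ‖NormedSpace.exp (((s * (1 - γ) / p.toReal : ℝ) : ℂ) • A)‖ ≤
        Real.exp (|1 - γ| / p.toReal * ‖A‖) := by
      intro s hs
      refine (norm_exp_le' _).trans (Real.exp_le_exp.2 (le_of_eq ?_))
      rw [norm_smul, Complex.norm_real, Real.norm_eq_abs, abs_div, abs_mul, hs, one_mul,
        abs_of_nonneg ENNReal.toReal_nonneg]
    have h2 := h1 (-1) (by simp)
    have h3 := h1 1 (by simp)
    have h4 : ‖Ring.inverse (1 + sandw (((1 * (1 - γ) / p.toReal : ℝ) : ℂ) • A)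
        (((2 * γ / p.toReal : ℝ) : ℂ) • B) ^ (-(p.toReal / 2)))‖ ≤ 1 :=
      norm_inverse_le CFC.rpow_nonneg
    set T := (1 / 2 : ℂ) • (NormedSpace.exp (((-1 * (1 - γ) / p.toReal : ℝ) : ℂ) • A) *
      Ring.inverse (1 + sandw (((1 * (1 - γ) / p.toReal : ℝ) : ℂ) • A)
        (((2 * γ / p.toReal : ℝ) : ℂ) • B) ^ (-(p.toReal / 2))) *
      NormedSpace.exp (((1 * (1 - γ) / p.toReal : ℝ) : ℂ) • A)) with hT
    have h5 : ‖T‖ ≤ 1 / 2 * (Real.exp (|1 - γ| / p.toReal * ‖A‖) * 1 *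
        Real.exp (|1 - γ| / p.toReal * ‖A‖)) := by
      rw [hT, norm_smul]
      have : ‖(1 / 2 : ℂ)‖ = 1 / 2 := by norm_num
      rw [this]
      gcongr
      refine norm_mul₃_le.trans ?_
      gcongr
    have h6 : Real.exp (2 * (|1 - γ| / p.toReal * ‖A‖)) = Real.exp (|1 - γ| / p.toReal * ‖A‖) * 1 *
        Real.exp (|1 - γ| / p.toReal * ‖A‖) := by
      rw [mul_one, ← Real.exp_add]
      ring_nf
    have h7 := norm_add_le T (star T)
    rw [norm_star] at h7
    linarith

end StrongConvergence

/-! ### Locality of the energy and entropy fluxes -/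

section Locality

theorem hasSum_entry_mul {ι : Type} [DecidableEq ι] (A B : Op ι) (x y : ι) :
    HasSum (fun z => entry A x z * entry B z y) (entry (A * B) x y) := by
  have h1 := ((hasSum_delta (B (delta y))).mapL A).mapL (innerSL ℂ (delta x))
  refine h1.congr_fun fun z => ?_
  rw [map_smul, map_smul, smul_eq_mul, mul_comm, innerSL_apply_apply, entry_eq B]
  rfl

theorem entry_compress_restrict {M : ℕ} (A : Op ℤ) (x y : Vol M) :
    entry (compress (restrict M) A) x y = entry A x.1 y.1 := by
  rw [entry, entry, compress, ContinuousLinearMap.comp_apply, ContinuousLinearMap.comp_apply,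
    adjoint_restrict_delta, ← ContinuousLinearMap.adjoint_inner_left, adjoint_restrict_delta]

namespace Chain

variable (X : Chain)

theorem entry_h_of_lt {x y : ℤ} (h : 1 < |x - y|) : entry X.h x y = 0 := by
  have h1 : ¬x + 1 = y := by
    rintro rfl
    simp at h
  have h2 : ¬x - 1 = y := by
    rintro rfl
    simp at h
  have h3 : ¬x = y := by
    rintro rfl
    simp at h
  rw [entry_h, if_neg h1, if_neg h2, if_neg h3]
  simp

/-- `k` arises from `h` by multiplying its matrix elements by a function that is locally constant
outside the central part of the chain. -/
structure IsLocalPart (k : Op ℤ) (c : ℤ → ℤ → ℂ) : Prop where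
  entry : ∀ x y, XY.entry k x y = c x y * XY.entry X.h x y
  locallyConst : ∀ x z y, (X.N : ℤ) + 2 ≤ |z| → |x - z| ≤ 1 → |z - y| ≤ 1 → c x z = c z y

theorem entry_proj_mul (s : Set ℤ) [DecidablePred (· ∈ s)] (A : Op ℤ) (x y : ℤ) :
    entry (proj s * A * proj s) x y = if x ∈ s ∧ y ∈ s then entry A x y else 0 := by
  have h1 : proj s (delta y) = (if y ∈ s then (1 : ℂ) else 0) • delta y := by
    refine ell2_ext fun z => ?_
    rw [proj, pullback_apply, ell2_smul]
    simp only [id, delta_apply]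
    by_cases hz : z = y
    · subst hz
      by_cases hs : z ∈ s <;> simp [hs]
    · simp [hz]
  rw [entry_eq, mul_apply_eq_comp, mul_apply_eq_comp, h1, map_smul, map_smul, ell2_smul,
    entry_eq A]
  rw [show (proj s (A (delta y))) x = (if x ∈ s then (1 : ℂ) else 0) * A (delta y) x by
    rw [proj, pullback_apply]
    by_cases hs : x ∈ s <;> simp [hs]]
  by_cases hx : x ∈ s <;> by_cases hy : y ∈ s <;> simp [hx, hy]

theorem isLocalPart_hL : X.IsLocalPart X.hL
    (fun x y => if x ≤ -(X.N : ℤ) - 1 ∧ y ≤ -(X.N : ℤ) - 1 then 1 else 0) where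
  entry x y := by
    classical
    rw [hL, entry_proj_mul]
    simp only [Set.mem_Iic]
    split_ifs <;> simp
  locallyConst x z y hz hx hy := by
    rw [abs_le] at hx hy
    rcases le_abs.1 hz with h | h
    · rw [if_neg (by omega), if_neg (by omega)]
    · rw [if_pos (by omega), if_pos (by omega)]

theorem isLocalPart_hR : X.IsLocalPart X.hR
    (fun x y => if (X.N : ℤ) + 1 ≤ x ∧ (X.N : ℤ) + 1 ≤ y then 1 else 0) where
  entry x y := by
    classical
    rw [hR, entry_proj_mul]
    simp only [Set.mem_Ici]
    split_ifs <;> simp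
  locallyConst x z y hz hx hy := by
    rw [abs_le] at hx hy
    rcases le_abs.1 hz with h | h
    · rw [if_pos (by omega), if_pos (by omega)]
    · rw [if_neg (by omega), if_neg (by omega)]

theorem exists_isLocalPart_k : ∃ c, X.IsLocalPart X.k c := by
  have h1 := X.isLocalPart_hL
  have h2 := X.isLocalPart_hR
  refine ⟨fun x y => -((X.betaL : ℂ) *
    if x ≤ -(X.N : ℤ) - 1 ∧ y ≤ -(X.N : ℤ) - 1 then 1 else 0) - (X.betaR : ℂ) *
    if (X.N : ℤ) + 1 ≤ x ∧ (X.N : ℤ) + 1 ≤ y then 1 else 0, ⟨fun x y => ?_, fun x z y a b c => ?_⟩⟩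
  · rw [k, sub_eq_add_neg, ← neg_smul, ← neg_smul, entry_add, entry_smul, entry_smul, h1.entry,
      h2.entry]
    ring
  · rw [h1.locallyConst x z y a b c, h2.locallyConst x z y a b c]

variable {X} {k : Op ℤ} {c : ℤ → ℤ → ℂ}

/-- Away from the centre of the chain `k` is locally a multiple of `h`, so that the terms of the
commutator `[k, h]` cancel. -/
theorem IsLocalPart.term_eq_zero (hk : X.IsLocalPart k c) {x y z : ℤ}
    (hz : (X.N : ℤ) + 2 ≤ |z|) :
    XY.entry k x z * XY.entry X.h z y - XY.entry X.h x z * XY.entry k z y = 0 := by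
  by_cases h1 : 1 < |x - z|
  · rw [hk.entry, X.entry_h_of_lt h1]
    ring
  by_cases h2 : 1 < |z - y|
  · rw [hk.entry z y, X.entry_h_of_lt h2]
    ring
  rw [hk.entry, hk.entry, hk.locallyConst x z y hz (not_lt.1 h1) (not_lt.1 h2)]
  ring

theorem IsLocalPart.entry_commutator (hk : X.IsLocalPart k c) {s : Finset ℤ}
    (hs : Finset.Icc (-((X.N : ℤ) + 1)) (X.N + 1) ⊆ s) (x y : ℤ) :
    XY.entry (k * X.h - X.h * k) x y =
      ∑ z ∈ s, (XY.entry k x z * XY.entry X.h z y - XY.entry X.h x z * XY.entry k z y) := by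
  have h1 := (hasSum_entry_mul k X.h x y).sub (hasSum_entry_mul X.h k x y)
  have h2 : XY.entry (k * X.h - X.h * k) x y =
      XY.entry (k * X.h) x y - XY.entry (X.h * k) x y := by
    rw [entry_eq, entry_eq, entry_eq, sub_apply, ell2_sub]
  rw [h2]
  refine h1.unique (hasSum_sum_of_ne_finset_zero fun z hz => hk.term_eq_zero ?_)
  by_contra hlt
  rw [not_le, abs_lt] at hlt
  exact hz (hs (Finset.mem_Icc.2 ⟨by omega, by omega⟩))

theorem IsLocalPart.entry_commutator_eq_zero (hk : X.IsLocalPart k c) {x y : ℤ}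
    (hxy : (X.N : ℤ) + 2 < |x| ∨ (X.N : ℤ) + 2 < |y|) : XY.entry (k * X.h - X.h * k) x y = 0 := by
  rw [hk.entry_commutator subset_rfl]
  refine Finset.sum_eq_zero fun z hz => ?_
  rw [Finset.mem_Icc] at hz
  have hz' : |z| ≤ (X.N : ℤ) + 1 := abs_le.2 hz
  rcases hxy with h | h
  · have h1 : 1 < |x - z| := by
      have := abs_sub_abs_le_abs_sub x z
      omega
    rw [hk.entry, X.entry_h_of_lt h1]
    ring
  · have h1 : 1 < |z - y| := by
      have := abs_sub_abs_le_abs_sub y z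
      rw [abs_sub_comm] at this
      omega
    rw [hk.entry z y, X.entry_h_of_lt h1]
    ring

theorem IsLocalPart.entry_commutator_compress (hk : X.IsLocalPart k c) {M : ℕ}
    (hM : X.N + 1 ≤ M) (x y : Vol M) :
    XY.entry (compress (restrict M) k * compress (restrict M) X.h -
      compress (restrict M) X.h * compress (restrict M) k) x y =
      XY.entry (k * X.h - X.h * k) x.1 y.1 := by
  have h2 : XY.entry (compress (restrict M) k * compress (restrict M) X.h -
      compress (restrict M) X.h * compress (restrict M) k) x y =
      XY.entry (compress (restrict M) k * compress (restrict M) X.h) x y -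
      XY.entry (compress (restrict M) X.h * compress (restrict M) k) x y := by
    rw [entry_eq, entry_eq, entry_eq, sub_apply, ell2_sub]
  rw [h2, entry_mul, entry_mul, hk.entry_commutator (s := Finset.Icc (-(M : ℤ)) M)
    (Finset.Icc_subset_Icc (by omega) (by omega)), ← Finset.sum_sub_distrib,
    ← Finset.sum_coe_sort (Finset.Icc (-(M : ℤ)) M)]
  simp only [entry_compress_restrict]

end Chain

/-- The finite set of sites that carries the flux. -/
def Chain.core (X : Chain) : Finset ℤ := Finset.Icc (-((X.N : ℤ) + 2)) (X.N + 2)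

theorem Chain.notMem_core {X : Chain} {x : ℤ} : x ∉ X.core ↔ (X.N : ℤ) + 2 < |x| := by
  rw [Chain.core, Finset.mem_Icc, ← abs_le, not_le]

variable (X : Chain)

theorem entry_flow_eq_zero {x y : ℤ} (h : x ∉ X.core ∨ y ∉ X.core) :
    entry (flow X.h X.k) x y = 0 := by
  obtain ⟨c, hc⟩ := X.exists_isLocalPart_k
  rw [Chain.notMem_core, Chain.notMem_core] at h
  rw [flow, entry_smul, hc.entry_commutator_eq_zero h, mul_zero]

theorem entry_flow_vol {M : ℕ} (hM : X.N + 1 ≤ M) (x y : Vol M) :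
    entry (flow (X.hVol M) (X.kVol M)) x y = entry (flow X.h X.k) x.1 y.1 := by
  obtain ⟨c, hc⟩ := X.exists_isLocalPart_k
  rw [flow, entry_smul, X.kVol_eq, Chain.hVol, hc.entry_commutator_compress hM, flow, entry_smul]

theorem tr_mul_flow (K : Op ℤ) : tr (K * flow X.h X.k) =
    ∑ x ∈ X.core, ∑ y ∈ X.core, entry K x y * entry (flow X.h X.k) y x := by
  have h1 : ∀ x, entry (K * flow X.h X.k) x x =
      ∑ y ∈ X.core, entry K x y * entry (flow X.h X.k) y x := fun x =>
    (hasSum_entry_mul K (flow X.h X.k) x x).unique (hasSum_sum_of_ne_finset_zero fun y hy => by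
      rw [entry_flow_eq_zero X (Or.inl hy), mul_zero])
  rw [tr]
  simp only [h1]
  exact tsum_eq_sum fun x hx => Finset.sum_eq_zero fun y _ => by
    rw [entry_flow_eq_zero X (Or.inr hx), mul_zero]

theorem tr_mul_flow_vol {M : ℕ} (hM : X.N + 2 ≤ M) (K : Op (Vol M)) :
    tr (K * flow (X.hVol M) (X.kVol M)) =
      ∑ x ∈ X.core, ∑ y ∈ X.core, entryIn K x y * entry (flow X.h X.k) y x := by
  have hsub : X.core ⊆ Finset.Icc (-(M : ℤ)) M := Finset.Icc_subset_Icc (by omega) (by omega)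
  have h1 : ∀ x y : Vol M, entry K x y = entryIn K x.1 y.1 := fun x y => by
    rw [entryIn, restrict_delta, restrict_delta, entry]
  have h2 : ∀ x : ℤ, ∑ y : Vol M, entryIn K x y.1 * entry (flow X.h X.k) y.1 x =
      ∑ y ∈ X.core, entryIn K x y * entry (flow X.h X.k) y x := fun x => by
    rw [Finset.sum_coe_sort (Finset.Icc (-(M : ℤ)) M)
      (fun y => entryIn K x y * entry (flow X.h X.k) y x)]
    refine (Finset.sum_subset hsub fun y _ hy => ?_).symm
    rw [entry_flow_eq_zero X (Or.inl hy), mul_zero]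
  rw [tr_eq_sum]
  simp only [entry_mul, entry_flow_vol X (show X.N + 1 ≤ M by omega), h1, h2]
  rw [Finset.sum_coe_sort (Finset.Icc (-(M : ℤ)) M)
      (fun x => ∑ y ∈ X.core, entryIn K x y * entry (flow X.h X.k) y x)]
  refine (Finset.sum_subset hsub fun x _ hx => Finset.sum_eq_zero fun y _ => ?_).symm
  rw [entry_flow_eq_zero X (Or.inr hx), mul_zero]

/-- The sum of the absolute values of the matrix elements of the flux. -/
def Chain.fluxBound : ℝ := ∑ x ∈ X.core, ∑ y ∈ X.core, ‖entry (flow X.h X.k) y x‖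

theorem norm_sum_mul_flow_le {f : ℤ → ℤ → ℂ} {C : ℝ} (hf : ∀ x y, ‖f x y‖ ≤ C) :
    ‖∑ x ∈ X.core, ∑ y ∈ X.core, f x y * entry (flow X.h X.k) y x‖ ≤ C * X.fluxBound := by
  rw [Chain.fluxBound, Finset.mul_sum]
  refine (norm_sum_le _ _).trans (Finset.sum_le_sum fun x _ => ?_)
  rw [Finset.mul_sum]
  refine (norm_sum_le _ _).trans (Finset.sum_le_sum fun y _ => ?_)
  rw [norm_mul]
  exact mul_le_mul_of_nonneg_right (hf x y) (norm_nonneg _)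

end Locality

/-! ### The infinite-volume limit of the trace formulas -/

section TraceLimit

variable {κ : Type} {T : Type*} [TopologicalSpace T]

theorem continuous_kernelK {h k : Op κ} (hh : IsSelfAdjoint h) (hk : IsSelfAdjoint k)
    {p : T → ℝ≥0∞} {t γ u : T → ℝ} (hp : Continuous p) (hp0 : ∀ x, 0 < p x) (ht : Continuous t)
    (hγ : Continuous γ) (hu : Continuous u) :
    Continuous fun x => kernelK h k (p x) (t x) (γ x) (u x) := by
  simp only [kernelK_eq]
  refine continuous_kernelAB hp hp0 hγ ?_ ?_ (fun x => isSelfAdjoint_evolve hh hk _)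
    (fun x => isSelfAdjoint_evolve hh hk _)
  · exact Continuous.comp (g := fun q : Op κ × ℝ => evolve h q.1 q.2)
      (f := fun x => (k, t x * u x)) (continuous_evolve h) (continuous_const.prodMk (ht.mul hu))
  · exact Continuous.comp (g := fun q : Op κ × ℝ => evolve h q.1 q.2)
      (f := fun x => (k, -(t x * (1 - u x)))) (continuous_evolve h)
      (continuous_const.prodMk (ht.mul (continuous_const.sub hu)).neg)

theorem norm_kernelK_le {h k : Op κ} (hh : IsSelfAdjoint h) (hk : IsSelfAdjoint k) (p : ℝ≥0∞)
    (t γ u : ℝ) {C : ℝ} (hC : ‖k‖ ≤ C) :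
    ‖kernelK h k p t γ u‖ ≤ Real.exp (2 * (|1 - γ| / p.toReal * C)) := by
  rw [kernelK_eq_evolve hh hk]
  refine (norm_evolve_le hh _ _).trans
    ((norm_kernelAB_le p γ hk (isSelfAdjoint_evolve hh hk _)).trans
    (Real.exp_le_exp.2 ?_))
  exact mul_le_mul_of_nonneg_left (mul_le_mul_of_nonneg_left hC
    (div_nonneg (abs_nonneg _) ENNReal.toReal_nonneg)) zero_le_two

variable (X : Chain)

theorem continuous_tr_mul_flow : Continuous fun K : Op ℤ => tr (K * flow X.h X.k) := by
  simp only [tr_mul_flow]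
  exact continuous_finsetSum _ fun x _ => continuous_finsetSum _ fun y _ =>
    (continuous_entry x y).mul continuous_const

theorem norm_tr_mul_flow_vol_le {M : ℕ} (hM : X.N + 2 ≤ M) (K : Op (Vol M)) :
    ‖tr (K * flow (X.hVol M) (X.kVol M))‖ ≤ ‖K‖ * X.fluxBound := by
  rw [tr_mul_flow_vol X hM]
  exact norm_sum_mul_flow_le X fun x y => norm_entryIn_le K x y

theorem sConv_hVol : SConv X.hVol X.h := sConv_compress X.h

theorem sConv_kVol : SConv X.kVol X.k := by
  have h := sConv_compress X.k
  simpa only [← X.kVol_eq] using h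

theorem norm_kVol_le (M : ℕ) : ‖X.kVol M‖ ≤ ‖X.k‖ := by
  rw [X.kVol_eq]
  exact norm_compress_restrict_le M X.k

theorem tendsto_tr_kernelK (p : ℝ≥0∞) (t γ u : ℝ) :
    Tendsto (fun M => tr (kernelK (X.hVol M) (X.kVol M) p t γ u * flow (X.hVol M) (X.kVol M))) atTop
      (𝓝 (tr (kernelK X.h X.k p t γ u * flow X.h X.k))) := by
  have h1 : ∀ x y, Tendsto (fun M => entryIn (kernelK (X.hVol M) (X.kVol M) p t γ u) x y) atTop
      (𝓝 (entry (kernelK X.h X.k p t γ u) x y)) := fun x y => by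
    simp only [kernelK_eq]
    exact tendsto_entryIn_kernelAB γ ((sConv_hVol X).evolve (sConv_kVol X) _)
      ((sConv_hVol X).evolve (sConv_kVol X) _)
      (fun M => isSelfAdjoint_evolve (X.isSelfAdjoint_hVol M) (X.isSelfAdjoint_kVol M) _)
      (fun M => isSelfAdjoint_evolve (X.isSelfAdjoint_hVol M) (X.isSelfAdjoint_kVol M) _)
      (isSelfAdjoint_evolve X.isSelfAdjoint_h X.isSelfAdjoint_k _)
      (isSelfAdjoint_evolve X.isSelfAdjoint_h X.isSelfAdjoint_k _) x y
  have h2 := tendsto_finsetSum X.core fun x _ => tendsto_finsetSum X.core fun y _ =>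
    (h1 x y).mul_const (entry (flow X.h X.k) y x)
  rw [tr_mul_flow]
  refine h2.congr' ?_
  filter_upwards [eventually_ge_atTop (X.N + 2)] with M hM
  rw [tr_mul_flow_vol X hM]

theorem continuous_tr_kernelK_vol {p : ℝ≥0∞} (hp : 0 < p) (t : ℝ) (M : ℕ) :
    Continuous fun q : ℝ × ℝ => tr (kernelK (X.hVol M) (X.kVol M) p t q.1 q.2 *
      flow (X.hVol M) (X.kVol M)) :=
  trL.continuous.comp ((continuous_kernelK (X.isSelfAdjoint_hVol M) (X.isSelfAdjoint_kVol M)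
    continuous_const (fun _ => hp) continuous_const continuous_fst continuous_snd).mul
    continuous_const)

theorem tendsto_traceFormula {p : ℝ≥0∞} (hp : 0 < p) (t α : ℝ) :
    Tendsto (fun M => traceFormula (X.hVol M) (X.kVol M) p t α) atTop
      (𝓝 (traceFormula X.h X.k p t α)) := by
  refine Tendsto.const_mul (t : ℂ) ?_
  have hbd : ∀ M, X.N + 2 ≤ M → ∀ γ u, ‖tr (kernelK (X.hVol M) (X.kVol M) p t γ u *
      flow (X.hVol M) (X.kVol M))‖ ≤
        Real.exp (2 * (|1 - γ| / p.toReal * ‖X.k‖)) * X.fluxBound := by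
    intro M hM γ u
    refine (norm_tr_mul_flow_vol_le X hM _).trans ?_
    have h0 : 0 ≤ X.fluxBound := Finset.sum_nonneg fun _ _ => Finset.sum_nonneg fun _ _ =>
      norm_nonneg _
    exact mul_le_mul_of_nonneg_right (norm_kernelK_le (X.isSelfAdjoint_hVol M)
      (X.isSelfAdjoint_kVol M) p t γ u (norm_kVol_le X M)) h0
  have hcont : Continuous fun γ : ℝ =>
      Real.exp (2 * (|1 - γ| / p.toReal * ‖X.k‖)) * X.fluxBound := by
    fun_prop
  refine intervalIntegral.tendsto_integral_filter_of_dominated_convergence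
    (fun γ => Real.exp (2 * (|1 - γ| / p.toReal * ‖X.k‖)) * X.fluxBound) ?_ ?_
    (hcont.intervalIntegrable 0 α) ?_
  · refine Eventually.of_forall fun M => Continuous.aestronglyMeasurable ?_
    exact intervalIntegral.continuous_parametric_intervalIntegral_of_continuous'
      (continuous_tr_kernelK_vol X hp t M) 0 1
  · filter_upwards [eventually_ge_atTop (X.N + 2)] with M hM
    refine Eventually.of_forall fun γ _ => ?_
    refine (intervalIntegral.norm_integral_le_of_norm_le_const fun u _ => hbd M hM γ u).trans ?_
    simp
  · refine Eventually.of_forall fun γ _ => ?_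
    refine intervalIntegral.tendsto_integral_filter_of_dominated_convergence
      (fun _ => Real.exp (2 * (|1 - γ| / p.toReal * ‖X.k‖)) * X.fluxBound) ?_ ?_
      intervalIntegrable_const (Eventually.of_forall fun u _ => tendsto_tr_kernelK X p t γ u)
    · refine Eventually.of_forall fun M => Continuous.aestronglyMeasurable ?_
      exact Continuous.comp (f := fun u : ℝ => (γ, u)) (continuous_tr_kernelK_vol X hp t M)
        (by fun_prop)
    · filter_upwards [eventually_ge_atTop (X.N + 2)] with M hM
      exact Eventually.of_forall fun u _ => hbd M hM γ u

namespace Chain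

/-- The entropic pressure functional `e_{p,t}(α)` of the extended chain. -/
def e (p : ℝ≥0∞) (t α : ℝ) : ℝ := (traceFormula X.h X.k p t α).re

theorem tendsto_eVol {p : ℝ≥0∞} (hp : 0 < p) (t α : ℝ) :
    Tendsto (fun M => X.eVol M p t α) atTop (𝓝 (X.e p t α)) := by
  have h := (Complex.continuous_re.tendsto _).comp (tendsto_traceFormula X hp t α)
  refine h.congr fun M => ?_
  rw [Function.comp_apply, ← X.eVol_eq_traceFormula hp, Complex.ofReal_re]

theorem e_eq_traceFormula {p : ℝ≥0∞} (hp : 0 < p) (t α : ℝ) :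
    (X.e p t α : ℂ) = traceFormula X.h X.k p t α := by
  refine tendsto_nhds_unique ?_ (tendsto_traceFormula X hp t α)
  simp only [← X.eVol_eq_traceFormula hp]
  exact (Complex.continuous_ofReal.tendsto _).comp (X.tendsto_eVol hp t α)

theorem continuousOn_e :
    ContinuousOn (fun q : ℝ≥0∞ × ℝ × ℝ => X.e q.1 q.2.1 q.2.2) {q | 0 < q.1} := by
  rw [continuousOn_iff_continuous_domRestrict]
  have h1 : Continuous fun w : ({q : ℝ≥0∞ × ℝ × ℝ | 0 < q.1} × ℝ) × ℝ =>
      tr (kernelK X.h X.k w.1.1.1.1 w.1.1.1.2.1 w.1.2 w.2 * flow X.h X.k) :=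
    (continuous_tr_mul_flow X).comp (continuous_kernelK X.isSelfAdjoint_h X.isSelfAdjoint_k
      (by fun_prop) (fun w => w.1.1.2) (by fun_prop) (by fun_prop) (by fun_prop))
  have h2 : Continuous fun w : {q : ℝ≥0∞ × ℝ × ℝ | 0 < q.1} × ℝ => ∫ u in (0 : ℝ)..1,
      tr (kernelK X.h X.k w.1.1.1 w.1.1.2.1 w.2 u * flow X.h X.k) :=
    intervalIntegral.continuous_parametric_intervalIntegral_of_continuous' h1 0 1
  have h3 : Continuous fun w : {q : ℝ≥0∞ × ℝ × ℝ | 0 < q.1} => ∫ γ in (0 : ℝ)..w.1.2.2,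
      ∫ u in (0 : ℝ)..1, tr (kernelK X.h X.k w.1.1 w.1.2.1 γ u * flow X.h X.k) :=
    intervalIntegral.continuous_parametric_intervalIntegral_of_continuous h2 (by fun_prop)
  exact Complex.continuous_re.comp ((Complex.continuous_ofReal.comp (by fun_prop)).mul h3)

end Chain

end TraceLimit

/-! ### Real-analyticity of the pressure -/

section Analyticity

variable {κ : Type}

/-- The power series `-log (1 - Y) = ∑ Y ^ n / n`. -/
def negLog (Y : Op κ) : Op κ :=
  FormalMultilinearSeries.ofScalarsSum (fun n : ℕ => (n : ℂ)⁻¹) Y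

theorem one_le_radius_negLog : (1 : ℝ≥0∞) ≤
    (FormalMultilinearSeries.ofScalars (Op κ) (fun n : ℕ => (n : ℂ)⁻¹)).radius := by
  refine (FormalMultilinearSeries.ofScalars (Op κ) (fun n : ℕ => (n : ℂ)⁻¹)).le_radius_of_bound
    (r := 1) 1 fun n => ?_
  rw [NNReal.coe_one, one_pow, mul_one]
  rcases Nat.eq_zero_or_pos n with rfl | hn
  · have h0 : FormalMultilinearSeries.ofScalars (Op κ) (fun n : ℕ => (n : ℂ)⁻¹) 0 = 0 :=
      FormalMultilinearSeries.ofScalars_eq_zero_of_scalar_zero _ (by simp)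
    rw [h0, norm_zero]
    exact zero_le_one
  · refine (FormalMultilinearSeries.ofScalars_norm_le _ _ n hn).trans ?_
    rw [norm_inv, Complex.norm_natCast]
    exact inv_le_one_of_one_le₀ (by exact_mod_cast hn)

theorem hasFPowerSeriesOnBall_negLog : HasFPowerSeriesOnBall (negLog (κ := κ))
    (FormalMultilinearSeries.ofScalars (Op κ) (fun n : ℕ => (n : ℂ)⁻¹)) 0
    (FormalMultilinearSeries.ofScalars (Op κ) (fun n : ℕ => (n : ℂ)⁻¹)).radius :=
  FormalMultilinearSeries.hasFPowerSeriesOnBall _ (zero_lt_one.trans_le one_le_radius_negLog)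

theorem mem_eball_negLog {Y : Op κ} (hY : ‖Y‖ < 1) : Y ∈ Metric.eball (0 : Op κ)
    (FormalMultilinearSeries.ofScalars (Op κ) (fun n : ℕ => (n : ℂ)⁻¹)).radius := by
  rw [Metric.mem_eball, edist_zero_right]
  refine lt_of_lt_of_le ?_ one_le_radius_negLog
  rw [← ofReal_norm, ENNReal.ofReal_lt_one]
  exact hY

theorem analyticAt_negLog {Y : Op κ} (hY : ‖Y‖ < 1) : AnalyticAt ℂ (negLog (κ := κ)) Y :=
  hasFPowerSeriesOnBall_negLog.analyticAt_of_mem (mem_eball_negLog hY)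

theorem negLog_eq_cfc {Y : Op κ} (hY : ‖Y‖ < 1) (hsa : IsSelfAdjoint Y) :
    negLog Y = cfc (fun y : ℝ => -Real.log (1 - y)) Y := by
  have hsp : ∀ y ∈ spectrum ℝ Y, |y| ≤ ‖Y‖ := fun y hy => abs_le.2 (spectrum_subset_Icc hy)
  have h1 : HasSum (fun n : ℕ => (n : ℂ)⁻¹ • Y ^ n) (negLog Y) := by
    have h := hasFPowerSeriesOnBall_negLog.hasSum (y := Y) (by
      simpa using mem_eball_negLog hY)
    rw [zero_add] at h
    simpa only [FormalMultilinearSeries.ofScalars_apply_eq] using h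
  have h2 := h1.tendsto_sum_nat.comp (tendsto_add_atTop_nat 1)
  have hlog : ContinuousOn (fun y : ℝ => -Real.log (1 - y)) (spectrum ℝ Y) :=
    (ContinuousOn.log (by fun_prop) fun y hy => by
      have := (abs_le.1 (hsp y hy)).2
      linarith).neg
  refine tendsto_nhds_unique h2 (tendsto_iff_norm_sub_tendsto_zero.2 ?_)
  have h3 : Tendsto (fun n : ℕ => ‖Y‖ ^ (n + 1) / (1 - ‖Y‖)) atTop (𝓝 0) := by
    have := ((tendsto_pow_atTop_nhds_zero_of_lt_one (norm_nonneg Y) hY).comp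
      (tendsto_add_atTop_nat 1)).div_const (1 - ‖Y‖)
    simpa using this
  refine squeeze_zero (fun _ => norm_nonneg _) (fun n => ?_) h3
  have h4 : ∑ i ∈ Finset.range (n + 1), (i : ℂ)⁻¹ • Y ^ i =
      cfc (fun y : ℝ => ∑ i ∈ Finset.range n, y ^ (i + 1) / ((i : ℝ) + 1)) Y := by
    have h5 : (fun y : ℝ => ∑ i ∈ Finset.range n, y ^ (i + 1) / ((i : ℝ) + 1)) =
        ∑ i ∈ Finset.range n, fun y : ℝ => ((i : ℝ) + 1)⁻¹ * y ^ (i + 1) := by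
      funext y
      rw [Finset.sum_apply]
      exact Finset.sum_congr rfl fun i _ => by rw [div_eq_inv_mul]
    rw [Finset.sum_range_succ', h5, cfc_sum _ Y _ (fun i _ => by fun_prop)]
    simp only [CharP.cast_eq_zero, inv_zero, zero_smul, add_zero]
    refine Finset.sum_congr rfl fun i _ => ?_
    rw [cfc_const_mul _ (fun y : ℝ => y ^ (i + 1)) Y (by fun_prop), cfc_pow_id Y (i + 1) hsa,
      ← Complex.coe_smul]
    push_cast
    rfl
  rw [Function.comp_apply, h4, ← cfc_sub _ _ Y (by fun_prop) hlog]
  refine norm_cfc_le (by have := norm_nonneg Y; positivity) fun y hy => ?_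
  have h5 := hsp y hy
  have h6 := Real.abs_log_sub_add_sum_range_le (h5.trans_lt hY) n
  rw [Real.norm_eq_abs, sub_neg_eq_add]
  refine h6.trans ?_
  have : 0 < 1 - ‖Y‖ := by linarith
  gcongr

/-- Real powers of an analytic curve of positive operators are the restriction to the real line of
an analytic curve. -/
theorem exists_analyticAt_rpow {F : ℂ → Op κ} {γ₀ R : ℝ} (hF : AnalyticAt ℂ F γ₀)
    (h0 : ∀ γ : ℝ, 0 ≤ F γ) (hR0 : 0 ≤ R)
    (hR : spectrum ℝ (F γ₀) ⊆ Set.Icc (Real.exp (-R)) (Real.exp R))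
    (s : ℝ) : ∃ G : ℂ → Op κ, AnalyticAt ℂ G γ₀ ∧ ∀ᶠ γ : ℝ in 𝓝 γ₀, F γ ^ s = G γ := by
  have hc : ((Real.exp R : ℝ) : ℂ) ≠ 0 := by exact_mod_cast (Real.exp_pos R).ne'
  set Y : ℂ → Op κ := fun z => 1 - ((Real.exp R : ℝ) : ℂ)⁻¹ • F z with hYdef
  have hYa : AnalyticAt ℂ Y γ₀ := analyticAt_const.sub hF.fun_const_smul
  have hYsa : ∀ γ : ℝ, IsSelfAdjoint (Y γ) := fun γ => by
    refine (IsSelfAdjoint.one _).sub ?_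
    rw [← Complex.ofReal_inv]
    exact sa_smul (h0 γ).isSelfAdjoint _
  -- the scaling by `e^R` moves the spectrum into the domain of convergence of the series
  have hY0 : ‖Y γ₀‖ < 1 := by
    have h1 : Y γ₀ = cfc (fun x : ℝ => 1 - (Real.exp R)⁻¹ * x) (F γ₀) := by
      have hsa := (h0 γ₀).isSelfAdjoint
      rw [cfc_sub (fun _ : ℝ => (1 : ℝ)) (fun x => (Real.exp R)⁻¹ * x) (F γ₀),
        cfc_const_one ℝ (F γ₀),
        cfc_const_mul _ (fun x : ℝ => x) (F γ₀), cfc_id' ℝ (F γ₀), hYdef]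
      simp only [← Complex.ofReal_inv, Complex.coe_smul]
    rw [h1]
    refine (norm_cfc_le (c := 1 - (Real.exp R)⁻¹ * Real.exp (-R)) ?_ fun x hx => ?_).trans_lt ?_
    · have h2 : (Real.exp R)⁻¹ * Real.exp (-R) ≤ (Real.exp R)⁻¹ * Real.exp R :=
        mul_le_mul_of_nonneg_left (Real.exp_le_exp.2 (by linarith)) (by positivity)
      rw [inv_mul_cancel₀ (Real.exp_pos R).ne'] at h2
      linarith
    · have h2 : (Real.exp R)⁻¹ * Real.exp (-R) ≤ (Real.exp R)⁻¹ * x :=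
        mul_le_mul_of_nonneg_left (hR hx).1 (by positivity)
      have h3 : (Real.exp R)⁻¹ * x ≤ (Real.exp R)⁻¹ * Real.exp R :=
        mul_le_mul_of_nonneg_left (hR hx).2 (by positivity)
      rw [inv_mul_cancel₀ (Real.exp_pos R).ne'] at h3
      rw [Real.norm_eq_abs, abs_of_nonneg (by linarith)]
      linarith
    · have := mul_pos (inv_pos.2 (Real.exp_pos R)) (Real.exp_pos (-R))
      linarith
  refine ⟨fun z => NormedSpace.exp ((s : ℂ) • (-negLog (Y z) - ((-R : ℝ) : ℂ) • 1)), ?_, ?_⟩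
  · have h1 : AnalyticAt ℂ (fun z => negLog (Y z)) γ₀ := (analyticAt_negLog hY0).comp hYa
    exact (NormedSpace.exp_analytic _).comp
      (h1.neg.sub analyticAt_const).fun_const_smul
  · have hcont : ContinuousAt (fun γ : ℝ => ‖Y γ‖) γ₀ :=
      (hYa.continuousAt.comp Complex.continuous_ofReal.continuousAt).norm
    filter_upwards [hcont.eventually_lt continuousAt_const hY0] with γ hγ
    have hsp : ∀ y ∈ spectrum ℝ (Y γ), |y| ≤ ‖Y γ‖ := fun y hy => abs_le.2 (spectrum_subset_Icc hy)
    have hL := negLog_eq_cfc hγ (hYsa γ)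
    have hLsa : IsSelfAdjoint (negLog (Y γ)) := by
      rw [hL]
      exact cfc_predicate _ _
    have hpos : ∀ y ∈ spectrum ℝ (Y γ), 0 < 1 - y := fun y hy => by
      have := (abs_le.1 (hsp y hy)).2
      linarith
    have hexp : NormedSpace.exp (-negLog (Y γ)) = 1 - Y γ := by
      have h1 : -negLog (Y γ) = cfc (fun y : ℝ => Real.log (1 - y)) (Y γ) := by
        rw [hL, ← cfc_neg]
        simp
      have hlog : ContinuousOn (fun y : ℝ => Real.log (1 - y)) (spectrum ℝ (Y γ)) :=
        ContinuousOn.log (by fun_prop) fun y hy => (hpos y hy).ne'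
      rw [← CFC.real_exp_eq_normedSpace_exp (ha := hLsa.neg), h1,
        ← cfc_comp' Real.exp (fun y : ℝ => Real.log (1 - y)) (Y γ) (by fun_prop) hlog]
      have h2 : cfc (fun y : ℝ => Real.exp (Real.log (1 - y))) (Y γ) =
          cfc (fun y : ℝ => 1 - y) (Y γ) :=
        cfc_congr fun y hy => Real.exp_log (hpos y hy)
      have hsa := hYsa γ
      rw [h2, cfc_sub (fun _ : ℝ => (1 : ℝ)) (fun x => x) (Y γ), cfc_const_one ℝ (Y γ),
        cfc_id' ℝ (Y γ)]
    have hFe : F γ = NormedSpace.exp (-negLog (Y γ) - ((-R : ℝ) : ℂ) • 1) := by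
      rw [Chain.exp_sub_smul_one, hexp, hYdef, neg_neg, sub_sub_cancel, smul_smul,
        mul_inv_cancel₀ hc, one_smul]
    rw [hFe, exp_rpow]
    exact hLsa.neg.sub (sa_smul (IsSelfAdjoint.one _) _)

/-- The non-symmetrized kernel is the restriction of an analytic function of `γ`. -/
theorem exists_analyticAt_kernelAB (p : ℝ≥0∞) {A B : Op κ} (hA : IsSelfAdjoint A)
    (hB : IsSelfAdjoint B) (γ₀ : ℝ) : ∃ G : ℂ → Op κ, AnalyticAt ℂ G γ₀ ∧
      ∀ᶠ γ : ℝ in 𝓝 γ₀, kernelAB p γ A B = G γ + star (G γ) := by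
  have hexp : ∀ (C : Op κ) (f : ℂ → ℂ), Differentiable ℂ f →
      AnalyticAt ℂ (fun z => NormedSpace.exp (f z • C)) γ₀ := fun C f hf =>
    (NormedSpace.exp_analytic _).comp
      (f := fun z => f z • C) ((hf.analyticAt _).smul analyticAt_const)
  have hinv : ∀ G : ℂ → Op κ, AnalyticAt ℂ G γ₀ → 0 ≤ G γ₀ →
      AnalyticAt ℂ (fun z => Ring.inverse (1 + G z)) γ₀ := fun G hG h0 =>
    AnalyticAt.comp (g := Ring.inverse) (f := fun z => 1 + G z)
      (analyticAt_inverse (isUnit_one_add h0).unit) (analyticAt_const.add hG)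
  by_cases hp : p = ⊤
  · refine ⟨fun z => (1 / 2 : ℂ) • Ring.inverse (1 + NormedSpace.exp
      (-((1 - z) • A) - z • B)), ?_, Eventually.of_forall fun γ => ?_⟩
    · refine AnalyticAt.fun_const_smul (hinv _ ?_ ?_)
      · refine (NormedSpace.exp_analytic _).comp (f := fun z : ℂ => -((1 - z) • A) - z • B) ?_
        exact ((((differentiable_const (1 : ℂ)).sub differentiable_id).analyticAt _).smul
          analyticAt_const).neg.sub ((differentiable_id.analyticAt _).smul analyticAt_const)
      · refine IsSelfAdjoint.exp_nonneg ?_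
        have := (sa_smul hA (1 - γ₀)).neg.sub (sa_smul hB γ₀)
        simpa using this
    · have h1 : IsSelfAdjoint (kernelAB p γ A B) := isSelfAdjoint_kernelAB p γ hA hB
      simp only [kernelAB, if_pos hp] at h1 ⊢
      push_cast at h1 ⊢
      rw [star_smul, h1.star_eq, ← add_smul]
      norm_num
  · set q := p.toReal
    have hdiv : ∀ a b : ℂ, Differentiable ℂ fun z : ℂ => (a + b * z) / (q : ℂ) := fun a b => by
      fun_prop
    set F : ℂ → Op κ := fun z => sandw (((1 + -1 * z) / (q : ℂ)) • A) (((0 + 2 * z) / (q : ℂ)) • B)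
      with hFdef
    have e1 : ∀ γ : ℝ, ((1 + -1 * (γ : ℂ)) / (q : ℂ)) • A = ((1 * (1 - γ) / q : ℝ) : ℂ) • A := by
      intro γ
      congr 1
      push_cast
      ring
    have e2 : ∀ γ : ℝ, ((-1 + 1 * (γ : ℂ)) / (q : ℂ)) • A = ((-1 * (1 - γ) / q : ℝ) : ℂ) • A := by
      intro γ
      congr 1
      push_cast
      ring
    have e3 : ∀ γ : ℝ, ((0 + 2 * (γ : ℂ)) / (q : ℂ)) • B = ((2 * γ / q : ℝ) : ℂ) • B := by
      intro γ
      congr 1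
      push_cast
      ring
    have hFa : AnalyticAt ℂ F γ₀ :=
      ((hexp A _ (hdiv 1 (-1))).mul (hexp B _ (hdiv 0 2))).mul (hexp A _ (hdiv 1 (-1)))
    have hFr : ∀ γ : ℝ, F γ = sandw (((1 * (1 - γ) / q : ℝ) : ℂ) • A) (((2 * γ / q : ℝ) : ℂ) • B) :=
      fun γ => by rw [hFdef]; simp only [e1, e3]
    obtain ⟨P, hPa, hP⟩ := exists_analyticAt_rpow hFa
      (fun γ => by rw [hFr]; exact sandw_nonneg (sa_smul hA _) (sa_smul hB _))
      (R := 2 * ‖((1 * (1 - γ₀) / q : ℝ) : ℂ) • A‖ + ‖((2 * γ₀ / q : ℝ) : ℂ) • B‖)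
      (by positivity) (by rw [hFr]; exact spectrum_sandw (sa_smul hA _) (sa_smul hB _)) (-(q / 2))
    have hP0 : 0 ≤ P γ₀ := by
      rw [← hP.self_of_nhds]
      exact CFC.rpow_nonneg
    refine ⟨fun z => (1 / 2 : ℂ) • (NormedSpace.exp (((-1 + 1 * z) / (q : ℂ)) • A) *
      Ring.inverse (1 + P z) * NormedSpace.exp (((1 + -1 * z) / (q : ℂ)) • A)), ?_, ?_⟩
    · exact AnalyticAt.fun_const_smul (((hexp A _ (hdiv (-1) 1)).mul (hinv P hPa hP0)).mul
        (hexp A _ (hdiv 1 (-1))))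
    · filter_upwards [hP] with γ hγ
      simp only [kernelAB, if_neg hp]
      rw [← hγ, hFr, e1, e2]

/-- A function on the line whose derivative is the real part of a holomorphic function is
real-analytic. -/
theorem analyticAt_of_hasDerivAt_re {f : ℝ → ℝ} {G : ℂ → ℂ} {x₀ : ℝ}
    (hf : ∀ᶠ x : ℝ in 𝓝 x₀, HasDerivAt f (G x).re x) (hG : AnalyticAt ℂ G x₀) :
    AnalyticAt ℝ f x₀ := by
  obtain ⟨r, hr, hball⟩ := Metric.eventually_nhds_iff_ball.1 hG.eventually_analyticAt
  obtain ⟨r', hr', hball'⟩ := Metric.eventually_nhds_iff_ball.1 hf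
  have hd : DifferentiableOn ℂ G (Metric.ball (x₀ : ℂ) r) := fun z hz =>
    (hball z hz).differentiableAt.differentiableWithinAt
  -- the real part of a holomorphic primitive of `G` differs from `f` by a constant
  obtain ⟨g, hg⟩ := hd.isExactOn_ball
  have hga : AnalyticAt ℂ g x₀ := by
    have h1 : DifferentiableOn ℂ g (Metric.ball (x₀ : ℂ) r) := fun z hz =>
      (hg z hz).differentiableAt.differentiableWithinAt
    exact h1.analyticAt (Metric.ball_mem_nhds _ hr)
  set s := Metric.ball x₀ (min r r') with hs
  have hder : ∀ x ∈ s, HasDerivAt (fun x : ℝ => (g x).re) (G x).re x := fun x hx => by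
    refine HasDerivAt.real_of_complex (hg x ?_)
    rw [Metric.mem_ball, Complex.dist_eq, ← Complex.ofReal_sub, Complex.norm_real]
    exact (Metric.mem_ball.1 hx).trans_le (min_le_left _ _)
  have hder' : ∀ x ∈ s, HasDerivAt f (G x).re x := fun x hx =>
    hball' x (Metric.ball_subset_ball (min_le_right _ _) hx)
  obtain ⟨a, ha⟩ := IsOpen.exists_is_const_of_deriv_eq_zero Metric.isOpen_ball
    (convex_ball x₀ (min r r')).isPreconnected
    (f := fun x => f x - (g x).re)
    (fun x hx => ((hder' x hx).sub (hder x hx)).differentiableAt.differentiableWithinAt)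
    (fun x hx => by
      refine ((hder' x hx).sub (hder x hx)).deriv.trans ?_
      simp)
  have h1 : (fun x : ℝ => (g x).re + a) =ᶠ[𝓝 x₀] f := by
    filter_upwards [Metric.ball_mem_nhds x₀ (lt_min hr hr')] with x hx
    have := ha x hx
    linarith
  exact (hga.re_ofReal.add analyticAt_const).congr h1

variable (X : Chain)

/-- The linear functional `K ↦ tr(K i[k, h])`. -/
def trFlow : Op ℤ →L[ℂ] ℂ where
  toFun K := tr (K * flow X.h X.k)
  map_add' K L := by
    simp only [tr_mul_flow]
    simp only [entry_add, add_mul, Finset.sum_add_distrib]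
  map_smul' z K := by
    simp only [tr_mul_flow]
    simp only [entry_smul, mul_assoc, ← Finset.mul_sum, RingHom.id_apply, smul_eq_mul]
  cont := continuous_tr_mul_flow X

theorem trFlow_apply (K : Op ℤ) : trFlow X K = tr (K * flow X.h X.k) := rfl

theorem trFlow_star (K : Op ℤ) : trFlow X (star K) = star (trFlow X K) := by
  have h1 := isSelfAdjoint_flow X.isSelfAdjoint_h X.isSelfAdjoint_k
  have h2 : ∀ x y, entry (flow X.h X.k) y x = star (entry (flow X.h X.k) x y) := fun x y => by
    rw [← entry_star, h1.star_eq]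
  rw [trFlow_apply, trFlow_apply, tr_mul_flow, tr_mul_flow, Finset.sum_comm, star_sum]
  refine Finset.sum_congr rfl fun x _ => ?_
  rw [star_sum]
  refine Finset.sum_congr rfl fun y _ => ?_
  rw [entry_star, star_mul, h2 y x, mul_comm]

theorem continuous_tr_evolve (K : Op ℤ) (t : ℝ) :
    Continuous fun u : ℝ => trFlow X (evolve X.h K (t * u)) :=
  (trFlow X).continuous.comp (Continuous.comp (g := fun q : Op ℤ × ℝ => evolve X.h q.1 q.2)
      (f := fun u => (K, t * u)) (continuous_evolve X.h) (by fun_prop))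

/-- The continuous linear functional `K ↦ t ∫₀¹ tr(K_{tu} i[k, h]) du`, which maps the kernel at
`(γ, 0)` to the derivative of the pressure at `γ`. -/
def fluxFunctional (t : ℝ) : Op ℤ →L[ℂ] ℂ :=
  LinearMap.mkContinuous
    { toFun := fun K => (t : ℂ) * ∫ u in (0 : ℝ)..1, trFlow X (evolve X.h K (t * u))
      map_add' := fun K L => by
        rw [← mul_add, ← intervalIntegral.integral_add
          ((continuous_tr_evolve X K t).intervalIntegrable _ _)
          ((continuous_tr_evolve X L t).intervalIntegrable _ _)]
        simp only [← evolveHom_apply X.isSelfAdjoint_h, map_add]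
      map_smul' := fun z K => by
        simp only [evolve_smul, map_smul, smul_eq_mul, intervalIntegral.integral_const_mul,
          RingHom.id_apply]
        ring }
    (|t| * ‖trFlow X‖) (fun K => by
      simp only [LinearMap.coe_mk, AddHom.coe_mk]
      rw [norm_mul, Complex.norm_real, Real.norm_eq_abs, mul_assoc]
      refine mul_le_mul_of_nonneg_left ?_ (abs_nonneg t)
      refine (intervalIntegral.norm_integral_le_of_norm_le_const (C := ‖trFlow X‖ * ‖K‖)
        fun u _ => ?_).trans (by simp)
      exact (trFlow X).le_of_opNorm_le_of_le le_rfl (norm_evolve_le X.isSelfAdjoint_h K _))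

theorem fluxFunctional_apply (t : ℝ) (K : Op ℤ) : fluxFunctional X t K =
    (t : ℂ) * ∫ u in (0 : ℝ)..1, tr (evolve X.h K (t * u) * flow X.h X.k) := rfl

theorem fluxFunctional_star (t : ℝ) (K : Op ℤ) :
    fluxFunctional X t (star K) = star (fluxFunctional X t K) := by
  have h1 : ∀ u : ℝ, tr (evolve X.h (star K) (t * u) * flow X.h X.k) =
      star (tr (evolve X.h K (t * u) * flow X.h X.k)) := fun u => by
    rw [← trFlow_apply, ← trFlow_apply, ← trFlow_star, ← evolveHom_apply X.isSelfAdjoint_h,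
      ← evolveHom_apply X.isSelfAdjoint_h, map_star]
  rw [fluxFunctional_apply, fluxFunctional_apply]
  simp only [h1, star_mul', Complex.star_def, Complex.conj_ofReal]
  congr 1
  simp only [intervalIntegral, map_sub, ← integral_conj]

theorem Chain.hasDerivAt_e {p : ℝ≥0∞} (hp : 0 < p) (t γ : ℝ) : HasDerivAt (X.e p t)
    (fluxFunctional X t (kernelAB p γ X.k (evolve X.h X.k (-t)))).re γ := by
  have hB := isSelfAdjoint_evolve X.isSelfAdjoint_h X.isSelfAdjoint_k (-t)
  have hc : Continuous fun γ => fluxFunctional X t (kernelAB p γ X.k (evolve X.h X.k (-t))) :=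
    (fluxFunctional X t).continuous.comp (continuous_kernelAB continuous_const (fun _ => hp)
      continuous_id continuous_const continuous_const (fun _ => X.isSelfAdjoint_k) (fun _ => hB))
  have h1 := intervalIntegral.integral_hasDerivAt_right (hc.intervalIntegrable 0 γ)
    hc.stronglyMeasurable.stronglyMeasurableAtFilter hc.continuousAt
  have h2 : X.e p t = fun α => (∫ γ in (0 : ℝ)..α,
      fluxFunctional X t (kernelAB p γ X.k (evolve X.h X.k (-t)))).re := by
    funext α
    rw [Chain.e, traceFormula, ← intervalIntegral.integral_const_mul]
    simp only [kernelK_eq_evolve X.isSelfAdjoint_h X.isSelfAdjoint_k, fluxFunctional_apply, flow]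
  rw [h2]
  exact Complex.reCLM.hasFDerivAt.comp_hasDerivAt γ h1

theorem Chain.analyticOnNhd_e {p : ℝ≥0∞} (hp : 0 < p) (t : ℝ) :
    AnalyticOnNhd ℝ (X.e p t) Set.univ := by
  intro γ₀ _
  obtain ⟨G, hG, hGe⟩ := exists_analyticAt_kernelAB p X.isSelfAdjoint_k
    (isSelfAdjoint_evolve X.isSelfAdjoint_h X.isSelfAdjoint_k (-t)) γ₀
  refine analyticAt_of_hasDerivAt_re (G := fun z => (2 : ℂ) * fluxFunctional X t (G z)) ?_ ?_
  · filter_upwards [hGe] with γ hγ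
    refine (X.hasDerivAt_e hp t γ).congr_deriv ?_
    rw [hγ, map_add, fluxFunctional_star, Complex.add_re, Complex.star_def, Complex.conj_re]
    simp
    ring
  · exact analyticAt_const.mul (((fluxFunctional X t).analyticAt _).comp hG)

end Analyticity

/-! ### Spectral sums and the free Fermi gas -/

section SpectralSums

theorem exists_eigenvalues {ι : Type} [DecidableEq ι] [Fintype ι] {C : Op ι}
    (hC : IsSelfAdjoint C) :
    ∃ c : ι → ℝ, ∀ f : ℝ → ℝ, Continuous f → tr (cfc f C) = ((∑ j, f (c j) : ℝ) : ℂ) := by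
  have hM : (toMat C).IsHermitian := by
    rw [Matrix.IsHermitian, ← Matrix.star_eq_conjTranspose, ← map_star, hC.star_eq]
  refine ⟨hM.eigenvalues, fun f hf => ?_⟩
  have hcont : Continuous (toMat : Op ι →⋆ₐ[ℂ] Matrix ι ι ℂ) :=
    continuous_matrix fun x y => continuous_entry x y
  rw [tr_eq_trace, StarAlgHom.map_cfc (toMat : Op ι →⋆ₐ[ℂ] Matrix ι ι ℂ) f C hf.continuousOn hcont
    hC (hC.map _), hM.cfc_eq, Matrix.IsHermitian.cfc, Unitary.conjStarAlgAut_apply,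
    Matrix.trace_mul_cycle, Unitary.coe_star_mul_self, one_mul, Matrix.trace_diagonal]
  push_cast
  rfl

theorem cfc_affine {κ : Type} {C : Op κ} (hC : IsSelfAdjoint C) {f : ℝ → ℝ} (hf : Continuous f)
    (a b : ℝ) : cfc f ((a : ℂ) • C + (b : ℂ) • 1) = cfc (fun x => f (a * x + b)) C := by
  rw [cfc_comp' f (fun x => a * x + b) C hf.continuousOn (by fun_prop),
    cfc_add C (fun x => a * x) (fun _ => b), cfc_const_mul a (fun x => x) C, cfc_id' ℝ C,
    cfc_const b C, Algebra.algebraMap_eq_smul_one, Complex.coe_smul, Complex.coe_smul]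

/-- The function `log (1 + e^x)`. -/
def softplus (x : ℝ) : ℝ := Real.log (1 + Real.exp x)

theorem one_add_exp_pos (x : ℝ) : 0 < 1 + Real.exp x := by positivity

theorem hasDerivAt_softplus (x : ℝ) : HasDerivAt softplus (1 + Real.exp (-x))⁻¹ x := by
  have h := ((Real.hasDerivAt_exp x).const_add 1).log (one_add_exp_pos x).ne'
  refine h.congr_deriv ?_
  have := one_add_exp_pos x
  rw [Real.exp_neg]
  field_simp
  exact add_comm _ _

theorem continuous_softplus : Continuous softplus :=
  continuous_iff_continuousAt.2 fun x => (hasDerivAt_softplus x).continuousAt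

theorem max_le_softplus (x : ℝ) : max x 0 ≤ softplus x := by
  rw [softplus, max_le_iff, Real.le_log_iff_exp_le (one_add_exp_pos x)]
  have := Real.exp_pos x
  exact ⟨by linarith, Real.log_nonneg (by linarith)⟩

theorem softplus_le (x : ℝ) : softplus x ≤ max x 0 + Real.log 2 := by
  rw [softplus, Real.log_le_iff_le_exp (one_add_exp_pos x), Real.exp_add, Real.exp_log two_pos]
  have h1 : Real.exp x ≤ Real.exp (max x 0) := Real.exp_le_exp.2 (le_max_left _ _)
  have h2 : 1 ≤ Real.exp (max x 0) := Real.one_le_exp (le_max_right _ _)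
  linarith

variable {ι : Type} [LinearOrder ι] [Fintype ι]

/-- The partition function of a free Fermi gas with one-particle operator `C`. -/
theorem log_tr_exp_dGamma {C : Op ι} (hC : IsSelfAdjoint C) :
    Real.log (tr (NormedSpace.exp (dGamma C))).re = (tr (cfc softplus C)).re := by
  -- at `β = 0` both sides are `log 2^n`, and for `βC` they have the same derivative in `β`
  have h1 : ∀ β, HasDerivAt (pressure ⊤ 0 C) (tr (kernelAB ⊤ β 0 C * C)).re β := fun β => by
    simpa using hasDerivAt_pressure (p := ⊤) (by simp) (IsSelfAdjoint.zero _) hC β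
  have h2 : ∀ β, HasDerivAt (fun β : ℝ => (tr (cfc softplus ((β : ℂ) • C))).re)
      (tr (kernelAB ⊤ β 0 C * C)).re β := by
    intro β
    have hY : IsSelfAdjoint ((β : ℂ) • C) := sa_smul hC β
    have h3 := hasDerivAt_tr_cfc (X := fun β : ℝ => (β : ℂ) • C) (X' := fun _ => C) (γ₀ := β)
      (a := -((|β| + 1) * ‖C‖)) (b := (|β| + 1) * ‖C‖) (C := ‖C‖) one_pos
      (fun γ _ => by
        simpa only [Complex.coe_smul, one_smul] using (hasDerivAt_id' γ).smul_const C)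
      (fun γ _ => sa_smul hC γ)
      (fun γ hγ => by
        have h4 : |γ| ≤ |β| + 1 := by
          have h5 : |γ - β| < 1 := hγ
          have := abs_sub_abs_le_abs_sub γ β
          linarith
        have h6 : ‖(γ : ℂ) • C‖ ≤ (|β| + 1) * ‖C‖ := by
          rw [norm_smul, Complex.norm_real, Real.norm_eq_abs]
          gcongr
        exact spectrum_subset_Icc.trans (Set.Icc_subset_Icc (neg_le_neg h6) h6))
      (fun _ _ => le_rfl) (fun x _ => hasDerivAt_softplus x)
      (Continuous.continuousOn (by
        refine Continuous.inv₀ (by fun_prop) fun x => (one_add_exp_pos (-x)).ne'))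
    have h7 : kernelAB ⊤ β 0 C = cfc (fun x : ℝ => (1 + Real.exp (-x))⁻¹) ((β : ℂ) • C) := by
      have h8 : cfc (fun x : ℝ => Real.exp (-x)) ((β : ℂ) • C) =
          NormedSpace.exp (-((β : ℂ) • C)) := by
        rw [cfc_comp' Real.exp (fun x : ℝ => -x) ((β : ℂ) • C) (by fun_prop) (by fun_prop),
          cfc_neg_id (R := ℝ) ((β : ℂ) • C) hY, CFC.real_exp_eq_normedSpace_exp (ha := hY.neg)]
      rw [cfc_inv (R := ℝ) (f := fun x : ℝ => 1 + Real.exp (-x)) (a := (β : ℂ) • C)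
        (fun x _ => (one_add_exp_pos (-x)).ne')
        (by fun_prop) hY, cfc_add (R := ℝ) ((β : ℂ) • C) (fun _ : ℝ => (1 : ℝ))
        (fun x => Real.exp (-x)) (by fun_prop)
        (by fun_prop), cfc_const_one ℝ ((β : ℂ) • C), h8, kernelAB, if_pos rfl, smul_zero, neg_zero,
        zero_sub]
    rw [h7]
    exact Complex.reCLM.hasFDerivAt.comp_hasDerivAt β h3
  have h3 : ∀ β,
      HasDerivAt (fun β => pressure ⊤ 0 C β - (tr (cfc softplus ((β : ℂ) • C))).re) 0 β :=
    fun β => ((h1 β).sub (h2 β)).congr_deriv (sub_self _)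
  have h4 := is_const_of_deriv_eq_zero (fun β => (h3 β).differentiableAt)
    (fun β => (h3 β).deriv) 1 0
  have h5 : pressure ⊤ 0 C 0 - (tr (cfc softplus (((0 : ℝ) : ℂ) • C))).re = 0 := by
    have h6 : (tr (NormedSpace.exp (dGamma (0 : Op ι)))).re = (2 : ℝ) ^ Fintype.card ι := by
      have : dGamma (0 : Op ι) = 0 := by simpa using dGamma_smul 0 (0 : Op ι)
      rw [this, NormedSpace.exp_zero, tr_one, Fintype.card_finset]
      norm_cast
    rw [Chain.pressure_zero_right (by simp) (IsSelfAdjoint.zero _), h6, Complex.ofReal_zero,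
      zero_smul, cfc_apply_zero, Algebra.algebraMap_eq_smul_one, ← Complex.coe_smul, tr_smul,
      tr_one,
      Real.log_pow, softplus, Real.exp_zero, one_add_one_eq_two, Complex.re_ofReal_mul,
      Complex.natCast_re]
    ring
  have h6 : pressure ⊤ 0 C 1 = Real.log (tr (NormedSpace.exp (dGamma C))).re := by
    rw [pressure, pressureOp, if_pos rfl]
    simp
  simp only [h5, h6, Complex.ofReal_one, one_smul] at h4
  linarith

theorem norm_le_tr {κ : Type} [DecidableEq κ] [Fintype κ] (Y : Op κ) :
    ‖Y‖ ^ 2 ≤ Fintype.card κ * (tr (star Y * Y)).re := by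
  have h1 : ‖Y‖ ≤ ∑ x, ‖Y (delta x)‖ := by
    refine Y.opNorm_le_bound (Finset.sum_nonneg fun _ _ => norm_nonneg _) fun u => ?_
    calc ‖Y u‖ = ‖∑ x, u x • Y (delta x)‖ := by
          conv_lhs => rw [eq_sum_delta u]
          rw [map_sum]
          simp only [map_smul]
      _ ≤ ∑ x, ‖u x • Y (delta x)‖ := norm_sum_le _ _
      _ ≤ ∑ x, ‖Y (delta x)‖ * ‖u‖ := by
          refine Finset.sum_le_sum fun x _ => ?_
          rw [norm_smul, mul_comm]
          refine mul_le_mul_of_nonneg_left ?_ (norm_nonneg _)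
          rw [← inner_delta x u]
          refine (norm_inner_le_norm _ _).trans ?_
          rw [norm_delta, one_mul]
      _ = _ := by rw [Finset.sum_mul]
  calc ‖Y‖ ^ 2 ≤ (∑ x, ‖Y (delta x)‖) ^ 2 := by gcongr
    _ ≤ Fintype.card κ * ∑ x, ‖Y (delta x)‖ ^ 2 := by
        simpa using sq_sum_le_card_mul_sum_sq (s := Finset.univ) (f := fun x => ‖Y (delta x)‖)
    _ = _ := by rw [tr_star_mul_self, Complex.ofReal_re]

theorem abs_log_norm_sub_le {κ : Type} [DecidableEq κ] [Fintype κ] [Nonempty κ] {A : Op κ}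
    (hA : IsSelfAdjoint A) : |Real.log (tr (NormedSpace.exp A)).re - Real.log ‖NormedSpace.exp A‖| ≤
      Real.log (Fintype.card κ) := by
  have hcard : 0 < (Fintype.card κ : ℝ) := by exact_mod_cast Fintype.card_pos
  have hpos := tr_exp_pos hA
  have h1 : (tr (NormedSpace.exp A)).re ≤ Fintype.card κ * ‖NormedSpace.exp A‖ := by
    have := norm_tr_mul_le (ρ := (1 : Op κ)) zero_le_one (NormedSpace.exp A)
    rw [one_mul, tr_one, Complex.natCast_re] at this
    exact (Complex.re_le_norm _).trans this
  have hn : 0 < ‖NormedSpace.exp A‖ := by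
    by_contra h
    have : ‖NormedSpace.exp A‖ = 0 := le_antisymm (not_lt.1 h) (norm_nonneg _)
    rw [this, mul_zero] at h1
    linarith
  have h2 : ‖NormedSpace.exp A‖ ≤ Fintype.card κ * (tr (NormedSpace.exp A)).re := by
    have hs : IsSelfAdjoint ((1 / 2 : ℂ) • A) := by
      simpa using sa_smul hA (1 / 2)
    have h3 : NormedSpace.exp A = star (NormedSpace.exp ((1 / 2 : ℂ) • A)) *
        NormedSpace.exp ((1 / 2 : ℂ) • A) := by
      rw [(sa_exp hs).star_eq, ← exp_add_of_comm (Commute.refl _), ← add_smul]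
      norm_num
    have h4 := norm_le_tr (NormedSpace.exp ((1 / 2 : ℂ) • A))
    rw [← h3] at h4
    refine le_trans ?_ h4
    conv_lhs => rw [h3]
    rw [CStarRing.norm_star_mul_self, sq]
  have h3 := Real.log_le_log hpos h1
  have h4 := Real.log_le_log hn h2
  rw [Real.log_mul hcard.ne' hn.ne'] at h3
  rw [Real.log_mul hcard.ne' hpos.ne'] at h4
  rw [abs_le]
  constructor <;> linarith

theorem norm_exp_smul {κ : Type} {A : Op κ} (hA : IsSelfAdjoint A) {β : ℝ} (hβ : 0 < β) :
    ‖NormedSpace.exp ((β : ℂ) • A)‖ = ‖NormedSpace.exp A‖ ^ β := by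
  rw [← exp_rpow hA, CFC.norm_rpow _ hβ hA.exp_nonneg]

/-- In terms of the eigenvalues `c_j` of `C`, the trace of `e^{dΓ(aC + b)}` is
`∏ (1 + e^{a c_j + b})`, and the norm of `e^{dΓ(C - s)}` is `∏ e^{max(c_j - s, 0)}`: the latter is the
weight of the state in which all levels above `s` are filled. -/
theorem exists_spectral_sums {C : Op ι} (hC : IsSelfAdjoint C) : ∃ c : ι → ℝ,
    Real.log (tr (NormedSpace.exp (dGamma C))).re = ∑ j, softplus (c j) ∧
    ∀ s : ℝ, Real.log ‖NormedSpace.exp (dGamma (C - (s : ℂ) • 1))‖ = ∑ j, max (c j - s) 0 := by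
  obtain ⟨c, hc⟩ := exists_eigenvalues hC
  have h1 : ∀ a b : ℝ, Real.log (tr (NormedSpace.exp (dGamma ((a : ℂ) • C + (b : ℂ) • 1)))).re =
      ∑ j, softplus (a * c j + b) := fun a b => by
    rw [log_tr_exp_dGamma ((sa_smul hC a).add (sa_smul (IsSelfAdjoint.one _) b)),
      cfc_affine hC continuous_softplus, hc (fun x => softplus (a * x + b))
        (continuous_softplus.comp (by fun_prop)),
      Complex.ofReal_re]
  refine ⟨c, by simpa using h1 1 0, fun s => ?_⟩
  set K := dGamma (C - (s : ℂ) • 1) with hK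
  have hKsa : IsSelfAdjoint K :=
    isSelfAdjoint_dGamma (hC.sub (sa_smul (IsSelfAdjoint.one _) s))
  set D := Real.log (Fintype.card (Finset ι))
  -- `log tr e^{βK}` is `β log ‖e^K‖` up to a bounded error, and `log (1 + e^{βx})` is `β max(x, 0)`
  -- up to a bounded error; division by `β → ∞` removes both errors
  have h2 : ∀ β : ℝ, 0 < β → |∑ j, softplus (β * c j + -(β * s)) -
      β * Real.log ‖NormedSpace.exp K‖| ≤ D := fun β hβ => by
    have h3 := abs_log_norm_sub_le (sa_smul hKsa β)
    rw [norm_exp_smul hKsa hβ, Real.log_rpow] at h3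
    · rw [← h1 β (-(β * s))]
      have h4 : (β : ℂ) • C + ((-(β * s) : ℝ) : ℂ) • (1 : Op ι) = (β : ℂ) • (C - (s : ℂ) • 1) := by
        push_cast
        module
      rw [h4, dGamma_smul]
      exact h3
    · exact norm_pos_iff.2 fun h0 => by
        have := tr_exp_pos hKsa
        rw [h0, ← trL_apply, map_zero] at this
        simp at this
  have h3 : ∀ β : ℝ, 0 < β → |∑ j, softplus (β * c j + -(β * s)) - β * ∑ j, max (c j - s) 0| ≤
      Fintype.card ι * Real.log 2 := fun β hβ => by
    rw [Finset.mul_sum, ← Finset.sum_sub_distrib]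
    refine (Finset.abs_sum_le_sum_abs _ _).trans ?_
    refine (Finset.sum_le_card_nsmul _ _ (Real.log 2) fun j _ => ?_).trans (by simp)
    have h4 : β * max (c j - s) 0 = max (β * c j + -(β * s)) 0 := by
      rw [mul_max_of_nonneg _ _ hβ.le]
      congr 1 <;> ring
    rw [h4, abs_le]
    have h5 := max_le_softplus (β * c j + -(β * s))
    have h6 := softplus_le (β * c j + -(β * s))
    have h7 : 0 ≤ Real.log 2 := Real.log_nonneg one_le_two
    constructor <;> linarith
  -- the two quantities differ by `O(1/β)` for every `β > 0`
  by_contra hne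
  set d := |Real.log ‖NormedSpace.exp K‖ - ∑ j, max (c j - s) 0| with hd
  have hd0 : 0 < d := abs_pos.2 (sub_ne_zero.2 hne)
  set E := D + Fintype.card ι * Real.log 2 with hE
  have h4 : ∀ β : ℝ, 0 < β → β * d ≤ E := fun β hβ => by
    have h7 : β * d = |β * (Real.log ‖NormedSpace.exp K‖ - ∑ j, max (c j - s) 0)| := by
      rw [abs_mul, abs_of_pos hβ]
    rw [h7]
    have h5 := h2 β hβ
    have h6 := h3 β hβ
    rw [abs_le] at h5 h6 ⊢
    constructor <;> nlinarith
  have h5 : 0 ≤ E := (mul_pos one_pos hd0).le.trans (h4 1 one_pos)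
  have h6 := h4 ((E + 1) / d) (by positivity)
  rw [div_mul_cancel₀ _ hd0.ne'] at h6
  linarith

end SpectralSums

section Mixtures

variable {ι : Type} [Fintype ι]

/-- Sums of `log (1 + e^x)` are mixtures of sums of the hinge functions `max(x - s, 0)`. -/
theorem sum_softplus_eq (c : ι → ℝ) {R : ℝ} (hR : ∀ j, |c j| ≤ R) :
    ∑ j, softplus (c j) = Fintype.card ι * softplus (-R) +
      (1 + Real.exp R)⁻¹ * ∑ j, max (c j - -R) 0 +
      ∫ s in (-R)..R, (Real.exp (-s) / (1 + Real.exp (-s)) ^ 2) * ∑ j, max (c j - s) 0 := by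
  have hcw : Continuous fun s : ℝ => Real.exp (-s) / (1 + Real.exp (-s)) ^ 2 :=
    Continuous.div (by fun_prop) (by fun_prop) fun s => (pow_pos (one_add_exp_pos _) 2).ne'
  have hci : ∀ j, Continuous fun s : ℝ =>
      Real.exp (-s) / (1 + Real.exp (-s)) ^ 2 * max (c j - s) 0 := fun j =>
    hcw.mul (by fun_prop)
  have h1 : ∀ j, softplus (c j) = softplus (-R) + (1 + Real.exp R)⁻¹ * max (c j - -R) 0 +
      ∫ s in (-R)..R, Real.exp (-s) / (1 + Real.exp (-s)) ^ 2 * max (c j - s) 0 := by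
    intro j
    have hj := abs_le.1 (hR j)
    have h2 : ∫ s in (c j)..R, Real.exp (-s) / (1 + Real.exp (-s)) ^ 2 * max (c j - s) 0 = 0 := by
      rw [intervalIntegral.integral_congr (g := fun _ => 0) fun s hs => ?_]
      · simp
      · rw [Set.uIcc_of_le hj.2] at hs
        simp only
        rw [max_eq_right (by linarith [hs.1]), mul_zero]
    -- integration by parts: the weight is the derivative of `(1 + e^{-s})⁻¹`, itself the
    -- derivative of `softplus`
    have h3 : ∀ s ∈ Set.uIcc (-R) (c j), HasDerivAt
        (fun s => (1 + Real.exp (-s))⁻¹ * (c j - s) + softplus s)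
        (Real.exp (-s) / (1 + Real.exp (-s)) ^ 2 * max (c j - s) 0) s := by
      intro s hs
      rw [Set.uIcc_of_le hj.1] at hs
      rw [max_eq_left (by linarith [hs.2])]
      have h4 : HasDerivAt (fun s : ℝ => 1 + Real.exp (-s)) (-Real.exp (-s)) s := by
        simpa using ((hasDerivAt_neg s).exp).const_add 1
      have h5 := h4.inv (one_add_exp_pos (-s)).ne'
      have h6 : HasDerivAt (fun s : ℝ => c j - s) (-1) s := by
        simpa using (hasDerivAt_id s).const_sub (c j)
      refine ((h5.mul h6).add (hasDerivAt_softplus s)).congr_deriv ?_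
      simp only [Pi.inv_apply]
      ring
    rw [← intervalIntegral.integral_add_adjacent_intervals
      ((hci j).intervalIntegrable (-R) (c j)) ((hci j).intervalIntegrable (c j) R), h2,
      intervalIntegral.integral_eq_sub_of_hasDerivAt h3 ((hci j).intervalIntegrable _ _),
      max_eq_left (by linarith)]
    rw [neg_neg]
    ring
  have h2 : ∀ s : ℝ, Real.exp (-s) / (1 + Real.exp (-s)) ^ 2 * ∑ j, max (c j - s) 0 =
      ∑ j, Real.exp (-s) / (1 + Real.exp (-s)) ^ 2 * max (c j - s) 0 := fun s => Finset.mul_sum ..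
  simp only [h2]
  rw [intervalIntegral.integral_finsetSum fun j _ => (hci j).intervalIntegrable _ _,
    Finset.mul_sum, Finset.sum_congr rfl fun j _ => h1 j, Finset.sum_add_distrib,
    Finset.sum_add_distrib]
  simp

/-- Inequalities between the sums of all hinge functions pass to `log (1 + e^x)`. -/
theorem sum_softplus_le {c c₀ c₁ : ι → ℝ} {θ₀ θ₁ : ℝ} (hθ : θ₀ + θ₁ = 1)
    (h : ∀ s, ∑ j, max (c j - s) 0 ≤ θ₀ * ∑ j, max (c₀ j - s) 0 + θ₁ * ∑ j, max (c₁ j - s) 0) :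
    ∑ j, softplus (c j) ≤ θ₀ * ∑ j, softplus (c₀ j) + θ₁ * ∑ j, softplus (c₁ j) := by
  set R := ∑ j, (|c j| + |c₀ j| + |c₁ j|) with hR
  have hb : ∀ j, |c j| + |c₀ j| + |c₁ j| ≤ R := fun j =>
    Finset.single_le_sum (f := fun j => |c j| + |c₀ j| + |c₁ j|) (fun i _ => by positivity)
      (Finset.mem_univ j)
  have hR0 : 0 ≤ R := Finset.sum_nonneg fun j _ => by positivity
  have hb0 : ∀ j, |c j| ≤ R := fun j => by
    have := hb j
    have := abs_nonneg (c₀ j)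
    have := abs_nonneg (c₁ j)
    linarith
  have hb1 : ∀ j, |c₀ j| ≤ R := fun j => by
    have := hb j
    have := abs_nonneg (c j)
    have := abs_nonneg (c₁ j)
    linarith
  have hb2 : ∀ j, |c₁ j| ≤ R := fun j => by
    have := hb j
    have := abs_nonneg (c₀ j)
    have := abs_nonneg (c j)
    linarith
  have hcw : Continuous fun s : ℝ => Real.exp (-s) / (1 + Real.exp (-s)) ^ 2 :=
    Continuous.div (by fun_prop) (by fun_prop) fun s => (pow_pos (one_add_exp_pos _) 2).ne'
  have hci : ∀ c : ι → ℝ, Continuous fun s : ℝ =>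
      Real.exp (-s) / (1 + Real.exp (-s)) ^ 2 * ∑ j, max (c j - s) 0 := fun c =>
    hcw.mul (continuous_finsetSum _ fun j _ => by fun_prop)
  have hcj : ∀ (θ : ℝ) (c : ι → ℝ), IntervalIntegrable (fun s : ℝ =>
      θ * (Real.exp (-s) / (1 + Real.exp (-s)) ^ 2 * ∑ j, max (c j - s) 0)) volume (-R) R :=
    fun θ c => (continuous_const.mul (hci c)).intervalIntegrable _ _
  rw [sum_softplus_eq c hb0, sum_softplus_eq c₀ hb1, sum_softplus_eq c₁ hb2]
  have h1 : ∫ s in (-R)..R, (Real.exp (-s) / (1 + Real.exp (-s)) ^ 2) * ∑ j, max (c j - s) 0 ≤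
      θ₀ * (∫ s in (-R)..R, (Real.exp (-s) / (1 + Real.exp (-s)) ^ 2) * ∑ j, max (c₀ j - s) 0) +
      θ₁ * ∫ s in (-R)..R, (Real.exp (-s) / (1 + Real.exp (-s)) ^ 2) * ∑ j, max (c₁ j - s) 0 := by
    rw [← intervalIntegral.integral_const_mul, ← intervalIntegral.integral_const_mul,
      ← intervalIntegral.integral_add (hcj θ₀ c₀) (hcj θ₁ c₁)]
    refine intervalIntegral.integral_mono_on (by linarith) ((hci c).intervalIntegrable _ _)
      ((hcj θ₀ c₀).add (hcj θ₁ c₁))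
      fun s _ => ?_
    have hw : 0 ≤ Real.exp (-s) / (1 + Real.exp (-s)) ^ 2 := by positivity
    have := mul_le_mul_of_nonneg_left (h s) hw
    refine this.trans (le_of_eq ?_)
    ring
  have h2 : (1 + Real.exp R)⁻¹ * ∑ j, max (c j - -R) 0 ≤ (1 + Real.exp R)⁻¹ *
      (θ₀ * ∑ j, max (c₀ j - -R) 0 + θ₁ * ∑ j, max (c₁ j - -R) 0) :=
    mul_le_mul_of_nonneg_left (h (-R)) (by positivity)
  have h3 : (Fintype.card ι : ℝ) * softplus (-R) = θ₀ * (Fintype.card ι * softplus (-R)) +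
      θ₁ * (Fintype.card ι * softplus (-R)) := by
    rw [← add_mul, hθ, one_mul]
  linarith

end Mixtures

/-! ### Complex interpolation -/

section Interpolation

variable {κ : Type} {A B : Op κ}

theorem norm_exp_I_le (hA : IsSelfAdjoint A) (s : ℝ) :
    ‖NormedSpace.exp ((Complex.I * (s : ℂ)) • A)‖ ≤ 1 := by
  have h1 : star (NormedSpace.exp ((Complex.I * (s : ℂ)) • A)) *
      NormedSpace.exp ((Complex.I * (s : ℂ)) • A) = 1 := by
    rw [star_exp_I hA, exp_neg_mul_exp]
  have h2 := CStarRing.norm_star_mul_self (x := NormedSpace.exp ((Complex.I * (s : ℂ)) • A))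
  rw [h1] at h2
  have h3 := norm_one_op_le (ι := κ)
  nlinarith [norm_nonneg (NormedSpace.exp ((Complex.I * (s : ℂ)) • A))]

/-- The entire family of operators `e^{zB} D e^{zA}`. -/
def expFamily (B D A : Op κ) (z : ℂ) : Op κ := NormedSpace.exp (z • B) * D * NormedSpace.exp (z • A)

/-- The imaginary part of `z` only contributes unitary factors. -/
theorem norm_expFamily_le_re (hB : IsSelfAdjoint B) (D : Op κ) (hA : IsSelfAdjoint A) (z : ℂ) :
    ‖expFamily B D A z‖ ≤ ‖expFamily B D A (z.re : ℂ)‖ := by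
  have hz : z = (z.re : ℂ) + Complex.I * (z.im : ℂ) := by
    rw [mul_comm]
    exact (Complex.re_add_im z).symm
  have h1 : NormedSpace.exp (z • B) = NormedSpace.exp ((Complex.I * (z.im : ℂ)) • B) *
      NormedSpace.exp ((z.re : ℂ) • B) := by
    rw [← exp_add_of_comm (((Commute.refl B).smul_left _).smul_right _), ← add_smul, add_comm, ← hz]
  have h2 : NormedSpace.exp (z • A) = NormedSpace.exp ((z.re : ℂ) • A) *
      NormedSpace.exp ((Complex.I * (z.im : ℂ)) • A) := by
    rw [← exp_add_of_comm (((Commute.refl A).smul_left _).smul_right _), ← add_smul, ← hz]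
  have h3 : expFamily B D A z = NormedSpace.exp ((Complex.I * (z.im : ℂ)) • B) *
      expFamily B D A (z.re : ℂ) * NormedSpace.exp ((Complex.I * (z.im : ℂ)) • A) := by
    rw [expFamily, h1, h2, expFamily]
    simp only [mul_assoc]
  rw [h3]
  refine (norm_mul_le _ _).trans ?_
  refine (mul_le_of_le_one_right (norm_nonneg _) (norm_exp_I_le hA _)).trans ?_
  refine (norm_mul_le _ _).trans ?_
  exact mul_le_of_le_one_left (norm_nonneg _) (norm_exp_I_le hB _)

theorem norm_expFamily_le (hB : IsSelfAdjoint B) (D : Op κ) (hA : IsSelfAdjoint A) {x C : ℝ}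
    (hx : |x| ≤ C) : ‖expFamily B D A (x : ℂ)‖ ≤
      Real.exp (C * ‖B‖) * ‖D‖ * Real.exp (C * ‖A‖) := by
  have h1 : ∀ {A : Op κ}, IsSelfAdjoint A →
      ‖NormedSpace.exp ((x : ℂ) • A)‖ ≤ Real.exp (C * ‖A‖) := fun {A} hA => by
    refine (norm_exp_le (sa_smul hA x)).trans (Real.exp_le_exp.2 ?_)
    rw [norm_smul, Complex.norm_real, Real.norm_eq_abs]
    exact mul_le_mul_of_nonneg_right hx (norm_nonneg _)
  refine (norm_mul_le _ _).trans (mul_le_mul ((norm_mul_le _ _).trans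
    (mul_le_mul_of_nonneg_right (h1 hB) (norm_nonneg _))) (h1 hA) (norm_nonneg _) (by positivity))

theorem differentiable_exp_smul (A : Op κ) :
    Differentiable ℂ fun z : ℂ => NormedSpace.exp (z • A) :=
  fun z => (hasDerivAt_exp_smul_const A z).differentiableAt

theorem differentiable_expFamily (B D A : Op κ) : Differentiable ℂ (expFamily B D A) :=
  ((differentiable_exp_smul B).mul_const D).mul (differentiable_exp_smul A)

/-- Log-convexity of the norm along `x ↦ e^{xB} D e^{xA}`, by the three lines theorem. -/
theorem log_norm_expFamily_le (hB : IsSelfAdjoint B) (D : Op κ) (hA : IsSelfAdjoint A)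
    (hpos : ∀ x : ℝ, 0 < ‖expFamily B D A (x : ℂ)‖) {x₀ x₁ θ : ℝ} (h0 : 0 ≤ θ) (h1 : θ ≤ 1) :
    Real.log ‖expFamily B D A (((1 - θ) * x₀ + θ * x₁ : ℝ) : ℂ)‖ ≤
      (1 - θ) * Real.log ‖expFamily B D A (x₀ : ℂ)‖ + θ * Real.log ‖expFamily B D A (x₁ : ℂ)‖ := by
  set f : ℂ → Op κ := fun z => expFamily B D A ((x₀ : ℂ) + z * ((x₁ - x₀ : ℝ) : ℂ)) with hf
  have hre : ∀ z : ℂ, ((x₀ : ℂ) + z * ((x₁ - x₀ : ℝ) : ℂ)).re = x₀ + z.re * (x₁ - x₀) := fun z => by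
    rw [Complex.add_re, Complex.ofReal_re, Complex.re_mul_ofReal]
  have hd : Differentiable ℂ f := (differentiable_expFamily B D A).comp (by fun_prop)
  have hbd : BddAbove ((norm ∘ f) '' Complex.HadamardThreeLines.verticalClosedStrip 0 1) := by
    refine ⟨Real.exp ((|x₀| + |x₁ - x₀|) * ‖B‖) * ‖D‖ * Real.exp ((|x₀| + |x₁ - x₀|) * ‖A‖), ?_⟩
    rintro _ ⟨z, hz, rfl⟩
    have hz' : 0 ≤ z.re ∧ z.re ≤ 1 := hz
    refine (norm_expFamily_le_re hB D hA _).trans (norm_expFamily_le hB D hA ?_)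
    rw [hre]
    refine (abs_add_le _ _).trans ?_
    rw [abs_mul, abs_of_nonneg hz'.1]
    gcongr
    exact mul_le_of_le_one_left (abs_nonneg _) hz'.2
  have h := Complex.HadamardThreeLines.norm_le_interp_of_mem_verticalClosedStrip₀₁' f
    (z := (θ : ℂ)) (a := ‖expFamily B D A (x₀ : ℂ)‖) (b := ‖expFamily B D A (x₁ : ℂ)‖)
    (by simpa [Complex.HadamardThreeLines.verticalClosedStrip] using ⟨h0, h1⟩)
    hd.diffContOnCl hbd
    (fun z hz => by
      have hz' : z.re = 0 := hz
      refine (norm_expFamily_le_re hB D hA _).trans (le_of_eq ?_)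
      rw [hre, hz', zero_mul, add_zero])
    (fun z hz => by
      have hz' : z.re = 1 := hz
      refine (norm_expFamily_le_re hB D hA _).trans (le_of_eq ?_)
      rw [hre, hz', one_mul, add_sub_cancel])
  have e1 : f (θ : ℂ) = expFamily B D A (((1 - θ) * x₀ + θ * x₁ : ℝ) : ℂ) := by
    simp only [hf]
    congr 1
    push_cast
    ring
  rw [e1, Complex.ofReal_re] at h
  refine (Real.log_le_log (hpos _) h).trans (le_of_eq ?_)
  rw [Real.log_mul (Real.rpow_pos_of_pos (hpos _) _).ne' (Real.rpow_pos_of_pos (hpos _) _).ne',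
    Real.log_rpow (hpos _), Real.log_rpow (hpos _)]

theorem norm_pos_of_mul_eq_one [Nonempty κ] {Y Z : Op κ} (h : Y * Z = 1) : 0 < ‖Y‖ := by
  classical
  refine norm_pos_iff.2 fun h0 => ?_
  obtain ⟨x⟩ := ‹Nonempty κ›
  have h1 := norm_delta x
  have h2 : (Y * Z) (delta x) = delta x := by rw [h]; rfl
  rw [← h2, h0, zero_mul, zero_apply, norm_zero] at h1
  exact zero_ne_one h1

theorem norm_exp_mul_exp_pos [Nonempty κ] (a b : Op κ) :
    0 < ‖NormedSpace.exp a * NormedSpace.exp b‖ := by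
  refine norm_pos_of_mul_eq_one (Z := NormedSpace.exp (-b) * NormedSpace.exp (-a)) ?_
  calc _ = NormedSpace.exp a * (NormedSpace.exp b * NormedSpace.exp (-b)) *
        NormedSpace.exp (-a) := by
        simp only [mul_assoc]
    _ = 1 := by rw [exp_mul_exp_neg, mul_one, exp_mul_exp_neg]

end Interpolation

/-! ### Convexity, monotonicity and symmetries of the pressure -/

section PressureInequalities

variable {ι : Type} [LinearOrder ι] [Fintype ι] {A B : Op ι}

/-- The operator `e^{xαB̂} e^{x((1-α)Â - sN)}` on the Fock space, where `N` is the number operator. -/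
def interpOp (A B : Op ι) (x α s : ℝ) : Op (Finset ι) :=
  NormedSpace.exp (((x * α : ℝ) : ℂ) • dGamma B) *
    NormedSpace.exp ((x : ℂ) • (((1 - α : ℝ) : ℂ) • dGamma A - (s : ℂ) • dGamma 1))

theorem interpOp_pos (A B : Op ι) (x α s : ℝ) : 0 < ‖interpOp A B x α s‖ := norm_exp_mul_exp_pos _ _

theorem commute_dGamma_one (A : Op ι) : Commute (dGamma A) (dGamma 1) := by
  have h := ann_isCAR.dG_comm A (1 : Op ι)
  rw [mul_one, one_mul, sub_self, map_zero, ← dGamma_eq, ← dGamma_eq] at h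
  exact sub_eq_zero.1 h

/-- The pressure, as well as the norm of `interpOp`, is a spectral sum of the one-particle operator
`(p/2) log (e^{(1-α)A/p} e^{2αB/p} e^{(1-α)A/p})`. -/
theorem exists_sums_pressure {p : ℝ≥0∞} (hp : 0 < p) (hp' : p ≠ ⊤) (hA : IsSelfAdjoint A)
    (hB : IsSelfAdjoint B) (α : ℝ) : ∃ c : ι → ℝ, pressure p A B α = ∑ j, softplus (c j) ∧
      ∀ s : ℝ, ∑ j, max (c j - s) 0 = p.toReal * Real.log ‖interpOp A B (p.toReal⁻¹) α s‖ := by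
  set q := p.toReal with hq
  have hq0 : 0 < q := ENNReal.toReal_pos hp.ne' hp'
  obtain ⟨L, hL, hLe⟩ := exists_log_sandw (sa_smul hA ((1 - α) / q)) (sa_smul hB (2 * α / q))
  obtain ⟨c, hc1, hc2⟩ := exists_spectral_sums (sa_smul hL (q / 2))
  refine ⟨c, ?_, fun s => ?_⟩
  · rw [← hc1, pressure, pressureOp, if_neg hp', ← hq, ← dGamma_smul, ← dGamma_smul,
      sandw_dGamma hLe,
      exp_rpow (isSelfAdjoint_dGamma hL), dGamma_smul]
  -- `Y* Y = e^{dΓ(L - 2s/q)}` for `Y = interpOp A B q⁻¹ α s`, which has the norm `‖Y‖²`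
  · rw [← hc2]
    set Y := interpOp A B q⁻¹ α s with hY
    have hone : IsSelfAdjoint ((s : ℂ) • (1 : Op ι)) := sa_smul (IsSelfAdjoint.one _) s
    have h1 : ((q / 2 : ℝ) : ℂ) • L - (s : ℂ) • (1 : Op ι) =
        ((q / 2 : ℝ) : ℂ) • (L - ((2 * (s / q) : ℝ) : ℂ) • 1) := by
      rw [smul_sub, smul_smul, ← Complex.ofReal_mul]
      congr 3
      field_simp
    set a := (q⁻¹ : ℂ) • (((1 - α : ℝ) : ℂ) • A - (s : ℂ) • (1 : Op ι)) with ha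
    have ha' : a = (((1 - α) / q : ℝ) : ℂ) • A + -(((s / q : ℝ) : ℂ) • (1 : Op ι)) := by
      rw [ha]
      push_cast
      rw [smul_sub, smul_smul, smul_smul, ← sub_eq_add_neg]
      congr 2 <;> ring
    have h2 : NormedSpace.exp (L - ((2 * (s / q) : ℝ) : ℂ) • 1) =
        sandw a (((2 * α / q : ℝ) : ℂ) • B) := by
      have e1 : ∀ r : ℝ, NormedSpace.exp (-((r : ℂ) • (1 : Op ι))) = (Real.exp (-r) : ℂ) • 1 := by
        intro r
        have := Chain.exp_sub_smul_one (0 : Op ι) r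
        rwa [zero_sub, NormedSpace.exp_zero] at this
      rw [sub_eq_add_neg, exp_add_of_comm (((Commute.one_right L).smul_right _).neg_right), hLe, e1,
        sandw, sandw, ha', exp_add_of_comm (((Commute.one_right _).smul_right _).neg_right), e1]
      simp only [mul_smul_comm, smul_mul_assoc, mul_one, smul_smul]
      congr 1
      rw [← Complex.ofReal_mul, ← Real.exp_add]
      congr 2
      ring
    have h3 : NormedSpace.exp (dGamma (L - ((2 * (s / q) : ℝ) : ℂ) • 1)) = star Y * Y := by
      rw [← sandw_dGamma h2, sandw, hY, interpOp, star_mul,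
        (sa_exp (sa_smul (isSelfAdjoint_dGamma hB) _)).star_eq, (sa_exp (sa_smul
          ((sa_smul (isSelfAdjoint_dGamma hA) _).sub (sa_smul (isSelfAdjoint_dGamma
            (IsSelfAdjoint.one _)) _)) _)).star_eq]
      have e1 : NormedSpace.exp (dGamma (((2 * α / q : ℝ) : ℂ) • B)) =
          NormedSpace.exp (((q⁻¹ * α : ℝ) : ℂ) • dGamma B) *
            NormedSpace.exp (((q⁻¹ * α : ℝ) : ℂ) • dGamma B) := by
        rw [← exp_add_of_comm (Commute.refl _), ← add_smul, dGamma_smul]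
        congr 2
        push_cast
        ring
      have e2 : dGamma a =
          ((q⁻¹ : ℝ) : ℂ) • (((1 - α : ℝ) : ℂ) • dGamma A - (s : ℂ) • dGamma 1) := by
        rw [ha, dGamma_smul, dGamma_sub, dGamma_smul, dGamma_smul, Complex.ofReal_inv]
      rw [e1, e2]
      simp only [mul_assoc]
    have hYpos : 0 < ‖Y‖ := interpOp_pos _ _ _ _ _
    rw [h1, dGamma_smul, norm_exp_smul (isSelfAdjoint_dGamma (hL.sub
      (sa_smul (IsSelfAdjoint.one _) _))) (half_pos hq0), h3, CStarRing.norm_star_mul_self,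
      Real.log_rpow (mul_pos hYpos hYpos), Real.log_mul hYpos.ne' hYpos.ne']
    ring

theorem isSelfAdjoint_interp (hA : IsSelfAdjoint A) (α s : ℝ) :
    IsSelfAdjoint (((1 - α : ℝ) : ℂ) • dGamma A - (s : ℂ) • dGamma (1 : Op ι)) :=
  (sa_smul (isSelfAdjoint_dGamma hA) _).sub (sa_smul (isSelfAdjoint_dGamma (IsSelfAdjoint.one _)) _)

/-- Comparison of pressures through the norms of the operators `interpOp`. -/
theorem pressure_le_of_log_norm_le {p p₀ p₁ : ℝ≥0∞} (hp : 0 < p) (hp' : p ≠ ⊤) (hp₀ : 0 < p₀)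
    (hp₀' : p₀ ≠ ⊤) (hp₁ : 0 < p₁) (hp₁' : p₁ ≠ ⊤) {A₀ A₁ B₀ B₁ : Op ι} (hA : IsSelfAdjoint A)
    (hB : IsSelfAdjoint B) (hA₀ : IsSelfAdjoint A₀) (hB₀ : IsSelfAdjoint B₀) (hA₁ : IsSelfAdjoint A₁)
    (hB₁ : IsSelfAdjoint B₁) {α α₀ α₁ θ₀ θ₁ : ℝ} (hθ : θ₀ + θ₁ = 1)
    (h : ∀ s, p.toReal * Real.log ‖interpOp A B (p.toReal⁻¹) α s‖ ≤
      θ₀ * (p₀.toReal * Real.log ‖interpOp A₀ B₀ (p₀.toReal⁻¹) α₀ s‖) +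
      θ₁ * (p₁.toReal * Real.log ‖interpOp A₁ B₁ (p₁.toReal⁻¹) α₁ s‖)) :
    pressure p A B α ≤ θ₀ * pressure p₀ A₀ B₀ α₀ + θ₁ * pressure p₁ A₁ B₁ α₁ := by
  obtain ⟨c, hc1, hc2⟩ := exists_sums_pressure hp hp' hA hB α
  obtain ⟨c₀, hc₀1, hc₀2⟩ := exists_sums_pressure hp₀ hp₀' hA₀ hB₀ α₀
  obtain ⟨c₁, hc₁1, hc₁2⟩ := exists_sums_pressure hp₁ hp₁' hA₁ hB₁ α₁
  rw [hc1, hc₀1, hc₁1]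
  refine sum_softplus_le hθ fun s => ?_
  rw [hc2, hc₀2, hc₁2]
  exact h s

theorem convexOn_pressure {p : ℝ≥0∞} (hp : 0 < p) (hp' : p ≠ ⊤) (hA : IsSelfAdjoint A)
    (hB : IsSelfAdjoint B) : ConvexOn ℝ Set.univ (pressure p A B) := by
  -- by the mixture formula it is enough that `log ‖interpOp A B q⁻¹ α s‖` is convex in `α`, and
  -- `interpOp A B q⁻¹ α s = e^{αB̂/q} e^{(Â - sN)/q} e^{-αÂ/q}` is entire in `α`
  refine ⟨convex_univ, fun α₀ _ α₁ _ θ₀ θ₁ h0 h1 hθ => ?_⟩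
  simp only [smul_eq_mul]
  refine pressure_le_of_log_norm_le hp hp' hp hp' hp hp' hA hB hA hB hA hB hθ fun s => ?_
  set q := p.toReal with hq
  have hq0 : 0 < q := ENNReal.toReal_pos hp.ne' hp'
  have e1 : ∀ α, interpOp A B q⁻¹ α s = expFamily (((q⁻¹ : ℝ) : ℂ) • dGamma B)
      (NormedSpace.exp (((q⁻¹ : ℝ) : ℂ) • (dGamma A - (s : ℂ) • dGamma 1)))
      (((-q⁻¹ : ℝ) : ℂ) • dGamma A) (α : ℂ) := fun α => by
    have hcomm : Commute (((q⁻¹ : ℝ) : ℂ) • (dGamma A - (s : ℂ) • dGamma (1 : Op ι)))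
        ((α : ℂ) • ((-q⁻¹ : ℝ) : ℂ) • dGamma A) :=
      ((((Commute.refl _).sub_left ((commute_dGamma_one A).symm.smul_left _)).smul_left
        _).smul_right _).smul_right _
    rw [interpOp, expFamily, mul_assoc, ← exp_add_of_comm hcomm, smul_smul, ← Complex.ofReal_mul]
    congr 2
    · rw [mul_comm]
    · push_cast
      module
  rw [e1, e1, e1]
  have h2 := log_norm_expFamily_le (x₀ := α₀) (x₁ := α₁) (sa_smul (isSelfAdjoint_dGamma hB) q⁻¹)
    (NormedSpace.exp (((q⁻¹ : ℝ) : ℂ) • (dGamma A - (s : ℂ) • dGamma 1)))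
    (sa_smul (isSelfAdjoint_dGamma hA) (-q⁻¹)) (fun x => by
      rw [← e1]
      exact interpOp_pos _ _ _ _ _) h1 (by linarith : θ₁ ≤ 1)
  rw [show 1 - θ₁ = θ₀ by linarith] at h2
  have h3 := mul_le_mul_of_nonneg_left h2 hq0.le
  linarith

theorem pressure_antitone {p₀ p₁ : ℝ≥0∞} (hp₀ : 0 < p₀) (h01 : p₀ ≤ p₁) (hp₁' : p₁ ≠ ⊤)
    (hA : IsSelfAdjoint A) (hB : IsSelfAdjoint B) (α : ℝ) :
    pressure p₁ A B α ≤ pressure p₀ A B α := by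
  have hp₀' : p₀ ≠ ⊤ := ne_top_of_le_ne_top hp₁' h01
  have hp₁ : 0 < p₁ := hp₀.trans_le h01
  have h := pressure_le_of_log_norm_le (A₀ := A) (B₀ := B) (A₁ := A) (B₁ := B) (α₀ := α) (α₁ := α)
    (α := α) (θ₀ := 1) (θ₁ := 0)
    hp₁ hp₁' hp₀ hp₀' hp₀ hp₀' hA hB hA hB hA hB (add_zero 1) fun s => ?_
  · simpa using h
  set q₀ := p₀.toReal with hq₀
  set q₁ := p₁.toReal with hq₁
  have h0 : 0 < q₀ := ENNReal.toReal_pos hp₀.ne' hp₀'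
  have h1 : 0 < q₁ := ENNReal.toReal_pos hp₁.ne' hp₁'
  have hle : q₀ ≤ q₁ := ENNReal.toReal_mono hp₁' h01
  have e1 : ∀ x, interpOp A B x α s = expFamily ((α : ℂ) • dGamma B) 1
      (((1 - α : ℝ) : ℂ) • dGamma A - (s : ℂ) • dGamma 1) (x : ℂ) := fun x => by
    rw [interpOp, expFamily, mul_one, smul_smul, ← Complex.ofReal_mul]
  -- the convex function `x ↦ log ‖e^{xαB̂} e^{x((1-α)Â - sN)}‖` vanishes at `0`
  have h2 := log_norm_expFamily_le (x₀ := 0) (x₁ := q₀⁻¹) (θ := q₀ / q₁)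
    (sa_smul (isSelfAdjoint_dGamma hB) α) 1 (isSelfAdjoint_interp hA α s) (fun x => by
      rw [← e1]
      exact interpOp_pos _ _ _ _ _) (by positivity) ((div_le_one h1).2 hle)
  have h3 : (1 - q₀ / q₁) * 0 + q₀ / q₁ * q₀⁻¹ = q₁⁻¹ := by
    field_simp
    ring
  have h4 : Real.log ‖expFamily ((α : ℂ) • dGamma B) 1
      (((1 - α : ℝ) : ℂ) • dGamma A - (s : ℂ) • dGamma 1) ((0 : ℝ) : ℂ)‖ ≤ 0 := by
    refine Real.log_nonpos (norm_nonneg _) ?_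
    simp only [expFamily, Complex.ofReal_zero, zero_smul, NormedSpace.exp_zero, mul_one]
    exact norm_one_op_le
  rw [h3] at h2
  rw [e1, e1]
  have h5 : q₁ * (q₀ / q₁) = q₀ := by field_simp
  have h6 := mul_le_mul_of_nonneg_left h2 h1.le
  have h7 : 0 ≤ q₁ * (1 - q₀ / q₁) := by
    rw [mul_sub, h5]
    linarith
  rw [mul_add, ← mul_assoc, ← mul_assoc, h5] at h6
  nlinarith

/-- The pressure depends on the operators `interpOp` only through their norms. -/
theorem pressure_eq_of_norm_eq {p : ℝ≥0∞} (hp : 0 < p) (hp' : p ≠ ⊤) {A' B' : Op ι}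
    (hA : IsSelfAdjoint A) (hB : IsSelfAdjoint B) (hA' : IsSelfAdjoint A') (hB' : IsSelfAdjoint B')
    {α α' : ℝ} (h : ∀ s, ‖interpOp A B (p.toReal⁻¹) α s‖ = ‖interpOp A' B' (p.toReal⁻¹) α' s‖) :
    pressure p A B α = pressure p A' B' α' := by
  refine le_antisymm ?_ ?_
  · have := pressure_le_of_log_norm_le (A₀ := A') (B₀ := B') (A₁ := A') (B₁ := B') (α₀ := α')
      (α₁ := α') (α := α) (θ₀ := 1) (θ₁ := 0) hp hp' hp hp' hp hp' hA hB hA' hB' hA' hB' (add_zero 1)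
      fun s => by rw [h s, one_mul, zero_mul, add_zero]
    simpa using this
  · have := pressure_le_of_log_norm_le (A₀ := A) (B₀ := B) (A₁ := A) (B₁ := B) (α₀ := α)
      (α₁ := α) (α := α') (θ₀ := 1) (θ₁ := 0) hp hp' hp hp' hp hp' hA' hB' hA hB hA hB (add_zero 1)
      fun s => by rw [h s, one_mul, zero_mul, add_zero]
    simpa using this

/-- Exchanging the two operators amounts to replacing `Y*Y` by `YY*`. -/
theorem pressure_swap {p : ℝ≥0∞} (hp : 0 < p) (hp' : p ≠ ⊤) (hA : IsSelfAdjoint A)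
    (hB : IsSelfAdjoint B) (α : ℝ) : pressure p A B α = pressure p B A (1 - α) := by
  refine pressure_eq_of_norm_eq hp hp' hA hB hB hA fun s => ?_
  rw [← norm_star]
  congr 1
  set x := p.toReal⁻¹
  have e1 : ∀ (A : Op ι) (β : ℝ),
      NormedSpace.exp ((x : ℂ) • ((β : ℂ) • dGamma A - (s : ℂ) • dGamma 1)) =
      NormedSpace.exp (((x * β : ℝ) : ℂ) • dGamma A) *
        NormedSpace.exp (-((x * s : ℝ) : ℂ) • dGamma (1 : Op ι)) := fun A β => by
    rw [← exp_add_of_comm (((commute_dGamma_one A).smul_left _).smul_right _)]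
    congr 1
    push_cast
    module
  have e2 : ∀ (A : Op ι) (β : ℝ),
      NormedSpace.exp ((x : ℂ) • ((β : ℂ) • dGamma A - (s : ℂ) • dGamma 1)) =
      NormedSpace.exp (-((x * s : ℝ) : ℂ) • dGamma (1 : Op ι)) *
      NormedSpace.exp (((x * β : ℝ) : ℂ) • dGamma A) := fun A β => by
    rw [← exp_add_of_comm (((commute_dGamma_one A).symm.smul_left _).smul_right _)]
    congr 1
    push_cast
    module
  rw [interpOp, interpOp, star_mul, (sa_exp (sa_smul (isSelfAdjoint_dGamma hB) _)).star_eq,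
    (sa_exp (sa_smul (isSelfAdjoint_interp hA α s) x)).star_eq, e1, sub_sub_cancel, e2, mul_assoc]

theorem interpOp_evolve {h : Op ι} (hh : IsSelfAdjoint h) (A B : Op ι) (x α s t : ℝ) :
    interpOp (evolve h A t) (evolve h B t) x α s = evolve (dGamma h) (interpOp A B x α s) t := by
  have hsa := isSelfAdjoint_dGamma hh
  have h1 : dGamma (1 : Op ι) = evolve (dGamma h) (dGamma 1) t := by
    rw [Chain.evolve_dGamma, ← evolveHom_apply hh, map_one]
  conv_lhs => rw [interpOp, h1, ← Chain.evolve_dGamma, ← Chain.evolve_dGamma]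
  simp only [← evolveHom_apply hsa, interpOp, map_mul, map_exp_op _ (continuous_evolveHom hsa _),
    map_smul, map_sub]

theorem pressure_evolve {p : ℝ≥0∞} (hp : 0 < p) (hp' : p ≠ ⊤) {h : Op ι} (hh : IsSelfAdjoint h)
    (hA : IsSelfAdjoint A) (hB : IsSelfAdjoint B) (t α : ℝ) :
    pressure p (evolve h A t) (evolve h B t) α = pressure p A B α := by
  refine pressure_eq_of_norm_eq hp hp' (isSelfAdjoint_evolve hh hA t) (isSelfAdjoint_evolve hh hB t)
    hA hB fun s => ?_
  rw [interpOp_evolve hh]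
  refine le_antisymm (norm_evolve_le (isSelfAdjoint_dGamma hh) _ _) ?_
  have := norm_evolve_le (isSelfAdjoint_dGamma hh)
    (evolve (dGamma h) (interpOp A B (p.toReal⁻¹) α s) t) (-t)
  rwa [evolve_evolve, add_neg_cancel, evolve_zero] at this

end PressureInequalities

/-! ### Time reversal -/

section TimeReversal

variable {κ : Type}

/-- Complex conjugation on `ℓ²(κ)`. -/
def conjE (κ : Type) : Ell2 κ ≃ₗᵢ⋆[ℂ] Ell2 κ :=
  (starₗᵢ ℂ : lp (fun _ : κ => ℂ) 2 ≃ₗᵢ⋆[ℂ] lp (fun _ : κ => ℂ) 2)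

theorem conjE_apply (u : Ell2 κ) (x : κ) : conjE κ u x = star (u x) := rfl

theorem conjE_conjE (u : Ell2 κ) : conjE κ (conjE κ u) = u :=
  ell2_ext fun x => by rw [conjE_apply, conjE_apply, star_star]

/-- The complex conjugate of an operator. -/
def conjOp (A : Op κ) : Op κ :=
  ((conjE κ).toContinuousLinearEquiv : Ell2 κ →SL[starRingEnd ℂ] Ell2 κ).comp
    (A.comp ((conjE κ).toContinuousLinearEquiv : Ell2 κ →SL[starRingEnd ℂ] Ell2 κ))

theorem conjOp_apply (A : Op κ) (u : Ell2 κ) : conjOp A u = conjE κ (A (conjE κ u)) := rfl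

theorem conjOp_smul (c : ℂ) (A : Op κ) : conjOp (c • A) = star c • conjOp A := by
  ext u
  simp only [conjOp_apply, smul_apply, map_smulₛₗ]
  rfl

variable [DecidableEq κ]

theorem conjE_delta (x : κ) : conjE κ (delta x) = delta x :=
  ell2_ext fun y => by
    rw [conjE_apply, delta_apply]
    split_ifs <;> simp

theorem entry_conjOp (A : Op κ) (x y : κ) : entry (conjOp A) x y = star (entry A x y) := by
  rw [entry_eq, entry_eq, conjOp_apply, conjE_delta, conjE_apply]

/-- Complex conjugation of operators is a real-linear `*`-automorphism. -/
def conjHom (κ : Type) [DecidableEq κ] : Op κ →⋆ₐ[ℝ] Op κ where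
  toFun := conjOp
  map_one' := by
    ext u
    simp [conjOp_apply, conjE_conjE]
  map_mul' A B := by
    ext u
    simp [conjOp_apply, conjE_conjE]
  map_zero' := by
    ext u
    simp [conjOp_apply]
  map_add' A B := by
    ext u
    simp [conjOp_apply]
  commutes' r := by
    ext u
    rw [Algebra.algebraMap_eq_smul_one, ← Complex.coe_smul, conjOp_smul]
    simp [conjOp_apply, conjE_conjE]
  map_star' A := op_ext_entry fun x y => by
    rw [entry_conjOp, entry_star, entry_star, entry_conjOp]

theorem conjHom_apply (A : Op κ) : conjHom κ A = conjOp A := rfl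

theorem continuous_conjHom : Continuous (conjHom κ) := by
  have h : ∀ A : Op κ, ‖conjHom κ A‖ ≤ 1 * ‖A‖ := fun A => by
    refine ContinuousLinearMap.opNorm_le_bound _ (by positivity) fun u => ?_
    rw [conjHom_apply, conjOp_apply, LinearIsometryEquiv.norm_map, one_mul]
    exact (A.le_opNorm _).trans (by rw [LinearIsometryEquiv.norm_map])
  exact AddMonoidHomClass.continuous_of_bound (conjHom κ) 1 h

theorem tr_conjOp (A : Op κ) : tr (conjOp A) = star (tr A) := by
  simp only [tr, entry_conjOp, tsum_star]

theorem conjOp_eq_of_entry_real {A : Op κ} (h : ∀ x y, star (entry A x y) = entry A x y) :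
    conjOp A = A := op_ext_entry fun x y => by rw [entry_conjOp, h]

theorem conjOp_evolve {h k : Op κ} (hh : conjOp h = h) (hk : conjOp k = k) (s : ℝ) :
    conjOp (evolve h k s) = evolve h k (-s) := by
  have h1 : ∀ s : ℝ, conjOp (NormedSpace.exp ((Complex.I * (s : ℂ)) • h)) =
      NormedSpace.exp ((Complex.I * ((-s : ℝ) : ℂ)) • h) := fun s => by
    rw [← conjHom_apply, map_exp_op _ continuous_conjHom, conjHom_apply, conjOp_smul, hh]
    congr 2
    simp
  have h2 : evolve h k s = NormedSpace.exp ((Complex.I * (s : ℂ)) • h) * k *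
      NormedSpace.exp ((Complex.I * ((-s : ℝ) : ℂ)) • h) := by rw [evolve, smul_I_neg]
  have h3 : evolve h k (-s) = NormedSpace.exp ((Complex.I * ((-s : ℝ) : ℂ)) • h) * k *
      NormedSpace.exp ((Complex.I * ((- -s : ℝ) : ℂ)) • h) := by rw [evolve, smul_I_neg _ (-s)]
  rw [h2, h3, ← conjHom_apply, map_mul, map_mul, conjHom_apply, conjHom_apply, conjHom_apply, h1, h1,
    hk]

/-- Time-reversal invariance of the trace formula, for real `h` and `k`. -/
theorem traceFormula_neg {h k : Op κ} (hh : IsSelfAdjoint h) (hk : IsSelfAdjoint k)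
    (hh' : conjOp h = h) (hk' : conjOp k = k) (p : ℝ≥0∞) (t α : ℝ) :
    traceFormula h k p (-t) α = star (traceFormula h k p t α) := by
  have h1 : ∀ γ u, kernelK h k p (-t) γ u = conjOp (kernelK h k p t γ u) := fun γ u => by
    rw [kernelK_eq, kernelK_eq, ← conjHom_apply, map_kernelAB continuous_conjHom p γ
      (isSelfAdjoint_evolve hh hk _) (isSelfAdjoint_evolve hh hk _), conjHom_apply, conjHom_apply,
      conjOp_evolve hh' hk', conjOp_evolve hh' hk']
    congr 2 <;> ring
  have h2 : Complex.I • (k * h - h * k) = -conjOp (Complex.I • (k * h - h * k)) := by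
    rw [conjOp_smul, ← conjHom_apply, map_sub, map_mul, map_mul, conjHom_apply, conjHom_apply, hh',
      hk']
    simp
  have h3 : ∀ γ u, tr (kernelK h k p (-t) γ u * (Complex.I • (k * h - h * k))) =
      -star (tr (kernelK h k p t γ u * (Complex.I • (k * h - h * k)))) := fun γ u => by
    rw [h1, ← tr_conjOp]
    conv_lhs => rw [h2]
    rw [mul_neg, ← conjHom_apply, ← conjHom_apply, ← map_mul, conjHom_apply]
    simp only [tr, entry_eq, neg_apply]
    rw [← tsum_neg]
    rfl
  have h4 : ∀ (f : ℝ → ℂ) (a b : ℝ), ∫ x in a..b, star (f x) = star (∫ x in a..b, f x) :=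
    fun f a b => by
      simp only [intervalIntegral, Complex.star_def, integral_conj, map_sub]
  simp only [traceFormula, h3, intervalIntegral.integral_neg, h4]
  simp

end TimeReversal

/-! ### Convexity, monotonicity and symmetries in the infinite volume -/

namespace Chain

variable (X : Chain)

theorem star_entry_h (x y : ℤ) : star (entry X.h x y) = entry X.h x y := by
  rw [entry_h]
  split_ifs <;> simp

theorem conjOp_h : conjOp X.h = X.h := conjOp_eq_of_entry_real X.star_entry_h

theorem conjOp_proj_mul (s : Set ℤ) : conjOp (proj s * X.h * proj s) = proj s * X.h * proj s := by
  classical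
  refine conjOp_eq_of_entry_real fun x y => ?_
  rw [entry_proj_mul]
  split_ifs
  · exact X.star_entry_h x y
  · exact star_zero _

theorem conjOp_k : conjOp X.k = X.k := by
  rw [k, ← conjHom_apply, map_sub, map_neg, map_ofReal_smul, map_ofReal_smul, conjHom_apply,
    conjHom_apply, hL, hR, conjOp_proj_mul, conjOp_proj_mul]

theorem e_neg_time {p : ℝ≥0∞} (t α : ℝ) : X.e p (-t) α = X.e p t α := by
  rw [e, traceFormula_neg X.isSelfAdjoint_h X.isSelfAdjoint_k X.conjOp_h X.conjOp_k, e,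
    Complex.star_def, Complex.conj_re]

theorem e_zero (p : ℝ≥0∞) (t : ℝ) : X.e p t 0 = 0 := by
  simp [e, traceFormula]

/-- Functions that are continuous in `p` at `p = ⊤` inherit the closed relations between their values
at finite `p`. -/
theorem tendsto_e_top (t α : ℝ) : Tendsto (fun p => X.e p t α) (𝓝[<] ⊤) (𝓝 (X.e ⊤ t α)) := by
  have h := X.continuousOn_e ((⊤ : ℝ≥0∞), t, α) (by simp)
  have h1 : Tendsto (fun p : ℝ≥0∞ => (p, t, α)) (𝓝[<] ⊤)
      (𝓝[{q : ℝ≥0∞ × ℝ × ℝ | 0 < q.1}] ((⊤ : ℝ≥0∞), t, α)) := by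
    refine tendsto_nhdsWithin_iff.2 ⟨((continuous_id.prodMk continuous_const).tendsto _).mono_left
      nhdsWithin_le_nhds, ?_⟩
    filter_upwards [nhdsWithin_le_nhds (lt_mem_nhds ENNReal.zero_lt_top)] with p hp
    exact hp
  exact Tendsto.comp (g := fun q : ℝ≥0∞ × ℝ × ℝ => X.e q.1 q.2.1 q.2.2) h h1

instance : (𝓝[<] (⊤ : ℝ≥0∞)).NeBot := nhdsLT_neBot_of_exists_lt ⟨0, ENNReal.zero_lt_top⟩

theorem eventually_finite : ∀ᶠ p : ℝ≥0∞ in 𝓝[<] ⊤, 0 < p ∧ p ≠ ⊤ := by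
  filter_upwards [nhdsWithin_le_nhds (lt_mem_nhds ENNReal.zero_lt_top), self_mem_nhdsWithin]
    with p hp hp'
  exact ⟨hp, ne_of_lt hp'⟩

theorem convexOn_e {p : ℝ≥0∞} (hp : 0 < p) (t : ℝ) : ConvexOn ℝ Set.univ (X.e p t) := by
  have h1 : ∀ p : ℝ≥0∞, 0 < p ∧ p ≠ ⊤ → ConvexOn ℝ Set.univ (X.e p t) := fun p hp => by
    refine ⟨convex_univ, fun α₀ _ α₁ _ θ₀ θ₁ h0 h1 hθ => ?_⟩
    refine le_of_tendsto_of_tendsto' (X.tendsto_eVol hp.1 t _)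
      (((X.tendsto_eVol hp.1 t α₀).const_smul θ₀).add ((X.tendsto_eVol hp.1 t α₁).const_smul θ₁))
      fun M => ?_
    have hk := X.isSelfAdjoint_kVol M
    have h2 := (convexOn_pressure hp.1 hp.2 hk (isSelfAdjoint_evolve (X.isSelfAdjoint_hVol M) hk
      (-t))).2 (Set.mem_univ α₀) (Set.mem_univ α₁) h0 h1 hθ
    rw [X.eVol_eq_pressure hp.1, X.eVol_eq_pressure hp.1, X.eVol_eq_pressure hp.1]
    simp only [smul_eq_mul] at h2 ⊢
    have h3 : θ₁ = 1 - θ₀ := by linarith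
    subst h3
    linarith
  by_cases hp' : p = ⊤
  · subst hp'
    refine ⟨convex_univ, fun α₀ _ α₁ _ θ₀ θ₁ h0 h1' hθ => ?_⟩
    refine le_of_tendsto_of_tendsto (X.tendsto_e_top t _)
      (((X.tendsto_e_top t α₀).const_smul θ₀).add ((X.tendsto_e_top t α₁).const_smul θ₁)) ?_
    filter_upwards [eventually_finite] with p hp
    exact (h1 p hp).2 (Set.mem_univ α₀) (Set.mem_univ α₁) h0 h1' hθ
  · exact h1 p ⟨hp, hp'⟩

theorem e_antitone (t α : ℝ) : AntitoneOn (fun p => X.e p t α) (Set.Ioi 0) := by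
  have h1 : ∀ p₀ p₁ : ℝ≥0∞, 0 < p₀ → p₀ ≤ p₁ → p₁ ≠ ⊤ → X.e p₁ t α ≤ X.e p₀ t α :=
    fun p₀ p₁ hp₀ hle hp₁ => by
      refine le_of_tendsto_of_tendsto' (X.tendsto_eVol (hp₀.trans_le hle) t _)
        (X.tendsto_eVol hp₀ t _) fun M => ?_
      have hk := X.isSelfAdjoint_kVol M
      rw [X.eVol_eq_pressure hp₀, X.eVol_eq_pressure (hp₀.trans_le hle), pressure_zero_right hp₀ hk,
        pressure_zero_right (hp₀.trans_le hle) hk]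
      exact sub_le_sub_right (pressure_antitone hp₀ hle hp₁ hk
        (isSelfAdjoint_evolve (X.isSelfAdjoint_hVol M) hk (-t)) α) _
  intro p₀ hp₀ p₁ _ hle
  by_cases hp₁' : p₁ = ⊤
  · subst hp₁'
    by_cases hp₀' : p₀ = ⊤
    · rw [hp₀']
    · refine le_of_tendsto (X.tendsto_e_top t α) ?_
      filter_upwards [nhdsWithin_le_nhds (lt_mem_nhds (lt_top_iff_ne_top.2 hp₀')), eventually_finite]
        with p hp hpf
      exact h1 p₀ p hp₀ hp.le hpf.2
  · exact h1 p₀ p₁ hp₀ hle hp₁'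

theorem e_symm {p : ℝ≥0∞} (hp : 0 < p) (t α : ℝ) : X.e p t α = X.e p t (1 - α) := by
  have h1 : ∀ p : ℝ≥0∞, 0 < p ∧ p ≠ ⊤ → X.e p t α = X.e p t (1 - α) := fun p hp => by
    rw [← X.e_neg_time t (1 - α)]
    refine tendsto_nhds_unique (X.tendsto_eVol hp.1 t α) ((X.tendsto_eVol hp.1 (-t) (1 - α)).congr
      fun M => ?_)
    have hk := X.isSelfAdjoint_kVol M
    have hh := X.isSelfAdjoint_hVol M
    have hB := isSelfAdjoint_evolve hh hk
    rw [X.eVol_eq_pressure hp.1, X.eVol_eq_pressure hp.1, pressure_zero_right hp.1 hk,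
      pressure_zero_right hp.1 hk, neg_neg, pressure_swap hp.1 hp.2 hk (hB t),
      ← pressure_evolve hp.1 hp.2 hh (hB t) hk (-t), evolve_evolve, add_neg_cancel, evolve_zero,
      sub_sub_cancel]
  by_cases hp' : p = ⊤
  · subst hp'
    refine tendsto_nhds_unique (X.tendsto_e_top t α) ((X.tendsto_e_top t (1 - α)).congr' ?_)
    filter_upwards [eventually_finite] with p hp
    exact (h1 p hp).symm
  · exact h1 p ⟨hp, hp'⟩

theorem e_one {p : ℝ≥0∞} (hp : 0 < p) (t : ℝ) : X.e p t 1 = 0 := by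
  rw [X.e_symm hp, sub_self, e_zero]

end Chain

/-! ### Convergence of moment generating functions -/

section MomentGeneratingFunctions

/-- A continuous function with an integrable square is the limit of its truncations, with an error
that is controlled by the integral of the square. -/
theorem abs_integral_sub_truncation_le {ν : Measure ℝ} {g w : ℝ → ℝ} (hg : Integrable g ν)
    (hw : Integrable w ν) (hgw : ∀ x, g x ^ 2 ≤ w x) {C R : ℝ} (hC : ∫ x, w x ∂ν ≤ C) (hR : 0 < R)
    (hgR : Integrable (fun x => max (-R) (min (g x) R)) ν) :
    |∫ x, g x ∂ν - ∫ x, max (-R) (min (g x) R) ∂ν| ≤ C / R := by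
  rw [← integral_sub hg hgR]
  refine (abs_integral_le_integral_abs).trans ?_
  calc ∫ x, |g x - max (-R) (min (g x) R)| ∂ν ≤ ∫ x, w x / R ∂ν := by
        refine integral_mono (hg.sub hgR).abs (hw.div_const R) fun x => ?_
        have h1 : |g x - max (-R) (min (g x) R)| ≤ g x ^ 2 / R := by
          rw [le_div_iff₀ hR]
          rcases le_total (g x) R with h | h
          · rw [min_eq_left h]
            rcases le_total (-R) (g x) with h2 | h2
            · rw [max_eq_right h2, sub_self, abs_zero, zero_mul]
              positivity
            · rw [max_eq_left h2, abs_of_nonpos (by linarith)]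
              nlinarith
          · rw [min_eq_right h, max_eq_right (by linarith), abs_of_nonneg (by linarith)]
            nlinarith
        exact h1.trans (div_le_div_of_nonneg_right (hgw x) hR.le)
    _ = (∫ x, w x ∂ν) / R := integral_div _ _
    _ ≤ C / R := div_le_div_of_nonneg_right hC hR.le

theorem integrable_truncation {ν : Measure ℝ} [IsFiniteMeasure ν] {g : ℝ → ℝ} (hg : Continuous g)
    {R : ℝ} (hR : 0 ≤ R) : Integrable (fun x => max (-R) (min (g x) R)) ν := by
  refine Integrable.of_bound (by fun_prop) R (ae_of_all _ fun x => ?_)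
  rw [Real.norm_eq_abs, abs_le]
  exact ⟨le_max_left _ _, max_le (by linarith) (min_le_right _ _)⟩

variable {ι : Type*} {F : Filter ι} {μ : ι → ProbabilityMeasure ℝ}
  {ν : ProbabilityMeasure ℝ}

theorem tendsto_integral_truncation (h : Tendsto μ F (𝓝 ν)) {g : ℝ → ℝ} (hg : Continuous g)
    {R : ℝ} (hR : 0 ≤ R) : Tendsto (fun n => ∫ x, max (-R) (min (g x) R) ∂(μ n : Measure ℝ)) F
      (𝓝 (∫ x, max (-R) (min (g x) R) ∂(ν : Measure ℝ))) :=
  ProbabilityMeasure.tendsto_iff_forall_integral_tendsto.1 h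
    (BoundedContinuousFunction.ofNormedAddCommGroup (fun x => max (-R) (min (g x) R))
      (by fun_prop) R
      fun x => by
        rw [Real.norm_eq_abs, abs_le]
        exact ⟨le_max_left _ _, max_le (by linarith) (min_le_right _ _)⟩)

theorem integrable_of_tendsto_of_bounded [F.NeBot] (h : Tendsto μ F (𝓝 ν)) {w : ℝ → ℝ}
    (hw : Continuous w)
    (hw0 : ∀ x, 0 ≤ w x) {C : ℝ} (hwi : ∀ n, Integrable w (μ n))
    (hC : ∀ n, ∫ x, w x ∂(μ n : Measure ℝ) ≤ C) :
    Integrable w (ν : Measure ℝ) ∧ ∫ x, w x ∂(ν : Measure ℝ) ≤ C := by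
  have hC0 : 0 ≤ C := by
    obtain ⟨n⟩ := F.nonempty_of_neBot
    exact (integral_nonneg hw0).trans (hC n)
  have h1 : ∀ R : ℕ, ∫ x, max (-(R : ℝ)) (min (w x) R) ∂(ν : Measure ℝ) ≤ C := fun R =>
    le_of_tendsto' (tendsto_integral_truncation h hw (Nat.cast_nonneg R)) fun n =>
      (integral_mono (integrable_truncation hw (Nat.cast_nonneg R)) (hwi n) fun x =>
        max_le (by linarith [hw0 x, (Nat.cast_nonneg R : (0 : ℝ) ≤ R)]) (min_le_left _ _)).trans (hC n)
  have h2 : ∫⁻ x, ENNReal.ofReal (w x) ∂(ν : Measure ℝ) ≤ ENNReal.ofReal C := by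
    refine le_of_tendsto' (lintegral_tendsto_of_tendsto_of_monotone
      (f := fun (R : ℕ) x => ENNReal.ofReal (max (-(R : ℝ)) (min (w x) R)))
      (fun R => (ENNReal.continuous_ofReal.comp (by fun_prop)).aemeasurable)
      (ae_of_all _ fun x R S hRS => ENNReal.ofReal_le_ofReal ?_) (ae_of_all _ fun x => ?_))
      fun R => ?_
    · have hRS' : (R : ℝ) ≤ S := by exact_mod_cast hRS
      have h3 : (0 : ℝ) ≤ R := Nat.cast_nonneg R
      rw [max_eq_right (by linarith [le_min (hw0 x) h3]),
        max_eq_right (by linarith [le_min (hw0 x) (h3.trans hRS')])]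
      exact min_le_min_left _ hRS'
    · refine tendsto_const_nhds.congr' ?_
      obtain ⟨R₀, hR₀⟩ := exists_nat_ge (w x)
      filter_upwards [eventually_ge_atTop R₀] with R hR
      have h3 : w x ≤ R := hR₀.trans (by exact_mod_cast hR)
      rw [min_eq_left h3, max_eq_right (by linarith [hw0 x])]
    · have h3 : ∀ x, 0 ≤ max (-(R : ℝ)) (min (w x) R) := fun x =>
        le_max_of_le_right (le_min (hw0 x) (Nat.cast_nonneg R))
      rw [← ofReal_integral_eq_lintegral_ofReal (integrable_truncation hw (Nat.cast_nonneg R))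
        (ae_of_all _ h3)]
      exact ENNReal.ofReal_le_ofReal (h1 R)
  have h3 : Integrable w (ν : Measure ℝ) :=
    ⟨hw.aestronglyMeasurable, by
      rw [hasFiniteIntegral_iff_ofReal (ae_of_all _ hw0)]
      exact h2.trans_lt ENNReal.ofReal_lt_top⟩
  refine ⟨h3, ?_⟩
  rw [← ofReal_integral_eq_lintegral_ofReal h3 (ae_of_all _ hw0)] at h2
  exact (ENNReal.ofReal_le_ofReal_iff hC0).1 h2

/-- Weak convergence extends to continuous functions whose squares have bounded integrals. -/
theorem tendsto_integral_of_sq_bounded [F.NeBot] (h : Tendsto μ F (𝓝 ν)) {g w : ℝ → ℝ}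
    (hg : Continuous g) (hw : Continuous w) (hgw : ∀ x, g x ^ 2 ≤ w x) {C : ℝ}
    (hwi : ∀ n, Integrable w (μ n))
    (hC : ∀ n, ∫ x, w x ∂(μ n : Measure ℝ) ≤ C) : Integrable g (ν : Measure ℝ) ∧
      Tendsto (fun n => ∫ x, g x ∂(μ n : Measure ℝ)) F (𝓝 (∫ x, g x ∂(ν : Measure ℝ))) := by
  have hw0 : ∀ x, 0 ≤ w x := fun x => (sq_nonneg _).trans (hgw x)
  obtain ⟨hwν, hCν⟩ := integrable_of_tendsto_of_bounded h hw hw0 hwi hC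
  have hgi : ∀ (ρ : ProbabilityMeasure ℝ), Integrable w (ρ : Measure ℝ) →
      Integrable g (ρ : Measure ℝ) := fun ρ hρ => by
    refine ((integrable_const 1).add hρ).mono' hg.aestronglyMeasurable (ae_of_all _ fun x => ?_)
    have h1 := hgw x
    have h2 := sq_nonneg (|g x| - 1)
    rw [Real.norm_eq_abs, Pi.add_apply]
    rw [sub_sq, sq_abs] at h2
    nlinarith [abs_nonneg (g x)]
  refine ⟨hgi ν hwν, Metric.tendsto_nhds.2 fun ε hε => ?_⟩
  set R := 3 * (|C| + 1) / ε with hR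
  have hR0 : 0 < R := by positivity
  have h1 : C / R ≤ ε / 3 := by
    rw [div_le_iff₀ hR0, hR]
    have : ε / 3 * (3 * (|C| + 1) / ε) = |C| + 1 := by field_simp
    rw [this]
    linarith [le_abs_self C]
  filter_upwards [Metric.tendsto_nhds.1 (tendsto_integral_truncation h hg hR0.le) (ε / 3)
    (by positivity)] with n hn
  have h2 := abs_integral_sub_truncation_le (hgi _ (hwi n)) (hwi n) hgw (hC n) hR0
    (integrable_truncation hg hR0.le)
  have h3 := abs_integral_sub_truncation_le (hgi _ hwν) hwν hgw hCν hR0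
    (integrable_truncation hg hR0.le)
  rw [Real.dist_eq] at hn ⊢
  rw [abs_lt] at hn ⊢
  rw [abs_le] at h2 h3
  constructor <;> linarith

theorem sq_pow_le_exp (k : ℕ) (x : ℝ) :
    (x ^ k) ^ 2 ≤ (2 * k).factorial * (Real.exp x + Real.exp (-x)) := by
  have h1 := Real.pow_div_factorial_le_exp |x| (abs_nonneg x) (2 * k)
  rw [div_le_iff₀ (by positivity)] at h1
  have h2 : (x ^ k) ^ 2 = |x| ^ (2 * k) := by
    rw [← pow_mul, mul_comm k 2, pow_mul, pow_mul, sq_abs]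
  have h3 : Real.exp |x| ≤ Real.exp x + Real.exp (-x) := by
    rcases abs_cases x with h | h <;> rw [h.1] <;> linarith [Real.exp_pos x, Real.exp_pos (-x)]
  rw [h2]
  refine h1.trans ?_
  rw [mul_comm]
  exact mul_le_mul_of_nonneg_left h3 (by positivity)

theorem eq_of_mgf_eq {μ ν : Measure ℝ} [IsProbabilityMeasure μ] [IsProbabilityMeasure ν]
    (hμ : ∀ z, Integrable (fun x => Real.exp (z * x)) μ)
    (h : ∀ z, ∫ x, Real.exp (z * x) ∂μ = ∫ x, Real.exp (z * x) ∂ν) : μ = ν := by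
  refine Measure.ext_of_complexMGF_id_eq (funext fun z => ?_)
  refine ProbabilityTheory.eqOn_complexMGF_of_mgf (funext h) ?_
  have : ProbabilityTheory.integrableExpSet id μ = Set.univ := Set.eq_univ_of_forall hμ
  change z.re ∈ interior (ProbabilityTheory.integrableExpSet id μ)
  rw [this, interior_univ]
  trivial

/-- If the moment generating functions of a sequence of probability measures on the line converge
everywhere, then so do the measures and all their moments. -/
theorem exists_limit_of_tendsto_mgf {μ : ℕ → Measure ℝ} [∀ n, IsProbabilityMeasure (μ n)]
    (hint : ∀ n z, Integrable (fun x => Real.exp (z * x)) (μ n)) {L : ℝ → ℝ}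
    (hL : ∀ z, Tendsto (fun n => ∫ x, Real.exp (z * x) ∂(μ n)) atTop (𝓝 (L z))) :
    ∃ P : Measure ℝ, IsProbabilityMeasure P ∧
      (∀ f : BoundedContinuousFunction ℝ ℝ,
        Tendsto (fun n => ∫ x, f x ∂(μ n)) atTop (𝓝 (∫ x, f x ∂P))) ∧
      (∀ z, Integrable (fun x => Real.exp (z * x)) P ∧ ∫ x, Real.exp (z * x) ∂P = L z) ∧
      ∀ k : ℕ, Integrable (fun x => x ^ k) P ∧
        Tendsto (fun n => ∫ x, x ^ k ∂(μ n)) atTop (𝓝 (∫ x, x ^ k ∂P)) := by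
  have hbd : ∀ z, ∃ C, ∀ n, ∫ x, Real.exp (z * x) ∂(μ n) ≤ C := fun z => by
    obtain ⟨C, hC⟩ := (hL z).bddAbove_range
    exact ⟨C, fun n => hC ⟨n, rfl⟩⟩
  set w : ℝ → ℝ := fun x => Real.exp x + Real.exp (-x) with hw
  have hwi : ∀ n, Integrable w (μ n) := fun n => by
    have h1 := hint n 1
    have h2 := hint n (-1)
    simp only [one_mul, neg_mul] at h1 h2
    exact h1.add h2
  obtain ⟨C, hC⟩ : ∃ C, ∀ n, ∫ x, w x ∂(μ n) ≤ C := by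
    obtain ⟨C₁, h1⟩ := hbd 1
    obtain ⟨C₂, h2⟩ := hbd (-1)
    refine ⟨C₁ + C₂, fun n => ?_⟩
    have h3 := hint n 1
    have h4 := hint n (-1)
    have h1 := h1 n
    have h2 := h2 n
    simp only [one_mul, neg_mul] at h1 h2 h3 h4
    rw [hw, integral_add h3 h4]
    exact add_le_add h1 h2
  set ν : ℕ → ProbabilityMeasure ℝ := fun n => ⟨μ n, inferInstance⟩ with hν
  -- by the Markov inequality for `w` the measures `μ n` are tight
  have htight : IsTightMeasureSet {((ρ : ProbabilityMeasure ℝ) : Measure ℝ) | ρ ∈ Set.range ν} := by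
    rw [isTightMeasureSet_iff_exists_isCompact_measure_compl_le]
    intro ε hε
    obtain ⟨δ, hδ0, hδ⟩ := ENNReal.lt_iff_exists_nnreal_btwn.1 hε
    have hδ0' : (0 : ℝ) < δ := by exact_mod_cast hδ0
    set R := (|C| + 1) / δ with hR
    have hR0 : 0 < R := by positivity
    refine ⟨Metric.closedBall 0 R, isCompact_closedBall 0 R, ?_⟩
    rintro _ ⟨_, ⟨n, rfl⟩, rfl⟩
    refine le_trans ?_ hδ.le
    have h1 : (μ n) (Metric.closedBall 0 R)ᶜ ≤ μ n {x | R ≤ w x} := by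
      refine measure_mono fun x hx => ?_
      simp only [Set.mem_compl_iff, Metric.mem_closedBall, dist_zero_right, Real.norm_eq_abs,
        not_le] at hx
      refine hx.le.trans ?_
      rcases abs_cases x with h | h <;> rw [h.1]
      · linarith [Real.add_one_le_exp x, Real.exp_pos (-x)]
      · linarith [Real.add_one_le_exp (-x), Real.exp_pos x]
    have h2 := mul_meas_ge_le_integral_of_nonneg (μ := μ n) (f := w) (ae_of_all _ fun x => by
      simp only [hw, Pi.zero_apply]
      positivity) (hwi n) R
    refine h1.trans ?_
    rw [← ENNReal.ofReal_toReal (measure_ne_top (μ n) {x | R ≤ w x}), ← ENNReal.ofReal_coe_nnreal]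
    refine ENNReal.ofReal_le_ofReal ?_
    have h3 : R * (μ n).real {x | R ≤ w x} ≤ R * δ := by
      refine h2.trans ((hC n).trans ?_)
      rw [hR, div_mul_cancel₀ _ hδ0'.ne']
      linarith [le_abs_self C]
    exact le_of_mul_le_mul_left h3 hR0
  -- by the theorem of Prokhorov there are cluster points; each of them has the moment generating
  -- function `L`, so there is only one
  have hK := isCompact_closure_of_isTightMeasureSet htight
  have hmem : ∀ n, ν n ∈ closure (Set.range ν) := fun n => subset_closure ⟨n, rfl⟩
  have hmgf : ∀ (F : Filter ℕ) [F.NeBot] (P : ProbabilityMeasure ℝ), F ≤ atTop → Tendsto ν F (𝓝 P) →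
      ∀ z, Integrable (fun x => Real.exp (z * x)) (P : Measure ℝ) ∧
        ∫ x, Real.exp (z * x) ∂(P : Measure ℝ) = L z := fun F _ P hF hP z => by
    obtain ⟨C', hC'⟩ := hbd (2 * z)
    obtain ⟨h1, h2⟩ := tendsto_integral_of_sq_bounded hP (g := fun x => Real.exp (z * x))
      (w := fun x => Real.exp (2 * z * x)) (by fun_prop) (by fun_prop) (fun x => by
        rw [← Real.exp_nat_mul]
        refine le_of_eq ?_
        congr 1
        push_cast
        ring) (fun n => hint n _) hC'
    exact ⟨h1, tendsto_nhds_unique h2 ((hL z).mono_left hF)⟩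
  obtain ⟨P, -, hP⟩ := hK.exists_mapClusterPt (f := atTop) (u := ν)
    (by simpa using ⟨0, fun n _ => hmem n⟩)
  have hPm : ∀ P : ProbabilityMeasure ℝ, MapClusterPt P atTop ν →
      ∀ z, Integrable (fun x => Real.exp (z * x)) (P : Measure ℝ) ∧
        ∫ x, Real.exp (z * x) ∂(P : Measure ℝ) = L z := fun P hP => by
    obtain ⟨U, hU, hUP⟩ := mapClusterPt_iff_ultrafilter.1 hP
    exact hmgf U P hU hUP
  have hlim : Tendsto ν atTop (𝓝 P) := by
    refine hK.tendsto_nhds_of_unique_mapClusterPt (Eventually.of_forall hmem) fun Q _ hQ => ?_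
    have : IsProbabilityMeasure (Q : Measure ℝ) := Q.2
    have : IsProbabilityMeasure (P : Measure ℝ) := P.2
    refine Subtype.ext (eq_of_mgf_eq (μ := (Q : Measure ℝ)) (ν := (P : Measure ℝ))
      (fun z => (hPm Q hQ z).1) fun z => ?_)
    exact (hPm Q hQ z).2.trans (hPm P hP z).2.symm
  refine ⟨P, inferInstance, ProbabilityMeasure.tendsto_iff_forall_integral_tendsto.1 hlim,
    hmgf atTop P le_rfl hlim, fun k => ?_⟩
  refine tendsto_integral_of_sq_bounded hlim (g := fun x => x ^ k)
    (w := fun x => (2 * k).factorial * w x) (by fun_prop) (by fun_prop) (sq_pow_le_exp k)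
    (fun n => (hwi n).const_mul _) (C := (2 * k).factorial * C) fun n => ?_
  rw [integral_const_mul]
  exact mul_le_mul_of_nonneg_left (hC n) (by positivity)

end MomentGeneratingFunctions

/-! ### Full counting statistics -/

section FiniteSpectrum

variable {κ : Type} [DecidableEq κ] [Fintype κ]

theorem finite_spectrum_op (A : Op κ) : (spectrum ℝ A).Finite := by
  have h0 : Polynomial.aeval A (toMat A).charpoly = 0 := by
    refine op_ext_entry fun x y => ?_
    rw [← toMat_apply, ← toMat_apply]
    have := Polynomial.aeval_algHom_apply (toMat : Op κ →⋆ₐ[ℂ] Matrix κ κ ℂ).toAlgHom A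
      (toMat A).charpoly
    have h1 : toMat (Polynomial.aeval A (toMat A).charpoly) = 0 :=
      this.symm.trans (Matrix.aeval_self_charpoly _)
    rw [h1, map_zero]
  have h1 : (spectrum ℂ A).Finite := by
    refine ((toMat A).charpoly.roots.toFinset.finite_toSet).subset fun z hz => ?_
    have h2 := spectrum.subset_polynomial_aeval A (toMat A).charpoly ⟨z, hz, rfl⟩
    rw [h0] at h2
    simp only [Finset.mem_coe, Multiset.mem_toFinset]
    refine (Polynomial.mem_roots (Matrix.charpoly_monic _).ne_zero).2 ?_
    by_contra h3
    refine h2 ?_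
    rw [spectrum.mem_resolventSet_iff, sub_zero]
    exact (IsUnit.mk0 _ h3).map (algebraMap ℂ (Op κ))
  rw [← spectrum.preimage_algebraMap (R := ℝ) ℂ]
  exact h1.preimage (Complex.ofReal_injective.injOn)

theorem continuousOn_spectrum (A : Op κ) (f : ℝ → ℝ) : ContinuousOn f (spectrum ℝ A) :=
  (finite_spectrum_op A).continuousOn f

/-- The spectral decomposition `f(A) = ∑_s f(s) 1_s(A)`. -/
theorem sum_smul_spectral {A : Op κ} [Fintype (spectrum ℝ A)] (f : ℝ → ℝ) :
    ∑ s : spectrum ℝ A, (f s : ℂ) • cfc (fun x : ℝ => if x = s then (1 : ℝ) else 0) A = cfc f A := by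
  have h1 : ∀ s : spectrum ℝ A, (f s : ℂ) • cfc (fun x : ℝ => if x = s then (1 : ℝ) else 0) A =
      cfc (fun x : ℝ => f s * if x = s then (1 : ℝ) else 0) A := fun s => by
    rw [cfc_const_mul _ _ _ (continuousOn_spectrum A _), Complex.coe_smul]
  simp only [h1]
  rw [← cfc_sum_univ _ A fun s => continuousOn_spectrum A _]
  refine cfc_congr fun x hx => ?_
  rw [Finset.sum_apply, Finset.sum_eq_single ⟨x, hx⟩]
  · simp
  · intro s _ hs
    rw [if_neg fun h => hs (Subtype.ext h.symm), mul_zero]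
  · simp

end FiniteSpectrum

namespace Chain

variable (X : Chain)

/-- The logarithm of the initial density matrix. -/
def logOmega (M : ℕ) : Op (Finset (Vol M)) := dGamma (X.kVol M) - (X.logZ M : ℂ) • 1

theorem isSelfAdjoint_logOmega (M : ℕ) : IsSelfAdjoint (X.logOmega M) :=
  (isSelfAdjoint_dGamma (X.isSelfAdjoint_kVol M)).sub (sa_smul (IsSelfAdjoint.one _) _)

theorem omega_eq (M : ℕ) : X.omega M = NormedSpace.exp (X.logOmega M) := X.omega_eq_exp M

theorem S_eq (M : ℕ) : X.S M = -X.logOmega M := by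
  rw [S, omega_eq, CFC.log_exp _ (X.isSelfAdjoint_logOmega M)]

theorem isSelfAdjoint_S (M : ℕ) : IsSelfAdjoint (X.S M) := by
  rw [S_eq]
  exact (X.isSelfAdjoint_logOmega M).neg

theorem cfc_exp_S (M : ℕ) (a : ℝ) : cfc (fun x : ℝ => Real.exp (a * x)) (X.S M) =
    NormedSpace.exp (((-a : ℝ) : ℂ) • X.logOmega M) := by
  have hS := X.isSelfAdjoint_S M
  have hE : IsSelfAdjoint ((a : ℂ) • X.S M) := sa_smul hS a
  have h1 : cfc (fun x : ℝ => Real.exp (a * x)) (X.S M) = cfc Real.exp ((a : ℂ) • X.S M) := by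
    have := cfc_affine hS Real.continuous_exp a 0
    simpa using this.symm
  rw [h1, CFC.real_exp_eq_normedSpace_exp (ha := hE), S_eq]
  congr 1
  push_cast
  rw [smul_neg, neg_smul]

/-- The two-time expectation `∑ f(s) g(s') ℙ(s, s')`. -/
def twoTime (M : ℕ) (t : ℝ) (f g : ℝ → ℝ) : ℝ :=
  (tr (X.U M (-t) * X.omega M * cfc f (X.S M) * X.U M t * cfc g (X.S M))).re

theorem star_U (M : ℕ) (t : ℝ) : star (X.U M t) = X.U M (-t) := by
  rw [U_eq_exp, star_exp_I (isSelfAdjoint_dGamma (X.isSelfAdjoint_hVol M)), U_neg_eq_exp]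

theorem twoTime_nonneg (M : ℕ) (t : ℝ) {f g : ℝ → ℝ} (hf : ∀ x, 0 ≤ f x) (hg : ∀ x, 0 ≤ g x) :
    0 ≤ X.twoTime M t f g := by
  have h1 : X.omega M * cfc f (X.S M) = cfc (fun x => Real.exp (-1 * x) * f x) (X.S M) := by
    rw [cfc_mul _ _ _ (continuousOn_spectrum _ _) (continuousOn_spectrum _ _), cfc_exp_S, omega_eq]
    simp
  have h2 := star_left_conjugate_nonneg (cfc_nonneg (a := X.S M)
    (f := fun x => Real.exp (-1 * x) * f x) fun x _ => mul_nonneg (Real.exp_pos _).le (hf x))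
    (X.U M t)
  rw [star_U, ← h1] at h2
  have h3 := tr_mul_nonneg h2 (cfc_nonneg (a := X.S M) (f := g) fun x _ => hg x)
  rwa [← mul_assoc] at h3

theorem twoTime_sum (M : ℕ) (t : ℝ) (f g : ℝ → ℝ) [Fintype (spectrum ℝ (X.S M))] :
    ∑ q : spectrum ℝ (X.S M) × spectrum ℝ (X.S M),
      (tr (X.U M (-t) * X.omega M * X.specProj M q.1 * X.U M t * X.specProj M q.2)).re *
        (f q.1 * g q.2) = X.twoTime M t f g := by
  rw [Fintype.sum_prod_type, twoTime, ← sum_smul_spectral f, ← sum_smul_spectral g]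
  simp only [Finset.mul_sum, Finset.sum_mul, ← trL_apply, map_sum, Complex.re_sum, mul_smul_comm,
    smul_mul_assoc, map_smul, smul_eq_mul, Complex.re_ofReal_mul, specProj]
  rw [Finset.sum_comm]
  refine Finset.sum_congr rfl fun s _ => Finset.sum_congr rfl fun s' _ => ?_
  ring

theorem specProj_nonneg_weight (M : ℕ) (t : ℝ) (s s' : ℝ) :
    0 ≤ (tr (X.U M (-t) * X.omega M * X.specProj M s * X.U M t * X.specProj M s')).re :=
  X.twoTime_nonneg M t (fun x => by split_ifs <;> norm_num) (fun x => by split_ifs <;> norm_num)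

theorem integrable_fcs (M : ℕ) (t : ℝ) (f : ℝ → ℝ) : Integrable f (X.fcs M t) := by
  have : Finite (spectrum ℝ (X.S M)) := finite_spectrum_op _
  exact integrable_sum_dirac (fun _ => ENNReal.ofReal_ne_top) (Summable.of_finite)

theorem integral_fcs (M : ℕ) (t : ℝ) (f : ℝ → ℝ) [Fintype (spectrum ℝ (X.S M))] :
    ∫ x, f x ∂(X.fcs M t) = ∑ q : spectrum ℝ (X.S M) × spectrum ℝ (X.S M),
      (tr (X.U M (-t) * X.omega M * X.specProj M q.1 * X.U M t * X.specProj M q.2)).re *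
        f (((q.2 : ℝ) - (q.1 : ℝ)) / t) := by
  rw [fcs, integral_sum_dirac fun _ => ENNReal.ofReal_ne_top, tsum_fintype]
  refine Finset.sum_congr rfl fun q _ => ?_
  rw [ENNReal.toReal_ofReal (X.specProj_nonneg_weight M t _ _), smul_eq_mul]

/-- For functions of `(s' - s) / t` that factorize, the sum over the spectrum is a two-time
correlation function of functions of `S_M`. -/
theorem integral_fcs_mul (M : ℕ) (t : ℝ) {F f g : ℝ → ℝ}
    (h : ∀ s s', F ((s' - s) / t) = f s * g s') : ∫ x, F x ∂(X.fcs M t) = X.twoTime M t f g := by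
  have : Fintype (spectrum ℝ (X.S M)) := (finite_spectrum_op _).fintype
  rw [integral_fcs, ← twoTime_sum]
  simp only [h]

theorem tr_omega (M : ℕ) : tr (X.omega M) = 1 := by
  rw [omega, tr_smul, tr_gibbs, inv_mul_cancel₀]
  exact_mod_cast (Real.exp_pos _).ne'

theorem tr_conj_omega (M : ℕ) (t : ℝ) (A : Op (Finset (Vol M))) :
    tr (X.U M (-t) * X.omega M * X.U M t * A) = tr (X.omega M * evolve (X.H M) A t) := by
  have h1 : evolve (X.H M) A t = X.U M t * A * X.U M (-t) := by
    rw [evolve, U_neg_eq_exp, U_eq_exp, H]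
  rw [h1, mul_assoc, mul_assoc, tr_mul_comm]
  simp only [mul_assoc]

theorem tr_U_neg_mul_mul_U (M : ℕ) (t : ℝ) (A : Op (Finset (Vol M))) :
    tr (X.U M (-t) * X.omega M * A * X.U M t) = tr (X.omega M * A) := by
  rw [mul_assoc (X.U M (-t)), mul_assoc (X.U M (-t)), tr_mul_comm, mul_assoc, U_mul_U_neg, mul_one]

theorem isProbabilityMeasure_fcs (M : ℕ) (t : ℝ) : IsProbabilityMeasure (X.fcs M t) := by
  have h1 : ∫ _, (1 : ℝ) ∂(X.fcs M t) = 1 := by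
    rw [X.integral_fcs_mul M t (f := fun _ => 1) (g := fun _ => 1) fun _ _ => (one_mul 1).symm,
      twoTime, cfc_const_one ℝ (X.S M) (X.isSelfAdjoint_S M),
      mul_one (X.U M (-t) * X.omega M), tr_conj_omega]
    simp [← evolveHom_apply (isSelfAdjoint_dGamma (X.isSelfAdjoint_hVol M)), H, tr_omega]
  rw [integral_const, smul_eq_mul, mul_one, measureReal_def] at h1
  refine ⟨?_⟩
  rw [← ENNReal.ofReal_one, ← h1, ENNReal.ofReal_toReal]
  intro h2
  simp [h2] at h1

theorem integral_exp_fcs (M : ℕ) {t : ℝ} (ht : t ≠ 0) (α : ℝ) :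
    ∫ x, Real.exp (-(t * α * x)) ∂(X.fcs M t) = Real.exp (X.eVol M 2 t (1 - α)) := by
  have := X.isProbabilityMeasure_fcs M t
  have hsa := isSelfAdjoint_dGamma (X.isSelfAdjoint_hVol M)
  have hK := X.isSelfAdjoint_logOmega M
  have hK2 := (hK.map (evolveHom hsa (-t)))
  have h1 : ∫ x, Real.exp (-(t * α * x)) ∂(X.fcs M t) =
      (tr (X.U M (-t) * NormedSpace.exp (((1 - α : ℝ) : ℂ) • X.logOmega M) * X.U M t *
        NormedSpace.exp ((α : ℂ) • X.logOmega M))).re := by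
    rw [X.integral_fcs_mul M t (f := fun x => Real.exp (α * x)) (g := fun x => Real.exp (-α * x))
      fun s s' => ?_, twoTime, cfc_exp_S, cfc_exp_S, omega_eq, mul_assoc (X.U M (-t)),
      ← exp_add_of_comm ((Commute.refl _).smul_right _), neg_neg]
    · congr 6
      push_cast
      module
    · rw [← Real.exp_add]
      congr 1
      field_simp
      ring
  have h2 : X.eVol M 2 t (1 - α) = Real.log (∫ x, Real.exp (-(t * α * x)) ∂(X.fcs M t)) := by
    rw [eVol, if_neg ENNReal.ofNat_ne_top, h1, ENNReal.toReal_ofNat, div_self two_ne_zero]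
    have e1 : ∀ s : ℝ, X.omega M ^ s = NormedSpace.exp ((s : ℂ) • X.logOmega M) := fun s => by
      rw [omega_eq, exp_rpow hK]
    have e2 : ∀ s : ℝ, X.omegaT M t ^ s =
        X.U M (-t) * NormedSpace.exp ((s : ℂ) • X.logOmega M) * X.U M t := fun s => by
      have e3 : X.omegaT M t = NormedSpace.exp (evolveHom hsa (-t) (X.logOmega M)) := by
        rw [omegaT_eq_evolve, omega_eq, ← evolveHom_apply hsa,
          map_exp_op _ (continuous_evolveHom hsa _)]
      rw [e3, exp_rpow hK2, ← map_smul, ← map_exp_op _ (continuous_evolveHom hsa _), evolveHom_apply,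
        evolve, smul_I_neg, neg_neg, U_neg_eq_exp, U_eq_exp]
    have e4 : 0 ≤ X.omega M ^ ((1 - (1 - α)) / 2) * X.omegaT M t ^ (2 * (1 - α) / 2) *
        X.omega M ^ ((1 - (1 - α)) / 2) := by
      have h3 := star_left_conjugate_nonneg (CFC.rpow_nonneg (a := X.omegaT M t)
        (y := 2 * (1 - α) / 2)) (X.omega M ^ ((1 - (1 - α)) / 2))
      rwa [(CFC.rpow_nonneg (a := X.omega M) (y := (1 - (1 - α)) / 2)).isSelfAdjoint.star_eq] at h3
    rw [CFC.rpow_one _ e4, tr_mul_comm, ← mul_assoc, e1, e2, ← exp_add_of_comm (Commute.refl _),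
      ← add_smul, tr_mul_comm]
    have e5 : (((1 - (1 - α)) / 2 : ℝ) : ℂ) + (((1 - (1 - α)) / 2 : ℝ) : ℂ) = (α : ℂ) := by
      push_cast
      ring
    have e6 : 2 * (1 - α) / 2 = 1 - α := by ring
    rw [e5, e6]
  rw [h2, Real.exp_log]
  exact integral_exp_pos (X.integrable_fcs M t _)

/-- The finite-volume cumulant generating functions of `φ` converge. -/
theorem tendsto_mgf_fcs {t : ℝ} (ht : t ≠ 0) (z : ℝ) :
    Tendsto (fun M => ∫ x, Real.exp (z * x) ∂(X.fcs M t)) atTop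
      (𝓝 (Real.exp (X.e 2 t (-(z / t))))) := by
  have h1 : ∀ M, ∫ x, Real.exp (z * x) ∂(X.fcs M t) = Real.exp (X.eVol M 2 t (1 - -(z / t))) := by
    intro M
    rw [← X.integral_exp_fcs M ht]
    congr 1
    funext x
    congr 1
    field_simp
  simp only [h1]
  rw [X.e_symm (by norm_num)]
  exact (Real.continuous_exp.tendsto _).comp (X.tendsto_eVol (by norm_num) t _)

/-- The full counting statistics of the infinitely extended chain. -/
theorem exists_fcs_limit {t : ℝ} (ht : t ≠ 0) : ∃ P : Measure ℝ, IsProbabilityMeasure P ∧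
    (∀ f : BoundedContinuousFunction ℝ ℝ,
      Tendsto (fun M => ∫ x, f x ∂(X.fcs M t)) atTop (𝓝 (∫ x, f x ∂P))) ∧
    (∀ z, Integrable (fun x => Real.exp (z * x)) P ∧
      ∫ x, Real.exp (z * x) ∂P = Real.exp (X.e 2 t (-(z / t)))) ∧
    ∀ k : ℕ, Integrable (fun x => x ^ k) P ∧
      Tendsto (fun n => ∫ x, x ^ k ∂(X.fcs n t)) atTop (𝓝 (∫ x, x ^ k ∂P)) := by
  have := fun M => X.isProbabilityMeasure_fcs M t
  exact exists_limit_of_tendsto_mgf (fun n z => X.integrable_fcs n t _) (X.tendsto_mgf_fcs ht)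

/-- The increment `S_t - S` of the entropy observable. -/
def entropyIncrement (M : ℕ) (t : ℝ) : Op (Finset (Vol M)) :=
  dGamma (X.kVol M - evolve (X.hVol M) (X.kVol M) t)

theorem evolve_S (M : ℕ) (t : ℝ) : evolve (X.H M) (X.S M) t = X.S M + X.entropyIncrement M t := by
  have hsa := isSelfAdjoint_dGamma (X.isSelfAdjoint_hVol M)
  rw [H, ← evolveHom_apply hsa, S_eq, logOmega, map_neg, map_sub, map_smul, map_one,
    evolveHom_apply,
    evolve_dGamma, entropyIncrement, dGamma_sub]
  abel

theorem integral_fcs_id (M : ℕ) {t : ℝ} (ht : t ≠ 0) :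
    t * ∫ x, x ∂(X.fcs M t) = (tr (X.omega M * X.entropyIncrement M t)).re := by
  have : Fintype (spectrum ℝ (X.S M)) := (finite_spectrum_op _).fintype
  have hS := X.isSelfAdjoint_S M
  have h1 : t * ∫ x, x ∂(X.fcs M t) =
      X.twoTime M t (fun _ => 1) id - X.twoTime M t id (fun _ => 1) := by
    rw [← twoTime_sum, ← twoTime_sum, integral_fcs, Finset.mul_sum, ← Finset.sum_sub_distrib]
    refine Finset.sum_congr rfl fun q _ => ?_
    simp only [id]
    field_simp
  rw [h1, twoTime, twoTime, cfc_const_one ℝ (X.S M) hS, cfc_id ℝ (X.S M) hS, mul_one, mul_one,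
    tr_conj_omega, evolve_S, tr_U_neg_mul_mul_U, mul_add, tr_add, Complex.add_re]
  ring

theorem integral_fcs_sq (M : ℕ) {t : ℝ} (ht : t ≠ 0) :
    t ^ 2 * ∫ x, x ^ 2 ∂(X.fcs M t) =
      (tr (X.omega M * (X.entropyIncrement M t * X.entropyIncrement M t))).re := by
  have : Fintype (spectrum ℝ (X.S M)) := (finite_spectrum_op _).fintype
  have hS := X.isSelfAdjoint_S M
  have hsa := isSelfAdjoint_dGamma (X.isSelfAdjoint_hVol M)
  have h1 : t ^ 2 * ∫ x, x ^ 2 ∂(X.fcs M t) = X.twoTime M t (fun _ => 1) (fun x => id x * id x) -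
      2 * X.twoTime M t id id + X.twoTime M t (fun x => id x * id x) (fun _ => 1) := by
    rw [← twoTime_sum, ← twoTime_sum, ← twoTime_sum, integral_fcs, Finset.mul_sum, Finset.mul_sum,
      ← Finset.sum_sub_distrib, ← Finset.sum_add_distrib]
    refine Finset.sum_congr rfl fun q _ => ?_
    simp only [id]
    field_simp
    ring
  have h2 : cfc (fun x : ℝ => id x * id x) (X.S M) = X.S M * X.S M := by
    rw [cfc_mul _ _ _ continuousOn_id continuousOn_id, cfc_id ℝ (X.S M) hS]
  have hcomm : X.omega M * X.S M = X.S M * X.omega M := by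
    rw [omega_eq, S_eq, mul_neg, neg_mul, ((Commute.refl (X.logOmega M)).exp_left).eq]
  set Y := X.entropyIncrement M t with hY
  have h3 : evolve (X.H M) (X.S M * X.S M) t = (X.S M + Y) * (X.S M + Y) := by
    rw [H, ← evolveHom_apply hsa, map_mul, evolveHom_apply, ← evolve_S, H]
  -- cyclicity of the trace
  have h4 : tr (X.U M (-t) * X.omega M * X.S M * X.U M t * X.S M) =
      tr (X.omega M * (X.S M * (X.S M + Y))) := by
    rw [← evolve_S]
    have e1 : evolve (X.H M) (X.S M) t = X.U M t * X.S M * X.U M (-t) := by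
      rw [evolve, U_neg_eq_exp, U_eq_exp, H]
    rw [e1]
    simp only [mul_assoc]
    rw [tr_mul_comm]
    simp only [mul_assoc]
  have h5 : tr (X.omega M * (Y * X.S M)) = tr (X.omega M * (X.S M * Y)) := by
    rw [← mul_assoc, tr_mul_comm, ← mul_assoc, ← hcomm, mul_assoc]
  rw [h1, twoTime, twoTime, twoTime, cfc_const_one ℝ (X.S M) hS, cfc_id ℝ (X.S M) hS, mul_one, mul_one,
    h2, tr_conj_omega, h3, h4, tr_U_neg_mul_mul_U]
  simp only [mul_add, add_mul, tr_add, Complex.add_re, h5]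
  ring

end Chain

/-! ### The algebra of observables of the extended chain -/

section Observables

instance : CompleteSpace obs :=
  (StarSubalgebra.isClosed_topologicalClosure
    (StarAlgebra.adjoin ℂ (Set.range (ann : ℤ → Op (Finset ℤ))))).completeSpace_coe

theorem coe_exp_obs (A : obs) :
    ((NormedSpace.exp A : obs) : Op (Finset ℤ)) = NormedSpace.exp (A : Op (Finset ℤ)) := by
  let _ : NormedAlgebra ℚ obs := NormedAlgebra.restrictScalars ℚ ℂ obs
  let _ : NormedAlgebra ℚ (Op (Finset ℤ)) := NormedAlgebra.restrictScalars ℚ ℂ _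
  exact NormedSpace.map_exp obs.subtype continuous_subtype_val A

theorem annO_isCAR : IsCAR annO where
  anti x y := Subtype.ext (ann_isCAR.anti x y)
  mixed x y := by
    refine Subtype.ext ((ann_isCAR.mixed x y).trans ?_)
    split_ifs <;> rfl

/-- The annihilation operators of the sites in `[-M, M]`. -/
def volO (M : ℕ) (x : Vol M) : obs := annO x.1

theorem volO_isCAR (M : ℕ) : IsCAR (volO M) where
  anti x y := annO_isCAR.anti x.1 y.1
  mixed x y := by
    refine (annO_isCAR.mixed x.1 y.1).trans ?_
    simp only [Subtype.ext_iff]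

theorem dGammaO_eq (M : ℕ) (A : Op ℤ) : dGammaO M A = dG (volO M) (compress (restrict M) A) := by
  rw [dG_apply, dGammaO, ← Finset.sum_coe_sort (Finset.Icc (-(M : ℤ)) M)]
  refine Finset.sum_congr rfl fun x _ => ?_
  rw [← Finset.sum_coe_sort (Finset.Icc (-(M : ℤ)) M)]
  refine Finset.sum_congr rfl fun y _ => ?_
  rw [entry_compress_restrict]
  rfl

/-- The creation operator of the part of `f ∈ ℓ²(ℤ)` that lives on `[-M, M]`. -/
def creaO (M : ℕ) : Ell2 ℤ →L[ℂ] obs := crea (volO M) ∘L restrict M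

theorem norm_creaO_le (M : ℕ) (f : Ell2 ℤ) : ‖creaO M f‖ ≤ ‖f‖ :=
  ((volO_isCAR M).norm_crea_le _).trans (norm_restrict_apply_le M f)

theorem creaO_delta {M : ℕ} {x : ℤ} (hx : x ∈ Finset.Icc (-(M : ℤ)) M) :
    creaO M (delta x) = star (annO x) := by
  rw [creaO, ContinuousLinearMap.comp_apply, restrict_delta M ⟨x, hx⟩, crea_delta]
  rfl

theorem creaO_apply (M : ℕ) (f : Ell2 ℤ) :
    creaO M f = ∑ x ∈ Finset.Icc (-(M : ℤ)) M, f x • star (annO x) := by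
  rw [creaO, ContinuousLinearMap.comp_apply, crea_apply,
    ← Finset.sum_coe_sort (Finset.Icc (-(M : ℤ)) M)]
  refine Finset.sum_congr rfl fun x _ => ?_
  rw [restrict_apply]
  rfl

theorem creaO_of_le {M K : ℕ} (h : M ≤ K) (f : Ell2 ℤ) :
    creaO M f = creaO K (ContinuousLinearMap.adjoint (restrict M) (restrict M f)) := by
  rw [adjoint_restrict_restrict, map_sum, creaO_apply]
  refine Finset.sum_congr rfl fun x hx => ?_
  rw [map_smul, creaO_delta]
  rw [Finset.mem_Icc] at hx ⊢
  omega

theorem cauchySeq_of_norm_sub_le {E F : Type*} [NormedAddCommGroup E] [NormedAddCommGroup F]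
    {a : ℕ → E} {b : ℕ → F} (ha : CauchySeq a) (h : ∀ m n, ‖b m - b n‖ ≤ ‖a m - a n‖) :
    CauchySeq b := by
  refine Metric.cauchySeq_iff.2 fun ε hε => ?_
  obtain ⟨N, hN⟩ := Metric.cauchySeq_iff.1 ha ε hε
  refine ⟨N, fun m hm n hn => ?_⟩
  have h1 := hN m hm n hn
  rw [dist_eq_norm] at h1 ⊢
  exact (h m n).trans_lt h1

theorem exists_tendsto_creaO (f : Ell2 ℤ) : ∃ l, Tendsto (fun M => creaO M f) atTop (𝓝 l) := by
  refine cauchySeq_tendsto_of_complete (cauchySeq_of_norm_sub_le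
    (tendsto_adjoint_restrict f).cauchySeq fun m n => ?_)
  rw [creaO_of_le (le_max_left m n), creaO_of_le (le_max_right m n), ← map_sub]
  exact norm_creaO_le _ _

/-- The set of points where a sequence of contractions converges is closed. -/
theorem isClosed_setOf_tendsto {E F : Type*} [NormedAddCommGroup E] [NormedAddCommGroup F]
    [CompleteSpace F] {f : ℕ → E → F} (hf : ∀ n a b, ‖f n a - f n b‖ ≤ ‖a - b‖) :
    IsClosed {a | ∃ l, Tendsto (fun n => f n a) atTop (𝓝 l)} := by
  refine isClosed_of_closure_subset fun a ha => ?_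
  refine cauchySeq_tendsto_of_complete (Metric.cauchySeq_iff.2 fun ε hε => ?_)
  obtain ⟨b, ⟨l, hl⟩, hb⟩ := Metric.mem_closure_iff.1 ha (ε / 3) (by positivity)
  obtain ⟨N, hN⟩ := Metric.cauchySeq_iff.1 hl.cauchySeq (ε / 3) (by positivity)
  refine ⟨N, fun m hm n hn => ?_⟩
  have h1 := hN m hm n hn
  have h2 : ∀ n, dist (f n a) (f n b) < ε / 3 := fun n => by
    rw [dist_eq_norm]
    rw [dist_eq_norm] at hb
    exact (hf n a b).trans_lt hb
  have h3 := dist_triangle4 (f m a) (f m b) (f n b) (f n a)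
  rw [dist_comm (f n b)] at h3
  linarith [h2 m, h2 n]

theorem dense_obsLoc : Dense (obsLoc : Set obs) := by
  have h1 : (Subtype.val '' (obsLoc : Set obs) : Set (Op (Finset ℤ))) =
      StarAlgebra.adjoin ℂ (Set.range (ann : ℤ → Op (Finset ℤ))) := by
    have h2 := StarAlgHom.map_adjoin obs.subtype (Set.range annO)
    rw [← Set.range_comp] at h2
    exact congrArg (fun S : StarSubalgebra ℂ (Op (Finset ℤ)) => (S : Set (Op (Finset ℤ)))) h2
  intro A
  rw [closure_subtype, h1, ← StarSubalgebra.topologicalClosure_coe]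
  exact A.2

/-- A closed property that is stable under the algebraic operations holds for all observables once it
holds for the creation operators. -/
theorem obs_induction {p : obs → Prop} (hcl : IsClosed {A | p A}) (hcrea : ∀ x, p (star (annO x)))
    (hone : ∀ z : ℂ, p (algebraMap ℂ obs z)) (hadd : ∀ A B, p A → p B → p (A + B))
    (hmul : ∀ A B, p A → p B → p (A * B)) (hstar : ∀ A, p A → p (star A)) (A : obs) : p A := by
  have h1 : (obsLoc : Set obs) ⊆ {A | p A} := fun A hA =>
    StarAlgebra.adjoin_induction (p := fun A _ => p A)
      (by
        rintro _ ⟨x, rfl⟩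
        have := hstar _ (hcrea x)
        rwa [star_star] at this)
      hone (fun _ _ _ _ h1 h2 => hadd _ _ h1 h2) (fun _ _ _ _ h1 h2 => hmul _ _ h1 h2)
      (fun _ _ h => hstar _ h) hA
  have h2 := hcl.closure_subset_iff.2 h1
  rw [dense_obsLoc.closure_eq] at h2
  exact h2 (Set.mem_univ A)

end Observables

/-! ### The dynamics of the extended chain -/

namespace Chain

variable (X : Chain)

theorem HO_eq (M : ℕ) : X.HO M = dG (volO M) (X.hVol M) := dGammaO_eq M X.h

theorem isSelfAdjoint_HO (M : ℕ) : IsSelfAdjoint (X.HO M : Op (Finset ℤ)) := by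
  have h : IsSelfAdjoint (X.HO M) := by
    rw [IsSelfAdjoint, HO_eq, star_dG, (X.isSelfAdjoint_hVol M).star_eq]
  exact h.map obs.subtype

/-- The dynamics generated by `H_M` on the observables of the extended chain. -/
def evolO (M : ℕ) (t : ℝ) (A : obs) : obs :=
  NormedSpace.exp ((Complex.I * (t : ℂ)) • X.HO M) * A *
    NormedSpace.exp (-((Complex.I * (t : ℂ)) • X.HO M))

theorem coe_evolO (M : ℕ) (t : ℝ) (A : obs) :
    (X.evolO M t A : Op (Finset ℤ)) = evolveHom (X.isSelfAdjoint_HO M) t A := by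
  rw [evolveHom_apply, evolve, evolO]
  push_cast
  rw [coe_exp_obs, coe_exp_obs]
  rfl

theorem norm_evolO_sub_le (M : ℕ) (t : ℝ) (A B : obs) :
    ‖X.evolO M t A - X.evolO M t B‖ ≤ ‖A - B‖ := by
  have h1 : ((X.evolO M t A - X.evolO M t B : obs) : Op (Finset ℤ)) =
      evolve (X.HO M : Op (Finset ℤ)) ((A - B : obs) : Op (Finset ℤ)) t := by
    rw [AddSubgroupClass.coe_sub, coe_evolO, coe_evolO, ← map_sub, evolveHom_apply,
      AddSubgroupClass.coe_sub]
  exact (congrArg norm h1).le.trans (norm_evolve_le (X.isSelfAdjoint_HO M) _ t)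

theorem evolO_evolO (M : ℕ) (s t : ℝ) (A : obs) :
    X.evolO M s (X.evolO M t A) = X.evolO M (s + t) A := by
  refine Subtype.ext ?_
  rw [coe_evolO, coe_evolO, coe_evolO, evolveHom_apply, evolveHom_apply, evolveHom_apply,
    evolve_evolve, add_comm]

theorem evolO_creaO (M : ℕ) (t : ℝ) (f : Ell2 (Vol M)) : X.evolO M t (crea (volO M) f) =
    crea (volO M) (NormedSpace.exp ((Complex.I * (t : ℂ)) • X.hVol M) f) := by
  have h := (volO_isCAR M).exp_crea ((Complex.I * (t : ℂ)) • X.hVol M) f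
  rw [map_smul, ← HO_eq] at h
  exact h

theorem tendsto_evolO_crea_sub (t : ℝ) (x : ℤ) :
    Tendsto (fun M => X.evolO M t (star (annO x)) -
      creaO M (NormedSpace.exp ((Complex.I * (t : ℂ)) • X.h) (delta x))) atTop (𝓝 0) := by
  have h1 := ((sConv_hVol X).smul (Complex.I * (t : ℂ))).exp.tendsto (delta x)
  refine squeeze_zero_norm' ?_ h1
  filter_upwards [eventually_ge_atTop x.natAbs] with M hM
  have hx : x ∈ Finset.Icc (-(M : ℤ)) M := by
    rw [Finset.mem_Icc]
    omega
  rw [← creaO_delta hx, creaO, ContinuousLinearMap.comp_apply, evolO_creaO,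
    ContinuousLinearMap.comp_apply, ← map_sub]
  exact (volO_isCAR M).norm_crea_le _

theorem exists_tendsto_evolO (t : ℝ) (A : obs) :
    ∃ l, Tendsto (fun M => X.evolO M t A) atTop (𝓝 l) := by
  -- convergence on the generators follows from the strong convergence of the one-particle dynamics
  -- and `‖a*(f)‖ ≤ ‖f‖`; the set of convergence is a closed `*`-subalgebra
  refine obs_induction (p := fun A => ∃ l, Tendsto (fun M => X.evolO M t A) atTop (𝓝 l))
    (isClosed_setOf_tendsto fun n a b => X.norm_evolO_sub_le n t a b) (fun x => ?_) (fun z => ?_)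
    (fun A B hA hB => ?_) (fun A B hA hB => ?_) (fun A hA => ?_) A
  · obtain ⟨l, hl⟩ := exists_tendsto_creaO
      (NormedSpace.exp ((Complex.I * (t : ℂ)) • X.h) (delta x))
    refine ⟨0 + l, ((X.tendsto_evolO_crea_sub t x).add hl).congr fun M => sub_add_cancel _ _⟩
  · refine ⟨algebraMap ℂ obs z, tendsto_const_nhds.congr fun M => Subtype.ext ?_⟩
    rw [coe_evolO]
    exact (AlgHomClass.commutes (evolveHom (X.isSelfAdjoint_HO M) t) z).symm
  · obtain ⟨l, hl⟩ := hA
    obtain ⟨l', hl'⟩ := hB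
    refine ⟨l + l', (hl.add hl').congr fun M => Subtype.ext ?_⟩
    push_cast
    rw [coe_evolO, coe_evolO, coe_evolO, ← map_add]
    rfl
  · obtain ⟨l, hl⟩ := hA
    obtain ⟨l', hl'⟩ := hB
    refine ⟨l * l', (hl.mul hl').congr fun M => Subtype.ext ?_⟩
    push_cast
    rw [coe_evolO, coe_evolO, coe_evolO, ← map_mul]
    rfl
  · obtain ⟨l, hl⟩ := hA
    refine ⟨star l, hl.star.congr fun M => Subtype.ext ?_⟩
    rw [coe_evolO]
    refine Eq.trans ?_ (map_star (evolveHom (X.isSelfAdjoint_HO M) t) (A : Op (Finset ℤ))).symm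
    rw [← coe_evolO]
    rfl

/-- The thermodynamic limit of the dynamics. -/
def tauFun (t : ℝ) (A : obs) : obs := Classical.choose (X.exists_tendsto_evolO t A)

theorem tendsto_evolO (t : ℝ) (A : obs) :
    Tendsto (fun M => X.evolO M t A) atTop (𝓝 (X.tauFun t A)) :=
  Classical.choose_spec (X.exists_tendsto_evolO t A)

theorem norm_tauFun_sub_le (t : ℝ) (A B : obs) : ‖X.tauFun t A - X.tauFun t B‖ ≤ ‖A - B‖ :=
  le_of_tendsto' ((X.tendsto_evolO t A).sub (X.tendsto_evolO t B)).norm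
    fun M => X.norm_evolO_sub_le M t A B

theorem tauFun_add (t : ℝ) (A B : obs) : X.tauFun t (A + B) = X.tauFun t A + X.tauFun t B := by
  refine tendsto_nhds_unique (X.tendsto_evolO t _)
    (((X.tendsto_evolO t A).add (X.tendsto_evolO t B)).congr fun M => Subtype.ext ?_)
  push_cast
  rw [coe_evolO, coe_evolO, coe_evolO, ← map_add]
  rfl

theorem tauFun_mul (t : ℝ) (A B : obs) : X.tauFun t (A * B) = X.tauFun t A * X.tauFun t B := by
  refine tendsto_nhds_unique (X.tendsto_evolO t _)
    (((X.tendsto_evolO t A).mul (X.tendsto_evolO t B)).congr fun M => Subtype.ext ?_)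
  push_cast
  rw [coe_evolO, coe_evolO, coe_evolO, ← map_mul]
  rfl

theorem tauFun_star (t : ℝ) (A : obs) : X.tauFun t (star A) = star (X.tauFun t A) := by
  refine tendsto_nhds_unique (X.tendsto_evolO t _)
    ((X.tendsto_evolO t A).star.congr fun M => Subtype.ext ?_)
  rw [coe_evolO]
  refine Eq.trans ?_ (map_star (evolveHom (X.isSelfAdjoint_HO M) t) (A : Op (Finset ℤ))).symm
  rw [← coe_evolO]
  rfl

theorem tauFun_smul (t : ℝ) (z : ℂ) (A : obs) : X.tauFun t (z • A) = z • X.tauFun t A := by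
  refine tendsto_nhds_unique (X.tendsto_evolO t _)
    (((X.tendsto_evolO t A).const_smul z).congr fun M => Subtype.ext ?_)
  push_cast
  rw [coe_evolO, coe_evolO, ← map_smul]
  rfl

theorem tauFun_algebraMap (t : ℝ) (z : ℂ) :
    X.tauFun t (algebraMap ℂ obs z) = algebraMap ℂ obs z := by
  refine tendsto_nhds_unique (X.tendsto_evolO t _)
    (tendsto_const_nhds.congr fun M => Subtype.ext ?_)
  rw [coe_evolO]
  exact (AlgHomClass.commutes (evolveHom (X.isSelfAdjoint_HO M) t) z).symm

theorem tauFun_tauFun (s t : ℝ) (A : obs) : X.tauFun s (X.tauFun t A) = X.tauFun (s + t) A := by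
  have h1 :
      Tendsto (fun M => X.evolO M s (X.evolO M t A) - X.evolO M s (X.tauFun t A)) atTop (𝓝 0) :=
    squeeze_zero_norm (fun M => X.norm_evolO_sub_le M s _ _)
      (tendsto_iff_norm_sub_tendsto_zero.1 (X.tendsto_evolO t A))
  have h2 := h1.add (X.tendsto_evolO s (X.tauFun t A))
  rw [zero_add] at h2
  refine tendsto_nhds_unique h2 ((X.tendsto_evolO (s + t) A).congr fun M => ?_)
  rw [evolO_evolO, sub_add_cancel]

theorem tauFun_zero (A : obs) : X.tauFun 0 A = A := by
  refine tendsto_nhds_unique (X.tendsto_evolO 0 A)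
    (tendsto_const_nhds.congr fun M => Subtype.ext ?_)
  rw [coe_evolO, evolveHom_apply, evolve_zero]

theorem continuous_tauFun (A : obs) : Continuous fun t => X.tauFun t A := by
  refine obs_induction (p := fun A => Continuous fun t => X.tauFun t A)
    (isClosed_of_closure_subset fun A hA => ?_) (fun x => ?_) (fun z => ?_)
    (fun A B hA hB => ?_) (fun A B hA hB => ?_) (fun A hA => ?_) A
  · refine continuous_of_uniform_approx_of_continuous fun u hu => ?_
    obtain ⟨ε, hε, hu⟩ := Metric.mem_uniformity_dist.1 hu
    obtain ⟨B, hB, hAB⟩ := Metric.mem_closure_iff.1 hA ε hε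
    refine ⟨_, hB, fun t => hu ?_⟩
    rw [dist_eq_norm] at hAB ⊢
    exact (X.norm_tauFun_sub_le t A B).trans_lt hAB
  · set F : ℝ → Ell2 ℤ := fun t => NormedSpace.exp ((Complex.I * (t : ℂ)) • X.h) (delta x) with hF
    have hFc : Continuous F := by
      have h1 : Continuous fun t : ℝ => NormedSpace.exp ((Complex.I * (t : ℂ)) • X.h) :=
        continuous_exp_op.comp (by fun_prop)
      exact h1.clm_apply continuous_const
    have h1 : ∀ s t, ‖X.tauFun s (star (annO x)) - X.tauFun t (star (annO x))‖ ≤ ‖F s - F t‖ := by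
      intro s t
      have h2 := (((X.tendsto_evolO s (star (annO x))).sub (X.tendsto_evolO t (star (annO x)))).sub
        ((X.tendsto_evolO_crea_sub s x).sub (X.tendsto_evolO_crea_sub t x))).norm
      rw [sub_zero, sub_zero] at h2
      refine le_of_tendsto' h2 fun M => ?_
      refine le_trans (le_of_eq ?_) (norm_creaO_le M (F s - F t))
      rw [map_sub]
      congr 1
      abel
    refine continuous_iff_continuousAt.2 fun s => tendsto_iff_norm_sub_tendsto_zero.2 ?_
    exact squeeze_zero (fun _ => norm_nonneg _) (fun t => h1 t s)
      (tendsto_iff_norm_sub_tendsto_zero.1 (hFc.tendsto s))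
  · simp only [tauFun_algebraMap]
    exact continuous_const
  · simp only [tauFun_add]
    exact hA.add hB
  · simp only [tauFun_mul]
    exact hA.mul hB
  · simp only [tauFun_star]
    exact hA.star

/-- The dynamics of the extended chain. -/
def tau (t : ℝ) : obs ≃⋆ₐ[ℂ] obs where
  toFun := X.tauFun t
  invFun := X.tauFun (-t)
  left_inv A := by rw [tauFun_tauFun, neg_add_cancel, tauFun_zero]
  right_inv A := by rw [tauFun_tauFun, add_neg_cancel, tauFun_zero]
  map_mul' := X.tauFun_mul t
  map_add' := X.tauFun_add t
  map_star' := X.tauFun_star t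
  map_smul' := X.tauFun_smul t

theorem isDynamics_tau : X.IsDynamics X.tau where
  add s t A := (X.tauFun_tauFun s t A).symm
  continuous := X.continuous_tauFun
  tendsto t A _ := X.tendsto_evolO t A

variable {X} {τ : ℝ → obs ≃⋆ₐ[ℂ] obs}

/-- The dynamics is determined by its values on the local observables. -/
theorem IsDynamics.eq_tauFun (hτ : X.IsDynamics τ) (t : ℝ) {A : obs} (hA : A ∈ obsLoc) :
    τ t A = X.tauFun t A :=
  tendsto_nhds_unique (hτ.tendsto t A hA) (X.tendsto_evolO t A)

end Chain

/-! ### Thermodynamic limit of the correlation functions -/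

section Letters

/-- The creation operator (for `b = true`) or the annihilation operator (for `b = false`) of the
one-particle vector `f`. -/
def field {ι : Type} [LinearOrder ι] [Fintype ι] (b : Bool) (f : Ell2 ι) : Op (Finset ι) :=
  if b then crea ann f else star (crea ann f)

/-- A creation or annihilation operator in each volume `[-M, M]`, such that the one-particle vectors
converge as `M → ∞`. -/
structure Letter where
  dag : Bool
  vec : ∀ M, Ell2 (Vol M)
  conv : ∃ u, Tendsto (fun M => ContinuousLinearMap.adjoint (restrict M) (vec M)) atTop (𝓝 u)

/-- The operator of a letter in the volume `[-M, M]`. -/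
def Letter.op (l : Letter) (M : ℕ) : Op (Finset (Vol M)) := field l.dag (l.vec M)

/-- The product of the operators of a list of letters. -/
def word (L : List Letter) (M : ℕ) : Op (Finset (Vol M)) := (L.map fun l => l.op M).prod

theorem word_cons (l : Letter) (L : List Letter) (M : ℕ) : word (l :: L) M = l.op M * word L M :=
  List.prod_cons

theorem word_append (L L' : List Letter) (M : ℕ) : word (L ++ L') M = word L M * word L' M := by
  rw [word, List.map_append, List.prod_append]
  rfl

variable {ι : Type} [LinearOrder ι] [Fintype ι]

theorem field_anticomm (b b' : Bool) (f g : Ell2 ι) :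
    field b f * field b' g + field b' g * field b f =
      (if b = b' then 0 else if b then ⟪g, f⟫_ℂ else ⟪f, g⟫_ℂ) • (1 : Op (Finset ι)) := by
  have h1 := ann_isCAR.crea_anti f g
  cases b <;> cases b'
  · have h2 := congrArg star (ann_isCAR.crea_anti g f)
    rw [star_add, star_mul, star_mul, star_zero] at h2
    simpa [field] using h2
  · simpa [field] using ann_isCAR.anni_crea g f
  · have h2 := ann_isCAR.anni_crea f g
    rw [add_comm] at h2
    simpa [field] using h2
  · simpa [field] using h1

theorem field_add (b : Bool) (f g : Ell2 ι) : field b (f + g) = field b f + field b g := by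
  cases b <;> simp [field]

theorem exp_mul_field {k : Op ι} (hk : IsSelfAdjoint k) (b : Bool) (f : Ell2 ι) :
    NormedSpace.exp (dGamma k) * field b f =
      field b (NormedSpace.exp (if b then k else -k) f) * NormedSpace.exp (dGamma k) := by
  have h1 : ∀ k : Op ι, NormedSpace.exp (dGamma k) * crea ann f =
      crea ann (NormedSpace.exp k f) * NormedSpace.exp (dGamma k) := fun k => (isGamma_exp k).2 f
  cases b
  · have h2 := congrArg star (h1 (-k))
    rw [star_mul, star_mul, (sa_exp (isSelfAdjoint_dGamma hk.neg)).star_eq, dGamma_neg] at h2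
    simp only [field, Bool.false_eq_true, if_false]
    calc _ = NormedSpace.exp (dGamma k) * (star (crea ann f) * NormedSpace.exp (-dGamma k)) *
          NormedSpace.exp (dGamma k) := by
          rw [mul_assoc, mul_assoc, exp_neg_mul_exp, mul_one]
      _ = _ := by rw [h2, ← mul_assoc, exp_mul_exp_neg, one_mul]
  · simpa [field] using h1 k

/-- The parity automorphism changes the sign of the creation operators. -/
theorem evolve_field (b : Bool) (f : Ell2 ι) :
    evolve (dGamma 1) (field b f) Real.pi = -field b f := by
  have hsa : IsSelfAdjoint (dGamma (1 : Op ι)) := isSelfAdjoint_dGamma (IsSelfAdjoint.one _)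
  have h1 : evolve (dGamma 1) (crea ann f) Real.pi = -crea ann f := by
    have h2 := ann_isCAR.exp_crea ((Complex.I * (Real.pi : ℂ)) • (1 : Op ι)) f
    have h3 : NormedSpace.exp ((Complex.I * (Real.pi : ℂ)) • (1 : Op ι)) = -1 := by
      have h4 := (NormedSpace.algebraMap_exp_comm (𝕂 := ℂ) (𝔸 := Op ι) (Complex.I * Real.pi)).symm
      rw [Algebra.algebraMap_eq_smul_one, Algebra.algebraMap_eq_smul_one, ← Complex.exp_eq_exp_ℂ,
        mul_comm Complex.I, Complex.exp_pi_mul_I, neg_one_smul, mul_comm] at h4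
      exact h4
    rw [h3, map_smul, ← dGamma_eq] at h2
    refine h2.trans ?_
    rw [neg_apply, map_neg]
    rfl
  cases b
  · have h2 := map_star (evolveHom hsa Real.pi) (crea ann f)
    rw [evolveHom_apply, evolveHom_apply, h1, star_neg] at h2
    simpa [field] using h2
  · simpa [field] using h1

end Letters

section Convergence

theorem tendsto_inner_of_adjoint {f g : ∀ M, Ell2 (Vol M)} {u v : Ell2 ℤ}
    (hf : Tendsto (fun M => ContinuousLinearMap.adjoint (restrict M) (f M)) atTop (𝓝 u))
    (hg : Tendsto (fun M => ContinuousLinearMap.adjoint (restrict M) (g M)) atTop (𝓝 v)) :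
    Tendsto (fun M => ⟪f M, g M⟫_ℂ) atTop (𝓝 ⟪u, v⟫_ℂ) := by
  refine (hf.inner hg).congr fun M => ?_
  rw [ContinuousLinearMap.adjoint_inner_right, ← ContinuousLinearMap.comp_apply,
    restrict_comp_adjoint]
  rfl

theorem norm_adjoint_restrict_le (M : ℕ) (f : Ell2 (Vol M)) :
    ‖ContinuousLinearMap.adjoint (restrict M) f‖ ≤ ‖f‖ := by
  refine ((ContinuousLinearMap.adjoint (restrict M)).le_of_opNorm_le (c := 1) ?_ f).trans
    (one_mul _).le
  rw [LinearIsometryEquiv.norm_map]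
  exact norm_restrict_le M

theorem SConv.tendsto_apply {A : ∀ M, Op (Vol M)} {A' : Op ℤ} (hA : SConv A A')
    {f : ∀ M, Ell2 (Vol M)} {u : Ell2 ℤ}
    (hf : Tendsto (fun M => ContinuousLinearMap.adjoint (restrict M) (f M)) atTop (𝓝 u)) :
    Tendsto (fun M => ContinuousLinearMap.adjoint (restrict M) (A M (f M))) atTop (𝓝 (A' u)) := by
  obtain ⟨C, hC⟩ := hA.bdd
  have hC0 : 0 ≤ C := (norm_nonneg _).trans (hC 0)
  have h1 : Tendsto (fun M => C * ‖ContinuousLinearMap.adjoint (restrict M) (f M) - u‖ +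
      ‖A M (restrict M u) - restrict M (A' u)‖ +
      ‖ContinuousLinearMap.adjoint (restrict M) (restrict M (A' u)) - A' u‖) atTop
      (𝓝 (C * 0 + 0 + 0)) :=
    (((tendsto_iff_norm_sub_tendsto_zero.1 hf).const_mul C).add (hA.tendsto u)).add
      (tendsto_iff_norm_sub_tendsto_zero.1 (tendsto_adjoint_restrict (A' u)))
  rw [mul_zero, add_zero, add_zero] at h1
  refine tendsto_iff_norm_sub_tendsto_zero.2 (squeeze_zero (fun _ => norm_nonneg _) (fun M => ?_) h1)
  have e1 : f M - restrict M u =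
      restrict M (ContinuousLinearMap.adjoint (restrict M) (f M) - u) := by
    rw [map_sub, ← ContinuousLinearMap.comp_apply, restrict_comp_adjoint]
    rfl
  have e2 : ‖A M (f M - restrict M u)‖ ≤
      C * ‖ContinuousLinearMap.adjoint (restrict M) (f M) - u‖ := by
    refine (A M).le_of_opNorm_le_of_le (hC M) ?_
    rw [e1]
    exact norm_restrict_apply_le M _
  have e3 : ContinuousLinearMap.adjoint (restrict M) (A M (f M)) - A' u =
      ContinuousLinearMap.adjoint (restrict M) (A M (f M - restrict M u)) +
      ContinuousLinearMap.adjoint (restrict M) (A M (restrict M u) - restrict M (A' u)) +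
      (ContinuousLinearMap.adjoint (restrict M) (restrict M (A' u)) - A' u) := by
    simp only [map_sub]
    abel
  rw [e3]
  exact (norm_add₃_le).trans (add_le_add_left (add_le_add
    ((norm_adjoint_restrict_le M _).trans e2) (norm_adjoint_restrict_le M _)) _)

theorem Letter.exists_anticomm (l l' : Letter) : ∃ s : ℕ → ℂ, (∃ c, Tendsto s atTop (𝓝 c)) ∧
    ∀ M, l.op M * l'.op M + l'.op M * l.op M = s M • 1 := by
  obtain ⟨u, hu⟩ := l.conv
  obtain ⟨v, hv⟩ := l'.conv
  refine ⟨_, ?_, fun M => field_anticomm l.dag l'.dag (l.vec M) (l'.vec M)⟩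
  split_ifs
  · exact ⟨0, tendsto_const_nhds⟩
  · exact ⟨_, tendsto_inner_of_adjoint hv hu⟩
  · exact ⟨_, tendsto_inner_of_adjoint hu hv⟩

namespace Chain

variable (X : Chain)

theorem omega_eq_smul (M : ℕ) : X.omega M =
    (tr (X.gibbs M))⁻¹ • NormedSpace.exp (dGamma (X.kVol M)) := by
  rw [← gibbs_eq]
  rfl

/-- Every field operator is the sum of two others that are exchanged when they are moved through the
density matrix `ω_M`. -/
theorem exists_pull_through (l : Letter) : ∃ l' g : Letter, ∀ M,
    l.op M = l'.op M + g.op M ∧ X.omega M * l'.op M = g.op M * X.omega M := by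
  obtain ⟨u, hu⟩ := l.conv
  -- `v = (1 + e^K)⁻¹ v + e^K (1 + e^K)⁻¹ v`, where `ω_M a(v) = a(e^K v) ω_M` for field
  -- operators `a` of both kinds, with `K = k_M` for creation and `K = -k_M` for
  -- annihilation operators
  set K : ∀ M, Op (Vol M) := fun M => if l.dag then X.kVol M else -X.kVol M with hK
  have hKs : ∀ M, IsSelfAdjoint (K M) := fun M => by
    simp only [hK]
    split_ifs
    · exact X.isSelfAdjoint_kVol M
    · exact (X.isSelfAdjoint_kVol M).neg
  obtain ⟨K', hK's, hKc⟩ : ∃ K' : Op ℤ, IsSelfAdjoint K' ∧ SConv K K' := by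
    simp only [hK]
    split_ifs
    · exact ⟨_, X.isSelfAdjoint_k, sConv_kVol X⟩
    · exact ⟨_, X.isSelfAdjoint_k.neg, (sConv_kVol X).neg⟩
  have hinv := hKc.exp.inverse (fun M => (hKs M).exp_nonneg) hK's.exp_nonneg
  refine ⟨⟨l.dag, fun M => Ring.inverse (1 + NormedSpace.exp (K M)) (l.vec M),
    _, hinv.tendsto_apply hu⟩, ⟨l.dag, fun M => NormedSpace.exp (K M)
      (Ring.inverse (1 + NormedSpace.exp (K M)) (l.vec M)),
    _, hKc.exp.tendsto_apply (hinv.tendsto_apply hu)⟩, fun M => ⟨?_, ?_⟩⟩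
  · refine (congrArg (field l.dag) ?_).trans (field_add _ _ _)
    have h1 := Ring.mul_inverse_cancel _ (isUnit_one_add (hKs M).exp_nonneg)
    have h2 := congrArg (fun A : Op (Vol M) => A (l.vec M)) h1
    simp only [mul_apply_eq_comp, add_apply] at h2
    exact h2.symm
  · rw [omega_eq_smul, smul_mul_assoc, mul_smul_comm]
    exact congrArg _ (exp_mul_field (X.isSelfAdjoint_kVol M) l.dag _)

theorem tr_omega_word_of_odd {L : List Letter} (hL : Odd L.length) (M : ℕ) :
    tr (X.omega M * word L M) = 0 := by
  -- conjugation with the parity operator `e^{iπN}` changes the sign of odd words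
  have hsa : IsSelfAdjoint (dGamma (1 : Op (Vol M))) := isSelfAdjoint_dGamma (IsSelfAdjoint.one _)
  have h1 : evolveHom hsa Real.pi (word L M) = (-1) ^ L.length * word L M := by
    clear hL
    induction L with
    | nil => simp [word]
    | cons l L ih =>
      rw [word_cons, map_mul, ih, List.length_cons, pow_succ, evolveHom_apply, Letter.op,
        evolve_field]
      have : Commute ((-1 : Op (Finset (Vol M))) ^ L.length) (field l.dag (l.vec M)) :=
        ((Commute.one_left _).neg_left).pow_left _
      rw [← mul_assoc, neg_mul, mul_neg_one, ← this.eq, neg_mul, neg_mul, mul_assoc]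
  have h2 : Commute (X.omega M) (NormedSpace.exp ((Complex.I * (Real.pi : ℂ)) •
      dGamma (1 : Op (Vol M)))) := by
    rw [omega_eq_smul]
    exact (((commute_dGamma_one _).smul_right _).exp).smul_left _
  have h3 : tr (X.omega M * evolve (dGamma 1) (word L M) Real.pi) = tr (X.omega M * word L M) := by
    rw [evolve, ← mul_assoc, tr_mul_comm, ← mul_assoc, ← mul_assoc,
      mul_assoc _ (X.omega M), h2.eq, ← mul_assoc, exp_neg_mul_exp, one_mul]
  rw [evolveHom_apply, hL.neg_one_pow, neg_one_mul] at h1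
  rw [h1, mul_neg, ← trL_apply, map_neg, trL_apply] at h3
  linear_combination (-1 / 2 : ℂ) * h3

/-- Moving a field operator through a word costs correlation functions of shorter words. -/
theorem exists_tendsto_move {n : ℕ}
    (h : ∀ L : List Letter, L.length = n →
      ∃ c, Tendsto (fun M => tr (X.omega M * word L M)) atTop (𝓝 c))
    (g : Letter) (A L : List Letter) (hn : A.length + L.length = n + 1) :
    ∃ c, Tendsto (fun M => tr (X.omega M * (word A M * word L M * g.op M)) -
      (-1) ^ L.length * tr (X.omega M * (word A M * g.op M * word L M))) atTop (𝓝 c) := by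
  induction L generalizing A with
  | nil =>
    refine ⟨0, tendsto_const_nhds.congr fun M => ?_⟩
    simp [word]
  | cons l L ih =>
    obtain ⟨c, hc⟩ := ih (A ++ [l]) (by simp at hn ⊢; omega)
    obtain ⟨s, ⟨c', hc'⟩, hs⟩ := l.exists_anticomm g
    obtain ⟨c'', hc''⟩ := h (A ++ L) (by simp at hn ⊢; omega)
    refine ⟨_, (hc.add ((hc'.mul hc'').const_mul ((-1) ^ L.length))).congr fun M => ?_⟩
    have e1 : s M * tr (X.omega M * word (A ++ L) M) =
        tr (X.omega M * (word A M * l.op M * g.op M * word L M)) +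
        tr (X.omega M * (word A M * g.op M * (l.op M * word L M))) := by
      have e2 : s M • (X.omega M * word (A ++ L) M) =
          X.omega M * (word A M * (s M • 1) * word L M) := by
        rw [word_append, mul_smul_comm, mul_one, smul_mul_assoc, mul_smul_comm]
      rw [← tr_smul, e2, ← hs, ← tr_add]
      congr 1
      noncomm_ring
    have e3 : word (A ++ [l]) M = word A M * l.op M := by
      rw [word_append]
      simp [word]
    rw [e1, e3, word_cons, List.length_cons, pow_succ, ← mul_assoc (word A M) (l.op M) (word L M)]
    ring

/-- The thermodynamic limit of the correlation functions of the field operators. -/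
theorem exists_tendsto_word (L : List Letter) :
    ∃ c, Tendsto (fun M => tr (X.omega M * word L M)) atTop (𝓝 c) := by
  induction hn : L.length using Nat.strong_induction_on generalizing L with
  | _ n ih =>
  rcases Nat.even_or_odd L.length with he | ho
  -- `ω(aW)` with `a = b + g` and `ω_M b = g ω_M` is `ω(W g) + ω(g W)` by the cyclicity of the
  -- trace, and moving `g` through the odd word `W` leaves only shorter words
  · match L, hn, he with
    | [], _, _ =>
      refine ⟨1, tendsto_const_nhds.congr fun M => ?_⟩
      simp [word, tr_omega]
    | [l], _, he => simp at he
    | l :: l₂ :: L, hn, he =>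
      obtain ⟨l', g, hlg⟩ := X.exists_pull_through l
      obtain ⟨c, hc⟩ := X.exists_tendsto_move (n := L.length)
        (fun L' hL' => ih L'.length (by simp at hn; omega) L' rfl) g [] (l₂ :: L) (by simp)
      refine ⟨c, hc.congr fun M => ?_⟩
      have hodd : Odd (l₂ :: L).length := by
        rw [List.length_cons] at he ⊢
        exact Nat.not_even_iff_odd.1 (Nat.even_add_one.1 he)
      have e1 : tr (X.omega M * (l'.op M * word (l₂ :: L) M)) =
          tr (X.omega M * (word (l₂ :: L) M * g.op M)) := by
        rw [← mul_assoc, (hlg M).2, mul_assoc, tr_mul_comm, mul_assoc]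
      have e2 : word [] M = 1 := rfl
      rw [hodd.neg_one_pow, word_cons l, (hlg M).1, add_mul, mul_add, tr_add, e1, e2, one_mul,
        one_mul]
      ring
  · exact ⟨0, tendsto_const_nhds.congr fun M => (X.tr_omega_word_of_odd ho M).symm⟩

end Chain

end Convergence

/-! ### Observables of the extended chain in finite volume -/

section Intertwining

theorem adjoint_restrictFock_delta (M : ℕ) (S : Finset (Vol M)) :
    ContinuousLinearMap.adjoint (restrictFock M) (delta S) =
      delta (S.map (Function.Embedding.subtype _)) := by
  rw [restrictFock, adjoint_pullback_delta, star_one, one_smul]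

theorem restrictFock_comp_adjoint (M : ℕ) :
    restrictFock M ∘L ContinuousLinearMap.adjoint (restrictFock M) = 1 := by
  refine clm_ext_delta fun S => ?_
  rw [ContinuousLinearMap.comp_apply, adjoint_restrictFock_delta, restrictFock, pullback_delta,
    one_smul]
  rfl

theorem norm_restrictFock_le (M : ℕ) : ‖restrictFock M‖ ≤ 1 := by
  have h := ContinuousLinearMap.norm_adjoint_comp_self
    (ContinuousLinearMap.adjoint (restrictFock M))
  rw [ContinuousLinearMap.adjoint_adjoint, restrictFock_comp_adjoint,
    LinearIsometryEquiv.norm_map] at h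
  have h1 : ‖(1 : Op (Finset (Vol M)))‖ ≤ 1 := norm_one_op_le
  nlinarith [norm_nonneg (restrictFock M)]

theorem norm_compress_restrictFock_le (M : ℕ) (A : Op (Finset ℤ)) :
    ‖compress (restrictFock M) A‖ ≤ ‖A‖ := by
  have h1 := norm_restrictFock_le M
  calc _ ≤ ‖restrictFock M‖ * (‖A‖ * ‖ContinuousLinearMap.adjoint (restrictFock M)‖) :=
        (ContinuousLinearMap.opNorm_comp_le _ _).trans
          (mul_le_mul_of_nonneg_left (ContinuousLinearMap.opNorm_comp_le _ _) (norm_nonneg _))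
    _ ≤ 1 * (‖A‖ * 1) := by
        rw [LinearIsometryEquiv.norm_map]
        gcongr
    _ = ‖A‖ := by rw [mul_one, one_mul]

/-- `A` leaves the Fock space over `ℓ²([-M, M])` invariant, and acts on it as `A'`. -/
def ActsAs (M : ℕ) (A : Op (Finset ℤ)) (A' : Op (Finset (Vol M))) : Prop :=
  A ∘L ContinuousLinearMap.adjoint (restrictFock M) =
    ContinuousLinearMap.adjoint (restrictFock M) ∘L A'

variable {M : ℕ} {A B : Op (Finset ℤ)} {A' B' : Op (Finset (Vol M))}

theorem ActsAs.compress_eq (h : ActsAs M A A') : compress (restrictFock M) A = A' := by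
  rw [compress, h, ← ContinuousLinearMap.comp_assoc, restrictFock_comp_adjoint]
  rfl

theorem ActsAs.one : ActsAs M 1 1 := rfl

theorem ActsAs.mul (hA : ActsAs M A A') (hB : ActsAs M B B') : ActsAs M (A * B) (A' * B') := by
  change A ∘L B ∘L _ = _ ∘L A' ∘L B'
  rw [hB, ← ContinuousLinearMap.comp_assoc, hA, ContinuousLinearMap.comp_assoc]

theorem ActsAs.smul (z : ℂ) (hA : ActsAs M A A') : ActsAs M (z • A) (z • A') := by
  rw [ActsAs, ContinuousLinearMap.smul_comp, hA, ContinuousLinearMap.comp_smul]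

theorem ActsAs.sum {α : Type*} {s : Finset α} {A : α → Op (Finset ℤ)}
    {A' : α → Op (Finset (Vol M))} (h : ∀ a ∈ s, ActsAs M (A a) (A' a)) :
    ActsAs M (∑ a ∈ s, A a) (∑ a ∈ s, A' a) := by
  rw [ActsAs, ContinuousLinearMap.finsetSum_comp, ContinuousLinearMap.comp_finsetSum]
  exact Finset.sum_congr rfl h

theorem jwSign_map (x : Vol M) (S : Finset (Vol M)) :
    jwSign x.1 (S.map (Function.Embedding.subtype _)) = jwSign x S := by
  rw [jwSign, jwSign, Finset.filter_map, Finset.card_map]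
  rfl

theorem toggle_map (x : Vol M) (S : Finset (Vol M)) :
    toggle x.1 (S.map (Function.Embedding.subtype _)) =
      (toggle x S).map (Function.Embedding.subtype _) := by
  ext y
  simp only [mem_toggle, Finset.mem_map, Function.Embedding.subtype_apply]
  constructor
  · rintro (⟨h1, z, hz, rfl⟩ | ⟨rfl, h⟩)
    · exact ⟨z, Or.inl ⟨fun h => h1 (congrArg Subtype.val h), hz⟩, rfl⟩
    · exact ⟨x, Or.inr ⟨rfl, fun h' => h ⟨x, h', rfl⟩⟩, rfl⟩
  · rintro ⟨z, ⟨h1, hz⟩ | ⟨rfl, h⟩, rfl⟩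
    · exact Or.inl ⟨fun h => h1 (Subtype.ext h), z, hz, rfl⟩
    · refine Or.inr ⟨rfl, ?_⟩
      rintro ⟨w, hw, hwz⟩
      rw [Subtype.ext hwz] at hw
      exact h hw

theorem mem_map_subtype (x : Vol M) (S : Finset (Vol M)) :
    x.1 ∈ S.map (Function.Embedding.subtype _) ↔ x ∈ S :=
  Finset.mem_map' (Function.Embedding.subtype _)

theorem actsAs_ann (x : Vol M) : ActsAs M (ann x.1) (ann x) := by
  refine clm_ext_delta fun S => ?_
  have h : ann x (delta S) = if x ∈ S then jwSign x S • delta (toggle x S) else 0 := by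
    convert ann_delta x S
  rw [ContinuousLinearMap.comp_apply, ContinuousLinearMap.comp_apply, adjoint_restrictFock_delta,
    ann_delta, h, jwSign_map, toggle_map]
  simp only [mem_map_subtype]
  split_ifs
  · rw [map_smul, adjoint_restrictFock_delta]
  · rw [map_zero]

theorem actsAs_star_ann (x : Vol M) : ActsAs M (star (ann x.1)) (star (ann x)) := by
  refine clm_ext_delta fun S => ?_
  have h : star (ann x) (delta S) = if x ∈ S then 0 else jwSign x S • delta (toggle x S) := by
    convert star_ann_delta x S
  rw [ContinuousLinearMap.comp_apply, ContinuousLinearMap.comp_apply, adjoint_restrictFock_delta,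
    star_ann_delta, h, jwSign_map, toggle_map]
  simp only [mem_map_subtype]
  split_ifs
  · rw [map_zero]
  · rw [map_smul, adjoint_restrictFock_delta]

theorem actsAs_dG (A : Op (Vol M)) : ActsAs M (dG (volO M) A : obs) (dGamma A) := by
  rw [dG_apply, dGamma]
  push_cast
  exact ActsAs.sum fun x _ => ActsAs.sum fun y _ =>
    ActsAs.smul _ ((actsAs_star_ann x).mul (actsAs_ann y))

end Intertwining

/-! ### The initial state of the extended chain -/

namespace Chain

variable (X : Chain)

theorem omega_nonneg (M : ℕ) : 0 ≤ X.omega M := by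
  rw [omega_eq]
  exact (X.isSelfAdjoint_logOmega M).exp_nonneg

theorem norm_tr_omega_mul_le (M : ℕ) (B : Op (Finset (Vol M))) : ‖tr (X.omega M * B)‖ ≤ ‖B‖ := by
  refine (norm_tr_mul_le (X.omega_nonneg M) B).trans ?_
  rw [tr_omega, Complex.one_re, one_mul]

/-- The finite-volume initial state `A ↦ tr(ω_M A)`, on the observables of the extended chain. -/
def stateVol (M : ℕ) : obs →L[ℂ] ℂ :=
  LinearMap.mkContinuous
    { toFun := fun A => tr (X.omega M * compress (restrictFock M) (A : Op (Finset ℤ)))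
      map_add' := fun A B => by
        rw [AddMemClass.coe_add, compress_add, mul_add, tr_add]
      map_smul' := fun z A => by
        rw [SetLike.val_smul, compress_smul, mul_smul_comm, tr_smul]
        rfl }
    1 fun A => by
      rw [one_mul]
      exact (X.norm_tr_omega_mul_le M _).trans (norm_compress_restrictFock_le M _)

theorem stateVol_apply (M : ℕ) (A : obs) : X.stateVol M A =
    tr (X.omega M * compress (restrictFock M) (A : Op (Finset ℤ))) := rfl

theorem norm_stateVol_le (M : ℕ) (A : obs) : ‖X.stateVol M A‖ ≤ ‖A‖ :=
  (X.norm_tr_omega_mul_le M _).trans (norm_compress_restrictFock_le M _)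

theorem stateVol_of_actsAs {M : ℕ} {A : obs} {A' : Op (Finset (Vol M))}
    (h : ActsAs M (A : Op (Finset ℤ)) A') : X.stateVol M A = tr (X.omega M * A') := by
  rw [stateVol_apply, h.compress_eq]

/-- The letter of the operator `a_x*` or `a_x`. -/
def siteLetter (b : Bool) (x : ℤ) : Letter :=
  ⟨b, fun M => restrict M (delta x), delta x, tendsto_adjoint_restrict _⟩

theorem eventually_actsAs (b : Bool) (x : ℤ) : ∀ᶠ M in atTop,
    ActsAs M ((if b then star (annO x) else annO x : obs) : Op (Finset ℤ))
      ((siteLetter b x).op M) := by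
  filter_upwards [eventually_ge_atTop x.natAbs] with M hM
  have hx : x ∈ Finset.Icc (-(M : ℤ)) M := by
    rw [Finset.mem_Icc]
    omega
  have h1 : field true (restrict M (delta x)) = star (ann (⟨x, hx⟩ : Vol M)) := by
    rw [show restrict M (delta x) = delta (⟨x, hx⟩ : Vol M) from restrict_delta M ⟨x, hx⟩]
    rw [field, if_pos rfl]
    convert crea_delta ann (⟨x, hx⟩ : Vol M)
  cases b
  · have h2 : field false (restrict M (delta x)) = ann (⟨x, hx⟩ : Vol M) := by
      rw [← star_star (ann _), ← h1]
      rfl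
    rw [Letter.op, siteLetter, h2]
    exact actsAs_ann (⟨x, hx⟩ : Vol M)
  · rw [Letter.op, siteLetter, h1]
    exact actsAs_star_ann (⟨x, hx⟩ : Vol M)

theorem exists_tendsto_stateVol (A : obs) : ∃ c, Tendsto (fun M => X.stateVol M A) atTop (𝓝 c) := by
  have hcl : IsClosed {A | ∃ c, Tendsto (fun M => X.stateVol M A) atTop (𝓝 c)} :=
    isClosed_setOf_tendsto fun M A B => by
      rw [← map_sub]
      exact X.norm_stateVol_le M _
  have h1 : (obsLoc : Set obs) ⊆ {A | ∃ c, Tendsto (fun M => X.stateVol M A) atTop (𝓝 c)} := by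
    intro A hA
    have h2 : A ∈ Submodule.span ℂ
        (Submonoid.closure (Set.range annO ∪ star (Set.range annO)) : Set obs) := by
      rw [← Algebra.adjoin_eq_span]
      exact hA
    clear hA
    induction h2 using Submodule.span_induction with
    | mem A hA =>
      obtain ⟨l, hl, rfl⟩ := Submonoid.exists_list_of_mem_closure hA
      have h3 : ∃ L : List Letter, ∀ᶠ M in atTop, ActsAs M (l.prod : obs) (word L M) := by
        clear hA
        induction l with
        | nil => exact ⟨[], Eventually.of_forall fun M => ActsAs.one⟩
        | cons a l ih =>
          obtain ⟨L, hL⟩ := ih fun y hy => hl y (List.mem_cons_of_mem _ hy)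
          have h4 : ∃ (b : Bool) (x : ℤ), a = if b then star (annO x) else annO x := by
            rcases hl a List.mem_cons_self with ⟨x, hx⟩ | ⟨x, hx⟩
            · exact ⟨false, x, hx.symm⟩
            · exact ⟨true, x, by simp [hx]⟩
          obtain ⟨b, x, rfl⟩ := h4
          refine ⟨siteLetter b x :: L, ?_⟩
          filter_upwards [hL, eventually_actsAs b x] with M h5 h6
          rw [List.prod_cons, word_cons]
          exact h6.mul h5
      obtain ⟨L, hL⟩ := h3
      obtain ⟨c, hc⟩ := X.exists_tendsto_word L
      refine ⟨c, hc.congr' ?_⟩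
      filter_upwards [hL] with M h4
      exact (X.stateVol_of_actsAs h4).symm
    | zero => exact ⟨0, by simp⟩
    | add A B _ _ hA hB =>
      obtain ⟨a, ha⟩ := hA
      obtain ⟨b, hb⟩ := hB
      exact ⟨a + b, by simpa only [map_add] using ha.add hb⟩
    | smul z A _ hA =>
      obtain ⟨a, ha⟩ := hA
      exact ⟨z * a, by simpa only [map_smul, smul_eq_mul] using ha.const_mul z⟩
  have h2 := hcl.closure_subset_iff.2 h1
  rw [dense_obsLoc.closure_eq] at h2
  exact h2 (Set.mem_univ A)

/-- The initial state of the extended chain. -/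
def state : obs →L[ℂ] ℂ :=
  continuousLinearMapOfTendsto (g := X.stateVol)
    (f := fun A => Classical.choose (X.exists_tendsto_stateVol A))
    (tendsto_pi_nhds.2 fun A => Classical.choose_spec (X.exists_tendsto_stateVol A))

theorem tendsto_stateVol (A : obs) : Tendsto (fun M => X.stateVol M A) atTop (𝓝 (X.state A)) :=
  Classical.choose_spec (X.exists_tendsto_stateVol A)

theorem compress_nonneg {M : ℕ} (A : obs) :
    0 ≤ compress (restrictFock M) ((star A * A : obs) : Op (Finset ℤ)) := by
  have h := ContinuousLinearMap.IsPositive.adjoint_conj (T := (star A * A : Op (Finset ℤ)))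
    ((ContinuousLinearMap.nonneg_iff_isPositive _).1 (star_mul_self_nonneg _))
    (ContinuousLinearMap.adjoint (restrictFock M))
  rw [ContinuousLinearMap.adjoint_adjoint] at h
  exact (ContinuousLinearMap.nonneg_iff_isPositive _).2 h

theorem stateVol_star (M : ℕ) (A : obs) : X.stateVol M (star A) = star (X.stateVol M A) := by
  have h1 : compress (restrictFock M) ((star A : obs) : Op (Finset ℤ)) =
      star (compress (restrictFock M) (A : Op (Finset ℤ))) := by
    rw [compress, compress, ContinuousLinearMap.star_eq_adjoint, ContinuousLinearMap.adjoint_comp,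
      ContinuousLinearMap.adjoint_comp, ContinuousLinearMap.adjoint_adjoint,
      ContinuousLinearMap.comp_assoc]
    rfl
  rw [stateVol_apply, stateVol_apply, h1, ← tr_star, star_mul, tr_mul_comm,
    (X.omega_nonneg M).isSelfAdjoint.star_eq]

theorem isInitialState_state : X.IsInitialState X.state where
  one := by
    refine tendsto_nhds_unique (X.tendsto_stateVol 1) (tendsto_const_nhds.congr fun M => ?_)
    rw [X.stateVol_of_actsAs ActsAs.one, mul_one, tr_omega]
  nonneg A := by
    have h1 := X.tendsto_stateVol (star A * A)
    have h2 : ∀ M, 0 ≤ (X.stateVol M (star A * A)).re := fun M =>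
      tr_mul_nonneg (X.omega_nonneg M) (compress_nonneg A)
    have h3 : ∀ M, (X.stateVol M (star A * A)).im = 0 := fun M => by
      have := X.stateVol_star M (star A * A)
      rw [star_mul, star_star] at this
      exact Complex.conj_eq_iff_im.1 this.symm
    refine ⟨(X.state (star A * A)).re, ge_of_tendsto' ((Complex.continuous_re.tendsto _).comp h1) h2,
      Complex.ext rfl ?_⟩
    refine tendsto_nhds_unique ((Complex.continuous_im.tendsto _).comp h1)
      (tendsto_const_nhds.congr fun M => ?_)
    exact ((h3 M).trans (Complex.ofReal_im _).symm).symm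
  tendsto A _ := X.tendsto_stateVol A

variable {X} {ω : obs →L[ℂ] ℂ}

/-- The initial state is determined by its values on the local observables. -/
theorem IsInitialState.eq_state (hω : X.IsInitialState ω) : ω = X.state := by
  refine DFunLike.coe_injective (Continuous.ext_on dense_obsLoc ω.continuous X.state.continuous
    fun A hA => tendsto_nhds_unique (hω.tendsto A hA) (X.tendsto_stateVol A))

theorem tendsto_stateVol_of_tendsto {A : ℕ → obs} {B : obs} (h : Tendsto A atTop (𝓝 B)) :
    Tendsto (fun M => X.stateVol M (A M)) atTop (𝓝 (X.state B)) := by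
  have h1 : Tendsto (fun M => X.stateVol M (A M - B)) atTop (𝓝 0) :=
    squeeze_zero_norm (fun M => X.norm_stateVol_le M _) (tendsto_iff_norm_sub_tendsto_zero.1 h)
  have h2 := h1.add (X.tendsto_stateVol B)
  rw [zero_add] at h2
  exact h2.congr fun M => by rw [map_sub, sub_add_cancel]

theorem state_star (A : obs) : X.state (star A) = star (X.state A) :=
  tendsto_nhds_unique (X.tendsto_stateVol _)
    ((X.tendsto_stateVol A).star.congr fun M => (X.stateVol_star M A).symm)

end Chain

/-! ### Entropy production -/

namespace Chain

variable (X : Chain)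

theorem fluxes_eq (M : ℕ) :
    -((X.betaL : ℂ) • -(Complex.I • (X.HO M * dGammaO M X.hL - dGammaO M X.hL * X.HO M))) -
      (X.betaR : ℂ) • -(Complex.I • (X.HO M * dGammaO M X.hR - dGammaO M X.hR * X.HO M)) =
    dG (volO M) (flow (X.hVol M) (X.kVol M)) := by
  rw [HO_eq, dGammaO_eq, dGammaO_eq, (volO_isCAR M).dG_comm, (volO_isCAR M).dG_comm]
  simp only [← map_smul, ← map_neg, ← map_sub]
  congr 1
  change -((X.betaL : ℂ) • -(Complex.I • (X.hVol M * X.hLVol M - X.hLVol M * X.hVol M))) -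
    (X.betaR : ℂ) • -(Complex.I • (X.hVol M * X.hRVol M - X.hRVol M * X.hVol M)) = _
  simp only [flow, kVol, sub_mul, mul_sub, neg_mul, mul_neg, smul_mul_assoc, mul_smul_comm]
  module

theorem dG_flow_eq {M : ℕ} (hM : X.N + 2 ≤ M) : dG (volO M) (flow (X.hVol M) (X.kVol M)) =
    ∑ x ∈ X.core, ∑ y ∈ X.core, entry (flow X.h X.k) x y • (star (annO x) * annO y) := by
  have hsub : X.core ⊆ Finset.Icc (-(M : ℤ)) M := by
    refine Finset.Icc_subset_Icc ?_ ?_ <;> omega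
  have h1 : dG (volO M) (flow (X.hVol M) (X.kVol M)) =
      ∑ x ∈ Finset.Icc (-(M : ℤ)) M, ∑ y ∈ Finset.Icc (-(M : ℤ)) M,
        entry (flow X.h X.k) x y • (star (annO x) * annO y) := by
    rw [dG_apply, ← Finset.sum_coe_sort (Finset.Icc (-(M : ℤ)) M)]
    refine Finset.sum_congr rfl fun x _ => ?_
    rw [← Finset.sum_coe_sort (Finset.Icc (-(M : ℤ)) M)]
    refine Finset.sum_congr rfl fun y _ => ?_
    rw [entry_flow_vol X (by omega)]
    rfl
  rw [h1]
  refine (Finset.sum_subset hsub fun x _ hx => ?_).symm.trans (Finset.sum_congr rfl fun x _ =>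
    (Finset.sum_subset hsub fun y _ hy => ?_).symm)
  · refine Finset.sum_eq_zero fun y _ => ?_
    rw [entry_flow_eq_zero X (Or.inl hx), zero_smul]
  · rw [entry_flow_eq_zero X (Or.inr hy), zero_smul]

/-- The entropy production observable is the second quantization of `i[k, h]`. -/
theorem sigma_eq_dG {M : ℕ} (hM : X.N + 2 ≤ M) :
    X.sigma = dG (volO M) (flow (X.hVol M) (X.kVol M)) := by
  rw [X.dG_flow_eq hM, ← X.dG_flow_eq le_rfl, ← X.fluxes_eq]
  rfl

theorem sigma_mem_obsLoc : X.sigma ∈ obsLoc := by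
  rw [X.sigma_eq_dG le_rfl, X.dG_flow_eq le_rfl]
  have h : ∀ x, annO x ∈ obsLoc := fun x => StarAlgebra.subset_adjoin ℂ _ (Set.mem_range_self x)
  exact sum_mem fun x _ => sum_mem fun y _ =>
    SMulMemClass.smul_mem _ (mul_mem (star_mem (h x)) (h y))

/-- The integrated entropy production `∫₀^t σ_s ds` of the chain confined to `[-M, M]`. -/
def entropyProdVol (M : ℕ) (t : ℝ) : obs :=
  dG (volO M) (X.kVol M - evolve (X.hVol M) (X.kVol M) t)

/-- The integrated entropy production `∫₀^t σ_s ds` of the extended chain. -/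
def entropyProd (t : ℝ) : obs := ∫ s in (0 : ℝ)..t, X.tauFun s X.sigma

theorem evolO_dG (M : ℕ) (t : ℝ) (A : Op (Vol M)) :
    X.evolO M t (dG (volO M) A) = dG (volO M) (evolve (X.hVol M) A t) := by
  have h := (volO_isCAR M).exp_dG ((Complex.I * (t : ℂ)) • X.hVol M) A
  rw [map_smul, ← HO_eq] at h
  exact h

theorem continuous_evolO (M : ℕ) (A : Op (Vol M)) :
    Continuous fun s => X.evolO M s (dG (volO M) A) := by
  simp only [evolO_dG]
  exact (dG (volO M)).continuous.comp (Continuous.comp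
    (g := fun q : Op (Vol M) × ℝ => evolve (X.hVol M) q.1 q.2) (f := fun s => (A, s))
    (continuous_evolve _) (by fun_prop))

theorem entropyProdVol_eq_integral {M : ℕ} (hM : X.N + 2 ≤ M) (t : ℝ) :
    X.entropyProdVol M t = ∫ s in (0 : ℝ)..t, X.evolO M s X.sigma := by
  have h1 : ∀ s, HasDerivAt (fun s => X.entropyProdVol M s) (X.evolO M s X.sigma) s := fun s => by
    have h2 := (hasDerivAt_const s (X.kVol M)).sub (hasDerivAt_evolve (X.hVol M) (X.kVol M) s)
    have h3 := ((dG (volO M)).restrictScalars ℝ).hasFDerivAt.comp_hasDerivAt s h2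
    rw [X.sigma_eq_dG hM, evolO_dG]
    refine h3.congr_deriv ?_
    change dG (volO M) (0 - _) = _
    rw [zero_sub, ← evolveHom_apply (X.isSelfAdjoint_hVol M),
      ← evolveHom_apply (X.isSelfAdjoint_hVol M),
      map_neg (evolveHom _ _), neg_neg]
  rw [intervalIntegral.integral_eq_sub_of_hasDerivAt (fun s _ => h1 s)]
  · rw [entropyProdVol, entropyProdVol, evolve_zero, sub_self, map_zero, sub_zero]
  · rw [X.sigma_eq_dG hM]
    exact (X.continuous_evolO M _).intervalIntegrable _ _

theorem norm_evolO_le (M : ℕ) (t : ℝ) (A : obs) : ‖X.evolO M t A‖ ≤ ‖A‖ := by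
  have h := X.norm_evolO_sub_le M t A 0
  have h0 : X.evolO M t 0 = 0 := by rw [evolO, mul_zero, zero_mul]
  rwa [h0, sub_zero, sub_zero] at h

theorem tendsto_entropyProdVol (t : ℝ) :
    Tendsto (fun M => X.entropyProdVol M t) atTop (𝓝 (X.entropyProd t)) := by
  have h :
      Tendsto (fun M => ∫ s in (0 : ℝ)..t, X.evolO M s X.sigma) atTop (𝓝 (X.entropyProd t)) := by
    refine intervalIntegral.tendsto_integral_filter_of_dominated_convergence (fun _ => ‖X.sigma‖)
      ?_ (Eventually.of_forall fun M => Eventually.of_forall fun s _ => X.norm_evolO_le M s _)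
      intervalIntegrable_const (Eventually.of_forall fun s _ => X.tendsto_evolO s X.sigma)
    filter_upwards [eventually_ge_atTop (X.N + 2)] with M hM
    rw [X.sigma_eq_dG hM]
    exact (X.continuous_evolO M _).aestronglyMeasurable
  refine h.congr' ?_
  filter_upwards [eventually_ge_atTop (X.N + 2)] with M hM
  exact (X.entropyProdVol_eq_integral hM t).symm

theorem isSelfAdjoint_entropyProd (t : ℝ) : IsSelfAdjoint (X.entropyProd t) := by
  refine tendsto_nhds_unique (X.tendsto_entropyProdVol t).star
    ((X.tendsto_entropyProdVol t).congr fun M => ?_)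
  rw [entropyProdVol, star_dG, ((X.isSelfAdjoint_kVol M).sub
    (isSelfAdjoint_evolve (X.isSelfAdjoint_hVol M) (X.isSelfAdjoint_kVol M) t)).star_eq]

theorem actsAs_entropyProdVol (M : ℕ) (t : ℝ) :
    ActsAs M (X.entropyProdVol M t) (X.entropyIncrement M t) := actsAs_dG _

theorem tendsto_tr_entropyIncrement (t : ℝ) :
    Tendsto (fun M => tr (X.omega M * X.entropyIncrement M t)) atTop
      (𝓝 (X.state (X.entropyProd t))) := by
  refine (tendsto_stateVol_of_tendsto (X.tendsto_entropyProdVol t)).congr fun M => ?_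
  rw [X.stateVol_of_actsAs (X.actsAs_entropyProdVol M t)]

theorem tendsto_tr_entropyIncrement_sq (t : ℝ) :
    Tendsto (fun M => tr (X.omega M * (X.entropyIncrement M t * X.entropyIncrement M t))) atTop
      (𝓝 (X.state (X.entropyProd t * X.entropyProd t))) := by
  refine (tendsto_stateVol_of_tendsto
    ((X.tendsto_entropyProdVol t).mul (X.tendsto_entropyProdVol t))).congr fun M => ?_
  exact X.stateVol_of_actsAs ((X.actsAs_entropyProdVol M t).mul (X.actsAs_entropyProdVol M t))

/-- The mean of the integrated entropy production. -/
def meanProd (t : ℝ) : ℝ := (X.state (X.entropyProd t)).re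

/-- The variance of the integrated entropy production. -/
def varProd (t : ℝ) : ℝ := (X.state (X.entropyProd t * X.entropyProd t)).re - X.meanProd t ^ 2

theorem ofReal_re_state {A : obs} (hA : IsSelfAdjoint A) : ((X.state A).re : ℂ) = X.state A := by
  have h := X.state_star A
  rw [hA.star_eq] at h
  exact Complex.conj_eq_iff_re.1 h.symm

theorem ofReal_meanProd (t : ℝ) : (X.meanProd t : ℂ) = X.state (X.entropyProd t) :=
  X.ofReal_re_state (X.isSelfAdjoint_entropyProd t)

theorem ofReal_varProd (t : ℝ) : (X.varProd t : ℂ) =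
    X.state (X.entropyProd t * X.entropyProd t) - X.state (X.entropyProd t) ^ 2 := by
  have h : IsSelfAdjoint (X.entropyProd t * X.entropyProd t) := by
    rw [IsSelfAdjoint, star_mul, (X.isSelfAdjoint_entropyProd t).star_eq]
  rw [varProd, Complex.ofReal_sub, Complex.ofReal_pow, ofReal_meanProd, X.ofReal_re_state h]

/-! ### Derivatives of the entropic functionals -/

theorem hasDerivAt_log_of_one {g g' : ℝ → ℝ} {c : ℝ} (hg : ∀ x, HasDerivAt g (g' x) x)
    (h0 : g 0 = 1) (hpos : ∀ x, 0 < g x) (hg' : HasDerivAt g' c 0) :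
    HasDerivAt (fun x => Real.log (g x)) (g' 0) 0 ∧
      iteratedDeriv 2 (fun x => Real.log (g x)) 0 = c - g' 0 ^ 2 := by
  have h1 : ∀ x, HasDerivAt (fun x => Real.log (g x)) (g' x / g x) x := fun x =>
    (hg x).log (hpos x).ne'
  refine ⟨by simpa [h0] using h1 0, ?_⟩
  rw [iteratedDeriv_succ, iteratedDeriv_one, funext fun x => (h1 x).deriv]
  have h2 := hg'.fun_div (hg 0) (hpos 0).ne'
  rw [h2.deriv, h0]
  ring

theorem e_time_zero (p : ℝ≥0∞) (α : ℝ) : X.e p 0 α = 0 := by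
  rw [e, traceFormula, Complex.ofReal_zero, zero_mul, Complex.zero_re]

theorem entropyProd_zero : X.entropyProd 0 = 0 := intervalIntegral.integral_same

theorem derivs_e_two (t : ℝ) : HasDerivAt (X.e 2 t) (-X.meanProd t) 0 ∧
    iteratedDeriv 2 (X.e 2 t) 0 = X.varProd t := by
  rcases eq_or_ne t 0 with rfl | ht
  · have h1 : X.e 2 0 = fun _ => 0 := funext (X.e_time_zero 2)
    have h2 : X.meanProd 0 = 0 := by rw [meanProd, entropyProd_zero, map_zero, Complex.zero_re]
    have h3 : X.varProd 0 = 0 := by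
      rw [varProd, entropyProd_zero, mul_zero, map_zero, Complex.zero_re, h2]
      ring
    rw [h1, h2, h3, neg_zero]
    exact ⟨hasDerivAt_const _ _, by simp⟩
  -- for `p = 2` the functional is the cumulant generating function of the full counting statistics,
  -- whose first two moments are those of the increment of `-log ω_M` in time
  · obtain ⟨P, hP, -, hmgf, hmom⟩ := X.exists_fcs_limit ht
    have hint : ∀ z, z ∈ interior (ProbabilityTheory.integrableExpSet id P) := fun z => by
      have h : ProbabilityTheory.integrableExpSet id P = Set.univ :=
        Set.eq_univ_of_forall fun z => (hmgf z).1
      rw [h, interior_univ]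
      exact Set.mem_univ z
    have hz : ∀ α : ℝ, HasDerivAt (fun α : ℝ => -(t * α)) (-t) α := fun α => by
      simpa using ((hasDerivAt_id α).const_mul t).fun_neg
    have hd : ∀ (n : ℕ) (α : ℝ), HasDerivAt (fun α => ∫ x, x ^ n * Real.exp (-(t * α) * x) ∂P)
        ((∫ x, x ^ (n + 1) * Real.exp (-(t * α) * x) ∂P) * -t) α := fun n α =>
      HasDerivAt.comp (h₂ := fun z => ∫ x, x ^ n * Real.exp (z * x) ∂P) α
        (ProbabilityTheory.hasDerivAt_integral_pow_mul_exp_real (hint (-(t * α))) n) (hz α)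
    have hexp : ∀ α, ∫ x, x ^ 0 * Real.exp (-(t * α) * x) ∂P = Real.exp (X.e 2 t α) := fun α => by
      simp only [pow_zero, one_mul]
      rw [(hmgf (-(t * α))).2]
      congr 2
      field_simp
    have h0 : (∫ x, x ^ 0 * Real.exp (-(t * (0 : ℝ)) * x) ∂P) = 1 := by
      rw [hexp, X.e_zero, Real.exp_zero]
    have h := hasDerivAt_log_of_one (hd 0) h0 (fun α => by rw [hexp]; exact Real.exp_pos _)
      ((hd 1 0).mul_const (-t))
    simp only [hexp, Real.log_exp] at h
    have h1 : t * ∫ x, x ∂P = X.meanProd t := by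
      have h2 := (hmom 1).2.const_mul t
      simp only [pow_one] at h2
      refine tendsto_nhds_unique h2 (((Complex.continuous_re.tendsto _).comp
        (X.tendsto_tr_entropyIncrement t)).congr fun M => ?_)
      rw [X.integral_fcs_id M ht]
      rfl
    have h2 : t ^ 2 * ∫ x, x ^ 2 ∂P = (X.state (X.entropyProd t * X.entropyProd t)).re := by
      refine tendsto_nhds_unique ((hmom 2).2.const_mul (t ^ 2))
        (((Complex.continuous_re.tendsto _).comp
        (X.tendsto_tr_entropyIncrement_sq t)).congr fun M => ?_)
      rw [X.integral_fcs_sq M ht]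
      rfl
    simp only [zero_add, mul_zero, neg_zero, zero_mul, Real.exp_zero, mul_one, pow_one] at h
    refine ⟨?_, ?_⟩
    · convert h.1 using 1
      rw [← h1]
      ring
    · refine h.2.trans ?_
      rw [varProd, ← h1, ← h2]
      ring

end Chain

/-- At `γ = 0` the kernel is the Fermi distribution of `A`, whatever `p` is. -/
theorem kernelAB_zero {κ : Type} {p : ℝ≥0∞} (hp : 0 < p) {A B : Op κ} (hA : IsSelfAdjoint A) :
    kernelAB p 0 A B = Ring.inverse (1 + NormedSpace.exp (-A)) := by
  by_cases hp' : p = ⊤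
  · simp [kernelAB, hp']
  · have hp0 : p.toReal ≠ 0 := (ENNReal.toReal_pos hp.ne' hp').ne'
    have h1 : sandw (((1 * (1 - 0) / p.toReal : ℝ) : ℂ) • A) (((2 * 0 / p.toReal : ℝ) : ℂ) • B) =
        NormedSpace.exp (((2 / p.toReal : ℝ) : ℂ) • A) := by
      rw [sandw, mul_zero, zero_div, Complex.ofReal_zero, zero_smul, NormedSpace.exp_zero, mul_one,
        ← exp_add_of_comm (Commute.refl _), ← add_smul]
      congr 2
      push_cast
      ring
    have h2 : sandw (((1 * (1 - 0) / p.toReal : ℝ) : ℂ) • A) (((2 * 0 / p.toReal : ℝ) : ℂ) • B) ^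
        (-(p.toReal / 2)) = NormedSpace.exp (-A) := by
      rw [h1, exp_rpow (sa_smul hA _), smul_smul, ← Complex.ofReal_mul]
      have h3 : -(p.toReal / 2) * (2 / p.toReal) = -1 := by field_simp
      rw [h3, Complex.ofReal_neg, Complex.ofReal_one, neg_one_smul]
    set R := Ring.inverse (1 + NormedSpace.exp (-A)) with hR
    have hu := isUnit_one_add hA.neg.exp_nonneg
    have h4 : ∀ s : ℝ, Commute (NormedSpace.exp ((s : ℂ) • A)) R := fun s => by
      have h5 : Commute (NormedSpace.exp ((s : ℂ) • A)) (1 + NormedSpace.exp (-A)) :=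
        (Commute.one_right _).add_right
          ((((Commute.refl A).smul_left _).neg_right).exp)
      rw [hR, ← hu.unit_spec, Ring.inverse_unit]
      exact (Units.commute_iff_inv_mul_cancel.2 (by
        have := h5.eq
        rw [← hu.unit_spec] at this
        rw [mul_assoc, this, ← mul_assoc, Units.inv_mul, one_mul])).symm.units_inv_right
    have h6 : NormedSpace.exp (((-1 * (1 - 0) / p.toReal : ℝ) : ℂ) • A) * R *
        NormedSpace.exp (((1 * (1 - 0) / p.toReal : ℝ) : ℂ) • A) = R := by
      rw [(h4 _).eq, mul_assoc, ← exp_add_of_comm (((Commute.refl A).smul_left _).smul_right _),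
        ← add_smul]
      have h7 : ((-1 * (1 - 0) / p.toReal : ℝ) : ℂ) + ((1 * (1 - 0) / p.toReal : ℝ) : ℂ) = 0 := by
        push_cast
        ring
      rw [h7, zero_smul, NormedSpace.exp_zero, mul_one]
    have h8 : star R = R := (isSelfAdjoint_inverse hA.neg.exp_nonneg).star_eq
    rw [kernelAB, if_neg hp', h2, ← hR, h6, star_smul, h8, ← add_smul]
    norm_num

namespace Chain

variable (X : Chain)

theorem hasDerivAt_e_zero {p : ℝ≥0∞} (hp : 0 < p) (t : ℝ) :
    HasDerivAt (X.e p t) (-X.meanProd t) 0 := by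
  have h1 := X.hasDerivAt_e hp t 0
  have h2 := X.hasDerivAt_e (p := 2) two_pos t 0
  rw [kernelAB_zero hp X.isSelfAdjoint_k] at h1
  rw [kernelAB_zero two_pos X.isSelfAdjoint_k] at h2
  rwa [h2.unique (X.derivs_e_two t).1] at h1

theorem hasDerivAt_e_one {p : ℝ≥0∞} (hp : 0 < p) (t : ℝ) :
    HasDerivAt (X.e p t) (X.meanProd t) 1 := by
  have h1 : HasDerivAt (fun α : ℝ => 1 - α) (-1) 1 := by
    simpa using (hasDerivAt_id (1 : ℝ)).const_sub 1
  have h2 : HasDerivAt (X.e p t) (-X.meanProd t) (1 - 1) := by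
    rw [sub_self]
    exact X.hasDerivAt_e_zero hp t
  have h3 := h2.comp (1 : ℝ) h1
  have h4 : X.e p t ∘ (fun α : ℝ => 1 - α) = X.e p t := funext fun α => (X.e_symm hp t α).symm
  rw [h4] at h3
  simpa using h3

/-- The moment generating function `α ↦ ω(e^{-αZ})` of the integrated entropy production `Z`. -/
def genFun (t α : ℝ) : ℝ := (X.state (NormedSpace.exp (-(α : ℂ) • X.entropyProd t))).re

theorem genFun_pos (t α : ℝ) : 0 < X.genFun t α := by
  set A : obs := -(α : ℂ) • X.entropyProd t with hA
  have hAs : IsSelfAdjoint (A : Op (Finset ℤ)) := by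
    have h : IsSelfAdjoint A := by
      rw [IsSelfAdjoint, hA, star_smul, (X.isSelfAdjoint_entropyProd t).star_eq]
      simp
    exact h.map obs.subtype
  -- `e^A ≥ e^{-‖A‖}`, and the finite-volume states are positive and normalized
  have h1 : algebraMap ℝ (Op (Finset ℤ)) (Real.exp (-‖A‖)) ≤
      NormedSpace.exp (A : Op (Finset ℤ)) := by
    rw [← CFC.real_exp_eq_normedSpace_exp hAs]
    exact algebraMap_le_cfc _ _ _ fun x hx => Real.exp_le_exp.2 (spectrum_subset_Icc hx).1
  refine (Real.exp_pos (-‖A‖)).trans_le (ge_of_tendsto'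
    ((Complex.continuous_re.tendsto _).comp (X.tendsto_stateVol (NormedSpace.exp A))) fun M => ?_)
  have h2 : 0 ≤ (tr (X.omega M * compress (restrictFock M) (NormedSpace.exp (A : Op (Finset ℤ)) -
      algebraMap ℝ (Op (Finset ℤ)) (Real.exp (-‖A‖))))).re := by
    refine tr_mul_nonneg (X.omega_nonneg M) ?_
    have h := ContinuousLinearMap.IsPositive.adjoint_conj
      ((ContinuousLinearMap.nonneg_iff_isPositive _).1 (sub_nonneg.2 h1))
      (ContinuousLinearMap.adjoint (restrictFock M))
    rw [ContinuousLinearMap.adjoint_adjoint] at h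
    exact (ContinuousLinearMap.nonneg_iff_isPositive _).2 h
  have h3 : NormedSpace.exp (A : Op (Finset ℤ)) - algebraMap ℝ (Op (Finset ℤ)) (Real.exp (-‖A‖)) =
      ((NormedSpace.exp A - ((Real.exp (-‖A‖) : ℝ) : ℂ) • (1 : obs) : obs) : Op (Finset ℤ)) := by
    rw [AddSubgroupClass.coe_sub, ← coe_exp_obs, Algebra.algebraMap_eq_smul_one, ← Complex.coe_smul]
    rfl
  rw [h3, ← stateVol_apply, map_sub, map_smul, X.stateVol_of_actsAs (A := 1) ActsAs.one, mul_one,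
    tr_omega, smul_eq_mul, mul_one, Complex.sub_re, Complex.ofReal_re, sub_nonneg] at h2
  exact h2

theorem analyticAt_genFun (t α : ℝ) : AnalyticAt ℝ (X.genFun t) α := by
  have h : AnalyticAt ℂ (fun z : ℂ => X.state (NormedSpace.exp (-z • X.entropyProd t))) α :=
    (X.state.analyticAt _).comp ((NormedSpace.exp_analytic _).comp
      (f := fun z : ℂ => -z • X.entropyProd t) ((analyticAt_id.neg).smul analyticAt_const))
  exact h.re_ofReal

theorem derivs_log_genFun (t : ℝ) :
    HasDerivAt (fun α => Real.log (X.genFun t α)) (-X.meanProd t) 0 ∧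
      iteratedDeriv 2 (fun α => Real.log (X.genFun t α)) 0 = X.varProd t := by
  set Z := X.entropyProd t with hZ
  have h1 : ∀ (C : obs) (α : ℝ), HasDerivAt
      (fun α : ℝ => (X.state (C * NormedSpace.exp (-(α : ℂ) • Z))).re)
      (-(X.state (C * Z * NormedSpace.exp (-(α : ℂ) • Z))).re) α := fun C α => by
    have h2 : HasDerivAt (fun z : ℂ => NormedSpace.exp (-z • Z))
        (-(Z * NormedSpace.exp (-(α : ℂ) • Z))) (α : ℂ) := by
      have := (hasDerivAt_exp_smul_const' Z (-(α : ℂ))).scomp (α : ℂ) (hasDerivAt_neg (α : ℂ))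
      rwa [neg_one_smul] at this
    have h3 := (X.state.hasFDerivAt.comp_hasDerivAt (α : ℂ) (h2.const_mul C)).real_of_complex
    refine h3.congr_deriv ?_
    rw [mul_neg, map_neg, Complex.neg_re, mul_assoc]
  have h0 : X.genFun t 0 = 1 := by
    rw [genFun, Complex.ofReal_zero, neg_zero, zero_smul, NormedSpace.exp_zero,
      X.isInitialState_state.one, Complex.one_re]
  have h4 := hasDerivAt_log_of_one (g := X.genFun t)
    (g' := fun α => -(X.state (Z * NormedSpace.exp (-(α : ℂ) • Z))).re)
    (fun α => by
      have := h1 1 α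
      simp only [one_mul] at this
      exact this) h0 (X.genFun_pos t) (h1 Z 0).fun_neg
  simp only [Complex.ofReal_zero, neg_zero, zero_smul, NormedSpace.exp_zero, mul_one, neg_neg] at h4
  refine ⟨h4.1, h4.2.trans ?_⟩
  rw [varProd, meanProd, neg_sq]

end Chain

namespace Chain

variable {X : Chain} {τ : ℝ → obs ≃⋆ₐ[ℂ] obs}

theorem IsDynamics.smul_meanRate (hτ : X.IsDynamics τ) (t : ℝ) :
    (t : ℂ) • X.meanRate τ t = X.entropyProd t := by
  have h : X.meanRate τ t = ((1 / t : ℝ) : ℂ) • X.entropyProd t := by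
    rw [meanRate, entropyProd]
    simp only [hτ.eq_tauFun _ X.sigma_mem_obsLoc]
  rw [h, smul_smul, ← Complex.ofReal_mul]
  rcases eq_or_ne t 0 with rfl | ht
  · rw [entropyProd_zero, smul_zero]
  · rw [mul_one_div_cancel ht, Complex.ofReal_one, one_smul]

theorem IsDynamics.ES_eq (hτ : X.IsDynamics τ) (t : ℝ) :
    X.ES τ X.state t = fun α => Real.log (X.genFun t α) := by
  funext α
  rw [ES, genFun, ← hτ.smul_meanRate, smul_smul]
  congr 6
  push_cast
  ring

theorem IsDynamics.integral_corr (hτ : X.IsDynamics τ) (t : ℝ) :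
    ∫ u in (0 : ℝ)..t, ∫ s in (0 : ℝ)..t, X.corr τ X.state s u = X.varProd t := by
  set c : ℝ → obs := fun s => τ s X.sigma - X.state (τ s X.sigma) • 1 with hc
  have hcont : Continuous fun s => τ s X.sigma := hτ.continuous X.sigma
  have hcc : Continuous c :=
    hcont.sub ((X.state.continuous.comp hcont).smul continuous_const)
  set C : obs := ∫ s in (0 : ℝ)..t, c s with hC
  -- the state is applied after the integration over `s`, then after the integration over `u`
  have h1 : ∀ u, ∫ s in (0 : ℝ)..t, X.corr τ X.state s u = X.state (C * c u) := fun u => by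
    have h2 := (X.state ∘L (ContinuousLinearMap.mul ℂ obs).flip (c u)).intervalIntegral_comp_comm
      (μ := volume) (hcc.intervalIntegrable 0 t)
    exact h2
  have h2 : ∫ u in (0 : ℝ)..t, X.state (C * c u) = X.state (C * C) :=
    (X.state ∘L ContinuousLinearMap.mul ℂ obs C).intervalIntegral_comp_comm
      (μ := volume) (hcc.intervalIntegrable 0 t)
  have hone : X.state 1 = 1 := X.isInitialState_state.one
  have h3 : C = X.entropyProd t - X.state (X.entropyProd t) • 1 := by
    have e1 : X.entropyProd t = ∫ s in (0 : ℝ)..t, τ s X.sigma := by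
      rw [entropyProd]
      simp only [hτ.eq_tauFun _ X.sigma_mem_obsLoc]
    have e2 : ∫ s in (0 : ℝ)..t, X.state (τ s X.sigma) • (1 : obs) =
        X.state (∫ s in (0 : ℝ)..t, τ s X.sigma) • 1 := by
      rw [← X.state.intervalIntegral_comp_comm (hcont.intervalIntegrable 0 t)]
      exact ((ContinuousLinearMap.id ℂ ℂ).smulRight (1 : obs)).intervalIntegral_comp_comm
        (μ := volume) ((X.state.continuous.comp hcont).intervalIntegrable 0 t)
    rw [hC, e1, ← e2]
    exact intervalIntegral.integral_sub (hcont.intervalIntegrable 0 t)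
      (((X.state.continuous.comp hcont).smul continuous_const).intervalIntegrable 0 t)
  simp only [h1]
  rw [h2, ofReal_varProd, h3, sub_mul, mul_sub, mul_sub, smul_mul_assoc, smul_mul_assoc, one_mul,
    one_mul, mul_smul_comm, mul_one, map_sub, map_sub, map_sub, map_smul, map_smul, map_smul, hone,
    smul_eq_mul, smul_eq_mul, smul_eq_mul]
  ring

end Chain

end XY

end

theorem mainTheorem6 (X : XY.Chain) :
    (∃ (τ : ℝ → XY.obs ≃⋆ₐ[ℂ] XY.obs) (ω : XY.obs →L[ℂ] ℂ),
      X.IsDynamics τ ∧ X.IsInitialState ω) ∧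
    ∀ (τ : ℝ → XY.obs ≃⋆ₐ[ℂ] XY.obs) (ω : XY.obs →L[ℂ] ℂ),
      X.IsDynamics τ → X.IsInitialState ω →
    ∃ e : ℝ≥0∞ → ℝ → ℝ → ℝ,
      -- finite-volume trace formulas, existence of the limits, trace formulas for the limits
      (∀ (p : ℝ≥0∞) (t α : ℝ), 0 < p →
        (∀ M : ℕ, (X.eVol M p t α : ℂ) = XY.traceFormula (X.hVol M) (X.kVol M) p t α) ∧
        Tendsto (fun M => X.eVol M p t α) atTop (𝓝 (e p t α)) ∧
        (e p t α : ℂ) = XY.traceFormula X.h X.k p t α) ∧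
      -- normalization
      (∀ (p : ℝ≥0∞) (t : ℝ), 0 < p → e p t 0 = 0 ∧ e p t 1 = 0) ∧
      -- real-analyticity, convexity, joint continuity
      (∀ (p : ℝ≥0∞) (t : ℝ), 0 < p → AnalyticOnNhd ℝ (e p t) Set.univ ∧ ConvexOn ℝ Set.univ (e p t)) ∧
      ContinuousOn (fun q : ℝ≥0∞ × ℝ × ℝ => e q.1 q.2.1 q.2.2) {q | 0 < q.1} ∧
      (∀ t : ℝ, AnalyticOnNhd ℝ (X.ES τ ω t) Set.univ) ∧
      -- symmetries
      (∀ (p : ℝ≥0∞) (t α : ℝ), 0 < p → e p t α = e p (-t) α) ∧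
      (∀ (p : ℝ≥0∞) (t α : ℝ), 0 < p → e p t α = e p t (1 - α)) ∧
      -- monotonicity and continuity in `p`
      (∀ t α : ℝ, ContinuousOn (fun p => e p t α) (Set.Ioi 0) ∧
        AntitoneOn (fun p => e p t α) (Set.Ioi 0)) ∧
      -- first derivatives
      (∀ t : ℝ, ∃ d : ℝ, (d : ℂ) = -(t : ℂ) * ω (X.meanRate τ t) ∧
        HasDerivAt (X.ES τ ω t) d 0 ∧
        ∀ p, 0 < p → HasDerivAt (e p t) d 0 ∧ HasDerivAt (e p t) (-d) 1) ∧
      -- second derivatives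
      (∀ t : ℝ, ((iteratedDeriv 2 (e 2 t) 0 : ℝ) : ℂ) =
          (∫ u in (0 : ℝ)..t, ∫ s in (0 : ℝ)..t, X.corr τ ω s u) ∧
        iteratedDeriv 2 (e 2 t) 0 = iteratedDeriv 2 (X.ES τ ω t) 0) ∧
      -- full counting statistics
      (∀ t : ℝ, t ≠ 0 → (∀ M : ℕ, IsProbabilityMeasure (X.fcs M t)) ∧
        ∃ P : Measure ℝ, IsProbabilityMeasure P ∧
          (∀ f : BoundedContinuousFunction ℝ ℝ,
            Tendsto (fun M => ∫ φ, f φ ∂(X.fcs M t)) atTop (𝓝 (∫ φ, f φ ∂P))) ∧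
          (∀ α : ℝ, Integrable (fun φ => Real.exp (-(t * α * φ))) P ∧
            e 2 t α = Real.log (∫ φ, Real.exp (-(t * α * φ)) ∂P)) ∧
          (∀ n : ℕ, Integrable (fun φ => φ ^ n) P ∧
            Tendsto (fun M => ∫ φ, φ ^ n ∂(X.fcs M t)) atTop (𝓝 (∫ φ, φ ^ n ∂P)))) := by
  refine ⟨⟨X.tau, X.state, X.isDynamics_tau, X.isInitialState_state⟩, fun τ ω hτ hω => ?_⟩
  obtain rfl := hω.eq_state
  have hES := hτ.ES_eq
  refine ⟨X.e, fun p t α hp => ⟨fun M => X.eVol_eq_traceFormula hp M t α, X.tendsto_eVol hp t α,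
    X.e_eq_traceFormula hp t α⟩, fun p t hp => ⟨X.e_zero p t, X.e_one hp t⟩,
    fun p t hp => ⟨X.analyticOnNhd_e hp t, X.convexOn_e hp t⟩, X.continuousOn_e, fun t α _ => ?_,
    fun p t α _ => (X.e_neg_time t α).symm, fun p t α hp => X.e_symm hp t α,
    fun t α => ⟨?_, X.e_antitone t α⟩, fun t => ⟨-X.meanProd t, ?_, ?_, fun p hp => ⟨?_, ?_⟩⟩,
    fun t => ⟨?_, ?_⟩, fun t ht => ⟨fun M => X.isProbabilityMeasure_fcs M t, ?_⟩⟩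
  · rw [hES]
    exact (X.analyticAt_genFun t α).log (X.genFun_pos t α)
  · exact X.continuousOn_e.comp (f := fun p => (p, t, α)) (by fun_prop) fun p hp => hp
  · rw [Complex.ofReal_neg, X.ofReal_meanProd, ← hτ.smul_meanRate, map_smul, smul_eq_mul, neg_mul]
  · rw [hES]
    exact (X.derivs_log_genFun t).1
  · exact X.hasDerivAt_e_zero hp t
  · rw [neg_neg]
    exact X.hasDerivAt_e_one hp t
  · rw [hτ.integral_corr, (X.derivs_e_two t).2]
  · rw [hES, (X.derivs_e_two t).2, (X.derivs_log_genFun t).2]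
  · obtain ⟨P, hP, hweak, hmgf, hmom⟩ := X.exists_fcs_limit ht
    refine ⟨P, hP, hweak, fun α => ?_, hmom⟩
    have h := hmgf (-(t * α))
    have hα : -(-(t * α) / t) = α := by field_simp
    simp only [hα, neg_mul] at h
    exact ⟨h.1, by rw [h.2, Real.log_exp]⟩
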